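/- Let $\kappa,M_0>0$ and let $W:\mathbb R^3\to\mathbb R$ be smooth, spherically symmetric, exponentially decaying together with all its derivatives, with $\int W\,dx\neq0$. For $T>0$ consider on $[0,T]$ the system $$\dot X_t=\frac{P_t}{M_0},\qquad \dot P_t=2\kappa\int \nabla W(x-X_t)\,\mathrm{Re}\,\beta_t(x)\,dx,\qquad i\dot\beta_t=-\tfrac12\Delta\beta_t+\kappa W(\cdot-X_t),$$ with initial data $X_0,P_0\in\mathbb R^3$, $\beta_0\in L^2(\mathbb R^3;\mathbb C)$; a solution has $\beta\in C([0,T];L^2)$, the last equation holding in the sense of tempered distributions. Write $\langle x\rangle=\sqrt{1+|x|^2}$, $W^a=W(\cdot-a)$, $Z=\frac{4\kappa^2}{3M_0}$, $f(t)=Z\,\mathrm{Re}\langle W,e^{i\Delta t/2}W\rangle$ (scalar product of $L^2$, conjugate linear in the first entry), and let $K:[0,\infty)\to\mathbb R$ solve $\dot K_t=-\int_0^tf(t-s)K_s\,ds$, $K_0=1$. For a trajectory $Q:[0,\infty)\to\mathbb R^3$ put $Y_t=X_0+\frac1{M_0}\int_0^tQ_s\,ds$, $$\begin{aligned}N(Q)(t)={}&2\kappa\,\mathrm{Re}\langle\nabla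 W^{Y_t},e^{i\Delta t/2}\beta_0\rangle+\tfrac{4\kappa^2}{M_0}\mathrm{Re}\Big\langle\nabla W,e^{i\Delta t/2}(-\Delta)^{-1}\!\int_0^t Q_s\cdot\nabla[W^{X_0-Y_s}-W]\,ds\Big\rangle\\&-\tfrac{4\kappa^2}{M_0}\mathrm{Re}\Big\langle\nabla W,\int_0^t e^{i\Delta(t-s)/2}(-\Delta)^{-1}Q_s\cdot\nabla[W^{Y_s-Y_t}-W]\,ds\Big\rangle,\end{aligned}$$ $$\begin{aligned}L(Q)(t)={}&2ZK_t\int_0^t\mathrm{Re}\langle W,(i\Delta)^{-1}[e^{i\Delta(t-s)/2}-e^{i\Delta t/2}]W\rangle Q_s\,ds-\int_0^t(K_{t-s}-K_t)f(s)\int_s^tQ_u\,du\,ds\\&+\int_0^tK_{t-s}f(s)\,ds\int_0^tQ_u\,du,\end{aligned}$$ $$\tilde F(Q)(t)=\frac1{1-K_t}\Big[L(Q)(t)+\int_0^t(K_{t-s}-K_t)N(Q)(s)\,ds\Big],\qquad \|Q\|_{\mathcal B_{\delta,T}}=\sup_{t\ge T}t^{\frac12+\delta}|Q_t| .$$ Then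 $K$ exists, and there is a function $\varepsilon:(0,\infty)\to(0,\infty)$ (depending only on $\kappa,M_0,W$) such that the following holds. 1. For all $T>0$, $X_0$, $P_0$, $\beta_0\in L^2$ with $\|\langle x-X_0\rangle^{-3}\beta_0\|_2\le\varepsilon(T)$ (in particular whenever $\|\langle x\rangle^{3}\beta_0\|_2\le\varepsilon(T)$) and $|P_0|\le\varepsilon(T)$, the system has a solution on $[0,T]$, and every solution satisfies $|P_t|\le T^{-2}$ for all $0\le t\le T$. 2. Assume in addition that $i\omega+\int_0^\infty e^{-i\omega t}f(t)\,dt\ne0$ for all real $\omega\neq0$, i.e. the linear equation for $K$ has no undamped oscillating mode (this holds e.g. if $\hat W$ has no zeros). Then for every $\delta\le\frac34$ there is $\tilde\varepsilon:(0,\infty)\to(0,\infty)$ with $\lim_{T\to\infty}\tilde\varepsilon(T)=0$ such that for all $T>0$, $X_0$, $P_0$, $\beta_0$ with $\|\langle x\rangle^{3}\beta_0\|_2\le\varepsilon(T)$, $|P_0|\le\varepsilon(T)$, every solution on $[0,T]$ satisfies $$\|\tilde F(\chi_{[0,T)}P_\cdot)\|_{\mathcal B_{\delta,T}}\le\tilde\varepsilon(T).$$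 -/

import Mathlib

open MeasureTheory Set Filter Topology
open scoped FourierTransform SchwartzMap Laplacian

noncomputable section

namespace Friction

/-- Physical space `ℝ³`. -/
abbrev R3 : Type := EuclideanSpace ℝ (Fin 3)

/-- The complex Hilbert space `L²(ℝ³)`. -/
abbrev L2 : Type := Lp ℂ 2 (volume : Measure R3)

/-- The Japanese bracket `⟨x⟩ = √(1 + |x|²)`. -/
def bracket (x : R3) : ℝ := Real.sqrt (1 + ‖x‖ ^ 2)

/-- The weighted norm `‖⟨x - a⟩ⁿ b‖₂` of `b ∈ L²`, possibly infinite. -/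
def weightedNorm (a : R3) (n : ℤ) (b : L2) : ENNReal :=
  eLpNorm (fun x : R3 => ((bracket (x - a) ^ n : ℝ) : ℂ) * b x) 2 volume

/-- The assumptions on the potential: `W` is smooth, exponentially decaying (together with
its derivatives), spherically symmetric, and `∫ W ≠ 0`. -/
structure IsAdmissible (W : R3 → ℝ) : Prop where
  smooth : ContDiff ℝ (⊤ : ℕ∞) W
  decay : ∀ n : ℕ, ∃ C a : ℝ, 0 < a ∧
    ∀ x, ‖iteratedFDeriv ℝ n W x‖ ≤ C * Real.exp (-a * ‖x‖)
  radial : ∀ x y : R3, ‖x‖ = ‖y‖ → W x = W y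
  integral_ne_zero : ∫ x, W x ≠ 0

/-! ### The equations of motion -/

/-- `(X, P, β)` solves, on the time interval `[0, T]`,
`Ẋ = P / M₀`, `Ṗ = 2 κ ∫ ∇W(x - X) Re β dx`, `i β̇ = -½ Δ β + κ W(· - X)`,
with initial data `(X₀, P₀, β₀)`. Here `β` is a continuous curve in `L²` and its equation
holds in the sense of tempered distributions in `x`. -/
structure IsSolution (κ M₀ : ℝ) (W : R3 → ℝ) (T : ℝ) (X₀ P₀ : R3) (β₀ : L2)
    (X P : ℝ → R3) (β : ℝ → L2) : Prop where
  X_zero : X 0 = X₀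
  P_zero : P 0 = P₀
  β_zero : β 0 = β₀
  X_deriv : ∀ t ∈ Icc 0 T, HasDerivWithinAt X (M₀⁻¹ • P t) (Icc 0 T) t
  P_deriv : ∀ t ∈ Icc 0 T,
    HasDerivWithinAt P ((2 * κ) • ∫ x, (β t x).re • gradient W (x - X t)) (Icc 0 T) t
  β_cont : ContinuousOn β (Icc 0 T)
  β_deriv : ∀ φ : 𝓢(R3, ℂ), ∀ t ∈ Icc 0 T,
    HasDerivWithinAt (fun s => ∫ x, φ x * β s x)
      (Complex.I / 2 * (∫ x, (Δ φ) x * β t x)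
        - Complex.I * κ * ∫ x, φ x * (W (x - X t) : ℂ)) (Icc 0 T) t

/-! ### Scalar products with functions of the Laplacian -/

/-- If `u`, `v` are the Fourier transforms of `g`, `h`, this is the `L²` scalar product
`⟨g, m(-Δ) h⟩ = ∫ conj(ĝ(ξ)) m(|2πξ|²) ĥ(ξ) dξ`. With Mathlib's normalisation
`ĝ(ξ) = ∫ e^{-2πi⟨x, ξ⟩} g(x) dx`, the operator `-Δ` is multiplication by `|2πξ|²`. -/
def specPair (m : ℝ → ℂ) (u v : R3 → ℂ) : ℂ :=
  ∫ ξ : R3, (starRingEnd ℂ) (u ξ) * m ((2 * Real.pi * ‖ξ‖) ^ 2) * v ξ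

/-- The symbol of `e^{iΔt/2}` as a function of `-Δ`. -/
def schr (t : ℝ) (lam : ℝ) : ℂ := Complex.exp (-Complex.I * (lam * t / 2 : ℝ))

/-- The Fourier transform of a real function. -/
def hat (g : R3 → ℝ) : R3 → ℂ := 𝓕 (fun x : R3 => (g x : ℂ))

/-- The `j`-th partial derivative of `W(· - a)`. -/
def dW (W : R3 → ℝ) (j : Fin 3) (a : R3) : R3 → ℝ := fun x => gradient W (x - a) j

/-- The function `p · ∇[W(· - a) - W]`. -/
def drift (W : R3 → ℝ) (p a : R3) : R3 → ℝ :=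
  fun x => inner ℝ p (gradient W (x - a) - gradient W x)

/-! ### The effective equation for the momentum -/

/-- The constant `Z = 4κ² / (3 M₀)`. -/
def Z (κ M₀ : ℝ) : ℝ := 4 * κ ^ 2 / (3 * M₀)

/-- The memory kernel `f(t) = Z Re ⟨W, e^{iΔt/2} W⟩`. -/
def f (κ M₀ : ℝ) (W : R3 → ℝ) (t : ℝ) : ℝ :=
  Z κ M₀ * (specPair (schr t) (hat W) (hat W)).re

/-- `K` solves `K̇(t) = -∫₀ᵗ f(t - s) K(s) ds` on `[0, ∞)`, with `K(0) = 1`. -/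
def IsResolvent (κ M₀ : ℝ) (W : R3 → ℝ) (K : ℝ → ℝ) : Prop :=
  K 0 = 1 ∧ ∀ t, 0 ≤ t →
    HasDerivWithinAt K (-∫ s in (0 : ℝ)..t, f κ M₀ W (t - s) * K s) (Ici 0) t

/-- The characteristic function `λ + ∫₀^∞ e^{-λt} f(t) dt` of the equation for `K` has no zero
`λ = iω` with `ω ≠ 0`, i.e. that equation has no undamped oscillating mode. -/
def NonResonant (κ M₀ : ℝ) (W : R3 → ℝ) : Prop :=
  ∀ ω : ℝ, ω ≠ 0 →
    Complex.I * ω + ∫ t in Ioi (0 : ℝ), Complex.exp (-Complex.I * ω * t) * (f κ M₀ W t : ℂ) ≠ 0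

/-- The position at time `t` along the momentum trajectory `P`. -/
def position (M₀ : ℝ) (X₀ : R3) (P : ℝ → R3) (t : ℝ) : R3 :=
  X₀ + M₀⁻¹ • ∫ s in (0 : ℝ)..t, P s

/-- The nonlinear term `N(P)(t)`, with `X_s = position s`, whose components are
`2κ Re⟨∇W(· - X_t), e^{iΔt/2} β₀⟩`
`+ (4κ²/M₀) Re⟨∇W, e^{iΔt/2} (-Δ)⁻¹ ∫₀ᵗ P_s · ∇[W(· - X₀ + X_s) - W] ds⟩`
`- (4κ²/M₀) Re⟨∇W, ∫₀ᵗ e^{iΔ(t-s)/2} (-Δ)⁻¹ P_s · ∇[W(· - X_s + X_t) - W] ds⟩`. -/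
def N (κ M₀ : ℝ) (W : R3 → ℝ) (X₀ : R3) (β₀ : L2) (P : ℝ → R3) (t : ℝ) : R3 :=
  WithLp.toLp 2 fun j =>
    2 * κ * (specPair (schr t) (hat (dW W j (position M₀ X₀ P t))) (𝓕 β₀ : L2)).re
    + 4 * κ ^ 2 / M₀ * (∫ s in (0 : ℝ)..t,
        (specPair (fun lam => schr t lam / lam) (hat (dW W j 0))
          (hat (drift W (P s) (X₀ - position M₀ X₀ P s)))).re)
    - 4 * κ ^ 2 / M₀ * (∫ s in (0 : ℝ)..t,
        (specPair (fun lam => schr (t - s) lam / lam) (hat (dW W j 0))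
          (hat (drift W (P s) (position M₀ X₀ P s - position M₀ X₀ P t)))).re)

/-- The linear part `L(P)(t)` of the identity `(1 - K_t) P_t = L(P)(t) + ∫₀ᵗ (K_{t-s} - K_t) N(P)(s) ds`:
`2 Z K_t ∫₀ᵗ Re⟨W, (iΔ)⁻¹ [e^{iΔ(t-s)/2} - e^{iΔt/2}] W⟩ P_s ds`
`- Z ∫₀ᵗ (K_{t-s} - K_t) Re⟨W, e^{iΔs/2} W⟩ (∫ₛᵗ P_u du) ds`
`+ Z ∫₀ᵗ K_{t-s} Re⟨W, e^{iΔs/2} W⟩ ds ∫₀ᵗ P_u du`.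
The symbol of `(iΔ)⁻¹` is `1 / (-i lam)`. -/
def L (κ M₀ : ℝ) (W : R3 → ℝ) (K : ℝ → ℝ) (P : ℝ → R3) (t : ℝ) : R3 :=
  (2 * Z κ M₀ * K t) • (∫ s in (0 : ℝ)..t,
      (specPair (fun lam => (schr (t - s) lam - schr t lam) / (-Complex.I * lam))
        (hat W) (hat W)).re • P s)
  - (∫ s in (0 : ℝ)..t, ((K (t - s) - K t) * f κ M₀ W s) • ∫ u in s..t, P u)
  + (∫ s in (0 : ℝ)..t, K (t - s) * f κ M₀ W s) • ∫ u in (0 : ℝ)..t, P u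

/-- The inhomogeneous term
`F̃(Q)(t) = (1 - K_t)⁻¹ [ L(Q)(t) + ∫₀ᵗ (K_{t-s} - K_t) N(Q)(s) ds ]`. -/
def Ftilde (κ M₀ : ℝ) (W : R3 → ℝ) (K : ℝ → ℝ) (X₀ : R3) (β₀ : L2)
    (Q : ℝ → R3) (t : ℝ) : R3 :=
  (1 - K t)⁻¹ • (L κ M₀ W K Q t
    + ∫ s in (0 : ℝ)..t, (K (t - s) - K t) • N κ M₀ W X₀ β₀ Q s)

/-- The norm `‖Q‖_{δ,T} = sup_{t ≥ T} t^{1/2+δ} |Q_t|` of the space `B_{δ,T}`,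
possibly infinite. -/
def bNorm (δ T : ℝ) (Q : ℝ → R3) : ENNReal :=
  ⨆ t ∈ Ici T, ENNReal.ofReal (t ^ (1 / 2 + δ) * ‖Q t‖)

end Friction

end

/-! ### The free Schrödinger evolution: dispersive decay and time averages -/

noncomputable section

namespace Friction

open LineDeriv

/-! ### The free Schrödinger propagator on Schwartz functions -/

/-! Since `ε(T)` may be as small as one likes, constants may depend on `T` in an uncontrolled way.
What matters is the rate in `t` and the linear dependence on the size of the data.

Momentum bound. Duhamel's formula (`IsSolution.pair_eq`) splits the force into the contribution of
`β₀`, which stays localised near the particle on bounded time intervals, and a self-interaction. For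
a particle at rest the self-interaction vanishes by symmetry (`pair_U_shift_self`), so it is
controlled linearly by the displacement. A Gronwall barrier then keeps the momentum below any
prescribed `η` (`IsSolution.exists_norm_momentum_le`). Existence is a contraction argument in an
exponentially weighted norm.

Resolvent. The kernel `f(t - s)` is a Gram kernel of the curve `e^{iΔt/2} W`, which yields an energy
identity: `|K| ≤ 1`, and a return of `K` to the value `1` forces periodicity. In the variable `z =
√λ` the Laplace transform of `f` is `c z A(z)`, with `A(0) ≠ 0` because `∫ W ≠ 0`. Hence the
transform of `K̇` is `-cA / (z + cA)`; it equals `-1` at the origin and, without resonances, is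
continuous up to the boundary `|arg z| = π/4`. Fourier inversion on that boundary, with `λ = i
q²/2`, gives an integral with a quadratic phase. One integration by parts and a van der Corput
estimate give `K̇ = O(t^{-3/2})`, hence `K = O(t^{-1/2})` (`exists_abs_resolvent_le_rpow`), and `1 -
K` is bounded below on `[T, ∞)`.

Inhomogeneous term. The trajectory is switched off at `T`, so `L` decays like `t^{-3/2}`. In `N` the
self-interaction decays like `s^{-5/2}`: its time derivative no longer contains `(-Δ)⁻¹`
(`exists_norm_interKernel_le`). The force of the initial field is only `O(s^{-3/2})`, but after `T`
the position is frozen and time averages over `[s₁, s₂]` are `O(1/s₁)`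
(`exists_norm_integral_pair_le`). Integrating by parts in the convolution with `K_{t-s} - K_t` and
cutting at distance `√t` from `t` gives `t^{-5/4}`, which allows every `δ ≤ 3/4`. -/

/-- The symbol of `e^{iΔt/2}` as a function of the frequency. -/
def sym (t : ℝ) (ξ : R3) : ℂ := schr t ((2 * Real.pi * ‖ξ‖) ^ 2)

theorem sym_eq (t : ℝ) (ξ : R3) :
    sym t ξ = Complex.exp (Complex.I * ((-(2 * Real.pi ^ 2 * t) * ‖ξ‖ ^ 2 : ℝ) : ℂ)) := by
  unfold sym schr
  congr 1
  push_cast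
  ring

theorem norm_schr (t lam : ℝ) : ‖schr t lam‖ = 1 := by
  unfold schr
  rw [Complex.norm_exp]
  simp

theorem norm_sym (t : ℝ) (ξ : R3) : ‖sym t ξ‖ = 1 := norm_schr _ _

theorem schr_add (s t lam : ℝ) : schr (s + t) lam = schr s lam * schr t lam := by
  unfold schr
  rw [← Complex.exp_add]
  congr 1
  push_cast
  ring

theorem schr_zero (lam : ℝ) : schr 0 lam = 1 := by simp [schr]

theorem sym_add (s t : ℝ) (ξ : R3) : sym (s + t) ξ = sym s ξ * sym t ξ := schr_add _ _ _

theorem sym_zero (ξ : R3) : sym 0 ξ = 1 := schr_zero _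

theorem conj_sym (t : ℝ) (ξ : R3) : (starRingEnd ℂ) (sym t ξ) = sym (-t) ξ := by
  unfold sym schr
  rw [← Complex.exp_conj]
  congr 1
  simp only [map_mul, map_neg, Complex.conj_I, Complex.conj_ofReal]
  push_cast
  ring

theorem sym_neg (t : ℝ) (ξ : R3) : sym t (-ξ) = sym t ξ := by simp [sym]

/-- All derivatives of `e^{ix}` have modulus one, so growth exponent `0` and constant `1` serve for
every order. Composed with a quadratic polynomial this makes `sym t` a multiplier of Schwartz space.
-/
theorem hasTemperateGrowth_cexp_I : (fun x : ℝ => Complex.exp (Complex.I * x)).HasTemperateGrowth := by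
  have hd : ∀ n : ℕ, iteratedDeriv n (fun x : ℝ => Complex.exp (Complex.I * x))
      = fun x : ℝ => Complex.I ^ n * Complex.exp (Complex.I * x) := by
    intro n
    induction n with
    | zero => simp
    | succ k ih =>
      rw [iteratedDeriv_succ, ih]
      funext x
      have h : HasDerivAt (fun x : ℝ => Complex.exp (Complex.I * x))
          (Complex.exp (Complex.I * x) * Complex.I) x := by
        have h1 : HasDerivAt (fun x : ℝ => Complex.I * (x : ℂ)) Complex.I x := by
          simpa using (Complex.ofRealCLM.hasDerivAt (x := x)).const_mul Complex.I
        exact h1.cexp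
      rw [(h.const_mul _).deriv]
      ring
  refine ⟨?_, fun n => ⟨0, 1, fun x => ?_⟩⟩
  · have : ContDiff ℝ (⊤ : ℕ∞) (fun x : ℝ => Complex.I * (x : ℂ)) :=
      contDiff_const.mul Complex.ofRealCLM.contDiff
    exact this.cexp
  · rw [norm_iteratedFDeriv_eq_norm_iteratedDeriv, hd]
    rw [norm_mul, norm_pow, Complex.norm_I, Complex.norm_exp]
    simp

theorem hasTemperateGrowth_sym (t : ℝ) : (sym t).HasTemperateGrowth := by
  have h : sym t = (fun x : ℝ => Complex.exp (Complex.I * x)) ∘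
      (fun ξ : R3 => -(2 * Real.pi ^ 2 * t) * ‖ξ‖ ^ 2) := by
    funext ξ
    exact sym_eq t ξ
  rw [h]
  exact hasTemperateGrowth_cexp_I.comp (by fun_prop)

theorem continuous_sym (t : ℝ) : Continuous (sym t) := (hasTemperateGrowth_sym t).1.continuous

/-- The free propagator `e^{iΔt/2}` on Schwartz functions. -/
def U (t : ℝ) : 𝓢(R3, ℂ) →L[ℂ] 𝓢(R3, ℂ) := SchwartzMap.fourierMultiplierCLM ℂ (sym t)

theorem fourier_U (t : ℝ) (φ : 𝓢(R3, ℂ)) (ξ : R3) : 𝓕 (U t φ) ξ = sym t ξ * 𝓕 φ ξ := by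
  unfold U
  rw [SchwartzMap.fourierMultiplierCLM_apply, FourierTransform.fourier_fourierInv_eq,
    SchwartzMap.smulLeftCLM_apply_apply (hasTemperateGrowth_sym t)]
  rfl

/-- Propagators, translations and derivatives are all multiplication operators in frequency, so
identities between them are verified pointwise there. -/
theorem schwartz_ext_fourier {φ ψ : 𝓢(R3, ℂ)} (h : ∀ ξ, 𝓕 φ ξ = 𝓕 ψ ξ) : φ = ψ := by
  have : 𝓕 φ = 𝓕 ψ := SchwartzMap.ext h
  have h2 := congrArg (fun u : 𝓢(R3, ℂ) => (𝓕⁻ u : 𝓢(R3, ℂ))) this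
  simpa only [FourierTransform.fourierInv_fourier_eq] using h2

theorem U_zero (φ : 𝓢(R3, ℂ)) : U 0 φ = φ :=
  schwartz_ext_fourier fun ξ => by rw [fourier_U, sym_zero, one_mul]

theorem U_add (s t : ℝ) (φ : 𝓢(R3, ℂ)) : U (s + t) φ = U s (U t φ) :=
  schwartz_ext_fourier fun ξ => by rw [fourier_U, fourier_U, fourier_U, sym_add, mul_assoc]

theorem fourier_lineDeriv (m : R3) (φ : 𝓢(R3, ℂ)) (ξ : R3) :
    𝓕 (∂_{m} φ) ξ = 2 * Real.pi * Complex.I * (inner ℝ ξ m : ℝ) * 𝓕 φ ξ := by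
  rw [SchwartzMap.fourier_lineDerivOp_eq]
  have : (inner ℝ · m : R3 → ℝ).HasTemperateGrowth := by fun_prop
  simp [this]
  ring

theorem fourier_laplacian (φ : 𝓢(R3, ℂ)) (ξ : R3) :
    𝓕 (Δ φ) ξ = -((2 * Real.pi * ‖ξ‖ : ℝ) ^ 2 : ℂ) * 𝓕 φ ξ := by
  rw [SchwartzMap.laplacian_eq_sum (EuclideanSpace.basisFun (Fin 3) ℝ)]
  have h : 𝓕 (∑ i, ∂_{EuclideanSpace.basisFun (Fin 3) ℝ i}
      (∂_{EuclideanSpace.basisFun (Fin 3) ℝ i} φ)) ξ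
      = ∑ i, 𝓕 (∂_{EuclideanSpace.basisFun (Fin 3) ℝ i}
      (∂_{EuclideanSpace.basisFun (Fin 3) ℝ i} φ)) ξ := by
    have := map_sum (FourierTransform.fourierCLM ℂ 𝓢(R3, ℂ)) (fun i =>
      ∂_{EuclideanSpace.basisFun (Fin 3) ℝ i} (∂_{EuclideanSpace.basisFun (Fin 3) ℝ i} φ))
      Finset.univ
    simp only [FourierTransform.fourierCLM_apply] at this
    rw [this]
    simp
  rw [h]
  simp only [fourier_lineDeriv]
  have hn : ((‖ξ‖ : ℂ)) ^ 2 = ∑ i, ((ξ i : ℝ) : ℂ) ^ 2 := by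
    rw [← Complex.ofReal_pow, EuclideanSpace.real_norm_sq_eq]
    push_cast
    rfl
  push_cast
  rw [mul_pow, hn, Finset.mul_sum, ← Finset.sum_neg_distrib, Finset.sum_mul]
  refine Finset.sum_congr rfl fun i _ => ?_
  simp only [EuclideanSpace.basisFun_apply]
  rw [EuclideanSpace.inner_single_right]
  simp
  ring_nf
  rw [Complex.I_sq]
  ring

/-- Multiplication by the `j`-th coordinate. -/
def coordMul (j : Fin 3) : 𝓢(R3, ℂ) →L[ℂ] 𝓢(R3, ℂ) :=
  SchwartzMap.smulLeftCLM ℂ (fun x : R3 => ((x j : ℝ) : ℂ))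

theorem hasTemperateGrowth_coord (j : Fin 3) :
    (fun x : R3 => ((x j : ℝ) : ℂ)).HasTemperateGrowth := by
  have := (Complex.ofRealCLM.comp (EuclideanSpace.proj (𝕜 := ℝ) j)).hasTemperateGrowth
  exact this

theorem coordMul_apply (j : Fin 3) (φ : 𝓢(R3, ℂ)) (x : R3) :
    coordMul j φ x = (x j : ℂ) * φ x := by
  unfold coordMul
  rw [SchwartzMap.smulLeftCLM_apply_apply (hasTemperateGrowth_coord j)]
  rfl

/-- The `j`-th standard basis vector. -/
abbrev e (j : Fin 3) : R3 := EuclideanSpace.single j 1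

theorem inner_e (ξ : R3) (j : Fin 3) : inner ℝ ξ (e j) = ξ j := by
  rw [EuclideanSpace.inner_single_right]; simp

theorem fourier_coordMul (j : Fin 3) (φ : 𝓢(R3, ℂ)) (ξ : R3) :
    𝓕 (coordMul j φ) ξ = Complex.I / (2 * Real.pi) * (∂_{e j} (𝓕 φ)) ξ := by
  rw [SchwartzMap.lineDerivOp_fourier_eq]
  have h : SchwartzMap.smulLeftCLM ℂ (inner ℝ · (e j) : R3 → ℝ) φ = coordMul j φ := by
    ext x
    have h1 : (inner ℝ · (e j) : R3 → ℝ).HasTemperateGrowth := by fun_prop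
    rw [SchwartzMap.smulLeftCLM_apply_apply h1, coordMul_apply]
    simp only [inner_e]
    simp
  rw [h, FourierTransform.fourier_smul]
  have hp : (Real.pi : ℂ) ≠ 0 := by exact_mod_cast Real.pi_ne_zero
  simp
  field_simp
  rw [Complex.I_sq]
  ring

theorem lineDeriv_sym (t : ℝ) (j : Fin 3) (ξ : R3) :
    HasFDerivAt (sym t) (fderiv ℝ (sym t) ξ) ξ ∧
    fderiv ℝ (sym t) ξ (e j) = -(4 * Real.pi ^ 2 * t) * Complex.I * (ξ j) * sym t ξ := by
  have h0 : HasFDerivAt (sym t) (fderiv ℝ (sym t) ξ) ξ :=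
    ((hasTemperateGrowth_sym t).1.differentiable (by simp)).differentiableAt.hasFDerivAt
  refine ⟨h0, ?_⟩
  have hl : HasDerivAt (fun s : ℝ => ξ + s • e j) (e j) 0 := by
    simpa using ((hasDerivAt_id (0 : ℝ)).smul_const (e j)).const_add ξ
  have h1 : HasDerivAt (fun s : ℝ => sym t (ξ + s • e j)) (fderiv ℝ (sym t) ξ (e j)) 0 := by
    have h0' : HasFDerivAt (sym t) (fderiv ℝ (sym t) ξ) (ξ + (0 : ℝ) • e j) := by simpa using h0
    exact h0'.comp_hasDerivAt 0 hl
  have h2 : HasDerivAt (fun s : ℝ => sym t (ξ + s • e j))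
      (-(4 * Real.pi ^ 2 * t) * Complex.I * (ξ j) * sym t ξ) 0 := by
    have hs : (fun s : ℝ => sym t (ξ + s • e j)) = fun s : ℝ => Complex.exp (Complex.I *
        ((-(2 * Real.pi ^ 2 * t) * ‖ξ + s • e j‖ ^ 2 : ℝ) : ℂ)) := by
      funext s; rw [sym_eq]
    rw [hs]
    have h3 := hl.norm_sq
    have h4 := ((h3.const_mul (-(2 * Real.pi ^ 2 * t))).ofReal_comp.const_mul Complex.I).cexp
    convert h4 using 1
    rw [sym_eq]
    simp only [zero_smul, add_zero]
    rw [inner_e]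
    push_cast
    ring
  exact h1.unique h2

/-- The commutation relation `x e^{iΔt/2} = e^{iΔt/2} (x - i t ∇)`. -/
theorem coordMul_U (t : ℝ) (j : Fin 3) (φ : 𝓢(R3, ℂ)) :
    coordMul j (U t φ) = U t (coordMul j φ) - (Complex.I * t) • U t (∂_{e j} φ) := by
  apply schwartz_ext_fourier
  intro ξ
  have hsub : ∀ a b : 𝓢(R3, ℂ), 𝓕 (a - b) ξ = 𝓕 a ξ - 𝓕 b ξ := by
    intro a b
    have := map_sub (FourierTransform.fourierCLM ℂ 𝓢(R3, ℂ)) a b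
    simp only [FourierTransform.fourierCLM_apply] at this
    rw [this]; rfl
  rw [hsub, FourierTransform.fourier_smul, fourier_coordMul, _root_.smul_apply, fourier_U,
    fourier_U, fourier_coordMul, fourier_lineDeriv]
  have hU : (⇑(𝓕 (U t φ) : 𝓢(R3, ℂ)) : R3 → ℂ) = fun ξ => sym t ξ * 𝓕 φ ξ := by
    funext ξ; exact fourier_U t φ ξ
  rw [SchwartzMap.lineDerivOp_apply_eq_fderiv, SchwartzMap.lineDerivOp_apply_eq_fderiv, hU]
  -- In frequency, multiplication by `x_j` is a derivative. The product rule lets it fall on the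
  -- symbol, which produces the factor `t`, or on `𝓕 φ`.
  have h1 := lineDeriv_sym t j ξ
  have h2 := (h1.1.mul ((𝓕 φ).hasFDerivAt ξ)).fderiv
  have h3 : fderiv ℝ (fun ξ => sym t ξ * 𝓕 φ ξ) ξ = _ := h2
  rw [h3]
  simp only [_root_.add_apply, _root_.smul_apply, h1.2, inner_e]
  have hp : (Real.pi : ℂ) ≠ 0 := by exact_mod_cast Real.pi_ne_zero
  simp only [smul_eq_mul]
  field_simp
  ring_nf

/-- The commutation relation solved for the derivative: a derivative of the data is traded for a
factor `1/t`, at the price of a weight. This yields pointwise decay faster than `t^{-3/2}`. -/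
theorem U_lineDeriv_eq {t : ℝ} (ht : t ≠ 0) (j : Fin 3) (φ : 𝓢(R3, ℂ)) (y : R3) :
    U t (∂_{e j} φ) y = Complex.I / t * (y j * U t φ y - U t (coordMul j φ) y) := by
  have h := congrArg (fun ψ : 𝓢(R3, ℂ) => ψ y) (coordMul_U t j φ)
  simp only [coordMul_apply, _root_.sub_apply, _root_.smul_apply, smul_eq_mul] at h
  rw [h]
  have ht' : (t : ℂ) ≠ 0 := by exact_mod_cast ht
  field_simp
  ring_nf
  rw [Complex.I_sq]
  ring

theorem coordMul_lineDeriv (j k : Fin 3) (φ : 𝓢(R3, ℂ)) :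
    coordMul j (∂_{e k} φ) = ∂_{e k} (coordMul j φ) - (if j = k then (1 : ℂ) else 0) • φ := by
  ext x
  rw [_root_.sub_apply, _root_.smul_apply, coordMul_apply,
    SchwartzMap.lineDerivOp_apply_eq_fderiv, SchwartzMap.lineDerivOp_apply_eq_fderiv]
  have h0 : (⇑(coordMul j φ) : R3 → ℂ) = fun x => (x j : ℂ) * φ x := by
    funext x; exact coordMul_apply j φ x
  have h1 : HasFDerivAt (fun x : R3 => ((x j : ℝ) : ℂ))
      (Complex.ofRealCLM.comp (EuclideanSpace.proj (𝕜 := ℝ) j)) x :=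
    (Complex.ofRealCLM.comp (EuclideanSpace.proj (𝕜 := ℝ) j)).hasFDerivAt
  have h2 : fderiv ℝ (fun x : R3 => (x j : ℂ) * φ x) x = _ := (h1.mul (φ.hasFDerivAt x)).fderiv
  rw [h0, h2]
  simp
  split_ifs <;> simp

end Friction

end

noncomputable section

namespace Friction

open LineDeriv

/-! ### The Schrödinger kernel -/

theorem U_apply (t : ℝ) (φ : 𝓢(R3, ℂ)) (y : R3) :
    U t φ y = ∫ ξ, Complex.exp ((2 * Real.pi * inner ℝ ξ y : ℝ) * Complex.I)
      * (sym t ξ * 𝓕 φ ξ) := by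
  have h : (𝓕⁻ (𝓕 (U t φ) : 𝓢(R3, ℂ)) : 𝓢(R3, ℂ)) = U t φ :=
    FourierTransform.fourierInv_fourier_eq _
  rw [← h, SchwartzMap.fourierInv_coe, Real.fourierInv_eq']
  simp only [fourier_U, smul_eq_mul]

theorem integral_fourier_mul_eq_of_integrable {f g : R3 → ℂ} (hf : Integrable f)
    (hg : Integrable g) : ∫ ξ, 𝓕 f ξ * g ξ = ∫ x, f x * 𝓕 g x := by
  simpa using! VectorFourier.integral_bilin_fourierIntegral_eq_flip (.mul ℂ ℂ)
    (L := innerₗ R3) Real.continuous_fourierChar continuous_inner hf hg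

/-- The constant in the Schrödinger kernel. -/
def kernelConst : ℂ :=
  ((Real.pi / (2 * Real.pi ^ 2) : ℝ) / Complex.I : ℂ) ^ ((3 : ℂ) / 2)

/-- A positive real factor changes the logarithm by a real summand and does not affect the branch,
so it can be pulled out of the complex power. -/
theorem cpow_pi_div {t : ℝ} (ht : 0 < t) :
    ((Real.pi : ℂ) / (2 * Real.pi ^ 2 * t * Complex.I)) ^ ((3 : ℂ) / 2)
      = kernelConst * ((t ^ (-(3 / 2) : ℝ) : ℝ) : ℂ) := by
  have hp : (Real.pi : ℂ) ≠ 0 := by exact_mod_cast Real.pi_ne_zero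
  have ht' : (t : ℂ) ≠ 0 := by exact_mod_cast ht.ne'
  set z : ℂ := (Real.pi / (2 * Real.pi ^ 2) : ℝ) / Complex.I with hz
  have hz0 : z ≠ 0 := by
    rw [hz]; push_cast; simp [hp]
  have h1 : (Real.pi : ℂ) / (2 * Real.pi ^ 2 * t * Complex.I) = ((t⁻¹ : ℝ) : ℂ) * z := by
    rw [hz]; push_cast; field_simp
  have h2 : ((t⁻¹ : ℝ) : ℂ) * z ≠ 0 := mul_ne_zero (by simpa using ht') hz0
  rw [h1, Complex.cpow_def_of_ne_zero h2, Complex.log_ofReal_mul (by positivity) hz0, add_mul,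
    Complex.exp_add, kernelConst, ← hz, Complex.cpow_def_of_ne_zero hz0, mul_comm]
  congr 1
  rw [Real.rpow_def_of_pos ht, Complex.ofReal_exp]
  congr 1
  rw [Real.log_inv]
  push_cast
  ring

/-- The oscillating symbol is the limit `ε → 0` of Gaussians whose quadratic coefficient has real
part `ε`. For `ε > 0` the Fourier transform is explicit and can be moved from `φ` to the Gaussian;
both sides then converge by dominated convergence. -/
theorem U_kernel {t : ℝ} (ht : 0 < t) (φ : 𝓢(R3, ℂ)) (y : R3) :
    U t φ y = kernelConst * ((t ^ (-(3 / 2) : ℝ) : ℝ) : ℂ)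
      * ∫ x, φ x * Complex.exp (Complex.I * ((‖x - y‖ ^ 2 / (2 * t) : ℝ) : ℂ)) := by
  have hp : (Real.pi : ℂ) ≠ 0 := by exact_mod_cast Real.pi_ne_zero
  have ht' : (t : ℂ) ≠ 0 := by exact_mod_cast ht.ne'
  let b : ℝ → ℂ := fun ε => ε + 2 * Real.pi ^ 2 * t * Complex.I
  have hb0 : b 0 = 2 * Real.pi ^ 2 * t * Complex.I := by simp [b]
  have hb_re : ∀ ε, (b ε).re = ε := by
    intro ε
    simp only [b]
    have : (2 * (Real.pi : ℂ) ^ 2 * t * Complex.I) = ((2 * Real.pi ^ 2 * t : ℝ) : ℂ) * Complex.I := by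
      push_cast; ring
    rw [this, Complex.add_re, Complex.re_ofReal_mul]; simp
  have hbne : b 0 ≠ 0 := by
    rw [hb0]; simp [hp, ht']
  have hbc : Continuous b := by fun_prop
  let g : ℝ → R3 → ℂ := fun ε v =>
    Complex.exp (-b ε * ‖v‖ ^ 2 + 2 * Real.pi * Complex.I * (inner ℝ y v : ℝ))
  have key : ∀ ε, 0 < ε → ∫ ξ, 𝓕 φ ξ * g ε ξ =
      (Real.pi / b ε) ^ ((3 : ℂ) / 2) *
        ∫ x, φ x * Complex.exp (-Real.pi ^ 2 * ‖y - x‖ ^ 2 / b ε) := by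
    intro ε hε
    have hb' : 0 < (b ε).re := by rw [hb_re]; exact hε
    have hgi : Integrable (g ε) := GaussianFourier.integrable_cexp_neg_mul_sq_norm_add hb' _ y
    rw [SchwartzMap.fourier_coe, integral_fourier_mul_eq_of_integrable φ.integrable hgi,
      ← integral_const_mul]
    refine integral_congr_ae (Eventually.of_forall fun x => ?_)
    simp only [g]
    rw [fourier_gaussian_innerProductSpace' hb' y x]
    simp
    ring
  -- The transformed Gaussian still has an exponent with non-positive real part, so `‖φ x‖`
  -- dominates the integrand uniformly in `ε`.
  have hre : ∀ ε, 0 ≤ ε → ∀ r : ℝ, 0 ≤ r →  (-Real.pi ^ 2 * r / b ε : ℂ).re ≤ 0 := by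
    intro ε hε r hr
    have : (-Real.pi ^ 2 * r / b ε : ℂ) = ((-(Real.pi ^ 2 * r) : ℝ) : ℂ) * (b ε)⁻¹ := by
      push_cast; ring
    rw [this, Complex.re_ofReal_mul, Complex.inv_re, hb_re]
    have : 0 ≤ ε / Complex.normSq (b ε) := div_nonneg hε (Complex.normSq_nonneg _)
    have h2 : 0 ≤ Real.pi ^ 2 * r := by positivity
    nlinarith
  have hL : Tendsto (fun ε => ∫ ξ, 𝓕 φ ξ * g ε ξ) (𝓝[>] 0) (𝓝 (∫ ξ, 𝓕 φ ξ * g 0 ξ)) := by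
    refine tendsto_integral_filter_of_dominated_convergence (fun ξ => ‖𝓕 φ ξ‖) ?_ ?_ ?_ ?_
    · refine Eventually.of_forall fun ε => ?_
      exact ((𝓕 φ).continuous.mul (by fun_prop)).aestronglyMeasurable
    · filter_upwards [self_mem_nhdsWithin] with ε hε
      refine Eventually.of_forall fun ξ => ?_
      rw [norm_mul]
      refine mul_le_of_le_one_right (norm_nonneg _) ?_
      simp only [g]
      rw [Complex.norm_exp, Real.exp_le_one_iff]
      have : (-b ε * ‖ξ‖ ^ 2 + 2 * Real.pi * Complex.I * (inner ℝ y ξ : ℝ)).re = - ε * ‖ξ‖ ^ 2 := by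
        have h1 : (-b ε * ‖ξ‖ ^ 2 : ℂ) = ((‖ξ‖ ^ 2 : ℝ) : ℂ) * (-b ε) := by push_cast; ring
        have h2 : 2 * Real.pi * Complex.I * (inner ℝ y ξ : ℝ)
          = ((2 * Real.pi * inner ℝ y ξ : ℝ) : ℂ) * Complex.I := by push_cast; ring
        rw [h1, h2, Complex.add_re, Complex.re_ofReal_mul, Complex.neg_re, hb_re]
        simp
        ring
      rw [this]
      have hε' : 0 < ε := hε
      nlinarith [sq_nonneg ‖ξ‖]
    · exact (𝓕 φ).integrable.norm
    · refine Eventually.of_forall fun ξ => ?_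
      have : Continuous fun ε => 𝓕 φ ξ * g ε ξ := by fun_prop
      exact (this.tendsto 0).mono_left nhdsWithin_le_nhds
  have hR : Tendsto (fun ε => (Real.pi / b ε) ^ ((3 : ℂ) / 2) *
        ∫ x, φ x * Complex.exp (-Real.pi ^ 2 * ‖y - x‖ ^ 2 / b ε)) (𝓝[>] 0)
        (𝓝 ((Real.pi / b 0) ^ ((3 : ℂ) / 2) *
        ∫ x, φ x * Complex.exp (-Real.pi ^ 2 * ‖y - x‖ ^ 2 / b 0))) := by
    have hdiv : Tendsto (fun ε => (Real.pi : ℂ) / b ε) (𝓝[>] 0) (𝓝 (Real.pi / b 0)) :=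
      ((continuousAt_const.div hbc.continuousAt hbne).tendsto).mono_left nhdsWithin_le_nhds
    refine Tendsto.mul ?_ ?_
    -- The limit is a nonzero purely imaginary number, off the cut of the principal power, which is
    -- therefore continuous there.
    · have hs : (Real.pi : ℂ) / b 0 ∈ Complex.slitPlane := by
        right
        rw [hb0]
        have : (Real.pi : ℂ) / (2 * Real.pi ^ 2 * t * Complex.I)
            = ((-(1 / (2 * Real.pi * t)) : ℝ) : ℂ) * Complex.I := by
          push_cast
          field_simp
          rw [Complex.I_sq]
          ring
        rw [this]
        have : 0 < 1 / (2 * Real.pi * t) := by positivity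
        simp
        exact ht.ne'
      exact (continuousAt_cpow_const hs).tendsto.comp hdiv
    · refine tendsto_integral_filter_of_dominated_convergence (fun x => ‖φ x‖) ?_ ?_ ?_ ?_
      · refine Eventually.of_forall fun ε => ?_
        exact (φ.continuous.mul (by fun_prop)).aestronglyMeasurable
      · filter_upwards [self_mem_nhdsWithin] with ε hε
        refine Eventually.of_forall fun x => ?_
        rw [norm_mul]
        refine mul_le_of_le_one_right (norm_nonneg _) ?_
        rw [Complex.norm_exp, Real.exp_le_one_iff]
        have := hre ε (le_of_lt hε) (‖y - x‖ ^ 2) (by positivity)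
        simpa using this
      · exact φ.integrable.norm
      · refine Eventually.of_forall fun x => ?_
        refine Tendsto.const_mul _ ?_
        refine (Complex.continuous_exp.tendsto _).comp ?_
        exact ((continuousAt_const.div hbc.continuousAt hbne).tendsto).mono_left nhdsWithin_le_nhds
  have heq : ∫ ξ, 𝓕 φ ξ * g 0 ξ = (Real.pi / b 0) ^ ((3 : ℂ) / 2) *
        ∫ x, φ x * Complex.exp (-Real.pi ^ 2 * ‖y - x‖ ^ 2 / b 0) := by
    refine tendsto_nhds_unique hL (hR.congr' ?_)
    filter_upwards [self_mem_nhdsWithin] with ε hε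
    exact (key ε hε).symm
  have hUy : U t φ y = ∫ ξ, 𝓕 φ ξ * g 0 ξ := by
    rw [U_apply]
    refine integral_congr_ae (Eventually.of_forall fun ξ => ?_)
    simp only [g, sym_eq, hb0]
    rw [mul_comm, mul_assoc, mul_comm, mul_assoc, ← Complex.exp_add, real_inner_comm]
    congr 2
    push_cast
    ring
  rw [hUy, heq, hb0, cpow_pi_div ht]
  congr 1
  refine integral_congr_ae (Eventually.of_forall fun x => ?_)
  simp only
  congr 2
  rw [norm_sub_rev]
  push_cast
  field_simp
  rw [Complex.I_sq]
  ring

theorem norm_exp_I_mul_ofReal (x : ℝ) : ‖Complex.exp (Complex.I * x)‖ = 1 :=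
  Complex.norm_exp_I_mul_ofReal x

theorem norm_U_le_rpow {t : ℝ} (ht : 0 < t) (φ : 𝓢(R3, ℂ)) (y : R3) :
    ‖U t φ y‖ ≤ ‖kernelConst‖ * (∫ x, ‖φ x‖) * t ^ (-(3 / 2) : ℝ) := by
  rw [U_kernel ht, norm_mul, norm_mul, Complex.norm_real, Real.norm_of_nonneg (by positivity)]
  have : ‖∫ x, φ x * Complex.exp (Complex.I * ((‖x - y‖ ^ 2 / (2 * t) : ℝ) : ℂ))‖ ≤ ∫ x, ‖φ x‖ := by
    refine (norm_integral_le_integral_norm _).trans (le_of_eq ?_)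
    simp only [norm_mul, norm_exp_I_mul_ofReal, mul_one]
  calc _ ≤ ‖kernelConst‖ * t ^ (-(3 / 2) : ℝ) * ∫ x, ‖φ x‖ := by gcongr
    _ = _ := by ring

theorem norm_U_le_const (t : ℝ) (φ : 𝓢(R3, ℂ)) (y : R3) : ‖U t φ y‖ ≤ ∫ ξ, ‖𝓕 φ ξ‖ := by
  rw [U_apply]
  refine (norm_integral_le_integral_norm _).trans (le_of_eq ?_)
  simp only [norm_mul, norm_sym, one_mul]
  congr 1
  funext ξ
  rw [mul_comm ((2 * Real.pi * inner ℝ ξ y : ℝ) : ℂ), norm_exp_I_mul_ofReal, one_mul]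

/-- If `u` is bounded and decays like `C t^{-p}` then it is bounded by `C (1 + t)^{-p}`. -/
theorem le_one_add_rpow {A B p t u : ℝ} (hp : 0 ≤ p) (ht : 0 ≤ t) (hA : 0 ≤ A) (hB : 0 ≤ B)
    (h1 : u ≤ A) (h2 : 0 < t → u ≤ B * t ^ (-p)) :
    u ≤ (A + B) * 2 ^ p * (1 + t) ^ (-p) := by
  rcases le_or_gt t 1 with h | h
  · have : 1 ≤ 2 ^ p * (1 + t) ^ (-p) := by
      rw [Real.rpow_neg (by positivity), ← div_eq_mul_inv, le_div_iff₀ (by positivity), one_mul]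
      exact Real.rpow_le_rpow (by positivity) (by linarith) hp
    calc u ≤ (A + B) * 1 := by linarith
      _ ≤ (A + B) * (2 ^ p * (1 + t) ^ (-p)) := by gcongr
      _ = _ := by ring
  · have ht0 : 0 < t := by linarith
    have : t ^ (-p) ≤ 2 ^ p * (1 + t) ^ (-p) := by
      rw [Real.rpow_neg (by positivity), Real.rpow_neg (by positivity), ← div_eq_mul_inv,
        le_div_iff₀ (by positivity), ← div_eq_inv_mul, div_le_iff₀ (by positivity),
        ← Real.mul_rpow (by positivity) (by positivity)]
      exact Real.rpow_le_rpow (by positivity) (by linarith) hp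
    calc u ≤ B * t ^ (-p) := h2 ht0
      _ ≤ (A + B) * (2 ^ p * (1 + t) ^ (-p)) := by gcongr; linarith
      _ = _ := by ring

theorem exists_norm_U_le (φ : 𝓢(R3, ℂ)) : ∃ C, 0 ≤ C ∧ ∀ t, 0 ≤ t → ∀ y,
    ‖U t φ y‖ ≤ C * (1 + t) ^ (-(3 / 2) : ℝ) := by
  refine ⟨_, ?_, fun t ht y => le_one_add_rpow (p := 3 / 2) (by norm_num) ht
    (A := ∫ ξ, ‖𝓕 φ ξ‖) (B := ‖kernelConst‖ * ∫ x, ‖φ x‖) ?_ ?_ (norm_U_le_const t φ y)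
    (fun h => norm_U_le_rpow h φ y)⟩ <;> positivity

end Friction

end

noncomputable section

namespace Friction

open LineDeriv

/-! ### Pairings with square integrable functions -/

/-- Complex conjugation on Schwartz functions. -/
def conjS : 𝓢(R3, ℂ) →L[ℝ] 𝓢(R3, ℂ) :=
  SchwartzMap.postcompCLM (𝕜 := ℝ) (Complex.conjCLE : ℂ →L[ℝ] ℂ)

theorem conjS_apply (φ : 𝓢(R3, ℂ)) (x : R3) : conjS φ x = (starRingEnd ℂ) (φ x) := rfl

theorem fourier_conjS (φ : 𝓢(R3, ℂ)) (ξ : R3) :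
    𝓕 (conjS φ) ξ = (starRingEnd ℂ) (𝓕 φ (-ξ)) := by
  rw [SchwartzMap.fourier_coe, SchwartzMap.fourier_coe, Real.fourier_eq', Real.fourier_eq',
    ← integral_conj]
  refine integral_congr_ae (Eventually.of_forall fun x => ?_)
  simp only [conjS_apply, smul_eq_mul, map_mul, ← Complex.exp_conj, Complex.conj_I,
    Complex.conj_ofReal]
  congr 2
  rw [inner_neg_right]
  push_cast
  ring

theorem conjS_U (t : ℝ) (φ : 𝓢(R3, ℂ)) : conjS (U t φ) = U (-t) (conjS φ) := by
  apply schwartz_ext_fourier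
  intro ξ
  rw [fourier_conjS, fourier_U, fourier_U, fourier_conjS, map_mul, conj_sym, sym_neg]

/-- Schwartz functions as elements of `L²`. -/
def toL2 : 𝓢(R3, ℂ) →L[ℂ] L2 := SchwartzMap.toLpCLM ℂ ℂ 2 volume

theorem coeFn_toL2 (φ : 𝓢(R3, ℂ)) : toL2 φ =ᵐ[volume] φ := φ.coeFn_toLp 2 volume

theorem norm_fourier_toL2 (φ : 𝓢(R3, ℂ)) : ‖toL2 (𝓕 φ : 𝓢(R3, ℂ))‖ = ‖toL2 φ‖ :=
  SchwartzMap.norm_fourier_toL2_eq φ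

theorem fourier_toL2 (φ : 𝓢(R3, ℂ)) : 𝓕 (toL2 φ) = toL2 (𝓕 φ : 𝓢(R3, ℂ)) :=
  SchwartzMap.toLp_fourier_eq φ

theorem norm_toLp_le_mul {φ ψ : 𝓢(R3, ℂ)} {C : ℝ} (h : ∀ x, ‖φ x‖ ≤ C * ‖ψ x‖) :
    ‖toL2 φ‖ ≤ C * ‖toL2 ψ‖ := by
  refine Lp.norm_le_mul_norm_of_ae_le_mul ?_
  filter_upwards [coeFn_toL2 φ, coeFn_toL2 ψ] with x h1 h2
  rw [h1, h2]
  exact h x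

theorem norm_toLp_congr {φ ψ : 𝓢(R3, ℂ)} (h : ∀ x, ‖φ x‖ = ‖ψ x‖) :
    ‖toL2 φ‖ = ‖toL2 ψ‖ :=
  le_antisymm (by simpa using norm_toLp_le_mul (C := 1) fun x => by simpa using (h x).le)
    (by simpa using norm_toLp_le_mul (C := 1) fun x => by simpa using (h x).ge)

theorem norm_toLp_conjS (φ : 𝓢(R3, ℂ)) : ‖toL2 (conjS φ)‖ = ‖toL2 φ‖ :=
  norm_toLp_congr fun x => by rw [conjS_apply, RCLike.norm_conj]

theorem norm_toLp_U (t : ℝ) (φ : 𝓢(R3, ℂ)) : ‖toL2 (U t φ)‖ = ‖toL2 φ‖ := by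
  rw [← norm_fourier_toL2 (U t φ), ← norm_fourier_toL2 φ]
  exact norm_toLp_congr fun ξ => by rw [fourier_U, norm_mul, norm_sym, one_mul]

/-- The bilinear pairing `∫ φ b` of a Schwartz function and a square integrable function. -/
def pair (φ : 𝓢(R3, ℂ)) (b : L2) : ℂ := ∫ x, φ x * b x

theorem pair_eq_inner (φ : 𝓢(R3, ℂ)) (b : L2) : pair φ b = inner ℂ (toL2 (conjS φ)) b := by
  rw [L2.inner_def, pair]
  refine integral_congr_ae ?_
  filter_upwards [coeFn_toL2 (conjS φ)] with x h
  rw [h]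
  simp [conjS_apply, mul_comm]

theorem norm_pair_le (φ : 𝓢(R3, ℂ)) (b : L2) : ‖pair φ b‖ ≤ ‖toL2 φ‖ * ‖b‖ := by
  rw [pair_eq_inner, ← norm_toLp_conjS φ]
  exact norm_inner_le_norm _ _

theorem pair_toLp (φ ψ : 𝓢(R3, ℂ)) : pair φ (toL2 ψ) = ∫ x, φ x * ψ x := by
  refine integral_congr_ae ?_
  filter_upwards [coeFn_toL2 ψ] with x h
  rw [h]

theorem pair_sub (φ ψ : 𝓢(R3, ℂ)) (b : L2) : pair (φ - ψ) b = pair φ b - pair ψ b := by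
  rw [pair_eq_inner, pair_eq_inner, pair_eq_inner, map_sub, map_sub, inner_sub_left]

theorem pair_sub_right (φ : 𝓢(R3, ℂ)) (b c : L2) : pair φ (b - c) = pair φ b - pair φ c := by
  simp only [pair_eq_inner, inner_sub_right]

/-- Parseval's identity for `⟨g, e^{iΔt/2} b⟩`. -/
theorem specPair_schr (t : ℝ) (g : 𝓢(R3, ℂ)) (b : L2) :
    specPair (schr t) (𝓕 g : 𝓢(R3, ℂ)) (𝓕 b : L2) = pair (U t (conjS g)) b := by
  have h1 : U t (conjS g) = conjS (U (-t) g) := by rw [conjS_U, neg_neg]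
  have h2 : conjS (conjS (U (-t) g)) = U (-t) g := by ext x; simp [conjS_apply]
  rw [h1, pair_eq_inner, h2, ← Lp.inner_fourier_eq, fourier_toL2, L2.inner_def,
    specPair]
  refine integral_congr_ae ?_
  filter_upwards [coeFn_toL2 (𝓕 (U (-t) g) : 𝓢(R3, ℂ))] with ξ h
  rw [h, fourier_U]
  simp only [RCLike.inner_apply, map_mul, conj_sym, neg_neg]
  unfold sym
  ring

theorem specPair_schr_schwartz (t : ℝ) (g h : 𝓢(R3, ℂ)) :
    specPair (schr t) (𝓕 g : 𝓢(R3, ℂ)) (𝓕 h : 𝓢(R3, ℂ)) = ∫ x, U t (conjS g) x * h x := by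
  rw [← pair_toLp, ← specPair_schr, fourier_toL2]
  refine integral_congr_ae ?_
  filter_upwards [coeFn_toL2 (𝓕 h : 𝓢(R3, ℂ))] with ξ h
  rw [h]

/-! ### Translations -/

/-- Translation by `a`. -/
def shift (a : R3) : 𝓢(R3, ℂ) →L[ℂ] 𝓢(R3, ℂ) := SchwartzMap.compSubConstCLM ℂ a

theorem shift_apply (a : R3) (φ : 𝓢(R3, ℂ)) (x : R3) : shift a φ x = φ (x - a) := by
  simp [shift]

theorem fourier_shift (a : R3) (φ : 𝓢(R3, ℂ)) (ξ : R3) :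
    𝓕 (shift a φ) ξ = Complex.exp (Complex.I * ((-(2 * Real.pi * inner ℝ a ξ) : ℝ) : ℂ))
      * 𝓕 φ ξ := by
  rw [SchwartzMap.fourier_coe, SchwartzMap.fourier_coe, Real.fourier_eq', Real.fourier_eq',
    ← integral_const_mul]
  rw [← integral_add_right_eq_self _ a]
  refine integral_congr_ae (Eventually.of_forall fun x => ?_)
  simp only [shift_apply, add_sub_cancel_right, smul_eq_mul]
  rw [← mul_assoc, ← Complex.exp_add]
  congr 2
  rw [inner_add_left]
  push_cast
  ring

theorem U_shift (t : ℝ) (a : R3) (φ : 𝓢(R3, ℂ)) : U t (shift a φ) = shift a (U t φ) :=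
  schwartz_ext_fourier fun ξ => by rw [fourier_U, fourier_shift, fourier_shift, fourier_U]; ring

theorem conjS_shift (a : R3) (φ : 𝓢(R3, ℂ)) : conjS (shift a φ) = shift a (conjS φ) := by
  ext x; simp [conjS_apply, shift_apply]

theorem norm_toLp_shift (a : R3) (φ : 𝓢(R3, ℂ)) : ‖toL2 (shift a φ)‖ = ‖toL2 φ‖ := by
  rw [← norm_fourier_toL2 (shift a φ), ← norm_fourier_toL2 φ]
  exact norm_toLp_congr fun ξ => by
    rw [fourier_shift, norm_mul, norm_exp_I_mul_ofReal, one_mul]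

/-! ### Time derivative of the free evolution in `L²` -/

theorem norm_exp_sub_one_sub_le (θ : ℝ) :
    ‖Complex.exp (Complex.I * θ) - 1 - Complex.I * θ‖ ≤ 2 * θ ^ 2 := by
  have hn : ‖Complex.I * (θ : ℂ)‖ = |θ| := by simp
  rcases le_or_gt |θ| 1 with h | h
  · refine (Complex.norm_exp_sub_one_sub_id_le (by rwa [hn])).trans ?_
    rw [hn, sq_abs]
    nlinarith [sq_nonneg θ]
  · calc ‖Complex.exp (Complex.I * θ) - 1 - Complex.I * θ‖
        ≤ ‖Complex.exp (Complex.I * θ) - 1‖ + ‖Complex.I * (θ : ℂ)‖ := norm_sub_le _ _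
      _ ≤ |θ| + |θ| := by
        rw [hn]
        gcongr
        simpa using Real.norm_exp_I_mul_ofReal_sub_one_le (x := θ)
      _ ≤ 2 * θ ^ 2 := by
        rw [← sq_abs θ]; nlinarith

/-- By Plancherel the error is the second order Taylor remainder of `e^{-ihq/2}` with `q = |2πξ|²`.
It is at most `h²q²`, and `q²` is the symbol of `Δ²`; so the evolution of Schwartz data is
differentiable in `L²`. -/
theorem norm_U_sub_sub_le (t h : ℝ) (φ : 𝓢(R3, ℂ)) :
    ‖toL2 (U (t + h) φ) - toL2 (U t φ) - (h * (Complex.I / 2)) • toL2 (U t (Δ φ))‖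
      ≤ h ^ 2 * ‖toL2 (Δ (Δ φ))‖ := by
  rw [← map_smul, ← map_sub, ← map_sub, ← norm_fourier_toL2,
    ← norm_fourier_toL2 (Δ (Δ φ))]
  refine norm_toLp_le_mul fun ξ => ?_
  have hsub : ∀ a b : 𝓢(R3, ℂ), 𝓕 (a - b) = 𝓕 a - 𝓕 b := by
    intro a b
    simpa only [FourierTransform.fourierCLM_apply] using
      map_sub (FourierTransform.fourierCLM ℂ 𝓢(R3, ℂ)) a b
  rw [hsub, hsub, FourierTransform.fourier_smul]
  rw [_root_.sub_apply, _root_.sub_apply, _root_.smul_apply, fourier_U, fourier_U, fourier_U,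
    fourier_laplacian, fourier_laplacian, fourier_laplacian, sym_add, smul_eq_mul]
  set q : ℝ := (2 * Real.pi * ‖ξ‖) ^ 2 with hq
  have hq' : ((2 * Real.pi * ‖ξ‖ : ℝ) : ℂ) ^ 2 = (q : ℂ) := by rw [hq]; push_cast; ring
  rw [hq']
  have hs : sym h ξ = Complex.exp (Complex.I * ((-(h * q / 2) : ℝ) : ℂ)) := by
    unfold sym schr
    congr 1
    rw [← hq]
    push_cast
    ring
  have h1 : sym t ξ * sym h ξ * 𝓕 φ ξ - sym t ξ * 𝓕 φ ξ
      - h * (Complex.I / 2) * (sym t ξ * (-(q : ℂ) * 𝓕 φ ξ))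
      = sym t ξ * 𝓕 φ ξ * (Complex.exp (Complex.I * ((-(h * q / 2) : ℝ) : ℂ)) - 1
        - Complex.I * ((-(h * q / 2) : ℝ) : ℂ)) := by
    rw [hs]; push_cast; ring
  rw [h1, norm_mul, norm_mul, norm_sym, one_mul]
  have h2 := norm_exp_sub_one_sub_le (-(h * q / 2))
  calc ‖𝓕 φ ξ‖ * _ ≤ ‖𝓕 φ ξ‖ * (2 * (-(h * q / 2)) ^ 2) := by gcongr
    _ ≤ h ^ 2 * ‖-(q : ℂ) * (-(q : ℂ) * 𝓕 φ ξ)‖ := by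
      rw [norm_mul, norm_mul, norm_neg, Complex.norm_real, Real.norm_eq_abs]
      have : |q| * (|q| * ‖𝓕 φ ξ‖) = q ^ 2 * ‖𝓕 φ ξ‖ := by
        rw [← mul_assoc, ← sq, sq_abs]
      rw [this]
      nlinarith [mul_nonneg (mul_nonneg (sq_nonneg h) (sq_nonneg q)) (norm_nonneg (𝓕 φ ξ))]

theorem hasDerivAt_U (t : ℝ) (φ : 𝓢(R3, ℂ)) :
    HasDerivAt (fun s => toL2 (U s φ)) ((Complex.I / 2) • toL2 (U t (Δ φ))) t := by
  rw [hasDerivAt_iff_isLittleO_nhds_zero]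
  have h : (fun h : ℝ => toL2 (U (t + h) φ) - toL2 (U t φ)
      - h • (Complex.I / 2) • toL2 (U t (Δ φ))) =O[𝓝 0] fun h : ℝ => h ^ 2 := by
    refine Asymptotics.IsBigO.of_bound ‖toL2 (Δ (Δ φ))‖ (Eventually.of_forall fun h => ?_)
    have := norm_U_sub_sub_le t h φ
    rw [mul_smul] at this
    rw [norm_pow, Real.norm_eq_abs, sq_abs, mul_comm]
    exact this
  exact h.trans_isLittleO (by
    simpa using (Asymptotics.isLittleO_pow_id (𝕜 := ℝ) (n := 2) (by norm_num)))

lemma laplacian_conjS (φ : 𝓢(R3, ℂ)) : Δ (conjS φ) = conjS (Δ φ) :=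
  schwartz_ext_fourier fun ξ => by
    rw [fourier_laplacian, fourier_conjS, fourier_conjS, fourier_laplacian, norm_neg]
    simp only [map_mul, map_neg, map_pow, Complex.conj_ofReal]

theorem hasDerivAt_pair_U (t : ℝ) (φ : 𝓢(R3, ℂ)) (b : L2) :
    HasDerivAt (fun s => pair (U s φ) b) (Complex.I / 2 * pair (U t (Δ φ)) b) t := by
  have h1 : ∀ s, pair (U s φ) b = inner ℂ (toL2 (U (-s) (conjS φ))) b := by
    intro s; rw [pair_eq_inner, conjS_U]
  have h2 : Complex.I / 2 * pair (U t (Δ φ)) b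
      = inner ℂ ((-1 : ℝ) • ((Complex.I / 2) • toL2 (U (-t) (Δ (conjS φ))))) b := by
    rw [laplacian_conjS, pair_eq_inner, conjS_U]
    have hv : ∀ v : L2, (-1 : ℝ) • v = (-1 : ℂ) • v := fun v => by simp
    rw [hv, smul_smul, inner_smul_left]
    simp only [map_mul, map_div₀, Complex.conj_I, map_ofNat, map_neg, map_one]
    ring
  rw [h2]
  simp only [h1]
  have h3 : HasDerivAt (fun s : ℝ => toL2 (U (-s) (conjS φ)))
      ((-1 : ℝ) • ((Complex.I / 2) • toL2 (U (-t) (Δ (conjS φ))))) t :=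
    HasDerivAt.scomp t (h := fun s : ℝ => -s) (hasDerivAt_U (-t) (conjS φ)) (hasDerivAt_neg t)
  simpa using h3.inner ℂ (hasDerivAt_const t b)

theorem continuous_pair_U (φ : 𝓢(R3, ℂ)) (b : L2) : Continuous fun t => pair (U t φ) b :=
  continuous_iff_continuousAt.2 fun t => (hasDerivAt_pair_U t φ b).continuousAt

end Friction

end

noncomputable section

namespace Friction

open LineDeriv

/-! ### The potential as a Schwartz function -/

theorem exists_pow_mul_exp_le (k : ℕ) {a : ℝ} (ha : 0 < a) :
    ∃ B, ∀ r : ℝ, 0 ≤ r → r ^ k * Real.exp (-a * r) ≤ B := by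
  refine ⟨k.factorial / a ^ k, fun r hr => ?_⟩
  have h := Real.pow_div_factorial_le_exp (a * r) (by positivity) k
  rw [neg_mul, Real.exp_neg, ← div_eq_mul_inv, div_le_div_iff₀ (Real.exp_pos _) (by positivity)]
  rw [div_le_iff₀ (by positivity), mul_pow] at h
  nlinarith

theorem IsAdmissible.exists_schwartz {W : R3 → ℝ} (hW : IsAdmissible W) :
    ∃ w : 𝓢(R3, ℂ), ∀ x, w x = (W x : ℂ) := by
  let w0 : 𝓢(R3, ℝ) :=
    { toFun := W
      smooth' := hW.smooth
      decay' := by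
        intro k n
        obtain ⟨C, a, ha, h⟩ := hW.decay n
        obtain ⟨B, hB⟩ := exists_pow_mul_exp_le k ha
        refine ⟨|C| * B, fun x => ?_⟩
        calc ‖x‖ ^ k * ‖iteratedFDeriv ℝ n W x‖
            ≤ ‖x‖ ^ k * (|C| * Real.exp (-a * ‖x‖)) := by
              gcongr
              exact (h x).trans (by gcongr; exact le_abs_self C)
          _ = |C| * (‖x‖ ^ k * Real.exp (-a * ‖x‖)) := by ring
          _ ≤ |C| * B := by gcongr; exact hB _ (norm_nonneg _) }
  exact ⟨SchwartzMap.postcompCLM (𝕜 := ℝ) Complex.ofRealCLM w0, fun x => rfl⟩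

/-- `w` is the complexification of the admissible potential `W`. -/
structure IsComplexification (W : R3 → ℝ) (w : 𝓢(R3, ℂ)) : Prop where
  adm : IsAdmissible W
  eq : ∀ x, w x = (W x : ℂ)

namespace IsComplexification

variable {W : R3 → ℝ} {w : 𝓢(R3, ℂ)}

theorem conjS_eq (h : IsComplexification W w) : conjS w = w := by
  ext x; rw [conjS_apply, h.eq, Complex.conj_ofReal]

theorem hat_eq (h : IsComplexification W w) : hat W = (𝓕 w : 𝓢(R3, ℂ)) := by
  unfold hat
  rw [SchwartzMap.fourier_coe]
  congr 1
  funext x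
  exact (h.eq x).symm

theorem differentiable (h : IsComplexification W w) : Differentiable ℝ W :=
  h.adm.smooth.differentiable (by simp)

theorem lineDeriv_eq (h : IsComplexification W w) (j : Fin 3) (x : R3) :
    (∂_{e j} w) x = ((gradient W x j : ℝ) : ℂ) := by
  rw [SchwartzMap.lineDerivOp_apply_eq_fderiv]
  have h0 : (⇑w : R3 → ℂ) = fun x => (W x : ℂ) := funext h.eq
  have h1 : HasFDerivAt (fun x => (W x : ℂ)) (Complex.ofRealCLM.comp (fderiv ℝ W x)) x :=
    Complex.ofRealCLM.hasFDerivAt.comp x (h.differentiable x).hasFDerivAt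
  rw [h0, h1.fderiv, ContinuousLinearMap.comp_apply, Complex.ofRealCLM_apply]
  congr 1
  have h2 : fderiv ℝ W x (e j) = inner ℝ (gradient W x) (e j) := by
    unfold gradient
    rw [InnerProductSpace.toDual_symm_apply]
  rw [h2, inner_e]

theorem hat_dW (h : IsComplexification W w) (j : Fin 3) (a : R3) :
    hat (dW W j a) = (𝓕 (shift a (∂_{e j} w)) : 𝓢(R3, ℂ)) := by
  unfold hat
  rw [SchwartzMap.fourier_coe]
  congr 1
  funext x
  rw [shift_apply, h.lineDeriv_eq]
  rfl

theorem hat_drift (h : IsComplexification W w) (p a : R3) :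
    hat (drift W p a)
      = (𝓕 (∑ k, (p k : ℂ) • (shift a (∂_{e k} w) - ∂_{e k} w)) : 𝓢(R3, ℂ)) := by
  unfold hat
  rw [SchwartzMap.fourier_coe]
  congr 1
  funext x
  rw [_root_.sum_apply]
  simp only [_root_.smul_apply, _root_.sub_apply, shift_apply, h.lineDeriv_eq, drift]
  simp only [PiLp.inner_apply]
  push_cast
  refine Finset.sum_congr rfl fun k _ => ?_
  simp [mul_comm]

/-- Two vectors of equal length are exchanged by a reflection. The Fourier transform commutes with
linear isometries, and `W` is invariant under them. -/
theorem fourier_radial (h : IsComplexification W w) {ξ η : R3} (hξ : ‖ξ‖ = ‖η‖) :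
    𝓕 w ξ = 𝓕 w η := by
  let A : R3 ≃ₗᵢ[ℝ] R3 := Submodule.reflection (ℝ ∙ (ξ - η))ᗮ
  have hA : A ξ = η := Submodule.reflection_sub hξ
  have hc : (⇑w : R3 → ℂ) ∘ A = w := by
    funext x
    simp only [Function.comp_apply, h.eq]
    rw [h.adm.radial (A x) x (by simp)]
  rw [SchwartzMap.fourier_coe, ← hA, ← Real.fourier_comp_linearIsometry, hc]

/-- A real function has `𝓕 w (-ξ)` as the conjugate of `𝓕 w ξ`, and radial symmetry identifies the
two. -/
theorem conj_fourier (h : IsComplexification W w) (ξ : R3) :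
    (starRingEnd ℂ) (𝓕 w ξ) = 𝓕 w ξ := by
  have h1 := fourier_conjS w (-ξ)
  rw [h.conjS_eq, neg_neg] at h1
  rw [← h1]
  exact h.fourier_radial (norm_neg ξ)

theorem conjS_lineDeriv (h : IsComplexification W w) (j : Fin 3) :
    conjS (∂_{e j} w) = ∂_{e j} w := by
  ext x; rw [conjS_apply, h.lineDeriv_eq, Complex.conj_ofReal]

end IsComplexification

/-- The square of the Fourier transform of `w`, the spectral density of the potential. -/
def dens (w : 𝓢(R3, ℂ)) : 𝓢(R3, ℂ) := SchwartzMap.smulLeftCLM ℂ (𝓕 w : 𝓢(R3, ℂ)) (𝓕 w)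

theorem dens_apply (w : 𝓢(R3, ℂ)) (ξ : R3) : dens w ξ = 𝓕 w ξ * 𝓕 w ξ := by
  unfold dens
  rw [SchwartzMap.smulLeftCLM_apply_apply (𝓕 w : 𝓢(R3, ℂ)).hasTemperateGrowth, smul_eq_mul]

theorem IsComplexification.dens_eq {W : R3 → ℝ} {w : 𝓢(R3, ℂ)} (h : IsComplexification W w)
    (ξ : R3) : dens w ξ = ((‖𝓕 w ξ‖ ^ 2 : ℝ) : ℂ) := by
  rw [dens_apply]
  nth_rw 1 [← h.conj_fourier ξ]
  rw [← Complex.normSq_eq_conj_mul_self, Complex.normSq_eq_norm_sq]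

/-! ### Dispersive decay of derivatives -/

theorem norm_coord_le (y : R3) (j : Fin 3) : ‖((y j : ℝ) : ℂ)‖ ≤ ‖y‖ := by
  rw [Complex.norm_real]
  exact PiLp.norm_apply_le y j

theorem exists_norm_U_lineDeriv_le (k : Fin 3) (χ : 𝓢(R3, ℂ)) : ∃ C, 0 ≤ C ∧ ∀ t, 0 < t → ∀ y,
    ‖U t (∂_{e k} χ) y‖ ≤ C * (1 + ‖y‖) * t ^ (-(5 / 2) : ℝ) := by
  refine ⟨‖kernelConst‖ * (∫ x, ‖χ x‖) + ‖kernelConst‖ * (∫ x, ‖coordMul k χ x‖),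
    by positivity, fun t ht y => ?_⟩
  rw [U_lineDeriv_eq ht.ne', norm_mul, norm_div, Complex.norm_I, Complex.norm_real,
    Real.norm_of_nonneg ht.le]
  have h1 := norm_U_le_rpow ht χ y
  have h2 := norm_U_le_rpow ht (coordMul k χ) y
  have h3 := norm_coord_le y k
  have ht5 : t ^ (-(5 / 2) : ℝ) = 1 / t * t ^ (-(3 / 2) : ℝ) := by
    rw [one_div, ← Real.rpow_neg_one t, ← Real.rpow_add ht]
    norm_num
  set A := ‖kernelConst‖ * (∫ x, ‖χ x‖) with hA
  set B := ‖kernelConst‖ * (∫ x, ‖coordMul k χ x‖) with hB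
  have hA0 : 0 ≤ A := by positivity
  have hB0 : 0 ≤ B := by positivity
  have ht3 : 0 ≤ t ^ (-(3 / 2) : ℝ) := by positivity
  calc 1 / t * ‖(y k : ℂ) * U t χ y - U t (coordMul k χ) y‖
      ≤ 1 / t * (‖y‖ * (A * t ^ (-(3 / 2) : ℝ)) + B * t ^ (-(3 / 2) : ℝ)) := by
        gcongr
        refine (norm_sub_le _ _).trans ?_
        rw [norm_mul]
        gcongr
    _ = (‖y‖ * A + B) * t ^ (-(5 / 2) : ℝ) := by rw [ht5]; ring
    _ ≤ _ := by
        gcongr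
        nlinarith [norm_nonneg y, mul_nonneg hB0 (norm_nonneg y)]

theorem norm_exp_I_sub_exp_I_le (a b : ℝ) :
    ‖Complex.exp (Complex.I * a) - Complex.exp (Complex.I * b)‖ ≤ |a - b| := by
  have h : Complex.exp (Complex.I * a) - Complex.exp (Complex.I * b)
      = Complex.exp (Complex.I * b) * (Complex.exp (Complex.I * ((a - b : ℝ) : ℂ)) - 1) := by
    rw [mul_sub, ← Complex.exp_add, mul_one]
    congr 2
    push_cast
    ring
  rw [h, norm_mul, norm_exp_I_mul_ofReal, one_mul]
  exact Real.norm_exp_I_mul_ofReal_sub_one_le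

/-- In the kernel formula the phases at `y` and at `0` differ by `(|x - y|² - |x|²) / (2t)`; this
gains one power of `t` over the dispersive bound, at the price of one moment of `ψ`. -/
theorem exists_norm_U_sub_le (ψ : 𝓢(R3, ℂ)) : ∃ C, 0 ≤ C ∧ ∀ t, 0 < t → ∀ y,
    ‖U t ψ y - U t ψ 0‖ ≤ C * (1 + ‖y‖) ^ 2 * t ^ (-(5 / 2) : ℝ) := by
  have hi1 : Integrable fun x : R3 => (1 + ‖x‖) * ‖ψ x‖ := by
    have h1 := ψ.integrable_pow_mul volume 1
    have h2 := ψ.integrable (μ := volume).norm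
    refine (h2.add h1).congr (Eventually.of_forall fun x => ?_)
    simp
    ring
  refine ⟨‖kernelConst‖ * ∫ x, (1 + ‖x‖) * ‖ψ x‖, by positivity, fun t ht y => ?_⟩
  have ht5 : t ^ (-(5 / 2) : ℝ) = t ^ (-(3 / 2) : ℝ) * (1 / t) := by
    rw [one_div, ← Real.rpow_neg_one t, ← Real.rpow_add ht]
    norm_num
  have hint : ∀ y : R3, Integrable fun x =>
      ψ x * Complex.exp (Complex.I * ((‖x - y‖ ^ 2 / (2 * t) : ℝ) : ℂ)) := by
    intro y
    refine ψ.integrable.mono ((ψ.continuous.mul (by fun_prop)).aestronglyMeasurable)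
      (Eventually.of_forall fun x => ?_)
    rw [norm_mul, norm_exp_I_mul_ofReal, mul_one]
  rw [U_kernel ht, U_kernel ht, ← mul_sub, norm_mul, norm_mul, Complex.norm_real,
    Real.norm_of_nonneg (by positivity), ← integral_sub (hint y) (hint 0)]
  have hb : ‖∫ x, (ψ x * Complex.exp (Complex.I * ((‖x - y‖ ^ 2 / (2 * t) : ℝ) : ℂ))
      - ψ x * Complex.exp (Complex.I * ((‖x - 0‖ ^ 2 / (2 * t) : ℝ) : ℂ)))‖
      ≤ ∫ x, (1 + ‖y‖) ^ 2 * (1 / t) * ((1 + ‖x‖) * ‖ψ x‖) := by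
    refine norm_integral_le_of_norm_le (hi1.const_mul _) (Eventually.of_forall fun x => ?_)
    rw [← mul_sub, norm_mul]
    have h1 := norm_exp_I_sub_exp_I_le (‖x - y‖ ^ 2 / (2 * t)) (‖x - 0‖ ^ 2 / (2 * t))
    have h2 : |‖x - y‖ ^ 2 / (2 * t) - ‖x - 0‖ ^ 2 / (2 * t)|
        ≤ (1 + ‖y‖) ^ 2 * (1 / t) * (1 + ‖x‖) := by
      rw [sub_zero, ← sub_div, abs_div, abs_of_pos (by positivity : 0 < 2 * t)]
      rw [div_le_iff₀ (by positivity)]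
      have h3 : |‖x - y‖ ^ 2 - ‖x‖ ^ 2| ≤ ‖y‖ * (2 * ‖x‖ + ‖y‖) := by
        have e1 : ‖x - y‖ ^ 2 - ‖x‖ ^ 2 = (‖x - y‖ - ‖x‖) * (‖x - y‖ + ‖x‖) := by ring
        rw [e1, abs_mul]
        have e2 : |‖x - y‖ - ‖x‖| ≤ ‖y‖ := by
          simpa using abs_norm_sub_norm_le (x - y) x
        have e3 : |‖x - y‖ + ‖x‖| ≤ 2 * ‖x‖ + ‖y‖ := by
          rw [abs_of_nonneg (by positivity)]
          linarith [norm_sub_le x y]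
        gcongr
      have e4 : (1 + ‖y‖) ^ 2 * (1 / t) * (1 + ‖x‖) * (2 * t) = 2 * ((1 + ‖y‖) ^ 2 * (1 + ‖x‖)) := by
        field_simp
      rw [e4]
      have hx := norm_nonneg x
      have hy := norm_nonneg y
      nlinarith [mul_nonneg hx hy, mul_nonneg hx (mul_nonneg hy hy), sq_nonneg ‖y‖]
    calc _ ≤ ‖ψ x‖ * ((1 + ‖y‖) ^ 2 * (1 / t) * (1 + ‖x‖)) := by
          gcongr; exact h1.trans h2
      _ = _ := by ring
  rw [integral_const_mul] at hb
  calc _ ≤ ‖kernelConst‖ * t ^ (-(3 / 2) : ℝ)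
        * ((1 + ‖y‖) ^ 2 * (1 / t) * ∫ x, (1 + ‖x‖) * ‖ψ x‖) := by gcongr
    _ = _ := by rw [ht5]; ring

/-- Converting the outer derivative into `1/t` leaves terms that still contain `∂_k`, of order
`t^{-5/2}`, and, for `j = k`, the commutator term `U t ψ`, which is only `O(t^{-3/2})`. The latter
does not improve by itself; only its difference between `y` and `0` does, which is why the value at
`0` is subtracted. -/
theorem exists_norm_U_lineDeriv_lineDeriv_sub_le (j k : Fin 3) (ψ : 𝓢(R3, ℂ)) :
    ∃ C, 0 ≤ C ∧ ∀ t, 0 < t → ∀ y,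
      ‖U t (∂_{e j} (∂_{e k} ψ)) y - U t (∂_{e j} (∂_{e k} ψ)) 0‖
        ≤ C * (1 + ‖y‖) ^ 2 * t ^ (-(7 / 2) : ℝ) := by
  obtain ⟨C1, hC1, h1⟩ := exists_norm_U_lineDeriv_le k ψ
  obtain ⟨C2, hC2, h2⟩ := exists_norm_U_lineDeriv_le k (coordMul j ψ)
  obtain ⟨C3, hC3, h3⟩ := exists_norm_U_sub_le ψ
  refine ⟨C1 + 2 * C2 + C3, by positivity, fun t ht y => ?_⟩
  have ht7 : t ^ (-(7 / 2) : ℝ) = 1 / t * t ^ (-(5 / 2) : ℝ) := by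
    rw [one_div, ← Real.rpow_neg_one t, ← Real.rpow_add ht]
    norm_num
  have ht5 : 0 ≤ t ^ (-(5 / 2) : ℝ) := by positivity
  rw [U_lineDeriv_eq ht.ne' j (∂_{e k} ψ) y, U_lineDeriv_eq ht.ne' j (∂_{e k} ψ) 0,
    coordMul_lineDeriv]
  simp only [map_sub, map_smul, _root_.sub_apply, _root_.smul_apply, smul_eq_mul]
  set δ : ℂ := if j = k then 1 else 0 with hδ
  have hδ1 : ‖δ‖ ≤ 1 := by rw [hδ]; split_ifs <;> simp
  have e1 : Complex.I / t * (y j * U t (∂_{e k} ψ) y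
        - (U t (∂_{e k} (coordMul j ψ)) y - δ * U t ψ y))
      - Complex.I / t * (((0 : R3) j : ℂ) * U t (∂_{e k} ψ) 0
        - (U t (∂_{e k} (coordMul j ψ)) 0 - δ * U t ψ 0))
      = Complex.I / t * (y j * U t (∂_{e k} ψ) y - U t (∂_{e k} (coordMul j ψ)) y
        + U t (∂_{e k} (coordMul j ψ)) 0 + δ * (U t ψ y - U t ψ 0)) := by
    simp
    ring
  rw [e1, norm_mul, norm_div, Complex.norm_I, Complex.norm_real, Real.norm_of_nonneg ht.le]
  have b1 := h1 t ht y
  have b2 := h2 t ht y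
  have b3 := h2 t ht 0
  have b4 := h3 t ht y
  have b5 := norm_coord_le y j
  have hy := norm_nonneg y
  simp only [norm_zero, add_zero, mul_one] at b3
  calc 1 / t * ‖_‖ ≤ 1 / t * (‖y‖ * (C1 * (1 + ‖y‖) * t ^ (-(5 / 2) : ℝ))
        + C2 * (1 + ‖y‖) * t ^ (-(5 / 2) : ℝ) + C2 * t ^ (-(5 / 2) : ℝ)
        + 1 * (C3 * (1 + ‖y‖) ^ 2 * t ^ (-(5 / 2) : ℝ))) := by
        gcongr
        refine (norm_add_le _ _).trans (add_le_add ((norm_add_le _ _).trans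
          (add_le_add ((norm_sub_le _ _).trans (add_le_add ?_ b2)) b3)) ?_)
        · rw [norm_mul]; gcongr
        · rw [norm_mul]; gcongr
    _ = (C1 * (‖y‖ * (1 + ‖y‖)) + C2 * (1 + ‖y‖) + C2 + C3 * (1 + ‖y‖) ^ 2)
        * t ^ (-(7 / 2) : ℝ) := by rw [ht7]; ring
    _ ≤ _ := by
        gcongr
        nlinarith [mul_nonneg hC1 hy, mul_nonneg hC2 hy, mul_nonneg hC2 (sq_nonneg ‖y‖)]

end Friction

end

noncomputable section

namespace Friction

open LineDeriv

/-! ### Decay of the interaction kernels -/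

theorem continuous_sym_left (ξ : R3) : Continuous fun t => sym t ξ := by
  simp only [sym_eq]
  fun_prop

theorem sym_eq_schr (t : ℝ) (ξ : R3) : schr t ((2 * Real.pi * ‖ξ‖) ^ 2) = sym t ξ := rfl

/-- A Riemann-Lebesgue lemma for the quadratic phase. -/
theorem tendsto_integral_sym_mul {q : R3 → ℂ} (hq : Integrable q) :
    Tendsto (fun t => ∫ ξ, sym t ξ * q ξ) atTop (𝓝 0) := by
  rw [Metric.tendsto_atTop]
  intro ε hε
  have hd := SchwartzMap.denseRange_toLpCLM (F := ℂ) (E := R3) (p := 1) (by simp)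
    (μ := (volume : Measure R3))
  -- Approximate `q` in `L¹` by a Schwartz function `ψ`. For `ψ` the integral is a free evolution
  -- evaluated at the origin, and the dispersive estimate applies.
  obtain ⟨ψ, hψ⟩ := hd.exists_dist_lt (hq.toL1 q) (half_pos hε)
  obtain ⟨C, hC, hU⟩ := exists_norm_U_le (𝓕⁻ ψ : 𝓢(R3, ℂ))
  have hψt : ∀ t, ∫ ξ, sym t ξ * ψ ξ = U t (𝓕⁻ ψ : 𝓢(R3, ℂ)) 0 := by
    intro t
    have hF : (𝓕 (𝓕⁻ ψ : 𝓢(R3, ℂ)) : 𝓢(R3, ℂ)) = ψ := FourierTransform.fourier_fourierInv_eq ψ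
    rw [U_apply, hF]
    simp
  have hint : ∀ t, ∀ g : R3 → ℂ, Integrable g → Integrable fun ξ => sym t ξ * g ξ := by
    intro t g hg
    exact hg.bdd_mul (continuous_sym t).aestronglyMeasurable
      (Eventually.of_forall fun ξ => (norm_sym t ξ).le)
  have hdiff : ∀ t, ‖(∫ ξ, sym t ξ * q ξ) - ∫ ξ, sym t ξ * ψ ξ‖ ≤ ε / 2 := by
    intro t
    rw [← integral_sub (hint t q hq) (hint t ψ ψ.integrable)]
    have h1 : ‖∫ ξ, (sym t ξ * q ξ - sym t ξ * ψ ξ)‖ ≤ ∫ ξ, ‖q ξ - ψ ξ‖ := by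
      refine norm_integral_le_of_norm_le (hq.sub ψ.integrable).norm
        (Eventually.of_forall fun ξ => ?_)
      rw [← mul_sub, norm_mul, norm_sym, one_mul]
    refine h1.trans ?_
    rw [dist_eq_norm, L1.norm_eq_integral_norm] at hψ
    refine le_of_eq_of_le (integral_congr_ae ?_) hψ.le
    filter_upwards [Lp.coeFn_sub (hq.toL1 q) (ψ.toLp 1 volume), hq.coeFn_toL1,
      ψ.coeFn_toLp 1 volume] with ξ h1 h2 h3
    rw [SchwartzMap.toLpCLM_apply, h1, Pi.sub_apply, h2, h3]
  have hdecay : Tendsto (fun t : ℝ => C * (1 + t) ^ (-(3 / 2) : ℝ)) atTop (𝓝 0) := by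
    have h1 : Tendsto (fun t : ℝ => 1 + t) atTop atTop := tendsto_atTop_add_const_left _ _ tendsto_id
    have h2 := (tendsto_rpow_neg_atTop (y := 3 / 2) (by norm_num)).comp h1
    simpa using h2.const_mul C
  obtain ⟨t0, ht0⟩ := (Metric.tendsto_atTop.1 hdecay) (ε / 2) (half_pos hε)
  refine ⟨max t0 0, fun t ht => ?_⟩
  have ht1 := ht0 t ((le_max_left _ _).trans ht)
  have ht2 := hU t ((le_max_right _ _).trans ht) 0
  rw [Real.dist_eq, sub_zero] at ht1
  rw [dist_zero_right]
  have h3 := hdiff t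
  rw [hψt] at h3
  calc ‖∫ ξ, sym t ξ * q ξ‖ = ‖((∫ ξ, sym t ξ * q ξ) - U t (𝓕⁻ ψ : 𝓢(R3, ℂ)) 0)
        + U t (𝓕⁻ ψ : 𝓢(R3, ℂ)) 0‖ := by rw [sub_add_cancel]
    _ ≤ ε / 2 + C * (1 + t) ^ (-(3 / 2) : ℝ) := (norm_add_le _ _).trans (add_le_add h3 ht2)
    _ < ε := by linarith [le_abs_self (C * (1 + t) ^ (-(3 / 2) : ℝ))]

/-- The kernel `⟨∂ⱼW, e^{iΔt/2} (-Δ)⁻¹ ∂ₖ[W(· - a) - W]⟩`. -/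
def interKernel (w : 𝓢(R3, ℂ)) (j k : Fin 3) (t : ℝ) (a : R3) : ℂ :=
  specPair (fun lam => schr t lam / lam) (𝓕 (∂_{e j} w) : 𝓢(R3, ℂ))
    (𝓕 (shift a (∂_{e k} w) - ∂_{e k} w) : 𝓢(R3, ℂ))

/-- The spectral density of `interKernel`. -/
def interDens (w : 𝓢(R3, ℂ)) (j k : Fin 3) (a : R3) (ξ : R3) : ℂ :=
  ((ξ j * ξ k / ‖ξ‖ ^ 2 : ℝ) : ℂ) *
    ((Complex.exp (Complex.I * ((-(2 * Real.pi * inner ℝ a ξ) : ℝ) : ℂ)) - 1) * dens w ξ)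

theorem fourier_sub (φ ψ : 𝓢(R3, ℂ)) : 𝓕 (φ - ψ) = (𝓕 φ - 𝓕 ψ : 𝓢(R3, ℂ)) := by
  simpa only [FourierTransform.fourierCLM_apply] using
    map_sub (FourierTransform.fourierCLM ℂ 𝓢(R3, ℂ)) φ ψ

variable {W : R3 → ℝ} {w : 𝓢(R3, ℂ)}

theorem interKernel_integrand_eq (h : IsComplexification W w) (j k : Fin 3) (t : ℝ) (a ξ : R3) :
    (starRingEnd ℂ) ((𝓕 (∂_{e j} w) : 𝓢(R3, ℂ)) ξ)
        * (schr t ((2 * Real.pi * ‖ξ‖) ^ 2) / (((2 * Real.pi * ‖ξ‖) ^ 2 : ℝ) : ℂ))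
        * (𝓕 (shift a (∂_{e k} w) - ∂_{e k} w) : 𝓢(R3, ℂ)) ξ
      = sym t ξ * interDens w j k a ξ := by
  have hp : (Real.pi : ℂ) ≠ 0 := by exact_mod_cast Real.pi_ne_zero
  simp only [interDens]
  rw [fourier_lineDeriv, fourier_sub, _root_.sub_apply, fourier_shift, fourier_lineDeriv, inner_e,
    inner_e, dens_apply, ← sym_eq_schr]
  simp only [map_mul, Complex.conj_ofReal, Complex.conj_I, map_ofNat]
  rw [h.conj_fourier]
  -- At `ξ = 0` both sides vanish: the derivative factors are zero, and so is the quotient `0 / 0`.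
  rcases eq_or_ne ξ 0 with rfl | hξ
  · simp
  · have hn : (‖ξ‖ : ℂ) ≠ 0 := by simpa using hξ
    push_cast
    field_simp
    rw [Complex.I_sq]
    ring

theorem interKernel_eq (h : IsComplexification W w) (j k : Fin 3) (t : ℝ) (a : R3) :
    interKernel w j k t a = ∫ ξ, sym t ξ * interDens w j k a ξ :=
  integral_congr_ae (Eventually.of_forall fun ξ => interKernel_integrand_eq h j k t a ξ)

/-- This is the symbol of `∂_j ∂_k (-Δ)⁻¹` up to sign. Its boundedness makes the singularity of
`(-Δ)⁻¹` at zero frequency harmless. -/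
theorem norm_coord_div_le (ξ : R3) (j k : Fin 3) : |ξ j * ξ k / ‖ξ‖ ^ 2| ≤ 1 := by
  rw [abs_div, abs_mul, abs_of_nonneg (sq_nonneg ‖ξ‖)]
  refine div_le_one_of_le₀ ?_ (sq_nonneg _)
  rw [sq]
  have h1 := PiLp.norm_apply_le ξ j
  have h2 := PiLp.norm_apply_le ξ k
  rw [Real.norm_eq_abs] at h1 h2
  gcongr

theorem norm_interDens_le (w : 𝓢(R3, ℂ)) (j k : Fin 3) (a ξ : R3) :
    ‖interDens w j k a ξ‖ ≤ 2 * ‖dens w ξ‖ := by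
  unfold interDens
  rw [norm_mul, norm_mul, Complex.norm_real, Real.norm_eq_abs]
  have h1 := norm_coord_div_le ξ j k
  have h2 : ‖Complex.exp (Complex.I * ((-(2 * Real.pi * inner ℝ a ξ) : ℝ) : ℂ)) - 1‖ ≤ 2 := by
    refine (norm_sub_le _ _).trans ?_
    rw [norm_exp_I_mul_ofReal]
    norm_num
  calc _ ≤ 1 * (2 * ‖dens w ξ‖) := by gcongr
    _ = _ := one_mul _

theorem measurable_interDens (w : 𝓢(R3, ℂ)) (j k : Fin 3) (a : R3) :
    Measurable (interDens w j k a) := by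
  unfold interDens
  have h1 : ∀ i : Fin 3, Measurable fun ξ : R3 => ξ i := fun i =>
    (EuclideanSpace.proj (𝕜 := ℝ) i).continuous.measurable
  have h2 : Measurable fun ξ : R3 => ξ j * ξ k / ‖ξ‖ ^ 2 :=
    ((h1 j).mul (h1 k)).div (measurable_norm.pow_const 2)
  refine (Complex.measurable_ofReal.comp h2).mul ?_
  have h3 : Continuous fun ξ : R3 =>
    (Complex.exp (Complex.I * ((-(2 * Real.pi * inner ℝ a ξ) : ℝ) : ℂ)) - 1) * dens w ξ :=
    Continuous.mul (by fun_prop) (dens w).continuous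
  exact h3.measurable

theorem integrable_interDens (w : 𝓢(R3, ℂ)) (j k : Fin 3) (a : R3) :
    Integrable (interDens w j k a) :=
  ((dens w).integrable.norm.const_mul 2).mono' (measurable_interDens w j k a).aestronglyMeasurable
    (Eventually.of_forall fun ξ => norm_interDens_le w j k a ξ)

theorem norm_interKernel_le_const (h : IsComplexification W w) (j k : Fin 3) (t : ℝ) (a : R3) :
    ‖interKernel w j k t a‖ ≤ 2 * ∫ ξ, ‖dens w ξ‖ := by
  rw [interKernel_eq h, ← integral_const_mul]
  refine norm_integral_le_of_norm_le ((dens w).integrable.norm.const_mul 2)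
    (Eventually.of_forall fun ξ => ?_)
  rw [norm_mul, norm_sym, one_mul]
  exact norm_interDens_le w j k a ξ

theorem hasDerivAt_sym (t : ℝ) (ξ : R3) :
    HasDerivAt (fun s => sym s ξ)
      (-(Complex.I / 2) * (((2 * Real.pi * ‖ξ‖) ^ 2 : ℝ) : ℂ) * sym t ξ) t := by
  unfold sym schr
  have h1 : HasDerivAt (fun s : ℝ => -Complex.I * (((2 * Real.pi * ‖ξ‖) ^ 2 * s / 2 : ℝ) : ℂ))
      (-Complex.I * (((2 * Real.pi * ‖ξ‖) ^ 2 / 2 : ℝ) : ℂ)) t := by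
    have h2 : HasDerivAt (fun s : ℝ => (2 * Real.pi * ‖ξ‖) ^ 2 * s / 2)
        ((2 * Real.pi * ‖ξ‖) ^ 2 / 2) t := by
      simpa using ((hasDerivAt_id t).const_mul ((2 * Real.pi * ‖ξ‖) ^ 2)).div_const 2
    exact h2.ofReal_comp.const_mul _
  convert h1.cexp using 1
  push_cast
  ring

/-- Differentiation of `∫ e^{-i|2πξ|²t/2} q(ξ) dξ` in `t`. -/
theorem hasDerivAt_integral_sym {q : R3 → ℂ} (hq : Integrable q)
    (hq2 : Integrable fun ξ => ((‖ξ‖ ^ 2 : ℝ) : ℂ) * q ξ) (t : ℝ) :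
    HasDerivAt (fun s => ∫ ξ, sym s ξ * q ξ)
      (∫ ξ, -(Complex.I / 2) * (((2 * Real.pi * ‖ξ‖) ^ 2 : ℝ) : ℂ) * sym t ξ * q ξ) t := by
  refine (hasDerivAt_integral_of_dominated_loc_of_deriv_le (μ := volume)
    (F := fun s ξ => sym s ξ * q ξ)
    (F' := fun s ξ => -(Complex.I / 2) * (((2 * Real.pi * ‖ξ‖) ^ 2 : ℝ) : ℂ) * sym s ξ * q ξ)
    (bound := fun ξ => (1 / 2) * (2 * Real.pi) ^ 2 * ‖((‖ξ‖ ^ 2 : ℝ) : ℂ) * q ξ‖)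
    (s := univ) univ_mem ?_ ?_ ?_ ?_ ?_ ?_).2
  · exact Eventually.of_forall fun s =>
      (continuous_sym s).aestronglyMeasurable.mul hq.aestronglyMeasurable
  · exact hq.bdd_mul (continuous_sym t).aestronglyMeasurable
      (Eventually.of_forall fun ξ => (norm_sym t ξ).le)
  · refine AEStronglyMeasurable.mul ?_ hq.aestronglyMeasurable
    have := continuous_sym t
    exact Continuous.aestronglyMeasurable (by fun_prop)
  · refine Eventually.of_forall fun ξ s _ => le_of_eq ?_
    rw [norm_mul, norm_mul, norm_mul, norm_sym, norm_mul, norm_neg, norm_div, Complex.norm_I,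
      Complex.norm_real, Complex.norm_real, Real.norm_of_nonneg (by positivity),
      Real.norm_of_nonneg (by positivity)]
    simp
    ring
  · exact hq2.norm.const_mul _
  · exact Eventually.of_forall fun ξ s _ => (hasDerivAt_sym s ξ).mul_const _

/-- Differentiating the propagator in time produces `|2πξ|²`, which cancels `(-Δ)⁻¹`. What remains
is the free evolution of a Schwartz function, compared at the points `-a` and `0`. -/
theorem hasDerivAt_interKernel (h : IsComplexification W w) (j k : Fin 3) (t : ℝ) (a : R3) :
    HasDerivAt (fun s => interKernel w j k s a)
      (Complex.I / 2 * (U t (∂_{e j} (∂_{e k} (𝓕⁻ (dens w) : 𝓢(R3, ℂ)))) (-a)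
        - U t (∂_{e j} (∂_{e k} (𝓕⁻ (dens w) : 𝓢(R3, ℂ)))) 0)) t := by
  have hq2 : Integrable fun ξ => ((‖ξ‖ ^ 2 : ℝ) : ℂ) * interDens w j k a ξ := by
    refine (((dens w).integrable_pow_mul volume 2).const_mul 2).mono'
      ((by fun_prop : Continuous fun ξ : R3 => ((‖ξ‖ ^ 2 : ℝ) : ℂ)).aestronglyMeasurable.mul
        (measurable_interDens w j k a).aestronglyMeasurable) (Eventually.of_forall fun ξ => ?_)
    rw [norm_mul, Complex.norm_real, Real.norm_of_nonneg (by positivity)]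
    have := norm_interDens_le w j k a ξ
    calc ‖ξ‖ ^ 2 * ‖interDens w j k a ξ‖ ≤ ‖ξ‖ ^ 2 * (2 * ‖dens w ξ‖) := by gcongr
      _ = _ := by ring
  have h1 := hasDerivAt_integral_sym (integrable_interDens w j k a) hq2 t
  have hfun : (fun s => interKernel w j k s a) = fun s => ∫ ξ, sym s ξ * interDens w j k a ξ :=
    funext fun s => interKernel_eq h j k s a
  rw [hfun]
  convert h1 using 1
  set ψ : 𝓢(R3, ℂ) := 𝓕⁻ (dens w) with hψ
  have hF : (𝓕 ψ : 𝓢(R3, ℂ)) = dens w := FourierTransform.fourier_fourierInv_eq _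
  have hi : ∀ y : R3, Integrable fun ξ =>
      Complex.exp ((2 * Real.pi * inner ℝ ξ y : ℝ) * Complex.I)
        * (sym t ξ * 𝓕 (∂_{e j} (∂_{e k} ψ)) ξ) := by
    intro y
    refine ((𝓕 (∂_{e j} (∂_{e k} ψ)) : 𝓢(R3, ℂ)).integrable.bdd_mul (c := 1)
      (continuous_sym t).aestronglyMeasurable
      (Eventually.of_forall fun ξ => (norm_sym t ξ).le)).bdd_mul (c := 1) ?_ ?_
    · exact Continuous.aestronglyMeasurable (by fun_prop)
    · refine Eventually.of_forall fun ξ => ?_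
      rw [mul_comm, norm_exp_I_mul_ofReal]
  rw [U_apply, U_apply, ← integral_sub (hi _) (hi _), ← integral_const_mul]
  refine integral_congr_ae (Eventually.of_forall fun ξ => ?_)
  simp only
  rw [fourier_lineDeriv, fourier_lineDeriv, hF, inner_e, inner_e]
  unfold interDens
  have he : Complex.exp ((2 * Real.pi * inner ℝ ξ (-a) : ℝ) * Complex.I)
      = Complex.exp (Complex.I * ((-(2 * Real.pi * inner ℝ a ξ) : ℝ) : ℂ)) := by
    rw [inner_neg_right, real_inner_comm]
    congr 1
    push_cast
    ring
  rw [he]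
  rcases eq_or_ne ξ 0 with rfl | hξ
  · simp
  · have hn : (‖ξ‖ : ℂ) ≠ 0 := by simpa using hξ
    rw [inner_zero_right]
    push_cast
    field_simp
    rw [Complex.I_sq]
    simp

/-- The time derivative is `O(t^{-7/2})` and the kernel tends to zero at infinity by the
Riemann-Lebesgue lemma, so integrating back from infinity gives `t^{-5/2}`. The shift `a` enters
only through its bound `R`. -/
theorem exists_norm_interKernel_le (h : IsComplexification W w) (j k : Fin 3) (R : ℝ) :
    ∃ C, 0 ≤ C ∧ ∀ t, 0 ≤ t → ∀ a, ‖a‖ ≤ R →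
      ‖interKernel w j k t a‖ ≤ C * (1 + t) ^ (-(5 / 2) : ℝ) := by
  obtain ⟨C, hC, hV⟩ := exists_norm_U_lineDeriv_lineDeriv_sub_le j k (𝓕⁻ (dens w) : 𝓢(R3, ℂ))
  set M := C * (1 + R) ^ 2 with hM
  have hM0 : 0 ≤ M := by positivity
  have hlarge : ∀ a, ‖a‖ ≤ R → ∀ t, 0 < t → ‖interKernel w j k t a‖ ≤ M * t ^ (-(5 / 2) : ℝ) := by
    intro a ha t ht
    have hbound : ∀ S, t ≤ S → ‖interKernel w j k S a - interKernel w j k t a‖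
        ≤ M * t ^ (-(5 / 2) : ℝ) := by
      intro S hS
      have hB : ∀ x ∈ Icc t S, HasDerivAt
          (fun s : ℝ => M * t ^ (-(5 / 2) : ℝ) - M * s ^ (-(5 / 2) : ℝ))
          (5 / 2 * M * x ^ (-(7 / 2) : ℝ)) x := by
        intro x hx
        have hx0 : 0 < x := ht.trans_le hx.1
        have := ((Real.hasDerivAt_rpow_const (p := -(5 / 2)) (Or.inl hx0.ne')).const_mul M).const_sub
          (M * t ^ (-(5 / 2) : ℝ))
        have he : -(M * (-(5 / 2) * x ^ (-(5 / 2) - 1 : ℝ))) = 5 / 2 * M * x ^ (-(7 / 2) : ℝ) := by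
          norm_num
          ring
        rw [← he]
        exact this
      have hle := image_norm_le_of_norm_deriv_right_le_deriv_boundary'
        (f := fun s => interKernel w j k s a - interKernel w j k t a) (a := t) (b := S)
        (f' := fun s => Complex.I / 2 *
          (U s (∂_{e j} (∂_{e k} (𝓕⁻ (dens w) : 𝓢(R3, ℂ)))) (-a)
          - U s (∂_{e j} (∂_{e k} (𝓕⁻ (dens w) : 𝓢(R3, ℂ)))) 0))
        (B := fun s => M * t ^ (-(5 / 2) : ℝ) - M * s ^ (-(5 / 2) : ℝ))
        (B' := fun x => 5 / 2 * M * x ^ (-(7 / 2) : ℝ))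
        (fun x _ => ((hasDerivAt_interKernel h j k x a).sub_const _).continuousAt.continuousWithinAt)
        (fun x _ => ((hasDerivAt_interKernel h j k x a).sub_const _).hasDerivWithinAt)
        (by simp)
        (fun x hx => (hB x hx).continuousAt.continuousWithinAt)
        (fun x hx => (hB x (Ico_subset_Icc_self hx)).hasDerivWithinAt)
        (by
          intro x hx
          have hx0 : 0 < x := ht.trans_le hx.1
          have h1 := hV x hx0 (-a)
          rw [norm_neg] at h1
          rw [norm_mul, norm_div, Complex.norm_I]
          have h2 : C * (1 + ‖a‖) ^ 2 * x ^ (-(7 / 2) : ℝ) ≤ M * x ^ (-(7 / 2) : ℝ) := by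
            rw [hM]; gcongr
          have h3 : 0 ≤ M * x ^ (-(7 / 2) : ℝ) := by positivity
          have h4 := norm_nonneg (U x (∂_{e j} (∂_{e k} (𝓕⁻ (dens w) : 𝓢(R3, ℂ)))) (-a)
            - U x (∂_{e j} (∂_{e k} (𝓕⁻ (dens w) : 𝓢(R3, ℂ)))) 0)
          simp only [Complex.norm_ofNat]
          linarith)
        (right_mem_Icc.2 hS)
      refine hle.trans ?_
      have : 0 ≤ M * S ^ (-(5 / 2) : ℝ) := by
        have : 0 < S := ht.trans_le hS
        positivity
      linarith
    have hlim : Tendsto (fun S => ‖interKernel w j k S a - interKernel w j k t a‖) atTop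
        (𝓝 ‖0 - interKernel w j k t a‖) := by
      refine Tendsto.norm (Tendsto.sub_const ?_ _)
      simp only [interKernel_eq h]
      exact tendsto_integral_sym_mul (integrable_interDens w j k a)
    have := le_of_tendsto hlim ((eventually_ge_atTop t).mono fun S hS => hbound S hS)
    simpa using this
  refine ⟨_, ?_, fun t ht a ha => le_one_add_rpow (p := 5 / 2) (by norm_num) ht
    (A := 2 * ∫ ξ, ‖dens w ξ‖) (B := M) ?_ hM0 (norm_interKernel_le_const h j k t a)
    (hlarge a ha t)⟩ <;> positivity

end Friction

end

noncomputable section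

namespace Friction

open LineDeriv

/-! ### Time averages of the free evolution -/

theorem rpow_neg_half_mul_sq {σ : ℝ} (hσ : 0 < σ) :
    σ ^ (-(5 / 2) : ℝ) = σ ^ (-(1 / 2) : ℝ) * (σ ^ 2)⁻¹ := by
  rw [← Real.rpow_natCast σ 2, ← Real.rpow_neg hσ.le, ← Real.rpow_add hσ]
  norm_num

theorem integral_rpow_le {p s₁ s₂ : ℝ} (hp : p < -1) (h1 : 0 < s₁) (h12 : s₁ ≤ s₂) :
    ∫ σ in s₁..s₂, σ ^ p ≤ s₁ ^ (p + 1) / (-(p + 1)) := by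
  have h0 : (0 : ℝ) ∉ uIcc s₁ s₂ := by
    rw [uIcc_of_le h12]; exact fun h => absurd h.1 (not_le.2 h1)
  rw [integral_rpow (Or.inr ⟨by linarith, h0⟩)]
  have h2 : 0 < s₂ ^ (p + 1) := Real.rpow_pos_of_pos (h1.trans_le h12) _
  have h3 : (s₂ ^ (p + 1) - s₁ ^ (p + 1)) / (p + 1) = (s₁ ^ (p + 1) - s₂ ^ (p + 1)) / (-(p + 1)) := by
    rw [div_neg, ← neg_div]; ring
  rw [h3]
  have h4 : 0 < -(p + 1) := by linarith
  gcongr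
  linarith

theorem intervalIntegrable_rpow_pos {p s₁ s₂ : ℝ} (h1 : 0 < s₁) (h12 : s₁ ≤ s₂) :
    IntervalIntegrable (fun σ : ℝ => σ ^ p) volume s₁ s₂ := by
  refine intervalIntegral.intervalIntegrable_rpow (Or.inr ?_)
  rw [uIcc_of_le h12]; exact fun h => absurd h.1 (not_le.2 h1)

/-- The point is uniformity in `r`. For `r < √s₁` the modulus of the integrand suffices. For larger
`r` the phase oscillates: `σ^{-2} e^{ir²/(2σ)}` is the derivative of `(2i/r²) e^{ir²/(2σ)}`, and an
integration by parts gains `r^{-2}`. -/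
theorem norm_integral_phase_le {r s₁ s₂ : ℝ} (h1 : 0 < s₁) (h12 : s₁ ≤ s₂) :
    r * ‖∫ σ in s₁..s₂, ((σ ^ (-(5 / 2) : ℝ) : ℝ) : ℂ)
      * Complex.exp (Complex.I * ((r ^ 2 / (2 * σ) : ℝ) : ℂ))‖ ≤ 6 / s₁ := by
  have hs : 0 < Real.sqrt s₁ := Real.sqrt_pos.2 h1
  have hsq : Real.sqrt s₁ * Real.sqrt s₁ = s₁ := Real.mul_self_sqrt h1.le
  have hhalf : s₁ ^ (-(1 / 2) : ℝ) = 1 / Real.sqrt s₁ := by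
    rw [Real.rpow_neg h1.le, ← Real.sqrt_eq_rpow, one_div]
  have hpos : ∀ σ ∈ uIcc s₁ s₂, 0 < σ := by
    intro σ hσ
    rw [uIcc_of_le h12] at hσ
    exact h1.trans_le hσ.1
  rcases lt_or_ge r (Real.sqrt s₁) with h | h
  · have hb : ‖∫ σ in s₁..s₂, ((σ ^ (-(5 / 2) : ℝ) : ℝ) : ℂ)
        * Complex.exp (Complex.I * ((r ^ 2 / (2 * σ) : ℝ) : ℂ))‖ ≤ ∫ σ in s₁..s₂, σ ^ (-(5 / 2) : ℝ) := by
      refine intervalIntegral.norm_integral_le_of_norm_le h12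
        (Eventually.of_forall fun σ hσ => ?_) (intervalIntegrable_rpow_pos h1 h12)
      have hσ0 : 0 < σ := h1.trans hσ.1
      rw [norm_mul, norm_exp_I_mul_ofReal, mul_one, Complex.norm_real,
        Real.norm_of_nonneg (by positivity)]
    have h2 := integral_rpow_le (p := -(5 / 2)) (by norm_num) h1 h12
    have h3 : s₁ ^ (-(5 / 2) + 1 : ℝ) = 1 / Real.sqrt s₁ * (1 / s₁) := by
      rw [← hhalf, one_div, one_div, ← Real.rpow_neg_one s₁, ← Real.rpow_add h1]
      norm_num
    rw [h3] at h2
    calc r * _ ≤ Real.sqrt s₁ * (1 / Real.sqrt s₁ * (1 / s₁) / (-(-(5 / 2) + 1))) := by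
          gcongr
          exact hb.trans h2
      _ = (2 / 3) / s₁ := by field_simp; norm_num
      _ ≤ 6 / s₁ := by gcongr; norm_num
  · have hr0 : 0 < r := hs.trans_le h
    have hrc : (r : ℂ) ≠ 0 := by exact_mod_cast hr0.ne'
    let u : ℝ → ℂ := fun σ => ((σ ^ (-(1 / 2) : ℝ) : ℝ) : ℂ)
    let u' : ℝ → ℂ := fun σ => ((-(1 / 2) * σ ^ (-(3 / 2) : ℝ) : ℝ) : ℂ)
    let v : ℝ → ℂ := fun σ => 2 * Complex.I / (r : ℂ) ^ 2
      * Complex.exp (Complex.I * ((r ^ 2 / (2 * σ) : ℝ) : ℂ))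
    let v' : ℝ → ℂ := fun σ => ((σ ^ 2 : ℝ) : ℂ)⁻¹
      * Complex.exp (Complex.I * ((r ^ 2 / (2 * σ) : ℝ) : ℂ))
    have hu : ∀ σ ∈ uIcc s₁ s₂, HasDerivAt u (u' σ) σ := by
      intro σ hσ
      have h3 : HasDerivAt (fun x : ℝ => x ^ (-(1 / 2) : ℝ)) (-(1 / 2) * σ ^ (-(3 / 2) : ℝ)) σ := by
        have := Real.hasDerivAt_rpow_const (x := σ) (p := -(1 / 2)) (Or.inl (hpos σ hσ).ne')
        have he : (-(1 / 2) - 1 : ℝ) = -(3 / 2) := by norm_num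
        rwa [he] at this
      exact h3.ofReal_comp
    have hv : ∀ σ ∈ uIcc s₁ s₂, HasDerivAt v (v' σ) σ := by
      intro σ hσ
      have hσ0 := hpos σ hσ
      have hσc : (σ : ℂ) ≠ 0 := by exact_mod_cast hσ0.ne'
      have h3 : HasDerivAt (fun x : ℝ => r ^ 2 / (2 * x)) (-(r ^ 2 / (2 * σ ^ 2))) σ := by
        have := ((hasDerivAt_inv hσ0.ne').const_mul (r ^ 2 / 2))
        have he : r ^ 2 / 2 * -(σ ^ 2)⁻¹ = -(r ^ 2 / (2 * σ ^ 2)) := by field_simp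
        rw [he] at this
        refine this.congr_of_eventuallyEq (Eventually.of_forall fun x => ?_)
        show r ^ 2 / (2 * x) = r ^ 2 / 2 * x⁻¹
        rw [div_mul_eq_div_div, div_eq_mul_inv]
      have h4 := ((h3.ofReal_comp.const_mul Complex.I).cexp).const_mul (2 * Complex.I / (r : ℂ) ^ 2)
      have he : 2 * Complex.I / (r : ℂ) ^ 2 * (Complex.exp (Complex.I * ((r ^ 2 / (2 * σ) : ℝ) : ℂ))
          * (Complex.I * ((-(r ^ 2 / (2 * σ ^ 2)) : ℝ) : ℂ))) = v' σ := by
        simp only [v']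
        push_cast
        field_simp
        rw [Complex.I_sq]
        ring
      rw [← he]
      exact h4
    have hne : ∀ σ ∈ uIcc s₁ s₂, σ ≠ 0 := fun σ hσ => (hpos σ hσ).ne'
    have hu'c : ContinuousOn u' (uIcc s₁ s₂) := by
      refine Complex.continuous_ofReal.comp_continuousOn (continuousOn_const.mul ?_)
      exact continuousOn_id.rpow_const fun σ hσ => Or.inl (hne σ hσ)
    have hv'c : ContinuousOn v' (uIcc s₁ s₂) := by
      refine ContinuousOn.mul (ContinuousOn.inv₀ (by fun_prop) ?_) ?_
      · intro σ hσ
        exact_mod_cast pow_ne_zero 2 (hne σ hσ)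
      · refine Complex.continuous_exp.comp_continuousOn (continuousOn_const.mul
          (Complex.continuous_ofReal.comp_continuousOn ?_))
        exact continuousOn_const.div (by fun_prop) fun σ hσ => by simpa using hne σ hσ
    have hvn : ∀ σ, ‖v σ‖ = 2 / r ^ 2 := by
      intro σ
      simp only [v]
      rw [norm_mul, norm_exp_I_mul_ofReal, mul_one]
      simp
    have hibp := intervalIntegral.integral_mul_deriv_eq_deriv_mul hu hv
      hu'c.intervalIntegrable hv'c.intervalIntegrable
    have heq : ∫ σ in s₁..s₂, ((σ ^ (-(5 / 2) : ℝ) : ℝ) : ℂ)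
        * Complex.exp (Complex.I * ((r ^ 2 / (2 * σ) : ℝ) : ℂ)) = ∫ σ in s₁..s₂, u σ * v' σ := by
      refine intervalIntegral.integral_congr fun σ hσ => ?_
      simp only [u, v']
      rw [rpow_neg_half_mul_sq (hpos σ hσ)]
      push_cast
      ring
    have hint : ‖∫ σ in s₁..s₂, u' σ * v σ‖ ≤ 1 / Real.sqrt s₁ * (2 / r ^ 2) := by
      have h5 : ‖∫ σ in s₁..s₂, u' σ * v σ‖ ≤ ∫ σ in s₁..s₂, (1 / r ^ 2) * σ ^ (-(3 / 2) : ℝ) := by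
        refine intervalIntegral.norm_integral_le_of_norm_le h12
          (Eventually.of_forall fun σ hσ => le_of_eq ?_)
          ((intervalIntegrable_rpow_pos h1 h12).const_mul _)
        have hσ0 : 0 < σ := h1.trans hσ.1
        rw [norm_mul, hvn]
        simp only [u']
        rw [Complex.norm_real, norm_mul, Real.norm_of_nonneg (by positivity : 0 ≤ σ ^ (-(3 / 2) : ℝ))]
        norm_num
        ring
      rw [intervalIntegral.integral_const_mul] at h5
      have h6 := integral_rpow_le (p := -(3 / 2)) (by norm_num) h1 h12
      have he : (-(3 / 2) + 1 : ℝ) = -(1 / 2) := by norm_num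
      rw [he, hhalf] at h6
      calc _ ≤ (1 / r ^ 2) * (1 / Real.sqrt s₁ / (- -(1 / 2))) := h5.trans (by gcongr)
        _ = _ := by field_simp
    have hun : ∀ σ, s₁ ≤ σ → ‖u σ‖ ≤ 1 / Real.sqrt s₁ := by
      intro σ hσ
      have hσ0 : 0 < σ := h1.trans_le hσ
      simp only [u]
      rw [Complex.norm_real, Real.norm_of_nonneg (by positivity), ← hhalf]
      exact Real.rpow_le_rpow_of_nonpos h1 hσ (by norm_num)
    rw [heq, hibp]
    have hu2 : ‖u s₂ * v s₂‖ ≤ 1 / Real.sqrt s₁ * (2 / r ^ 2) := by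
      rw [norm_mul, hvn]; gcongr; exact hun s₂ h12
    have hu1 : ‖u s₁ * v s₁‖ ≤ 1 / Real.sqrt s₁ * (2 / r ^ 2) := by
      rw [norm_mul, hvn]; gcongr; exact hun s₁ le_rfl
    have hu1' : ‖u s₂ * v s₂ - u s₁ * v s₁‖ ≤ 1 / Real.sqrt s₁ * (2 / r ^ 2) +
        1 / Real.sqrt s₁ * (2 / r ^ 2) := (norm_sub_le _ _).trans (add_le_add hu2 hu1)
    calc r * ‖u s₂ * v s₂ - u s₁ * v s₁ - ∫ σ in s₁..s₂, u' σ * v σ‖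
        ≤ r * (1 / Real.sqrt s₁ * (2 / r ^ 2) + 1 / Real.sqrt s₁ * (2 / r ^ 2)
          + 1 / Real.sqrt s₁ * (2 / r ^ 2)) := by
          gcongr
          exact (norm_sub_le _ _).trans (add_le_add hu1' hint)
      _ = 6 / (Real.sqrt s₁ * r) := by field_simp; norm_num
      _ ≤ 6 / (Real.sqrt s₁ * Real.sqrt s₁) := by gcongr
      _ = 6 / s₁ := by rw [hsq]

theorem continuous_U_uncurry (φ : 𝓢(R3, ℂ)) : Continuous fun p : ℝ × R3 => U p.1 φ p.2 := by
  simp only [U_apply]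
  refine continuous_of_dominated (bound := fun ξ => ‖𝓕 φ ξ‖) ?_ ?_ (𝓕 φ).integrable.norm ?_
  · intro p
    have h1 := continuous_sym p.1
    have h2 := (𝓕 φ : 𝓢(R3, ℂ)).continuous
    exact Continuous.aestronglyMeasurable (by fun_prop)
  · refine fun p => Eventually.of_forall fun ξ => le_of_eq ?_
    rw [norm_mul, norm_mul, norm_sym, one_mul, mul_comm ((_ : ℝ) : ℂ), norm_exp_I_mul_ofReal,
      one_mul]
  · refine Eventually.of_forall fun ξ => ?_
    have h1 : Continuous fun p : ℝ × R3 => sym p.1 ξ := (continuous_sym_left ξ).comp continuous_fst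
    fun_prop

/-- In the kernel formula a derivative becomes the factor `(y_j - x_j)/σ`, which is unbounded in
`y`. Integrated against the phase in time, it is absorbed by `norm_integral_phase_le`, so the bound
is uniform in `y`. The pointwise bound `σ^{-3/2}` would give only `s₁^{-1/2}`. -/
theorem exists_norm_integral_U_lineDeriv_le (j : Fin 3) (φ : 𝓢(R3, ℂ)) :
    ∃ C, 0 ≤ C ∧ ∀ s₁ s₂, 0 < s₁ → s₁ ≤ s₂ → ∀ y,
      ‖∫ σ in s₁..s₂, U σ (∂_{e j} φ) y‖ ≤ C / s₁ := by
  refine ⟨‖kernelConst‖ * ((∫ x, ‖φ x‖) * 6), by positivity, fun s₁ s₂ h1 h12 y => ?_⟩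
  let g : R3 → ℂ := fun x => ((y j - x j : ℝ) : ℂ) * φ x
  have hg : Integrable g := by
    have := (φ.integrable (μ := volume)).const_mul (y j : ℂ)
    refine (this.sub (coordMul j φ).integrable).congr (Eventually.of_forall fun x => ?_)
    simp only [g, Pi.sub_apply, coordMul_apply]
    push_cast
    ring
  let F : ℝ → R3 → ℂ := fun σ x => g x * (((σ ^ (-(5 / 2) : ℝ) : ℝ) : ℂ)
    * Complex.exp (Complex.I * ((‖x - y‖ ^ 2 / (2 * σ) : ℝ) : ℂ)))
  have hU : ∀ σ, 0 < σ → U σ (∂_{e j} φ) y = Complex.I * kernelConst * ∫ x, F σ x := by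
    intro σ hσ
    have hσc : (σ : ℂ) ≠ 0 := by exact_mod_cast hσ.ne'
    have hi : ∀ ψ : 𝓢(R3, ℂ), Integrable fun x =>
        ψ x * Complex.exp (Complex.I * ((‖x - y‖ ^ 2 / (2 * σ) : ℝ) : ℂ)) := by
      intro ψ
      refine ψ.integrable.mono ((ψ.continuous.mul (by fun_prop)).aestronglyMeasurable)
        (Eventually.of_forall fun x => ?_)
      rw [norm_mul, norm_exp_I_mul_ofReal, mul_one]
    have h5 : σ ^ (-(5 / 2) : ℝ) = σ ^ (-(3 / 2) : ℝ) * σ⁻¹ := by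
      rw [← Real.rpow_neg_one σ, ← Real.rpow_add hσ]; norm_num
    rw [U_lineDeriv_eq hσ.ne', U_kernel hσ, U_kernel hσ]
    have h6 : ∫ x, F σ x = ((σ ^ (-(5 / 2) : ℝ) : ℝ) : ℂ) *
        ((y j : ℂ) * (∫ x, φ x * Complex.exp (Complex.I * ((‖x - y‖ ^ 2 / (2 * σ) : ℝ) : ℂ)))
        - ∫ x, coordMul j φ x * Complex.exp (Complex.I * ((‖x - y‖ ^ 2 / (2 * σ) : ℝ) : ℂ))) := by
      rw [← integral_const_mul (y j : ℂ), ← integral_sub ((hi φ).const_mul _) (hi _),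
        ← integral_const_mul]
      refine integral_congr_ae (Eventually.of_forall fun x => ?_)
      simp only [F, g, coordMul_apply]
      push_cast
      ring
    rw [h6, h5]
    push_cast
    field_simp
  have hFi : Integrable (Function.uncurry F) ((volume.restrict (uIoc s₁ s₂)).prod volume) := by
    rw [uIoc_of_le h12]
    have hb : Integrable (fun p : ℝ × R3 => s₁ ^ (-(5 / 2) : ℝ) * ‖g p.2‖)
        ((volume.restrict (Ioc s₁ s₂)).prod volume) :=
      (hg.norm.comp_snd (volume.restrict (Ioc s₁ s₂))).const_mul _
    refine hb.mono' ?_ ?_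
    · refine (hg.aestronglyMeasurable.comp_snd).mul ?_
      have hm : Measurable fun p : ℝ × R3 => ((p.1 ^ (-(5 / 2) : ℝ) : ℝ) : ℂ)
        * Complex.exp (Complex.I * ((‖p.2 - y‖ ^ 2 / (2 * p.1) : ℝ) : ℂ)) := by fun_prop
      exact hm.aestronglyMeasurable
    · have : ∀ᵐ p : ℝ × R3 ∂((volume.restrict (Ioc s₁ s₂)).prod volume), p.1 ∈ Ioc s₁ s₂ :=
        (Measure.quasiMeasurePreserving_fst).ae (ae_restrict_mem measurableSet_Ioc)
      filter_upwards [this] with p hp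
      have hp0 : 0 < p.1 := h1.trans hp.1
      have hn : ‖((p.1 ^ (-(5 / 2) : ℝ) : ℝ) : ℂ)
          * Complex.exp (Complex.I * ((‖p.2 - y‖ ^ 2 / (2 * p.1) : ℝ) : ℂ))‖
          = p.1 ^ (-(5 / 2) : ℝ) := by
        rw [norm_mul, norm_exp_I_mul_ofReal, mul_one, Complex.norm_real,
          Real.norm_of_nonneg (by positivity)]
      refine (norm_mul_le (g p.2) _).trans ?_
      rw [hn, mul_comm]
      exact mul_le_mul_of_nonneg_right (Real.rpow_le_rpow_of_nonpos h1 hp.1.le (by norm_num))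
        (norm_nonneg _)
  have hcongr : ∫ σ in s₁..s₂, U σ (∂_{e j} φ) y
      = Complex.I * kernelConst * ∫ x, ∫ σ in s₁..s₂, F σ x := by
    rw [← intervalIntegral_integral_swap hFi, ← intervalIntegral.integral_const_mul]
    refine intervalIntegral.integral_congr fun σ hσ => ?_
    rw [uIcc_of_le h12] at hσ
    exact hU σ (h1.trans_le hσ.1)
  rw [hcongr, norm_mul, norm_mul, Complex.norm_I, one_mul, mul_div_assoc]
  refine mul_le_mul_of_nonneg_left ?_ (norm_nonneg _)
  have hle : ‖∫ x, ∫ σ in s₁..s₂, F σ x‖ ≤ ∫ x, ‖φ x‖ * (6 / s₁) := by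
    refine norm_integral_le_of_norm_le (φ.integrable.norm.mul_const _)
      (Eventually.of_forall fun x => ?_)
    simp only [F]
    rw [intervalIntegral.integral_const_mul, norm_mul]
    simp only [g]
    rw [norm_mul, mul_comm _ ‖φ x‖, mul_assoc]
    refine mul_le_mul_of_nonneg_left ?_ (norm_nonneg _)
    refine le_trans ?_ (norm_integral_phase_le (r := ‖x - y‖) h1 h12)
    refine mul_le_mul_of_nonneg_right ?_ (norm_nonneg _)
    have := norm_coord_le (y - x) j
    rw [norm_sub_rev x y]
    simpa using this
  rw [integral_mul_const] at hle
  rwa [mul_div_assoc]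

theorem exists_norm_integral_pair_le (j : Fin 3) (φ : 𝓢(R3, ℂ)) :
    ∃ C, 0 ≤ C ∧ ∀ s₁ s₂, 0 < s₁ → s₁ ≤ s₂ → ∀ (a : R3) (b : L2), Integrable b →
      ‖∫ σ in s₁..s₂, pair (U σ (shift a (∂_{e j} φ))) b‖ ≤ C / s₁ * ∫ y, ‖b y‖ := by
  obtain ⟨C, hC, h⟩ := exists_norm_integral_U_lineDeriv_le j φ
  refine ⟨C, hC, fun s₁ s₂ h1 h12 a b hb => ?_⟩
  set χ := shift a (∂_{e j} φ) with hχ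
  have hFi : Integrable (Function.uncurry fun (σ : ℝ) (y : R3) => U σ χ y * b y)
      ((volume.restrict (uIoc s₁ s₂)).prod volume) := by
    rw [uIoc_of_le h12]
    have hb2 : Integrable (fun p : ℝ × R3 => (∫ ξ, ‖𝓕 χ ξ‖) * ‖b p.2‖)
        ((volume.restrict (Ioc s₁ s₂)).prod volume) :=
      (hb.norm.comp_snd (volume.restrict (Ioc s₁ s₂))).const_mul _
    refine hb2.mono' ?_ (Eventually.of_forall fun p => ?_)
    · exact (continuous_U_uncurry χ).aestronglyMeasurable.mul hb.aestronglyMeasurable.comp_snd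
    · simp only [Function.uncurry]
      rw [norm_mul]
      gcongr
      exact norm_U_le_const _ _ _
  unfold pair
  rw [intervalIntegral_integral_swap hFi, ← integral_const_mul]
  refine norm_integral_le_of_norm_le (hb.norm.const_mul _) (Eventually.of_forall fun y => ?_)
  rw [intervalIntegral.integral_mul_const, norm_mul]
  gcongr
  simp only [hχ, U_shift, shift_apply]
  exact h s₁ s₂ h1 h12 (y - a)

theorem norm_pair_U_le {χ : 𝓢(R3, ℂ)} {t D : ℝ} (h : ∀ y, ‖U t χ y‖ ≤ D) {b : L2}
    (hb : Integrable b) : ‖pair (U t χ) b‖ ≤ D * ∫ y, ‖b y‖ := by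
  rw [pair, ← integral_const_mul]
  refine norm_integral_le_of_norm_le (hb.norm.const_mul _) (Eventually.of_forall fun y => ?_)
  rw [norm_mul]
  gcongr
  exact h y

end Friction

end

/-! ### The resolvent: existence, energy identity, Laplace transform -/

noncomputable section

namespace Friction

open LineDeriv

/-! ### Fixed points in exponentially weighted spaces -/

/-- The contraction principle in the norm `sup_{t ≥ 0} e^{-at} ‖u t‖`. -/
theorem exists_weighted_fixedPoint {E : Type*} [NormedAddCommGroup E] [NormedSpace ℝ E]
    [CompleteSpace E] (V : (ℝ → E) → ℝ → E) (a m₀ : ℝ)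
    (hc : ∀ u, Continuous u → Continuous (V u))
    (h0 : ∀ t, 0 ≤ t → ‖V 0 t‖ ≤ m₀ * Real.exp (a * t))
    (hL : ∀ u v, Continuous u → Continuous v → ∀ m,
      (∀ s, 0 ≤ s → ‖u s - v s‖ ≤ m * Real.exp (a * s)) →
      ∀ t, 0 ≤ t → ‖V u t - V v t‖ ≤ m / 2 * Real.exp (a * t)) :
    ∃ u, Continuous u ∧ ∀ t, 0 ≤ t → u t = V u t := by
  let S : (ℝ → E) → ℝ → E := fun u t => Real.exp (a * t) • u t
  have hS : ∀ u, Continuous u → Continuous (S u) := fun u hu => by fun_prop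
  -- Conjugation by `e^{at}` turns the weighted norm into the supremum norm. Replacing `t` by `max t
  -- 0` freezes the map for negative times, so that it acts on bounded continuous functions on the
  -- whole line.
  let G : (ℝ → E) → ℝ → E := fun u t => Real.exp (-(a * max t 0)) • V (S u) (max t 0)
  have hG : ∀ u, Continuous u → Continuous (G u) := by
    intro u hu
    have := hc _ (hS u hu)
    fun_prop
  have hexp : ∀ t : ℝ, Real.exp (-(a * t)) * Real.exp (a * t) = 1 := by
    intro t; rw [← Real.exp_add]; simp
  have hGL : ∀ u v, Continuous u → Continuous v → ∀ m, (∀ s, ‖u s - v s‖ ≤ m) →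
      ∀ t, ‖G u t - G v t‖ ≤ m / 2 := by
    intro u v hu hv m h t
    have h1 := hL (S u) (S v) (hS u hu) (hS v hv) m (fun s _ => by
      simp only [S]
      rw [← smul_sub, norm_smul, Real.norm_of_nonneg (Real.exp_pos _).le, mul_comm]
      gcongr
      exact h s) (max t 0) (le_max_right _ _)
    simp only [G]
    rw [← smul_sub, norm_smul, Real.norm_of_nonneg (Real.exp_pos _).le]
    calc _ ≤ Real.exp (-(a * max t 0)) * (m / 2 * Real.exp (a * max t 0)) := by gcongr
      _ = m / 2 * (Real.exp (-(a * max t 0)) * Real.exp (a * max t 0)) := by ring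
      _ = m / 2 := by rw [hexp, mul_one]
  have hG0 : ∀ t, ‖G 0 t‖ ≤ m₀ := by
    intro t
    have h1 := h0 (max t 0) (le_max_right _ _)
    have h2 : S 0 = 0 := by funext s; simp [S]
    simp only [G]
    rw [h2, norm_smul, Real.norm_of_nonneg (Real.exp_pos _).le]
    calc _ ≤ Real.exp (-(a * max t 0)) * (m₀ * Real.exp (a * max t 0)) := by gcongr
      _ = m₀ * (Real.exp (-(a * max t 0)) * Real.exp (a * max t 0)) := by ring
      _ = m₀ := by rw [hexp, mul_one]
  let Φ : BoundedContinuousFunction ℝ E → BoundedContinuousFunction ℝ E := fun u =>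
    BoundedContinuousFunction.ofNormedAddCommGroup (G u) (hG u u.continuous) (m₀ + ‖u‖ / 2)
      (fun t => by
        have h1 := hGL u 0 u.continuous continuous_const ‖u‖
          (fun s => by simpa using u.norm_coe_le_norm s) t
        calc ‖G u t‖ = ‖G 0 t + (G u t - G 0 t)‖ := by rw [add_sub_cancel]
          _ ≤ m₀ + ‖u‖ / 2 := (norm_add_le _ _).trans (add_le_add (hG0 t) h1))
  have hΦ : ContractingWith (1 / 2) Φ := by
    refine ⟨by
      rw [div_lt_one (by norm_num)]; norm_num, LipschitzWith.of_dist_le_mul fun u v => ?_⟩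
    rw [BoundedContinuousFunction.dist_le (by positivity)]
    intro t
    rw [dist_eq_norm]
    have h1 := hGL u v u.continuous v.continuous (dist u v)
      (fun s => by rw [← dist_eq_norm]; exact BoundedContinuousFunction.dist_coe_le_dist s) t
    refine h1.trans (le_of_eq ?_)
    push_cast
    ring
  obtain ⟨u, hu⟩ : ∃ u, Φ u = u :=
    ⟨ContractingWith.fixedPoint Φ hΦ, ContractingWith.fixedPoint_isFixedPt hΦ⟩
  refine ⟨S u, hS u u.continuous, fun t ht => ?_⟩
  have h1 : G u t = u t := DFunLike.congr_fun hu t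
  simp only [S]
  rw [← h1]
  simp only [G]
  rw [max_eq_left ht, smul_smul, mul_comm, hexp, one_smul]

/-! ### The memory kernel -/

variable {W : R3 → ℝ} {w : 𝓢(R3, ℂ)}

theorem f_eq (h : IsComplexification W w) (κ M₀ t : ℝ) :
    f κ M₀ W t = Z κ M₀ * (pair (U t w) (toL2 w)).re := by
  rw [f, h.hat_eq, specPair_schr_schwartz, h.conjS_eq, pair_toLp]

theorem inner_toL2_U (h : IsComplexification W w) (s t : ℝ) :
    inner ℂ (toL2 (U s w)) (toL2 (U t w)) = pair (U (t - s) w) (toL2 w) := by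
  have h1 : conjS (U (s - t) w) = U (t - s) w := by rw [conjS_U, h.conjS_eq, neg_sub]
  have h2 : conjS (U (t - s) w) = U (s - t) w := by rw [conjS_U, h.conjS_eq, neg_sub]
  rw [pair_eq_inner, h2, ← Lp.inner_fourier_eq, ← Lp.inner_fourier_eq (toL2 (U (s - t) w)),
    fourier_toL2, fourier_toL2, fourier_toL2, fourier_toL2, L2.inner_def, L2.inner_def]
  refine integral_congr_ae ?_
  filter_upwards [coeFn_toL2 (𝓕 (U s w) : 𝓢(R3, ℂ)), coeFn_toL2 (𝓕 (U t w) : 𝓢(R3, ℂ)),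
    coeFn_toL2 (𝓕 (U (s - t) w) : 𝓢(R3, ℂ)), coeFn_toL2 (𝓕 w : 𝓢(R3, ℂ))] with ξ h1 h2 h3 h4
  rw [h1, h2, h3, h4, fourier_U, fourier_U, fourier_U, RCLike.inner_apply, RCLike.inner_apply,
    map_mul, map_mul, conj_sym, conj_sym, neg_sub, sub_eq_add_neg, sym_add]
  ring

theorem f_neg (h : IsComplexification W w) (κ M₀ t : ℝ) : f κ M₀ W (-t) = f κ M₀ W t := by
  have h1 := inner_toL2_U h 0 t
  have h2 := inner_toL2_U h t 0
  rw [sub_zero] at h1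
  rw [zero_sub] at h2
  rw [f_eq h, f_eq h, ← h1, ← h2, ← inner_conj_symm, Complex.conj_re]

/-- The memory kernel is a Gram kernel, hence positive definite. This is the structure behind the
energy identity. -/
theorem f_sub_eq (h : IsComplexification W w) (κ M₀ s t : ℝ) :
    f κ M₀ W (t - s) = Z κ M₀ * (inner ℂ (toL2 (U s w)) (toL2 (U t w))).re := by
  rw [inner_toL2_U h, f_eq h]

theorem Z_pos {κ M₀ : ℝ} (hκ : 0 < κ) (hM₀ : 0 < M₀) : 0 < Z κ M₀ := by
  unfold Z; positivity

/-- The derivative of the memory kernel. -/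
def f' (κ M₀ : ℝ) (w : 𝓢(R3, ℂ)) (t : ℝ) : ℝ :=
  Z κ M₀ * (Complex.I / 2 * pair (U t (Δ w)) (toL2 w)).re

theorem hasDerivAt_f (h : IsComplexification W w) (κ M₀ t : ℝ) :
    HasDerivAt (f κ M₀ W) (f' κ M₀ w t) t := by
  have h1 : f κ M₀ W = fun t => Z κ M₀ * (pair (U t w) (toL2 w)).re := funext (f_eq h κ M₀)
  rw [h1]
  have h2 := Complex.reCLM.hasFDerivAt.comp_hasDerivAt t (hasDerivAt_pair_U t w (toL2 w))
  exact h2.const_mul _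

theorem continuous_f (h : IsComplexification W w) (κ M₀ : ℝ) : Continuous (f κ M₀ W) :=
  continuous_iff_continuousAt.2 fun t => (hasDerivAt_f h κ M₀ t).continuousAt

theorem continuous_f' (κ M₀ : ℝ) (w : 𝓢(R3, ℂ)) : Continuous (f' κ M₀ w) := by
  have := continuous_pair_U (Δ w) (toL2 w)
  unfold f'
  fun_prop

theorem norm_pair_toL2_le {φ ψ : 𝓢(R3, ℂ)} {D : ℝ} (hφ : ∀ y, ‖φ y‖ ≤ D) :
    ‖pair φ (toL2 ψ)‖ ≤ D * ∫ y, ‖ψ y‖ := by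
  rw [pair_toLp, ← integral_const_mul]
  refine norm_integral_le_of_norm_le (ψ.integrable.norm.const_mul _)
    (Eventually.of_forall fun y => ?_)
  rw [norm_mul]
  gcongr
  exact hφ y

theorem exists_abs_f_le (h : IsComplexification W w) (κ M₀ : ℝ) :
    ∃ C, 0 ≤ C ∧ ∀ t, 0 ≤ t → |f κ M₀ W t| ≤ C * (1 + t) ^ (-(3 / 2) : ℝ)
      ∧ |f' κ M₀ w t| ≤ C * (1 + t) ^ (-(3 / 2) : ℝ) := by
  obtain ⟨C₁, hC₁, h₁⟩ := exists_norm_U_le w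
  obtain ⟨C₂, hC₂, h₂⟩ := exists_norm_U_le (Δ w)
  have hw : 0 ≤ ∫ y, ‖w y‖ := by positivity
  refine ⟨|Z κ M₀| * ((C₁ + C₂) * ∫ y, ‖w y‖), by positivity, fun t ht => ⟨?_, ?_⟩⟩
  · rw [f_eq h, abs_mul, mul_assoc]
    refine mul_le_mul_of_nonneg_left ?_ (abs_nonneg _)
    have hp : 0 ≤ (1 + t) ^ (-(3 / 2) : ℝ) := by positivity
    calc _ ≤ ‖pair (U t w) (toL2 w)‖ := Complex.abs_re_le_norm _
      _ ≤ C₁ * (1 + t) ^ (-(3 / 2) : ℝ) * ∫ y, ‖w y‖ := norm_pair_toL2_le (h₁ t ht)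
      _ ≤ (C₁ + C₂) * (1 + t) ^ (-(3 / 2) : ℝ) * ∫ y, ‖w y‖ := by gcongr; linarith
      _ = _ := by ring
  · rw [f', abs_mul, mul_assoc]
    refine mul_le_mul_of_nonneg_left ?_ (abs_nonneg _)
    have hp : 0 ≤ (1 + t) ^ (-(3 / 2) : ℝ) := by positivity
    calc _ ≤ ‖Complex.I / 2 * pair (U t (Δ w)) (toL2 w)‖ := Complex.abs_re_le_norm _
      _ = 1 / 2 * ‖pair (U t (Δ w)) (toL2 w)‖ := by rw [norm_mul]; simp
      _ ≤ 1 / 2 * (C₂ * (1 + t) ^ (-(3 / 2) : ℝ) * ∫ y, ‖w y‖) := by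
        gcongr; exact norm_pair_toL2_le (h₂ t ht)
      _ ≤ 1 * ((C₁ + C₂) * (1 + t) ^ (-(3 / 2) : ℝ) * ∫ y, ‖w y‖) := by
        gcongr
        · norm_num
        · linarith
      _ = _ := by ring

/-! ### Existence of the resolvent -/

theorem exists_bound_f (h : IsComplexification W w) (κ M₀ : ℝ) :
    ∃ C, 0 ≤ C ∧ ∀ t, |f κ M₀ W t| ≤ C := by
  obtain ⟨C, hC, hb⟩ := exists_abs_f_le h κ M₀
  refine ⟨C, hC, fun t => ?_⟩
  have h1 : f κ M₀ W t = f κ M₀ W |t| := by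
    rcases abs_cases t with ⟨h2, -⟩ | ⟨h2, -⟩
    · rw [h2]
    · rw [h2, f_neg h]
  rw [h1]
  refine ((hb |t| (abs_nonneg t)).1).trans ?_
  refine mul_le_of_le_one_right hC (Real.rpow_le_one_of_one_le_of_nonpos ?_ (by norm_num))
  linarith [abs_nonneg t]

theorem intervalIntegral_exp_mul_le {a : ℝ} (ha : 0 < a) {t : ℝ} :
    ∫ s in (0 : ℝ)..t, Real.exp (a * s) ≤ Real.exp (a * t) / a := by
  have h1 : ∀ s ∈ uIcc 0 t, HasDerivAt (fun s => Real.exp (a * s) / a) (Real.exp (a * s)) s := by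
    intro s _
    have := (((hasDerivAt_id s).const_mul a).exp).div_const a
    have he : Real.exp (a * id s) * (a * 1) / a = Real.exp (a * s) := by
      simp only [id]; field_simp
    rw [he] at this
    exact this
  have hc : Continuous fun s => Real.exp (a * s) := by fun_prop
  rw [intervalIntegral.integral_eq_sub_of_hasDerivAt h1 (hc.intervalIntegrable _ _)]
  have : 0 < Real.exp (a * 0) / a := by positivity
  linarith

theorem norm_intervalIntegral_le_exp {E : Type*} [NormedAddCommGroup E] [NormedSpace ℝ E]
    {a : ℝ} (ha : 0 < a) {m t : ℝ} (hm : 0 ≤ m) (ht : 0 ≤ t) {u : ℝ → E}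
    (hu : ∀ s, 0 ≤ s → s ≤ t → ‖u s‖ ≤ m * Real.exp (a * s)) :
    ‖∫ s in (0 : ℝ)..t, u s‖ ≤ m / a * Real.exp (a * t) := by
  have hc : Continuous fun s => m * Real.exp (a * s) := by fun_prop
  have h1 := intervalIntegral.norm_integral_le_of_norm_le ht
    (Eventually.of_forall fun s (hs : s ∈ Ioc 0 t) => hu s hs.1.le hs.2) (hc.intervalIntegrable (μ := volume) 0 t)
  rw [intervalIntegral.integral_const_mul] at h1
  calc _ ≤ m * (Real.exp (a * t) / a) := h1.trans (by gcongr; exact intervalIntegral_exp_mul_le ha)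
    _ = _ := by ring

theorem continuous_volterra {g : ℝ → ℝ} (hg : Continuous g) {u : ℝ → ℝ} (hu : Continuous u) :
    Continuous fun t => ∫ s in (0 : ℝ)..t, g (t - s) * u s := by
  have h1 : Continuous (Function.uncurry fun t s => g (t - s) * u s) := by fun_prop
  exact intervalIntegral.continuous_parametric_intervalIntegral_of_continuous h1 continuous_id

theorem exists_isResolvent (h : IsComplexification W w) (κ M₀ : ℝ) :
    ∃ K, Continuous K ∧ IsResolvent κ M₀ W K := by
  obtain ⟨C, hC, hf⟩ := exists_bound_f h κ M₀
  have hfc := continuous_f h κ M₀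
  -- Each of the two time integrations costs a factor `1/a`, so the Lipschitz constant is `C/a²`; it
  -- is at most `1/2` because `a ≥ 1` and `a ≥ 2C`.
  set a : ℝ := 2 * C + 1 with ha
  have ha1 : 1 ≤ a := by linarith
  have ha0 : 0 < a := by linarith
  let V : (ℝ → ℝ) → ℝ → ℝ := fun u t => 1 - ∫ s in (0 : ℝ)..t, ∫ r in (0 : ℝ)..s, f κ M₀ W (s - r) * u r
  have hVd : ∀ u, Continuous u → ∀ t, HasDerivAt (V u)
      (-∫ r in (0 : ℝ)..t, f κ M₀ W (t - r) * u r) t := by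
    intro u hu t
    have h1 := continuous_volterra hfc hu
    exact (intervalIntegral.integral_hasDerivAt_right (h1.intervalIntegrable _ _)
      (h1.stronglyMeasurableAtFilter _ _) h1.continuousAt).const_sub 1
  obtain ⟨K, hK, hKV⟩ := exists_weighted_fixedPoint V a 1
    (fun u hu => continuous_iff_continuousAt.2 fun t => (hVd u hu t).continuousAt)
    (fun t ht => by
      have : V 0 t = 1 := by simp [V]
      rw [this]
      simpa using Real.one_le_exp (by positivity))
    (fun u v hu hv m hm t ht => by
      have hm0 : 0 ≤ m := by
        have := (norm_nonneg _).trans (hm 0 le_rfl)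
        simpa using this
      have hVe : V u t - V v t = ∫ s in (0 : ℝ)..t, ∫ r in (0 : ℝ)..s,
          f κ M₀ W (s - r) * (v r - u r) := by
        have h1 := continuous_volterra hfc hu
        have h2 := continuous_volterra hfc hv
        simp only [V]
        rw [sub_sub_sub_cancel_left, ← intervalIntegral.integral_sub (h2.intervalIntegrable _ _)
          (h1.intervalIntegrable _ _)]
        refine intervalIntegral.integral_congr fun s _ => ?_
        have h3 : Continuous fun r => f κ M₀ W (s - r) * v r := by fun_prop
        have h4 : Continuous fun r => f κ M₀ W (s - r) * u r := by fun_prop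
        rw [← intervalIntegral.integral_sub (h3.intervalIntegrable _ _)
          (h4.intervalIntegrable _ _)]
        simp only [mul_sub]
      rw [hVe]
      have h5 := norm_intervalIntegral_le_exp ha0 (m := C * m / a) (by positivity) ht
        (u := fun s => ∫ r in (0 : ℝ)..s, f κ M₀ W (s - r) * (v r - u r)) fun s hs _ =>
          norm_intervalIntegral_le_exp ha0 (m := C * m) (by positivity) hs fun r hr _ => by
            rw [norm_mul, norm_sub_rev, mul_assoc]
            exact mul_le_mul (hf _) (hm r hr) (norm_nonneg _) hC
      refine h5.trans (mul_le_mul_of_nonneg_right ?_ (Real.exp_pos _).le)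
      rw [div_div, div_le_div_iff₀ (by positivity) (by norm_num)]
      nlinarith [mul_nonneg hm0 hC])
  refine ⟨K, hK, ?_, fun t ht => ?_⟩
  · rw [hKV 0 le_rfl]; simp [V]
  · exact ((hVd K hK t).hasDerivWithinAt).congr (fun s hs => hKV s hs) (hKV t ht)

/-! ### The energy identity -/

/-- Solutions of the linear equation without source. -/
structure IsHomSolution (κ M₀ : ℝ) (W : R3 → ℝ) (D : ℝ → ℝ) : Prop where
  cont : Continuous D
  deriv : ∀ t, 0 ≤ t →
    HasDerivWithinAt D (-∫ s in (0 : ℝ)..t, f κ M₀ W (t - s) * D s) (Ici 0) t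

/-- The field radiated by the source `D`, in the interaction picture. -/
def radiated (w : 𝓢(R3, ℂ)) (D : ℝ → ℝ) (t : ℝ) : L2 :=
  ∫ s in (0 : ℝ)..t, D s • toL2 (U s w)

theorem continuous_toL2_U (φ : 𝓢(R3, ℂ)) : Continuous fun s => toL2 (U s φ) :=
  continuous_iff_continuousAt.2 fun t => (hasDerivAt_U t φ).continuousAt

theorem hasDerivAt_radiated (w : 𝓢(R3, ℂ)) {D : ℝ → ℝ} (hD : Continuous D) (t : ℝ) :
    HasDerivAt (radiated w D) (D t • toL2 (U t w)) t := by
  have h1 : Continuous fun s => D s • toL2 (U s w) := hD.smul (continuous_toL2_U w)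
  exact intervalIntegral.integral_hasDerivAt_right (h1.intervalIntegrable _ _)
    (h1.stronglyMeasurableAtFilter _ _) h1.continuousAt

/-- Testing the field radiated up to time `r` against the source at time `t` recovers the part of
the memory integral that comes from `[0, r]`. The energy identity uses `r = t`, periodicity uses `r`
equal to the period. -/
theorem inner_radiated (h : IsComplexification W w) (κ M₀ : ℝ) {D : ℝ → ℝ} (hD : Continuous D)
    (r t : ℝ) : Z κ M₀ * (inner ℂ (radiated w D r) (toL2 (U t w))).re
      = ∫ s in (0 : ℝ)..r, f κ M₀ W (t - s) * D s := by
  have h1 : Continuous fun s => D s • toL2 (U s w) := hD.smul (continuous_toL2_U w)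
  have h2 : (inner ℂ (radiated w D r) (toL2 (U t w))).re
      = (Complex.reCLM.comp ((innerSL ℂ (toL2 (U t w))).restrictScalars ℝ)) (radiated w D r) := by
    show _ = (inner ℂ (toL2 (U t w)) (radiated w D r)).re
    rw [← inner_conj_symm, Complex.conj_re]
  rw [h2, radiated, ← ContinuousLinearMap.intervalIntegral_comp_comm _ (h1.intervalIntegrable _ _),
    ← intervalIntegral.integral_const_mul]
  refine intervalIntegral.integral_congr fun s _ => ?_
  show Z κ M₀ * (inner ℂ (toL2 (U t w)) (D s • toL2 (U s w))).re = f κ M₀ W (t - s) * D s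
  rw [f_sub_eq h, ← inner_conj_symm (toL2 (U s w)), Complex.conj_re, RCLike.real_smul_eq_coe_smul (K := ℂ) (D s),
    inner_smul_right]
  simp only [Complex.coe_algebraMap, Complex.re_ofReal_mul]
  ring

/-- The derivative of `D²` is `-2D` times the memory integral. By the Gram structure this is minus
the derivative of `Z ‖radiated‖²`: what the particle loses is stored in the radiated field. -/
theorem IsHomSolution.energy {κ M₀ : ℝ} (h : IsComplexification W w) {D : ℝ → ℝ}
    (hD : IsHomSolution κ M₀ W D) {t : ℝ} (ht : 0 ≤ t) :
    D t ^ 2 + Z κ M₀ * ‖radiated w D t‖ ^ 2 = D 0 ^ 2 := by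
  have hn : ∀ v : L2, ‖v‖ ^ 2 = (inner ℂ v v).re := fun v => by
    rw [inner_self_eq_norm_sq_to_K]
    norm_cast
  have hder : ∀ s, 0 ≤ s → HasDerivWithinAt
      (fun s => D s ^ 2 + Z κ M₀ * ‖radiated w D s‖ ^ 2) 0 (Ici 0) s := by
    intro s hs
    have h1 := (hD.deriv s hs).pow 2
    have h2 := hasDerivAt_radiated w hD.cont s
    have h3 := (Complex.reCLM.hasFDerivAt.comp_hasDerivAt s (h2.inner ℂ h2)).const_mul (Z κ M₀)
    have h4 := h1.add h3.hasDerivWithinAt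
    have he : Z κ M₀ * (inner ℂ (radiated w D s) (D s • toL2 (U s w))
        + inner ℂ (D s • toL2 (U s w)) (radiated w D s)).re
        = 2 * D s * ∫ r in (0 : ℝ)..s, f κ M₀ W (s - r) * D r := by
      rw [← inner_radiated h κ M₀ hD.cont, Complex.add_re,
        ← inner_conj_symm (D s • toL2 (U s w)), Complex.conj_re,
        RCLike.real_smul_eq_coe_smul (K := ℂ) (D s), inner_smul_right]
      simp only [Complex.coe_algebraMap, Complex.re_ofReal_mul]
      ring
    have h5 : ((2 : ℕ) : ℝ) * D s ^ (2 - 1) * (-∫ r in (0 : ℝ)..s, f κ M₀ W (s - r) * D r)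
        + Z κ M₀ * (inner ℂ (radiated w D s) (D s • toL2 (U s w))
        + inner ℂ (D s • toL2 (U s w)) (radiated w D s)).re = 0 := by
      rw [he]; push_cast; ring
    refine HasDerivWithinAt.congr (f := fun r => D r ^ 2
      + Z κ M₀ * (inner ℂ (radiated w D r) (radiated w D r)).re)
      (HasDerivWithinAt.congr_deriv h4 h5) (fun r _ => ?_) ?_
    · show _ = D r ^ 2 + Z κ M₀ * (inner ℂ (radiated w D r) (radiated w D r)).re
      rw [hn]
    · show _ = D s ^ 2 + Z κ M₀ * (inner ℂ (radiated w D s) (radiated w D s)).re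
      rw [hn]
  have hc := constant_of_has_deriv_right_zero (a := 0) (b := t)
    (f := fun s => D s ^ 2 + Z κ M₀ * ‖radiated w D s‖ ^ 2)
    (fun s hs => ((hder s hs.1).mono Icc_subset_Ici_self).continuousWithinAt)
    (fun s hs => (hder s hs.1).mono (Ici_subset_Ici.2 hs.1)) t ⟨ht, le_rfl⟩
  refine hc.trans ?_
  simp [radiated]

theorem IsHomSolution.eq_zero {κ M₀ : ℝ} (hZ : 0 < Z κ M₀) (h : IsComplexification W w)
    {D : ℝ → ℝ} (hD : IsHomSolution κ M₀ W D) (h0 : D 0 = 0) {t : ℝ} (ht : 0 ≤ t) : D t = 0 := by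
  have h1 := hD.energy h ht
  rw [h0] at h1
  have h2 : 0 ≤ Z κ M₀ * ‖radiated w D t‖ ^ 2 := by positivity
  nlinarith [sq_nonneg (D t)]

theorem IsHomSolution.abs_le {κ M₀ : ℝ} (hZ : 0 < Z κ M₀) (h : IsComplexification W w)
    {D : ℝ → ℝ} (hD : IsHomSolution κ M₀ W D) {t : ℝ} (ht : 0 ≤ t) : |D t| ≤ |D 0| := by
  have h1 := hD.energy h ht
  have h2 : 0 ≤ Z κ M₀ * ‖radiated w D t‖ ^ 2 := by positivity
  exact sq_le_sq.1 (by linarith)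

/-- A solution that returns to its initial value is periodic. -/
theorem IsHomSolution.periodic {κ M₀ : ℝ} (hZ : 0 < Z κ M₀) (h : IsComplexification W w)
    {D : ℝ → ℝ} (hD : IsHomSolution κ M₀ W D) {p : ℝ} (hp : 0 ≤ p) (h0 : D p = D 0) {t : ℝ}
    (ht : 0 ≤ t) : D (t + p) = D t := by
  -- By energy conservation no field is left at time `p`. The history before `p` then drops out of
  -- the memory integral, so the translate of `D` by `p` solves the same equation, and uniqueness
  -- applies.
  have hr : radiated w D p = 0 := by
    have h1 := hD.energy h hp
    rw [h0] at h1
    have h2 : Z κ M₀ * ‖radiated w D p‖ ^ 2 = 0 := by linarith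
    simpa [hZ.ne'] using h2
  have hfc := continuous_f h κ M₀
  have hcD := hD.cont
  have hsol : IsHomSolution κ M₀ W (fun t => D (t + p) - D t) := by
    refine ⟨by fun_prop, fun s hs => ?_⟩
    have h1 : HasDerivWithinAt (fun t => D (t + p))
        (-∫ r in (0 : ℝ)..(s + p), f κ M₀ W (s + p - r) * D r) (Ici 0) s := by
      have h2 := (hD.deriv (s + p) (by linarith)).scomp s (t' := Ici 0)
        (((hasDerivAt_id s).add_const p).hasDerivWithinAt) (fun r (hr : 0 ≤ r) => by
          show (0 : ℝ) ≤ r + p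
          linarith)
      rw [one_smul] at h2
      exact h2
    have h3 : ∫ r in (0 : ℝ)..(s + p), f κ M₀ W (s + p - r) * D r
        = ∫ r in (0 : ℝ)..s, f κ M₀ W (s - r) * D (r + p) := by
      have hi : ∀ a b, IntervalIntegrable (fun r => f κ M₀ W (s + p - r) * D r) volume a b :=
        fun a b => Continuous.intervalIntegrable (by fun_prop) a b
      rw [← intervalIntegral.integral_add_adjacent_intervals (hi 0 p) (hi p (s + p)),
        ← inner_radiated h κ M₀ hD.cont, hr]
      simp only [inner_zero_left, Complex.zero_re, mul_zero, zero_add]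
      have h4 := intervalIntegral.integral_comp_add_right (a := 0) (b := s)
        (fun r => f κ M₀ W (s + p - r) * D r) p
      rw [zero_add] at h4
      rw [← h4]
      simp only [add_sub_add_right_eq_sub]
    have h5 : (-∫ r in (0 : ℝ)..s, f κ M₀ W (s - r) * (D (r + p) - D r))
        = (-∫ r in (0 : ℝ)..(s + p), f κ M₀ W (s + p - r) * D r)
          - (-∫ r in (0 : ℝ)..s, f κ M₀ W (s - r) * D r) := by
      rw [h3, sub_neg_eq_add, neg_add_eq_sub, ← intervalIntegral.integral_sub
        (Continuous.intervalIntegrable (by fun_prop) _ _)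
        (Continuous.intervalIntegrable (by fun_prop) _ _), ← intervalIntegral.integral_neg]
      refine intervalIntegral.integral_congr fun r _ => ?_
      ring
    rw [h5]
    exact h1.sub (hD.deriv s hs)
  have h1 := hsol.eq_zero hZ h (by simp [h0]) ht
  linarith

end Friction

end

noncomputable section

namespace Friction

open LineDeriv

/-! ### The Laplace transform -/

/-- The Laplace transform `∫₀^∞ e^{-zt} g(t) dt`. -/
def lap (g : ℝ → ℂ) (z : ℂ) : ℂ := ∫ t in Ioi (0 : ℝ), Complex.exp (-z * t) * g t

theorem norm_exp_neg_mul (z : ℂ) (t : ℝ) : ‖Complex.exp (-z * t)‖ = Real.exp (-(z.re * t)) := by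
  rw [Complex.norm_exp]; simp

theorem norm_exp_neg_mul_le {z : ℂ} (hz : 0 ≤ z.re) {t : ℝ} (ht : 0 ≤ t) :
    ‖Complex.exp (-z * t)‖ ≤ 1 := by
  rw [norm_exp_neg_mul, Real.exp_le_one_iff]
  have := mul_nonneg hz ht
  linarith

theorem integrableOn_exp_neg_mul {g : ℝ → ℂ} (hg : IntegrableOn g (Ioi 0)) {z : ℂ}
    (hz : 0 ≤ z.re) : IntegrableOn (fun t : ℝ => Complex.exp (-z * t) * g t) (Ioi 0) := by
  refine Integrable.bdd_mul (c := 1) hg (Continuous.aestronglyMeasurable (by fun_prop)) ?_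
  exact (ae_restrict_mem measurableSet_Ioi).mono fun t ht => norm_exp_neg_mul_le hz (le_of_lt ht)

theorem norm_lap_le {g : ℝ → ℂ} (hg : IntegrableOn g (Ioi 0)) {z : ℂ} (hz : 0 ≤ z.re) :
    ‖lap g z‖ ≤ ∫ t in Ioi (0 : ℝ), ‖g t‖ := by
  refine norm_integral_le_of_norm_le hg.norm ?_
  filter_upwards [ae_restrict_mem measurableSet_Ioi] with t ht
  rw [norm_mul]
  exact mul_le_of_le_one_left (norm_nonneg _) (norm_exp_neg_mul_le hz (le_of_lt ht))

theorem continuousOn_lap {g : ℝ → ℂ} (hg : IntegrableOn g (Ioi 0)) :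
    ContinuousOn (lap g) {z : ℂ | 0 ≤ z.re} := by
  refine continuousOn_of_dominated (bound := fun t => ‖g t‖) ?_ ?_ hg.norm ?_
  · exact fun z hz => (integrableOn_exp_neg_mul hg hz).aestronglyMeasurable
  · intro z hz
    filter_upwards [ae_restrict_mem measurableSet_Ioi] with t ht
    rw [norm_mul]
    exact mul_le_of_le_one_left (norm_nonneg _) (norm_exp_neg_mul_le hz (le_of_lt ht))
  · exact Eventually.of_forall fun t => Continuous.continuousOn (by fun_prop)

theorem integral_exp_neg_mul_cexp {z : ℂ} (hz : 0 < z.re) (θ : ℝ) :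
    ∫ t in Ioi (0 : ℝ), Complex.exp (-z * t) * Complex.exp (-(Complex.I * θ) * t)
      = (z + Complex.I * θ)⁻¹ := by
  have h1 : (-(z + Complex.I * θ)).re < 0 := by simpa using hz
  have h2 := integral_exp_mul_complex_Ioi h1 0
  simp only [← Complex.exp_add]
  have h3 : ∀ t : ℝ, -z * t + -(Complex.I * θ) * t = -(z + Complex.I * θ) * t := fun t => by ring
  simp only [h3]
  rw [h2]
  rw [Complex.ofReal_zero, mul_zero, Complex.exp_zero, neg_div_neg_eq, one_div]

theorem add_I_mul_ne_zero {z : ℂ} (hz : 0 < z.re) (θ : ℝ) : z + Complex.I * θ ≠ 0 := by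
  intro h
  have := congrArg Complex.re h
  simp at this
  linarith

theorem integral_exp_neg_mul_cos {z : ℂ} (hz : 0 < z.re) (θ : ℝ) :
    ∫ t in Ioi (0 : ℝ), Complex.exp (-z * t) * ((Real.cos (θ * t) : ℝ) : ℂ)
      = z / (z ^ 2 + θ ^ 2) := by
  have h1 : ∀ t : ℝ, Complex.exp (-z * t) * ((Real.cos (θ * t) : ℝ) : ℂ)
      = 1 / 2 * (Complex.exp (-z * t) * Complex.exp (-(Complex.I * θ) * t))
        + 1 / 2 * (Complex.exp (-z * t) * Complex.exp (-(Complex.I * (-θ : ℝ)) * t)) := by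
    intro t
    push_cast
    rw [Complex.cos]
    have e1 : (θ : ℂ) * t * Complex.I = -(Complex.I * -θ) * t := by ring
    have e2 : -((θ : ℂ) * t) * Complex.I = -(Complex.I * θ) * t := by ring
    rw [e1, e2]
    ring
  have hi : ∀ θ : ℝ, IntegrableOn
      (fun t : ℝ => Complex.exp (-z * t) * Complex.exp (-(Complex.I * θ) * t)) (Ioi 0) := by
    intro θ
    have h2 : (-(z + Complex.I * θ)).re < 0 := by simpa using hz
    refine (integrableOn_exp_mul_complex_Ioi h2 0).congr_fun (fun t _ => ?_) measurableSet_Ioi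
    simp only
    rw [← Complex.exp_add]
    congr 1
    ring
  simp only [h1]
  rw [integral_add ((hi θ).const_mul _) ((hi (-θ)).const_mul _), integral_const_mul,
    integral_const_mul, integral_exp_neg_mul_cexp hz, integral_exp_neg_mul_cexp hz]
  have n1 := add_I_mul_ne_zero hz θ
  have n2 := add_I_mul_ne_zero hz (-θ)
  have n3 : z ^ 2 + (θ : ℂ) ^ 2 = (z + Complex.I * θ) * (z + Complex.I * (-θ : ℝ)) := by
    push_cast
    ring_nf
    rw [Complex.I_sq]
    ring
  rw [n3]
  field_simp
  push_cast
  ring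

/-! ### Spectral representation of the memory kernel -/

theorem antilipschitz_line : AntilipschitzWith 1
    (ContinuousLinearMap.toSpanSingleton ℝ (e 0)) :=
  AntilipschitzWith.of_le_mul_dist fun x y => by
    rw [dist_eq_norm, dist_eq_norm, ← map_sub, ContinuousLinearMap.toSpanSingleton_apply, norm_smul]
    simp

/-- The spectral density along a line. -/
def lineDens (w : 𝓢(R3, ℂ)) : 𝓢(ℝ, ℂ) :=
  SchwartzMap.compCLMOfAntilipschitz ℂ
    (ContinuousLinearMap.toSpanSingleton ℝ (e 0)).hasTemperateGrowth antilipschitz_line (dens w)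

theorem lineDens_apply (w : 𝓢(R3, ℂ)) (ρ : ℝ) : lineDens w ρ = dens w (ρ • e 0) := rfl

variable {W : R3 → ℝ} {w : 𝓢(R3, ℂ)}

theorem lineDens_eq (h : IsComplexification W w) (ρ : ℝ) :
    lineDens w ρ = ((‖𝓕 w (ρ • e 0)‖ ^ 2 : ℝ) : ℂ) := by
  rw [lineDens_apply, h.dens_eq]

theorem norm_smul_e (ρ : ℝ) : ‖ρ • e 0‖ = |ρ| := by
  rw [norm_smul]; simp

theorem lineDens_neg (h : IsComplexification W w) (ρ : ℝ) : lineDens w (-ρ) = lineDens w ρ := by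
  rw [lineDens_eq h, lineDens_eq h, h.fourier_radial (η := ρ • e 0)]
  rw [norm_smul_e, norm_smul_e, abs_neg]

/-- Here `∫ W ≠ 0` enters: it is the value of the Fourier transform at zero frequency. -/
theorem lineDens_zero_ne (h : IsComplexification W w) : lineDens w 0 ≠ 0 := by
  rw [lineDens_eq h, zero_smul]
  have h1 : 𝓕 w 0 = ((∫ x, W x : ℝ) : ℂ) := by
    rw [SchwartzMap.fourier_coe, Real.fourier_eq, ← integral_complex_ofReal]
    refine integral_congr_ae (Eventually.of_forall fun x => ?_)
    simp [h.eq]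
  have h2 := h.adm.integral_ne_zero
  rw [h1, Complex.norm_real]
  simpa using h2

theorem f_spectral (h : IsComplexification W w) (κ M₀ t : ℝ) :
    f κ M₀ W t = Z κ M₀ * ∫ ξ : R3, Real.cos (2 * Real.pi ^ 2 * ‖ξ‖ ^ 2 * t) * ‖𝓕 w ξ‖ ^ 2 := by
  rw [f, specPair, h.hat_eq]
  congr 1
  have h1 : ∀ ξ : R3, (starRingEnd ℂ) (𝓕 w ξ) * schr t ((2 * Real.pi * ‖ξ‖) ^ 2) * 𝓕 w ξ
      = sym t ξ * dens w ξ := by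
    intro ξ
    rw [h.conj_fourier, sym_eq_schr, dens_apply]
    ring
  have h2 : Integrable fun ξ => sym t ξ * dens w ξ :=
    (dens w).integrable.bdd_mul (continuous_sym t).aestronglyMeasurable
      (Eventually.of_forall fun ξ => (norm_sym t ξ).le)
  simp only [h1]
  have h3 := Complex.reCLM.integral_comp_comm h2
  rw [Complex.reCLM_apply] at h3
  rw [← h3]
  refine integral_congr_ae (Eventually.of_forall fun ξ => ?_)
  simp only [Complex.reCLM_apply]
  rw [h.dens_eq, Complex.re_mul_ofReal, sym_eq]
  congr 1
  rw [mul_comm Complex.I, Complex.exp_ofReal_mul_I_re, ← Real.cos_neg]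
  congr 1
  ring

theorem exists_f_polar (h : IsComplexification W w) {κ M₀ : ℝ} (hZ : 0 < Z κ M₀) :
    ∃ c : ℝ, 0 < c ∧ ∀ t, (f κ M₀ W t : ℂ)
      = c * ∫ ρ : ℝ, ((Real.cos (2 * Real.pi ^ 2 * ρ ^ 2 * t) : ℝ) : ℂ) * (ρ ^ 2 * lineDens w ρ) := by
  let v : ℝ := (volume : Measure R3).real (Metric.ball 0 1)
  have hv : 0 < v := ENNReal.toReal_pos (Metric.measure_ball_pos _ _ one_pos).ne'
    measure_ball_lt_top.ne
  -- Polar coordinates: `3v` is the area of the unit sphere, and the factor `1/2` comes from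
  -- extending the even radial integrand to the whole line.
  refine ⟨Z κ M₀ * (3 / 2 * v), by positivity, fun t => ?_⟩
  let g : ℝ → ℝ := fun ρ => Real.cos (2 * Real.pi ^ 2 * ρ ^ 2 * t) * ‖𝓕 w (ρ • e 0)‖ ^ 2
  have h1 : f κ M₀ W t = Z κ M₀ * ∫ ξ : R3, g ‖ξ‖ := by
    rw [f_spectral h]
    congr 1
    refine integral_congr_ae (Eventually.of_forall fun ξ => ?_)
    simp only [g]
    rw [h.fourier_radial (ξ := ‖ξ‖ • e 0) (η := ξ)]
    rw [norm_smul_e, abs_norm]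
  have h2 := integral_fun_norm_addHaar (volume : Measure R3) g
  have h3 := integral_comp_abs (f := fun ρ => ρ ^ 2 * g ρ)
  have h4 : ∀ ρ, |ρ| ^ 2 * g |ρ| = ρ ^ 2 * g ρ := by
    intro ρ
    simp only [g, sq_abs]
    rw [h.fourier_radial (ξ := |ρ| • e 0) (η := ρ • e 0)]
    rw [norm_smul_e, norm_smul_e, abs_abs]
  simp only [h4] at h3
  have h5 : ∫ ρ : ℝ, ((Real.cos (2 * Real.pi ^ 2 * ρ ^ 2 * t) : ℝ) : ℂ) * (ρ ^ 2 * lineDens w ρ)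
      = ((∫ ρ, ρ ^ 2 * g ρ : ℝ) : ℂ) := by
    rw [← integral_complex_ofReal]
    refine integral_congr_ae (Eventually.of_forall fun ρ => ?_)
    simp only [g]
    rw [lineDens_eq h]
    push_cast
    ring
  rw [h5, h1, h2, h3]
  simp only [finrank_euclideanSpace_fin, smul_eq_mul, nsmul_eq_mul]
  push_cast
  simp only [v]
  norm_num
  ring

theorem integrable_sq_mul_lineDens (w : 𝓢(R3, ℂ)) :
    Integrable fun ρ : ℝ => (ρ : ℂ) ^ 2 * lineDens w ρ := by
  have h1 := (lineDens w).integrable_pow_mul (μ := volume) 2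
  refine h1.mono' (Continuous.aestronglyMeasurable ?_) (Eventually.of_forall fun ρ => ?_)
  · have := (lineDens w).continuous
    fun_prop
  · simp

theorem lap_f_spectral {κ M₀ c : ℝ} (hc : ∀ t, (f κ M₀ W t : ℂ)
      = c * ∫ ρ : ℝ, ((Real.cos (2 * Real.pi ^ 2 * ρ ^ 2 * t) : ℝ) : ℂ) * (ρ ^ 2 * lineDens w ρ))
    {z : ℂ} (hz : 0 < z.re) :
    lap (fun t => (f κ M₀ W t : ℂ)) z
      = c * ∫ ρ : ℝ, z / (z ^ 2 + ((2 * Real.pi ^ 2 * ρ ^ 2 : ℝ) : ℂ) ^ 2) * (ρ ^ 2 * lineDens w ρ) := by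
  have hz' : (-z).re < 0 := by simpa using hz
  have hF : Integrable (Function.uncurry fun (t ρ : ℝ) => Complex.exp (-z * t) *
      (((Real.cos (2 * Real.pi ^ 2 * ρ ^ 2 * t) : ℝ) : ℂ) * (ρ ^ 2 * lineDens w ρ)))
      ((volume.restrict (Ioi 0)).prod volume) := by
    have h1 : Integrable (fun p : ℝ × ℝ => Complex.exp (-z * p.1) * ((p.2 : ℂ) ^ 2 * lineDens w p.2))
        ((volume.restrict (Ioi 0)).prod volume) :=
      Integrable.mul_prod (integrableOn_exp_mul_complex_Ioi hz' 0) (integrable_sq_mul_lineDens w)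
    refine h1.mono (Continuous.aestronglyMeasurable ?_) (Eventually.of_forall fun p => ?_)
    · have := (lineDens w).continuous
      fun_prop
    · simp only [Function.uncurry, norm_mul]
      refine mul_le_mul_of_nonneg_left ?_ (norm_nonneg _)
      refine mul_le_of_le_one_left (by positivity) ?_
      rw [Complex.norm_real]
      exact Real.abs_cos_le_one _
  unfold lap
  have h2 : ∀ t : ℝ, Complex.exp (-z * t) * (f κ M₀ W t : ℂ) = c * ∫ ρ : ℝ, Complex.exp (-z * t) *
      (((Real.cos (2 * Real.pi ^ 2 * ρ ^ 2 * t) : ℝ) : ℂ) * (ρ ^ 2 * lineDens w ρ)) := by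
    intro t
    rw [hc, integral_const_mul]
    ring
  simp only [h2]
  rw [integral_const_mul, integral_integral_swap hF]
  congr 1
  refine integral_congr_ae (Eventually.of_forall fun ρ => ?_)
  simp only [← mul_assoc]
  rw [integral_mul_const, integral_mul_const, integral_exp_neg_mul_cos hz]

/-- The Fourier transform of the spectral density along a line. -/
def lineCorr (w : 𝓢(R3, ℂ)) : 𝓢(ℝ, ℂ) := 𝓕 (lineDens w)

/-- Fubini gives the integral of `(p + 2πiρ)⁻¹` against the density. The density is even, so this
may be averaged with `ρ ↦ -ρ`, which gives the stated quotient. -/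
theorem lap_lineCorr (h : IsComplexification W w) {p : ℂ} (hp : 0 < p.re) :
    lap (lineCorr w) p = ∫ ρ : ℝ, p / (p ^ 2 + ((2 * Real.pi * ρ : ℝ) : ℂ) ^ 2) * lineDens w ρ := by
  have hp' : (-p).re < 0 := by simpa using hp
  have hF : Integrable (Function.uncurry fun (t ρ : ℝ) => Complex.exp (-p * t) *
      (Complex.exp (-(Complex.I * ((2 * Real.pi * ρ : ℝ) : ℂ)) * t) * lineDens w ρ))
      ((volume.restrict (Ioi 0)).prod volume) := by
    have h1 : Integrable (fun q : ℝ × ℝ => Complex.exp (-p * q.1) * lineDens w q.2)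
        ((volume.restrict (Ioi 0)).prod volume) :=
      Integrable.mul_prod (integrableOn_exp_mul_complex_Ioi hp' 0) (lineDens w).integrable
    refine h1.mono (Continuous.aestronglyMeasurable ?_) (Eventually.of_forall fun q => ?_)
    · have := (lineDens w).continuous
      fun_prop
    · simp only [Function.uncurry, norm_mul]
      refine mul_le_mul_of_nonneg_left ?_ (norm_nonneg _)
      refine mul_le_of_le_one_left (by positivity) ?_
      rw [Complex.norm_exp]
      simp
  have h2 : ∀ t : ℝ, Complex.exp (-p * t) * lineCorr w t = ∫ ρ : ℝ, Complex.exp (-p * t) *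
      (Complex.exp (-(Complex.I * ((2 * Real.pi * ρ : ℝ) : ℂ)) * t) * lineDens w ρ) := by
    intro t
    rw [integral_const_mul, lineCorr, SchwartzMap.fourier_coe, Real.fourier_eq']
    congr 1
    refine integral_congr_ae (Eventually.of_forall fun ρ => ?_)
    simp only [smul_eq_mul]
    congr 2
    simp
    ring
  have h3 : lap (lineCorr w) p = ∫ ρ : ℝ, (p + Complex.I * ((2 * Real.pi * ρ : ℝ) : ℂ))⁻¹
      * lineDens w ρ := by
    unfold lap
    simp only [h2]
    rw [integral_integral_swap hF]
    refine integral_congr_ae (Eventually.of_forall fun ρ => ?_)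
    simp only [← mul_assoc]
    rw [integral_mul_const, integral_exp_neg_mul_cexp hp]
  have hb : ∀ θ : ℝ, ‖(p + Complex.I * θ)⁻¹‖ ≤ p.re⁻¹ := by
    intro θ
    rw [norm_inv]
    refine inv_anti₀ hp ?_
    have := Complex.abs_re_le_norm (p + Complex.I * θ)
    simp at this
    exact (le_abs_self _).trans this
  have hi : ∀ s : ℝ, Integrable fun ρ : ℝ => (p + Complex.I * ((2 * Real.pi * (s * ρ) : ℝ) : ℂ))⁻¹
      * lineDens w ρ := by
    intro s
    refine (lineDens w).integrable.bdd_mul (c := p.re⁻¹) (Continuous.aestronglyMeasurable ?_)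
      (Eventually.of_forall fun ρ => hb _)
    exact Continuous.inv₀ (by fun_prop) fun ρ => add_I_mul_ne_zero hp _
  have h4 : lap (lineCorr w) p
      = ∫ ρ : ℝ, (p + Complex.I * ((2 * Real.pi * (-1 * ρ) : ℝ) : ℂ))⁻¹ * lineDens w ρ := by
    rw [h3, ← integral_neg_eq_self]
    refine integral_congr_ae (Eventually.of_forall fun ρ => ?_)
    simp only
    rw [lineDens_neg h, neg_one_mul]
  have h5 : lap (lineCorr w) p + lap (lineCorr w) p = 2 * ∫ ρ : ℝ,
      p / (p ^ 2 + ((2 * Real.pi * ρ : ℝ) : ℂ) ^ 2) * lineDens w ρ := by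
    nth_rw 2 [h4]
    have h6 := hi 1
    simp only [one_mul] at h6
    rw [h3, ← integral_add h6 (hi (-1)), ← integral_const_mul]
    refine integral_congr_ae (Eventually.of_forall fun ρ => ?_)
    have n1 := add_I_mul_ne_zero hp (2 * Real.pi * ρ)
    have n2 := add_I_mul_ne_zero hp (2 * Real.pi * (-1 * ρ))
    have n3 : p ^ 2 + ((2 * Real.pi * ρ : ℝ) : ℂ) ^ 2 = (p + Complex.I * ((2 * Real.pi * ρ : ℝ) : ℂ))
        * (p + Complex.I * ((2 * Real.pi * (-1 * ρ) : ℝ) : ℂ)) := by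
      push_cast
      ring_nf
      rw [Complex.I_sq]
      ring
    simp only
    have n4 : ∀ {a b q g : ℂ}, a ≠ 0 → b ≠ 0 → 2 * q = a + b →
        a⁻¹ * g + b⁻¹ * g = 2 * (q / (a * b) * g) := by
      intro a b q g ha hb hq
      field_simp
      linear_combination -g * hq
    rw [n3]
    refine n4 n1 n2 ?_
    push_cast
    ring
  linear_combination h5 / 2

/-! ### The memory kernel near the threshold -/

/-- The function `A` with `∫₀^∞ e^{-z²t} f(t) dt = c z A(z)`. -/
def thresh (w : 𝓢(R3, ℂ)) (z : ℂ) : ℂ :=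
  1 / 2 * ((1 + Complex.I) * lap (lineCorr w) ((1 - Complex.I) * z)
    + (1 - Complex.I) * lap (lineCorr w) ((1 + Complex.I) * z))

theorem re_one_sub_I_mul (z : ℂ) : ((1 - Complex.I) * z).re = z.re + z.im := by simp
theorem re_one_add_I_mul (z : ℂ) : ((1 + Complex.I) * z).re = z.re - z.im := by simp

/-- Partial fractions in `ρ²`: the denominator `z⁴ + 4π⁴ρ⁴` splits into `z² ± 2π²iρ²`, proportional
to `p² + 4π²ρ²` with `p = (1 ∓ i)z`. The quadratic dispersion thus becomes two Laplace transforms of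
a Schwartz function, and the square root singularity at the threshold `λ = 0` is isolated in the
factor `z`. -/
theorem exists_lap_f_eq (h : IsComplexification W w) {κ M₀ : ℝ} (hZ : 0 < Z κ M₀) :
    ∃ c : ℝ, 0 < c ∧ ∀ z : ℂ, |z.im| < z.re →
      lap (fun t => (f κ M₀ W t : ℂ)) (z ^ 2) = c * z * thresh w z := by
  obtain ⟨c, hc, hf⟩ := exists_f_polar h hZ
  refine ⟨c / (2 * Real.pi ^ 2), by positivity, fun z hz => ?_⟩
  have him := abs_lt.1 hz
  have hre : 0 < z.re := (abs_nonneg _).trans_lt hz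
  have hz2 : 0 < (z ^ 2).re := by
    rw [sq, Complex.mul_re]
    nlinarith [him.1, him.2]
  have hp1 : 0 < ((1 - Complex.I) * z).re := by rw [re_one_sub_I_mul]; linarith
  have hp2 : 0 < ((1 + Complex.I) * z).re := by rw [re_one_add_I_mul]; linarith
  have hb : ∀ p : ℂ, 0 < p.re → Integrable fun ρ : ℝ =>
      p / (p ^ 2 + ((2 * Real.pi * ρ : ℝ) : ℂ) ^ 2) * lineDens w ρ := by
    intro p hp
    have hb' : ∀ θ : ℝ, ‖p / (p ^ 2 + (θ : ℂ) ^ 2)‖ ≤ ‖p‖ * (p.re⁻¹ * p.re⁻¹) := by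
      intro θ
      have n3 : p ^ 2 + (θ : ℂ) ^ 2 = (p + Complex.I * θ) * (p + Complex.I * (-θ : ℝ)) := by
        push_cast
        ring_nf
        rw [Complex.I_sq]
        ring
      have hn : ∀ θ : ℝ, p.re ≤ ‖p + Complex.I * θ‖ := by
        intro θ
        have := Complex.abs_re_le_norm (p + Complex.I * θ)
        simp at this
        exact (le_abs_self _).trans this
      rw [norm_div, n3, norm_mul, div_eq_mul_inv, mul_inv]
      have i1 := inv_anti₀ hp (hn θ)
      have i2 := inv_anti₀ hp (hn (-θ))
      gcongr
    refine (lineDens w).integrable.bdd_mul (Continuous.aestronglyMeasurable ?_)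
      (Eventually.of_forall fun ρ => hb' _)
    refine Continuous.div (by fun_prop) (by fun_prop) fun ρ => ?_
    have n3 : p ^ 2 + ((2 * Real.pi * ρ : ℝ) : ℂ) ^ 2
        = (p + Complex.I * ((2 * Real.pi * ρ : ℝ) : ℂ))
        * (p + Complex.I * ((-(2 * Real.pi * ρ) : ℝ) : ℂ)) := by
      push_cast
      ring_nf
      rw [Complex.I_sq]
      ring
    rw [n3]
    exact mul_ne_zero (add_I_mul_ne_zero hp _) (add_I_mul_ne_zero hp _)
  rw [lap_f_spectral hf hz2, thresh, lap_lineCorr h hp1, lap_lineCorr h hp2,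
    ← integral_const_mul (1 + Complex.I), ← integral_const_mul (1 - Complex.I),
    ← integral_add ((hb _ hp1).const_mul _) ((hb _ hp2).const_mul _),
    ← integral_const_mul (1 / 2 : ℂ), ← integral_const_mul, ← integral_const_mul]
  refine integral_congr_ae (Eventually.of_forall fun ρ => ?_)
  have hpi : (Real.pi : ℂ) ≠ 0 := by exact_mod_cast Real.pi_ne_zero
  have n1 : z ^ 2 + Complex.I * ((2 * Real.pi ^ 2 * ρ ^ 2 : ℝ) : ℂ) ≠ 0 := add_I_mul_ne_zero hz2 _
  have n2 : z ^ 2 + Complex.I * ((-(2 * Real.pi ^ 2 * ρ ^ 2) : ℝ) : ℂ) ≠ 0 :=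
    add_I_mul_ne_zero hz2 _
  have q1 : ((1 - Complex.I) * z) ^ 2 + ((2 * Real.pi * ρ : ℝ) : ℂ) ^ 2
      = -(2 * Complex.I) * (z ^ 2 + Complex.I * ((2 * Real.pi ^ 2 * ρ ^ 2 : ℝ) : ℂ)) := by
    push_cast
    ring_nf
    rw [Complex.I_sq]
    ring
  have q2 : ((1 + Complex.I) * z) ^ 2 + ((2 * Real.pi * ρ : ℝ) : ℂ) ^ 2
      = (2 * Complex.I) * (z ^ 2 + Complex.I * ((-(2 * Real.pi ^ 2 * ρ ^ 2) : ℝ) : ℂ)) := by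
    push_cast
    ring_nf
    rw [Complex.I_sq]
    ring
  have q3 : (z ^ 2) ^ 2 + ((2 * Real.pi ^ 2 * ρ ^ 2 : ℝ) : ℂ) ^ 2
      = (z ^ 2 + Complex.I * ((2 * Real.pi ^ 2 * ρ ^ 2 : ℝ) : ℂ))
        * (z ^ 2 + Complex.I * ((-(2 * Real.pi ^ 2 * ρ ^ 2) : ℝ) : ℂ)) := by
    push_cast
    ring_nf
    rw [Complex.I_sq]
    ring
  simp only
  have q4 : (ρ : ℂ) ^ 2 = ((z ^ 2 + Complex.I * ((2 * Real.pi ^ 2 * ρ ^ 2 : ℝ) : ℂ))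
      - (z ^ 2 + Complex.I * ((-(2 * Real.pi ^ 2 * ρ ^ 2) : ℝ) : ℂ)))
        / (4 * Real.pi ^ 2 * Complex.I) := by
    have hI := Complex.I_ne_zero
    push_cast
    field_simp
    ring
  rw [q1, q2, q3, q4]
  push_cast
  push_cast at n1 n2
  generalize z ^ 2 + Complex.I * (2 * (Real.pi : ℂ) ^ 2 * (ρ : ℂ) ^ 2) = a at n1 ⊢
  generalize z ^ 2 + Complex.I * -(2 * (Real.pi : ℂ) ^ 2 * (ρ : ℂ) ^ 2) = b at n2 ⊢
  have hI := Complex.I_ne_zero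
  have hII : (1 + Complex.I) * (1 - Complex.I) = 2 := by
    ring_nf
    rw [Complex.I_sq]
    ring
  field_simp
  linear_combination (4 * c * z ^ 2 * lineDens w ρ * (b - a)) * hII

end Friction

end

noncomputable section

namespace Friction

open LineDeriv

variable {W : R3 → ℝ} {w : 𝓢(R3, ℂ)}

/-! ### The threshold function -/

/-- The closed sector `|arg z| ≤ π / 4`. -/
def sector : Set ℂ := {z | |z.im| ≤ z.re}

theorem integrableOn_lineCorr (w : 𝓢(R3, ℂ)) : IntegrableOn (lineCorr w) (Ioi 0) :=
  (lineCorr w).integrable.integrableOn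

theorem re_one_sub_I_mul_nonneg {z : ℂ} (hz : z ∈ sector) : 0 ≤ ((1 - Complex.I) * z).re := by
  rw [re_one_sub_I_mul]
  have := (abs_le.1 (show |z.im| ≤ z.re from hz)).1
  linarith

theorem re_one_add_I_mul_nonneg {z : ℂ} (hz : z ∈ sector) : 0 ≤ ((1 + Complex.I) * z).re := by
  rw [re_one_add_I_mul]
  have := (abs_le.1 (show |z.im| ≤ z.re from hz)).2
  linarith

theorem continuousOn_thresh (w : 𝓢(R3, ℂ)) : ContinuousOn (thresh w) sector := by
  have h := continuousOn_lap (integrableOn_lineCorr w)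
  have h1 : ContinuousOn (fun z => lap (lineCorr w) ((1 - Complex.I) * z)) sector :=
    h.comp (by fun_prop) fun z hz => re_one_sub_I_mul_nonneg hz
  have h2 : ContinuousOn (fun z => lap (lineCorr w) ((1 + Complex.I) * z)) sector :=
    h.comp (by fun_prop) fun z hz => re_one_add_I_mul_nonneg hz
  exact continuousOn_const.mul ((continuousOn_const.mul h1).add (continuousOn_const.mul h2))

theorem norm_half_combination_le {a b : ℂ} {B : ℝ} (ha : ‖a‖ ≤ B) (hb : ‖b‖ ≤ B) :
    ‖1 / 2 * ((1 + Complex.I) * a + (1 - Complex.I) * b)‖ ≤ 2 * B := by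
  have h1 : ‖1 + Complex.I‖ ≤ 2 := (norm_add_le _ _).trans (by simp; norm_num)
  have h2 : ‖1 - Complex.I‖ ≤ 2 := (norm_sub_le _ _).trans (by simp; norm_num)
  have h3 : ‖(1 / 2 : ℂ)‖ = 1 / 2 := by simp
  rw [norm_mul, h3]
  have h4 : ‖(1 + Complex.I) * a + (1 - Complex.I) * b‖ ≤ 2 * B + 2 * B := by
    refine (norm_add_le _ _).trans (add_le_add ?_ ?_) <;> rw [norm_mul] <;> gcongr
  linarith

theorem exists_norm_thresh_le (w : 𝓢(R3, ℂ)) : ∃ B, 0 ≤ B ∧ ∀ z ∈ sector, ‖thresh w z‖ ≤ B :=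
  ⟨2 * ∫ t in Ioi (0 : ℝ), ‖lineCorr w t‖, by positivity, fun _ hz => norm_half_combination_le
    (norm_lap_le (integrableOn_lineCorr w) (re_one_sub_I_mul_nonneg hz))
    (norm_lap_le (integrableOn_lineCorr w) (re_one_add_I_mul_nonneg hz))⟩

/-- At the origin `thresh` is the half-line integral of the correlation function, that is half of
its full integral by evenness. Fourier inversion identifies the full integral with the spectral
density at zero frequency. -/
theorem thresh_zero_ne (h : IsComplexification W w) : thresh w 0 ≠ 0 := by
  have h1 : thresh w 0 = lap (lineCorr w) 0 := by
    unfold thresh; rw [mul_zero, mul_zero]; ring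
  have heven : ∀ x, lineCorr w (-x) = lineCorr w x := by
    intro x
    unfold lineCorr
    rw [SchwartzMap.fourier_coe, Real.fourier_eq', Real.fourier_eq', ← integral_neg_eq_self]
    refine integral_congr_ae (Eventually.of_forall fun ρ => ?_)
    simp only [lineDens_neg h]
    simp
  have h2 : ∫ x, lineCorr w x = lineDens w 0 := by
    have h3 : (𝓕⁻ (𝓕 (lineDens w) : 𝓢(ℝ, ℂ)) : 𝓢(ℝ, ℂ)) = lineDens w :=
      FourierTransform.fourierInv_fourier_eq _
    rw [← h3, SchwartzMap.fourierInv_coe, Real.fourierInv_eq']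
    refine integral_congr_ae (Eventually.of_forall fun ρ => ?_)
    simp [lineCorr]
  have h4 : ∫ x, lineCorr w x = 2 * lap (lineCorr w) 0 := by
    have h5 : lap (lineCorr w) 0 = ∫ x in Ioi (0 : ℝ), lineCorr w x := by simp [lap]
    have h6 := integral_comp_neg_Iic (0 : ℝ) (lineCorr w)
    simp only [heven, neg_zero] at h6
    rw [h5, ← intervalIntegral.integral_Iic_add_Ioi (b := 0)
      (lineCorr w).integrable.integrableOn (lineCorr w).integrable.integrableOn, h6]
    ring
  rw [h1]
  intro h7
  rw [h7, mul_zero, h2] at h4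
  exact lineDens_zero_ne h h4

/-! ### The Laplace transform of the memory kernel -/

theorem integrableOn_one_add_rpow :
    IntegrableOn (fun t : ℝ => (1 + t) ^ (-(3 / 2) : ℝ)) (Ioi 0) := by
  have := integrableOn_add_rpow_Ioi_of_lt (a := -(3 / 2)) (c := 0) (m := 1) (by norm_num)
    (by norm_num)
  simpa only [add_comm] using this

theorem integrableOn_of_abs_le {g : ℝ → ℝ} (hg : Continuous g) {C : ℝ}
    (hb : ∀ t, 0 ≤ t → |g t| ≤ C * (1 + t) ^ (-(3 / 2) : ℝ)) :
    IntegrableOn (fun t => (g t : ℂ)) (Ioi 0) := by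
  refine Integrable.mono' (integrableOn_one_add_rpow.const_mul C)
    (Continuous.aestronglyMeasurable (by fun_prop)) ?_
  filter_upwards [ae_restrict_mem measurableSet_Ioi] with t ht
  rw [Complex.norm_real]
  exact hb t (le_of_lt ht)

theorem integrableOn_f (h : IsComplexification W w) (κ M₀ : ℝ) :
    IntegrableOn (fun t => (f κ M₀ W t : ℂ)) (Ioi 0) := by
  obtain ⟨C, -, hb⟩ := exists_abs_f_le h κ M₀
  exact integrableOn_of_abs_le (continuous_f h κ M₀) fun t ht => (hb t ht).1

theorem integrableOn_f' (h : IsComplexification W w) (κ M₀ : ℝ) :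
    IntegrableOn (fun t => (f' κ M₀ w t : ℂ)) (Ioi 0) := by
  obtain ⟨C, -, hb⟩ := exists_abs_f_le h κ M₀
  exact integrableOn_of_abs_le (continuous_f' κ M₀ w) fun t ht => (hb t ht).2

theorem hasDerivAt_exp_neg_mul (z : ℂ) (t : ℝ) :
    HasDerivAt (fun t : ℝ => Complex.exp (-z * t)) (Complex.exp (-z * t) * -z) t := by
  have := ((Complex.ofRealCLM.hasDerivAt (x := t)).const_mul (-z)).cexp
  simpa using this

theorem mul_lap_eq {g g' : ℝ → ℝ} {z : ℂ} (hg : ∀ t, 0 ≤ t → HasDerivWithinAt g (g' t) (Ici 0) t)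
    (h1 : IntegrableOn (fun t : ℝ => Complex.exp (-z * t) * (g t : ℂ)) (Ioi 0))
    (h2 : IntegrableOn (fun t : ℝ => Complex.exp (-z * t) * (g' t : ℂ)) (Ioi 0))
    (h3 : Tendsto (fun t : ℝ => Complex.exp (-z * t) * (g t : ℂ)) atTop (𝓝 0)) :
    z * lap (fun t => (g t : ℂ)) z = g 0 + lap (fun t => (g' t : ℂ)) z := by
  have hder : ∀ t ∈ Ioi (0 : ℝ), HasDerivAt (fun t : ℝ => Complex.exp (-z * t) * (g t : ℂ))
      (Complex.exp (-z * t) * -z * (g t : ℂ) + Complex.exp (-z * t) * (g' t : ℂ)) t := by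
    intro t ht
    exact (hasDerivAt_exp_neg_mul z t).mul ((hg t (le_of_lt ht)).hasDerivAt (Ici_mem_nhds ht)).ofReal_comp
  have hcont : ContinuousWithinAt (fun t : ℝ => Complex.exp (-z * t) * (g t : ℂ)) (Ici 0) 0 := by
    refine ContinuousWithinAt.mul (Continuous.continuousWithinAt (by fun_prop)) ?_
    exact Complex.continuous_ofReal.continuousAt.comp_continuousWithinAt
      (hg 0 le_rfl).continuousWithinAt
  have h4 : IntegrableOn (fun t : ℝ => Complex.exp (-z * t) * -z * (g t : ℂ)) (Ioi 0) := by
    refine Integrable.congr (h1.const_mul (-z)) (Eventually.of_forall fun t => ?_)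
    ring
  have h5 := integral_Ioi_of_hasDerivAt_of_tendsto hcont hder (h4.add h2) h3
  rw [integral_add h4 h2] at h5
  have h6 : ∫ t in Ioi (0 : ℝ), Complex.exp (-z * t) * -z * (g t : ℂ)
      = -z * lap (fun t => (g t : ℂ)) z := by
    unfold lap
    rw [← integral_const_mul]
    refine integral_congr_ae (Eventually.of_forall fun t => ?_)
    ring
  rw [h6] at h5
  simp only [Complex.ofReal_zero, mul_zero, Complex.exp_zero, one_mul, zero_sub] at h5
  have h7 : lap (fun t => (g' t : ℂ)) z = ∫ t in Ioi (0 : ℝ), Complex.exp (-z * t) * (g' t : ℂ) := rfl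
  rw [← h7] at h5
  linear_combination -h5

theorem tendsto_one_add_rpow : Tendsto (fun t : ℝ => (1 + t) ^ (-(3 / 2) : ℝ)) atTop (𝓝 0) := by
  have h1 : Tendsto (fun t : ℝ => 1 + t) atTop atTop := tendsto_atTop_add_const_left _ _ tendsto_id
  exact (tendsto_rpow_neg_atTop (y := 3 / 2) (by norm_num)).comp h1

/-- One integration by parts, as `f` and its derivative are integrable. The resulting decay at high
frequency later makes the boundary values of `resHat` integrable. -/
theorem exists_norm_mul_lap_f_le (h : IsComplexification W w) (κ M₀ : ℝ) :
    ∃ C, 0 ≤ C ∧ ∀ z : ℂ, 0 ≤ z.re → ‖z‖ * ‖lap (fun t => (f κ M₀ W t : ℂ)) z‖ ≤ C := by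
  obtain ⟨C, -, hb⟩ := exists_abs_f_le h κ M₀
  refine ⟨‖(f κ M₀ W 0 : ℂ)‖ + ∫ t in Ioi (0 : ℝ), ‖(f' κ M₀ w t : ℂ)‖, by positivity,
    fun z hz => ?_⟩
  rw [← norm_mul, mul_lap_eq (fun t _ => (hasDerivAt_f h κ M₀ t).hasDerivWithinAt)
    (integrableOn_exp_neg_mul (integrableOn_f h κ M₀) hz)
    (integrableOn_exp_neg_mul (integrableOn_f' h κ M₀) hz)]
  · exact (norm_add_le _ _).trans (add_le_add_right (norm_lap_le (integrableOn_f' h κ M₀) hz) _)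
  · have h1 := tendsto_one_add_rpow.const_mul C
    rw [mul_zero] at h1
    refine squeeze_zero_norm' ?_ h1
    filter_upwards [eventually_ge_atTop 0] with t ht
    rw [norm_mul, Complex.norm_real]
    calc _ ≤ 1 * |f κ M₀ W t| := by gcongr; exacts [norm_exp_neg_mul_le hz ht, le_rfl]
      _ ≤ _ := by rw [one_mul]; exact (hb t ht).1

/-- Both sides are continuous on the closed sector, and `z + s` with `s > 0` lies in the open
sector; let `s` tend to zero. -/
theorem lap_f_eq_of_mem_sector (h : IsComplexification W w) {κ M₀ c : ℝ}
    (hc : ∀ z : ℂ, |z.im| < z.re →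
      lap (fun t => (f κ M₀ W t : ℂ)) (z ^ 2) = c * z * thresh w z) {z : ℂ} (hz : z ∈ sector) :
    lap (fun t => (f κ M₀ W t : ℂ)) (z ^ 2) = c * z * thresh w z := by
  have hz' : |z.im| ≤ z.re := hz
  have hsec : ∀ s : ℝ, 0 ≤ s → z + s ∈ sector := by
    intro s hs
    show |(z + s).im| ≤ (z + s).re
    simp
    linarith
  have hsq : ∀ y ∈ sector, 0 ≤ (y ^ 2).re := by
    intro y hy
    have h1 := abs_le.1 (show |y.im| ≤ y.re from hy)
    rw [sq, Complex.mul_re]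
    nlinarith [h1.1, h1.2]
  have hline : ContinuousWithinAt (fun s : ℝ => z + s) (Ici 0) 0 :=
    Continuous.continuousWithinAt (by fun_prop)
  have hcl : ContinuousOn (fun y => lap (fun t => (f κ M₀ W t : ℂ)) (y ^ 2)) sector :=
    (continuousOn_lap (integrableOn_f h κ M₀)).comp (by fun_prop) hsq
  have hcr : ContinuousOn (fun y => c * y * thresh w y) sector :=
    (Continuous.continuousOn (by fun_prop)).mul (continuousOn_thresh w)
  have h0 : z + ((0 : ℝ) : ℂ) = z := by simp
  have hl : ContinuousWithinAt (fun s : ℝ => lap (fun t => (f κ M₀ W t : ℂ)) ((z + s) ^ 2))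
      (Ici 0) 0 :=
    ContinuousWithinAt.comp (g := fun y => lap (fun t => (f κ M₀ W t : ℂ)) (y ^ 2)) (t := sector)
      (x := (0 : ℝ)) (by rw [h0]; exact hcl z hz) hline fun s hs => hsec s hs
  have hr : ContinuousWithinAt (fun s : ℝ => c * (z + s) * thresh w (z + s)) (Ici 0) 0 :=
    ContinuousWithinAt.comp (g := fun y => c * y * thresh w y) (t := sector) (x := (0 : ℝ))
      (by rw [h0]; exact hcr z hz) hline fun s hs => hsec s hs
  have hl' := hl.mono_left (nhdsWithin_mono 0 Ioi_subset_Ici_self)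
  have hr' := hr.mono_left (nhdsWithin_mono 0 Ioi_subset_Ici_self)
  simp only [h0] at hl' hr'
  refine tendsto_nhds_unique hl' (hr'.congr' ?_)
  filter_upwards [self_mem_nhdsWithin] with s hs
  rw [hc]
  have hs' : 0 < s := hs
  simp
  linarith

/-! ### The Laplace transform of the resolvent -/

theorem IsResolvent.isHomSolution {κ M₀ : ℝ} {K : ℝ → ℝ} (hK : IsResolvent κ M₀ W K)
    (hc : Continuous K) : IsHomSolution κ M₀ W K := ⟨hc, hK.2⟩

/-- The derivative of the resolvent. -/
def resDeriv (κ M₀ : ℝ) (W : R3 → ℝ) (K : ℝ → ℝ) (t : ℝ) : ℝ :=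
  -∫ s in (0 : ℝ)..t, f κ M₀ W (t - s) * K s

theorem integrableOn_exp_mul_of_bound {g : ℝ → ℝ} (hg : Continuous g) {C : ℝ}
    (hb : ∀ t, 0 ≤ t → |g t| ≤ C) {z : ℂ} (hz : 0 < z.re) :
    IntegrableOn (fun t : ℝ => Complex.exp (-z * t) * (g t : ℂ)) (Ioi 0) := by
  have hz' : (-z).re < 0 := by simpa using hz
  refine Integrable.mul_bdd (c := C) (integrableOn_exp_mul_complex_Ioi hz' 0)
    (Continuous.aestronglyMeasurable (by fun_prop)) ?_
  filter_upwards [ae_restrict_mem measurableSet_Ioi] with t ht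
  rw [Complex.norm_real]
  exact hb t (le_of_lt ht)

section

variable {κ M₀ : ℝ} {K : ℝ → ℝ}

theorem continuous_resDeriv (h : IsComplexification W w) (hc : Continuous K) :
    Continuous (resDeriv κ M₀ W K) :=
  (continuous_volterra (continuous_f h κ M₀) hc).neg

theorem abs_resolvent_le (hZ : 0 < Z κ M₀) (h : IsComplexification W w)
    (hK : IsResolvent κ M₀ W K) (hc : Continuous K) {t : ℝ} (ht : 0 ≤ t) : |K t| ≤ 1 := by
  have := (hK.isHomSolution hc).abs_le hZ h ht
  rwa [hK.1, abs_one] at this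

/-- Reflecting the convolution puts the delay on `K`, which is bounded by one; only the
integrability of `f` is then needed. -/
theorem exists_abs_resDeriv_le (hZ : 0 < Z κ M₀) (h : IsComplexification W w)
    (hK : IsResolvent κ M₀ W K) (hc : Continuous K) :
    ∃ C, 0 ≤ C ∧ ∀ t, 0 ≤ t → |resDeriv κ M₀ W K t| ≤ C := by
  obtain ⟨C, hC, hb⟩ := exists_abs_f_le h κ M₀
  refine ⟨C * ∫ t in Ioi (0 : ℝ), (1 + t) ^ (-(3 / 2) : ℝ), ?_, fun t ht => ?_⟩
  · refine mul_nonneg hC (setIntegral_nonneg measurableSet_Ioi fun t ht => ?_)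
    have : (0 : ℝ) < t := ht
    positivity
  have hi : IntervalIntegrable (fun s => C * (1 + s) ^ (-(3 / 2) : ℝ)) volume 0 t := by
    rw [intervalIntegrable_iff_integrableOn_Ioc_of_le ht]
    have : IntegrableOn (fun s : ℝ => (1 + s) ^ (-(3 / 2) : ℝ)) (Ioc 0 t) :=
      integrableOn_one_add_rpow.mono_set Ioc_subset_Ioi_self
    exact this.const_mul C
  rw [resDeriv, abs_neg]
  have h1 : ∫ s in (0 : ℝ)..t, f κ M₀ W (t - s) * K s = ∫ s in (0 : ℝ)..t, f κ M₀ W s * K (t - s) := by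
    have := intervalIntegral.integral_comp_sub_left (a := 0) (b := t)
      (fun s => f κ M₀ W s * K (t - s)) t
    simpa using this
  rw [h1]
  have h2 : ‖∫ s in (0 : ℝ)..t, f κ M₀ W s * K (t - s)‖
      ≤ ∫ s in (0 : ℝ)..t, C * (1 + s) ^ (-(3 / 2) : ℝ) := by
    refine intervalIntegral.norm_integral_le_of_norm_le ht (Eventually.of_forall fun s hs => ?_) hi
    rw [norm_mul]
    calc _ ≤ C * (1 + s) ^ (-(3 / 2) : ℝ) * 1 := by
          have hp : 0 ≤ C * (1 + s) ^ (-(3 / 2) : ℝ) :=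
            mul_nonneg hC (Real.rpow_nonneg (by linarith [hs.1]) _)
          refine mul_le_mul (hb s hs.1.le).1 ?_ (norm_nonneg _) hp
          exact abs_resolvent_le hZ h hK hc (by linarith [hs.2])
      _ = _ := mul_one _
  refine h2.trans ?_
  rw [intervalIntegral.integral_of_le ht, integral_const_mul]
  refine mul_le_mul_of_nonneg_left ?_ hC
  refine setIntegral_mono_set integrableOn_one_add_rpow ?_ (Ioc_subset_Ioi_self).eventuallyLE
  filter_upwards [ae_restrict_mem measurableSet_Ioi] with s hs
  have : (0 : ℝ) < s := hs
  show (0 : ℝ) ≤ _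
  positivity

theorem lap_resDeriv_eq_mul (h : IsComplexification W w) (hZ : 0 < Z κ M₀)
    (hK : IsResolvent κ M₀ W K) (hc : Continuous K) {z : ℂ} (hz : 0 < z.re) :
    lap (fun t => (resDeriv κ M₀ W K t : ℂ)) z
      = -(lap (fun t => (f κ M₀ W t : ℂ)) z * lap (fun t => (K t : ℂ)) z) := by
  have h1 := integrableOn_exp_mul_of_bound hc (fun t ht => abs_resolvent_le hZ h hK hc ht) hz
  have h2 := integrableOn_exp_neg_mul (integrableOn_f h κ M₀) hz.le
  have h3 := integral_posConvolution h1 h2 (ContinuousLinearMap.mul ℝ ℂ)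
  simp only [ContinuousLinearMap.mul_apply'] at h3
  rw [lap, lap, lap, mul_comm, ← h3, ← integral_neg]
  refine integral_congr_ae (Eventually.of_forall fun t => ?_)
  simp only [resDeriv]
  rw [Complex.ofReal_neg, ← intervalIntegral.integral_ofReal, mul_neg,
    ← intervalIntegral.integral_const_mul]
  congr 1
  refine intervalIntegral.integral_congr fun s _ => ?_
  have h4 : Complex.exp (-z * t) = Complex.exp (-z * s) * Complex.exp (-z * (t - s : ℝ)) := by
    rw [← Complex.exp_add]
    congr 1
    push_cast
    ring
  rw [h4]
  push_cast
  ring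

theorem lap_resDeriv_eq_sub (h : IsComplexification W w) (hZ : 0 < Z κ M₀)
    (hK : IsResolvent κ M₀ W K) (hc : Continuous K) {z : ℂ} (hz : 0 < z.re) :
    z * lap (fun t => (K t : ℂ)) z = 1 + lap (fun t => (resDeriv κ M₀ W K t : ℂ)) z := by
  obtain ⟨C, hC, hb⟩ := exists_abs_resDeriv_le hZ h hK hc
  rw [mul_lap_eq (g' := resDeriv κ M₀ W K) hK.2
    (integrableOn_exp_mul_of_bound hc (fun t ht => abs_resolvent_le hZ h hK hc ht) hz)
    (integrableOn_exp_mul_of_bound (continuous_resDeriv h hc) hb hz), hK.1, Complex.ofReal_one]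
  have h1 : Tendsto (fun t : ℝ => Real.exp (-(z.re * t))) atTop (𝓝 0) :=
    Real.tendsto_exp_neg_atTop_nhds_zero.comp (tendsto_id.const_mul_atTop hz)
  refine squeeze_zero_norm' ?_ h1
  filter_upwards [eventually_ge_atTop 0] with t ht
  rw [norm_mul, norm_exp_neg_mul, Complex.norm_real]
  exact mul_le_of_le_one_right (Real.exp_pos _).le (abs_resolvent_le hZ h hK hc ht)

theorem add_lap_f_mul (h : IsComplexification W w) (hZ : 0 < Z κ M₀)
    (hK : IsResolvent κ M₀ W K) (hc : Continuous K) {z : ℂ} (hz : 0 < z.re) :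
    (z + lap (fun t => (f κ M₀ W t : ℂ)) z) * lap (fun t => (K t : ℂ)) z = 1 := by
  have h1 := lap_resDeriv_eq_mul h hZ hK hc hz
  have h2 := lap_resDeriv_eq_sub h hZ hK hc hz
  linear_combination h2 + h1

/-- The denominator in the Laplace transform of the resolvent, in the variable `z = √λ`. -/
def resDen (w : 𝓢(R3, ℂ)) (c : ℝ) (z : ℂ) : ℂ := z + c * thresh w z

/-- The Laplace transform of the derivative of the resolvent, in the variable `z = √λ`. -/
def resHat (w : 𝓢(R3, ℂ)) (c : ℝ) (z : ℂ) : ℂ := -(c * thresh w z) / resDen w c z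

variable {c : ℝ}

/-- In the open sector `Re z² > 0`, where the bounded function `K` has a Laplace transform. The
transformed equation says that this transform is the reciprocal of `z · resDen`, which excludes a
zero. -/
theorem resDen_ne_zero_of_lt (h : IsComplexification W w) (hZ : 0 < Z κ M₀)
    (hK : IsResolvent κ M₀ W K) (hKc : Continuous K)
    (hc : ∀ z : ℂ, |z.im| < z.re →
      lap (fun t => (f κ M₀ W t : ℂ)) (z ^ 2) = c * z * thresh w z)
    {z : ℂ} (hz : |z.im| < z.re) : resDen w c z ≠ 0 := by
  have h1 := abs_lt.1 hz
  have hz2 : 0 < (z ^ 2).re := by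
    rw [sq, Complex.mul_re]
    nlinarith [h1.1, h1.2]
  have h2 := add_lap_f_mul h hZ hK hKc hz2
  rw [hc z hz] at h2
  intro h3
  have h4 : z ^ 2 + c * z * thresh w z = z * resDen w c z := by unfold resDen; ring
  rw [h4, h3, mul_zero, zero_mul] at h2
  exact zero_ne_one h2

theorem lap_resDeriv_eq (h : IsComplexification W w) (hZ : 0 < Z κ M₀)
    (hK : IsResolvent κ M₀ W K) (hKc : Continuous K)
    (hc : ∀ z : ℂ, |z.im| < z.re →
      lap (fun t => (f κ M₀ W t : ℂ)) (z ^ 2) = c * z * thresh w z)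
    {z : ℂ} (hz : |z.im| < z.re) :
    lap (fun t => (resDeriv κ M₀ W K t : ℂ)) (z ^ 2) = resHat w c z := by
  have h1 := abs_lt.1 hz
  have hz2 : 0 < (z ^ 2).re := by
    rw [sq, Complex.mul_re]
    nlinarith [h1.1, h1.2]
  have hz0 : z ≠ 0 := by
    rintro rfl
    simp at hz
  have hD := resDen_ne_zero_of_lt h hZ hK hKc hc hz
  have h2 := add_lap_f_mul h hZ hK hKc hz2
  have h3 := lap_resDeriv_eq_mul h hZ hK hKc hz2
  rw [hc z hz] at h2 h3
  rw [h3, resHat, eq_div_iff hD]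
  unfold resDen at *
  have h4 : z * ((z + c * thresh w z) * lap (fun t => (K t : ℂ)) (z ^ 2)) = 1 := by
    rw [← h2]; ring
  linear_combination -(c * thresh w z) * h4

/-- In the open sector the existence of the resolvent excludes zeros, and at the origin `thresh`
does not vanish. On the rest of the boundary `z²` is a nonzero imaginary number, where `NonResonant`
is exactly what is needed. -/
theorem resDen_ne_zero (h : IsComplexification W w) (hZ : 0 < Z κ M₀)
    (hK : IsResolvent κ M₀ W K) (hKc : Continuous K) (hc0 : 0 < c)
    (hc : ∀ z : ℂ, |z.im| < z.re →
      lap (fun t => (f κ M₀ W t : ℂ)) (z ^ 2) = c * z * thresh w z)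
    (hN : NonResonant κ M₀ W) {z : ℂ} (hz : z ∈ sector) : resDen w c z ≠ 0 := by
  have hz' : |z.im| ≤ z.re := hz
  rcases hz'.lt_or_eq with hlt | heq
  · exact resDen_ne_zero_of_lt h hZ hK hKc hc hlt
  rcases eq_or_ne z.im 0 with him | him
  · have hz0 : z = 0 := by
      rw [him, abs_zero] at heq
      exact Complex.ext heq.symm him
    rw [hz0, resDen, zero_add]
    exact mul_ne_zero (by exact_mod_cast hc0.ne') (thresh_zero_ne h)
  · have hre : z.re ≠ 0 := by
      rw [← heq]; exact abs_ne_zero.2 him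
    have hsq : z ^ 2 = Complex.I * ((2 * z.re * z.im : ℝ) : ℂ) := by
      apply Complex.ext
      · rw [sq, Complex.mul_re]
        have : z.re * z.re = z.im * z.im := by rw [← heq, abs_mul_abs_self]
        simp [this]
      · rw [sq, Complex.mul_im]
        simp
        ring
    have h1 := hN (2 * z.re * z.im) (mul_ne_zero (mul_ne_zero two_ne_zero hre) him)
    have h2 : ∫ t in Ioi (0 : ℝ), Complex.exp (-Complex.I * ((2 * z.re * z.im : ℝ) : ℂ) * t)
        * (f κ M₀ W t : ℂ) = c * z * thresh w z := by
      rw [← lap_f_eq_of_mem_sector h hc hz, hsq, lap]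
      simp only [neg_mul]
    rw [h2, ← hsq] at h1
    intro h3
    apply h1
    unfold resDen at h3
    linear_combination z * h3

theorem isClosed_sector : IsClosed sector := isClosed_le (by fun_prop) (by fun_prop)

theorem exists_le_norm_resDen (hD : ∀ z ∈ sector, resDen w c z ≠ 0) :
    ∃ d, 0 < d ∧ ∀ z ∈ sector, d * (1 + ‖z‖) ≤ ‖resDen w c z‖ := by
  obtain ⟨B, hB, hb⟩ := exists_norm_thresh_le w
  -- Beyond radius `R` the term `z` dominates the bounded term `c * thresh w z`; inside, compactness
  -- gives a positive minimum.
  set R := 2 * (|c| * B) + 1 with hR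
  have hcB : 0 ≤ |c| * B := by positivity
  have hR1 : 1 ≤ R := by linarith
  have hcont : ContinuousOn (fun z => ‖resDen w c z‖) sector :=
    (continuousOn_id.add (continuousOn_const.mul (continuousOn_thresh w))).norm
  have hcomp : IsCompact (sector ∩ Metric.closedBall 0 R) :=
    (isCompact_closedBall _ _).inter_left isClosed_sector
  obtain ⟨z₀, hz₀, hmin⟩ := hcomp.exists_isMinOn
    ⟨0, by show |(0 : ℂ).im| ≤ (0 : ℂ).re; simp, by simp; linarith⟩ (hcont.mono inter_subset_left)
  have hd0 : 0 < ‖resDen w c z₀‖ := norm_pos_iff.2 (hD z₀ hz₀.1)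
  refine ⟨min (‖resDen w c z₀‖ / (1 + R)) (1 / 4), by positivity, fun z hz => ?_⟩
  rcases le_or_gt ‖z‖ R with hle | hgt
  · calc _ ≤ ‖resDen w c z₀‖ / (1 + R) * (1 + R) := by
          gcongr
          exact min_le_left _ _
      _ = ‖resDen w c z₀‖ := by field_simp
      _ ≤ _ := hmin ⟨hz, by simpa using hle⟩
  · have h1 : ‖z‖ ≤ ‖resDen w c z‖ + |c| * B := by
      have h2 : z = resDen w c z - c * thresh w z := by unfold resDen; ring
      calc ‖z‖ = ‖resDen w c z - c * thresh w z‖ := by rw [← h2]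
        _ ≤ ‖resDen w c z‖ + ‖c * thresh w z‖ := norm_sub_le _ _
        _ ≤ _ := by
          rw [norm_mul, Complex.norm_real]
          gcongr
          exacts [le_rfl, hb z hz]
    calc _ ≤ 1 / 4 * (1 + ‖z‖) := by
          gcongr
          exact min_le_right _ _
      _ ≤ _ := by linarith

theorem continuousOn_resHat (hD : ∀ z ∈ sector, resDen w c z ≠ 0) :
    ContinuousOn (resHat w c) sector :=
  ((continuousOn_const.mul (continuousOn_thresh w)).neg).div
    (continuousOn_id.add (continuousOn_const.mul (continuousOn_thresh w))) hD

/-- The numerator is the transform of `f` at `z²` divided by `z`, hence `O(|z|^{-3})` at infinity;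
the denominator contributes one more power. -/
theorem exists_norm_resHat_le (h : IsComplexification W w)
    (hc : ∀ z : ℂ, |z.im| < z.re →
      lap (fun t => (f κ M₀ W t : ℂ)) (z ^ 2) = c * z * thresh w z)
    (hD : ∀ z ∈ sector, resDen w c z ≠ 0) :
    ∃ C, 0 ≤ C ∧ ∀ z ∈ sector, ‖resHat w c z‖ ≤ C / (1 + ‖z‖ ^ 4) := by
  obtain ⟨B, hB, hb⟩ := exists_norm_thresh_le w
  obtain ⟨d, hd, hden⟩ := exists_le_norm_resDen hD
  obtain ⟨C, hC, hCf⟩ := exists_norm_mul_lap_f_le h κ M₀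
  refine ⟨|c| * B / d + C / d, by positivity, fun z hz => ?_⟩
  have hDpos : 0 < ‖resDen w c z‖ := norm_pos_iff.2 (hD z hz)
  have h1 : ‖resHat w c z‖ * ‖resDen w c z‖ = ‖c * thresh w z‖ := by
    rw [resHat, norm_div, norm_neg, div_mul_cancel₀ _ hDpos.ne']
  have h2 : ‖resHat w c z‖ * d ≤ |c| * B := by
    calc _ ≤ ‖resHat w c z‖ * ‖resDen w c z‖ := by
          gcongr
          refine le_trans ?_ (hden z hz)
          nlinarith [norm_nonneg z]
      _ = ‖c * thresh w z‖ := h1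
      _ ≤ _ := by
        rw [norm_mul, Complex.norm_real]
        gcongr
        exacts [le_rfl, hb z hz]
  have hz2 : 0 ≤ (z ^ 2).re := by
    have h1 := abs_le.1 (show |z.im| ≤ z.re from hz)
    rw [sq, Complex.mul_re]
    nlinarith [h1.1, h1.2]
  have h3 : ‖z‖ ^ 4 * (‖resHat w c z‖ * d) ≤ C := by
    have h4 := hCf _ hz2
    rw [lap_f_eq_of_mem_sector h hc hz, mul_assoc, mul_left_comm, norm_mul z, ← h1, norm_pow] at h4
    refine le_trans ?_ h4
    have h5 : d * ‖z‖ ≤ ‖resDen w c z‖ := le_trans (by nlinarith) (hden z hz)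
    calc _ = ‖z‖ ^ 2 * (‖z‖ * (‖resHat w c z‖ * (d * ‖z‖))) := by ring
      _ ≤ _ := by gcongr
  rw [le_div_iff₀ (by positivity), ← add_div, le_div_iff₀ hd]
  nlinarith

end

end Friction

end

/-! ### Decay of the resolvent by oscillatory integrals -/

noncomputable section

namespace Friction

open LineDeriv

/-! ### A van der Corput estimate -/

/-- The quadratic phase `e^{i t q² / 2}`. -/
def quadPhase (t q : ℝ) : ℂ := Complex.exp (Complex.I * ((t * q ^ 2 / 2 : ℝ) : ℂ))

theorem norm_quadPhase (t q : ℝ) : ‖quadPhase t q‖ = 1 := norm_exp_I_mul_ofReal _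

theorem continuous_quadPhase (t : ℝ) : Continuous (quadPhase t) := by
  unfold quadPhase; fun_prop

theorem hasDerivAt_quadPhase (t q : ℝ) :
    HasDerivAt (quadPhase t) (Complex.I * t * q * quadPhase t q) q := by
  have h1 : HasDerivAt (fun q : ℝ => t * q ^ 2 / 2) (t * q) q := by
    have := (((hasDerivAt_id q).pow 2).const_mul t).div_const 2
    refine this.congr_deriv ?_
    simp
    ring
  refine ((h1.ofReal_comp.const_mul Complex.I).cexp).congr_deriv ?_
  unfold quadPhase
  push_cast
  ring

/-- Away from the stationary point the phase derivative `tq` is at least `√t`, and one integration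
by parts divides by it. A singularity `B/q` of `φ'` at the origin is tolerated, since `q^{-2}/t`
integrates to `1/(ta)`. -/
theorem norm_integral_quadPhase_mul_le_of_le {φ φ' : ℝ → ℂ} (hφ : ∀ q, 0 < q → HasDerivAt φ (φ' q) q)
    (hφ' : ContinuousOn φ' (Ioi 0)) {B : ℝ} (hB : ∀ q, 0 < q → ‖φ q‖ ≤ B)
    (hB' : ∀ q, 0 < q → ‖φ' q‖ ≤ B / q) {t : ℝ} (ht : 0 < t) {a R : ℝ} (ha : (√t)⁻¹ ≤ a)
    (haR : a ≤ R) : ‖∫ q in a..R, quadPhase t q * φ q‖ ≤ 4 * B * (√t)⁻¹ := by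
  have hst : 0 < √t := Real.sqrt_pos.2 ht
  have ha0 : 0 < a := lt_of_lt_of_le (by positivity) ha
  have hB0 : 0 ≤ B := (norm_nonneg _).trans (hB 1 one_pos)
  have hta : √t ≤ t * a := by
    calc √t = t * (√t)⁻¹ := by
          rw [eq_mul_inv_iff_mul_eq₀ hst.ne', Real.mul_self_sqrt ht.le]
      _ ≤ t * a := by gcongr
  have hpos : ∀ q ∈ uIcc a R, 0 < q := by
    intro q hq
    rw [uIcc_of_le haR] at hq
    exact ha0.trans_le hq.1
  have hIt : Complex.I * (t : ℂ) ≠ 0 := mul_ne_zero Complex.I_ne_zero (by exact_mod_cast ht.ne')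
  let u : ℝ → ℂ := fun q => φ q * (Complex.I * t * q)⁻¹
  let u' : ℝ → ℂ := fun q => φ' q * (Complex.I * t * q)⁻¹
    + φ q * (-(Complex.I * t) / (Complex.I * t * q) ^ 2)
  have hne : ∀ q : ℝ, 0 < q → Complex.I * (t : ℂ) * q ≠ 0 := fun q hq =>
    mul_ne_zero hIt (by exact_mod_cast hq.ne')
  have hnorm : ∀ q : ℝ, 0 < q → ‖Complex.I * (t : ℂ) * q‖ = t * q := by
    intro q hq
    rw [norm_mul, norm_mul, Complex.norm_I, one_mul, Complex.norm_real, Complex.norm_real,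
      Real.norm_of_nonneg ht.le, Real.norm_of_nonneg hq.le]
  have hu : ∀ q ∈ uIcc a R, HasDerivAt u (u' q) q := by
    intro q hq
    have h1 : HasDerivAt (fun q : ℝ => Complex.I * (t : ℂ) * q) (Complex.I * t) q := by
      have := (Complex.ofRealCLM.hasDerivAt (x := q)).const_mul (Complex.I * (t : ℂ))
      simpa using this
    exact (hφ q (hpos q hq)).mul (h1.inv (hne q (hpos q hq)))
  have hsub : uIcc a R ⊆ Ioi 0 := fun q hq => hpos q hq
  have hu'c : ContinuousOn u' (uIcc a R) := by
    have c1 : ContinuousOn (fun q : ℝ => Complex.I * (t : ℂ) * q) (uIcc a R) :=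
      Continuous.continuousOn (by fun_prop)
    refine ((hφ'.mono hsub).mul (c1.inv₀ fun q hq => hne q (hpos q hq))).add
      (ContinuousOn.mul (fun q hq => (hφ q (hpos q hq)).continuousAt.continuousWithinAt) ?_)
    exact continuousOn_const.div (c1.pow 2) fun q hq => pow_ne_zero 2 (hne q (hpos q hq))
  have hEc : Continuous fun q : ℝ => Complex.I * t * q * quadPhase t q := by
    have := continuous_quadPhase t
    fun_prop
  have hibp := intervalIntegral.integral_mul_deriv_eq_deriv_mul hu
    (fun q _ => hasDerivAt_quadPhase t q) hu'c.intervalIntegrable (hEc.intervalIntegrable _ _)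
  have heq : ∫ q in a..R, quadPhase t q * φ q
      = ∫ q in a..R, u q * (Complex.I * t * q * quadPhase t q) := by
    refine intervalIntegral.integral_congr fun q hq => ?_
    have := hne q (hpos q hq)
    simp only [u]
    rw [← mul_assoc, inv_mul_cancel_right₀ this, mul_comm]
  have hub : ∀ q, a ≤ q → ‖u q * quadPhase t q‖ ≤ B * (√t)⁻¹ := by
    intro q hq
    have hq0 := ha0.trans_le hq
    simp only [u]
    rw [norm_mul, norm_quadPhase, mul_one, norm_mul, norm_inv, hnorm q hq0]
    have : √t ≤ t * q := hta.trans (by gcongr)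
    gcongr
    exact hB q hq0
  have hint : ‖∫ q in a..R, u' q * quadPhase t q‖ ≤ 2 * B * (√t)⁻¹ := by
    have h5 : ‖∫ q in a..R, u' q * quadPhase t q‖ ≤ ∫ q in a..R, (2 * B / t) * q ^ (-2 : ℝ) := by
      refine intervalIntegral.norm_integral_le_of_norm_le haR
        (Eventually.of_forall fun q hq => ?_) ((intervalIntegrable_rpow_pos ha0 haR).const_mul _)
      have hq0 : 0 < q := ha0.trans hq.1
      rw [norm_mul, norm_quadPhase, mul_one]
      refine (norm_add_le _ _).trans ?_
      rw [norm_mul, norm_mul, norm_div, norm_neg, norm_inv, norm_pow, hnorm q hq0, norm_mul,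
        Complex.norm_I, one_mul, Complex.norm_real, Real.norm_of_nonneg ht.le, Real.rpow_neg hq0.le]
      norm_num
      calc _ ≤ B / q * (q⁻¹ * t⁻¹) + B * (t / (t * q) ^ 2) := by
            gcongr
            exacts [hB' q hq0, hB q hq0]
        _ = _ := by field_simp; norm_num
    rw [intervalIntegral.integral_const_mul] at h5
    have h6 := integral_rpow_le (p := -2) (by norm_num) ha0 haR
    calc _ ≤ (2 * B / t) * (a ^ (-2 + 1 : ℝ) / (-(-2 + 1))) := h5.trans (by gcongr)
      _ = 2 * B * (t * a)⁻¹ := by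
        norm_num
        rw [Real.rpow_neg_one]
        field_simp
      _ ≤ _ := by gcongr
  rw [heq, hibp]
  calc _ ≤ ‖u R * quadPhase t R‖ + ‖u a * quadPhase t a‖ + ‖∫ q in a..R, u' q * quadPhase t q‖ :=
        (norm_sub_le _ _).trans (by gcongr; exact norm_sub_le _ _)
    _ ≤ B * (√t)⁻¹ + B * (√t)⁻¹ + 2 * B * (√t)⁻¹ := by
        gcongr
        exacts [hub R haR, hub a le_rfl]
    _ = _ := by ring

/-- The part of the interval below `(√t)⁻¹` contributes at most its length times `B`; the
oscillatory part contributes `4B(√t)⁻¹`. -/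
theorem norm_integral_quadPhase_mul_le {φ φ' : ℝ → ℂ} (hφ : ∀ q, 0 < q → HasDerivAt φ (φ' q) q)
    (hφ' : ContinuousOn φ' (Ioi 0)) {B : ℝ} (hB : ∀ q, 0 < q → ‖φ q‖ ≤ B)
    (hB' : ∀ q, 0 < q → ‖φ' q‖ ≤ B / q) {t : ℝ} (ht : 0 < t) {a R : ℝ} (ha : 0 < a)
    (haR : a ≤ R) : ‖∫ q in a..R, quadPhase t q * φ q‖ ≤ 5 * B * (√t)⁻¹ := by
  have hst : 0 < √t := Real.sqrt_pos.2 ht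
  have hB0 : 0 ≤ B := (norm_nonneg _).trans (hB 1 one_pos)
  have htriv : ∀ m, a ≤ m → m ≤ (√t)⁻¹ → ‖∫ q in a..m, quadPhase t q * φ q‖ ≤ B * (√t)⁻¹ := by
    intro m h1 h2
    have h3 := intervalIntegral.norm_integral_le_of_norm_le_const (a := a) (b := m) (C := B)
      (f := fun q => quadPhase t q * φ q) (fun q hq => by
        rw [uIoc_of_le h1] at hq
        rw [norm_mul, norm_quadPhase, one_mul]
        exact hB q (ha.trans hq.1))
    refine h3.trans ?_
    rw [abs_of_nonneg (by linarith)]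
    gcongr
    linarith
  have hBs : 0 ≤ B * (√t)⁻¹ := by positivity
  rcases le_total (√t)⁻¹ a with h1 | h1
  · have := norm_integral_quadPhase_mul_le_of_le hφ hφ' hB hB' ht h1 haR
    linarith
  rcases le_total R (√t)⁻¹ with h2 | h2
  · have := htriv R haR h2
    linarith
  · have hi : ∀ x y, 0 < x → x ≤ y →
        IntervalIntegrable (fun q => quadPhase t q * φ q) volume x y := by
      intro x y hx hxy
      refine ContinuousOn.intervalIntegrable ((continuous_quadPhase t).continuousOn.mul
        fun q hq => (hφ q ?_).continuousAt.continuousWithinAt)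
      rw [uIcc_of_le hxy] at hq
      exact hx.trans_le hq.1
    rw [← intervalIntegral.integral_add_adjacent_intervals (hi a _ ha h1) (hi _ R (by positivity) h2)]
    have h3 := norm_integral_quadPhase_mul_le_of_le hφ hφ' hB hB' ht le_rfl h2
    have h4 := htriv _ h1 le_rfl
    refine (norm_add_le _ _).trans ?_
    linarith

/-! ### Boundary values of the Laplace transform of the resolvent -/

/-- `∫₀^∞ tⁿ e^{-uqt} g(t) dt` for the correlation function `g`, up to the phase `(-u)ⁿ` the
`n`-th derivative in `q`. -/
def corrMoment (w : 𝓢(R3, ℂ)) (n : ℕ) (u : ℂ) (q : ℝ) : ℂ :=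
  lap (fun t => (t : ℂ) ^ n * lineCorr w t) (u * q)

theorem integrableOn_pow_mul_lineCorr (w : 𝓢(R3, ℂ)) (n : ℕ) :
    IntegrableOn (fun t : ℝ => (t : ℂ) ^ n * lineCorr w t) (Ioi 0) := by
  have h1 := (lineCorr w).integrable_pow_mul (μ := volume) n
  refine (h1.mono' (Continuous.aestronglyMeasurable ?_)
    (Eventually.of_forall fun t => ?_)).integrableOn
  · have := (lineCorr w).continuous
    fun_prop
  · simp

theorem norm_corrMoment_le (w : 𝓢(R3, ℂ)) (n : ℕ) {u : ℂ} (hu : 0 ≤ u.re) {q : ℝ} (hq : 0 ≤ q) :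
    ‖corrMoment w n u q‖ ≤ ∫ t in Ioi (0 : ℝ), ‖(t : ℂ) ^ n * lineCorr w t‖ :=
  norm_lap_le (integrableOn_pow_mul_lineCorr w n) (by simpa using mul_nonneg hu hq)

theorem hasDerivAt_corrMoment (w : 𝓢(R3, ℂ)) (n : ℕ) {u : ℂ} (hu : 0 ≤ u.re) {q : ℝ} (hq : 0 < q) :
    HasDerivAt (corrMoment w n u) (-u * corrMoment w (n + 1) u q) q := by
  have hre : ∀ x : ℝ, 0 ≤ x → 0 ≤ (u * x).re := fun x hx => by simpa using mul_nonneg hu hx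
  have h := hasDerivAt_integral_of_dominated_loc_of_deriv_le (μ := volume.restrict (Ioi (0 : ℝ)))
    (F := fun (x t : ℝ) => Complex.exp (-(u * x) * t) * ((t : ℂ) ^ n * lineCorr w t))
    (F' := fun (x t : ℝ) => Complex.exp (-(u * x) * t) * (-u * ((t : ℂ) ^ (n + 1) * lineCorr w t)))
    (bound := fun t => ‖-u * ((t : ℂ) ^ (n + 1) * lineCorr w t)‖) (x₀ := q)
    (s := Ioi 0) (Ioi_mem_nhds hq) ?_ ?_ ?_ ?_ ?_ ?_
  · refine h.2.congr_deriv ?_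
    simp only [corrMoment, lap]
    rw [← integral_const_mul]
    refine integral_congr_ae (Eventually.of_forall fun t => ?_)
    ring
  · filter_upwards [Ioi_mem_nhds hq] with x hx
    exact (integrableOn_exp_neg_mul (integrableOn_pow_mul_lineCorr w n)
      (hre x (le_of_lt hx))).aestronglyMeasurable
  · exact integrableOn_exp_neg_mul (integrableOn_pow_mul_lineCorr w n) (hre q hq.le)
  · exact (integrableOn_exp_neg_mul ((integrableOn_pow_mul_lineCorr w (n + 1)).const_mul (-u))
      (hre q hq.le)).aestronglyMeasurable
  · filter_upwards [ae_restrict_mem measurableSet_Ioi] with t ht x hx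
    rw [norm_mul]
    exact mul_le_of_le_one_left (norm_nonneg _)
      (norm_exp_neg_mul_le (hre x (le_of_lt hx)) (le_of_lt ht))
  · exact ((integrableOn_pow_mul_lineCorr w (n + 1)).const_mul (-u)).norm
  · refine Eventually.of_forall fun t x _ => ?_
    have h1 : HasDerivAt (fun x : ℝ => -(u * x) * (t : ℂ)) (-u * t) x := by
      have := ((Complex.ofRealCLM.hasDerivAt (x := x)).const_mul u).neg.mul_const (t : ℂ)
      simpa using this
    refine (h1.cexp.mul_const _).congr_deriv ?_
    ring

/-- The point `√(i q² / 2)` on the boundary of the sector. -/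
def ray (q : ℝ) : ℂ := (1 + Complex.I) / 2 * q

theorem ray_mem_sector {q : ℝ} (hq : 0 ≤ q) : ray q ∈ sector := by
  show |(ray q).im| ≤ (ray q).re
  have h1 : (ray q).re = q / 2 := by simp [ray]; ring
  have h2 : (ray q).im = q / 2 := by simp [ray]; ring
  rw [h1, h2, abs_of_nonneg (by positivity)]

theorem ray_sq (q : ℝ) : ray q ^ 2 = Complex.I * ((q ^ 2 / 2 : ℝ) : ℂ) := by
  unfold ray
  push_cast
  ring_nf
  rw [Complex.I_sq]
  ring

theorem norm_ray_ge {q : ℝ} (hq : 0 ≤ q) : q / 2 ≤ ‖ray q‖ := by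
  have h1 : (ray q).re = q / 2 := by simp [ray]; ring
  have := Complex.abs_re_le_norm (ray q)
  rwa [h1, abs_of_nonneg (by positivity)] at this

/-- The derivatives of `thresh w (ray q)` in `q`. -/
def rayThresh (w : 𝓢(R3, ℂ)) (n : ℕ) (q : ℝ) : ℂ :=
  1 / 2 * ((1 + Complex.I) * ((-1) ^ n * corrMoment w n 1 q)
    + (1 - Complex.I) * ((-Complex.I) ^ n * corrMoment w n Complex.I q))

theorem thresh_ray (w : 𝓢(R3, ℂ)) (q : ℝ) : thresh w (ray q) = rayThresh w 0 q := by
  unfold thresh rayThresh corrMoment ray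
  have h1 : (1 - Complex.I) * ((1 + Complex.I) / 2 * q) = 1 * q := by
    ring_nf; rw [Complex.I_sq]; ring
  have h2 : (1 + Complex.I) * ((1 + Complex.I) / 2 * q) = Complex.I * q := by
    ring_nf; rw [Complex.I_sq]; ring
  rw [h1, h2]
  simp only [pow_zero, one_mul]

theorem hasDerivAt_rayThresh (w : 𝓢(R3, ℂ)) (n : ℕ) {q : ℝ} (hq : 0 < q) :
    HasDerivAt (rayThresh w n) (rayThresh w (n + 1) q) q := by
  have h1 := hasDerivAt_corrMoment w n (u := 1) (by simp) hq
  have h2 := hasDerivAt_corrMoment w n (u := Complex.I) (by simp) hq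
  refine ((((h1.const_mul ((-1) ^ n)).const_mul (1 + Complex.I)).add
    ((h2.const_mul ((-Complex.I) ^ n)).const_mul (1 - Complex.I))).const_mul (1 / 2)).congr_deriv ?_
  unfold rayThresh
  ring

theorem exists_norm_rayThresh_le (w : 𝓢(R3, ℂ)) (n : ℕ) :
    ∃ B, 0 ≤ B ∧ ∀ q, 0 ≤ q → ‖rayThresh w n q‖ ≤ B := by
  refine ⟨2 * ∫ t in Ioi (0 : ℝ), ‖(t : ℂ) ^ n * lineCorr w t‖, by positivity, fun q hq => ?_⟩
  refine norm_half_combination_le ?_ ?_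
  · rw [norm_mul, norm_pow, norm_neg, norm_one, one_pow, one_mul]
    exact norm_corrMoment_le w n (by simp) hq
  · rw [norm_mul, norm_pow, norm_neg, Complex.norm_I, one_pow, one_mul]
    exact norm_corrMoment_le w n (by simp) hq

/-- Along the boundary ray the denominator grows like `1 + q`, while `thresh` and its derivatives
are bounded. This supplies the hypotheses of the van der Corput estimate for the derivative of
`resHat` along the ray. -/
theorem exists_resHat_ray_deriv (w : 𝓢(R3, ℂ)) {c : ℝ} (hD : ∀ z ∈ sector, resDen w c z ≠ 0) :
    ∃ (φ φ' : ℝ → ℂ) (B : ℝ), (∀ q, 0 < q → HasDerivAt (fun q => resHat w c (ray q)) (φ q) q) ∧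
      (∀ q, 0 < q → HasDerivAt φ (φ' q) q) ∧ ContinuousOn φ' (Ioi 0) ∧
      (∀ q, 0 < q → ‖φ q‖ ≤ B) ∧ ∀ q, 0 < q → ‖φ' q‖ ≤ B / q := by
  obtain ⟨d, hd, hden⟩ := exists_le_norm_resDen hD
  obtain ⟨B0, hB0, hb0⟩ := exists_norm_rayThresh_le w 0
  obtain ⟨B1, hB1, hb1⟩ := exists_norm_rayThresh_le w 1
  obtain ⟨B2, hB2, hb2⟩ := exists_norm_rayThresh_le w 2
  set m : ℂ := (1 + Complex.I) / 2 with hm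
  have hmn : ‖m‖ ≤ 1 := by
    rw [hm, norm_div, Complex.norm_ofNat, div_le_one (by norm_num)]
    exact (norm_add_le _ _).trans (by simp; norm_num)
  let A := rayThresh w
  let D : ℝ → ℂ := fun q => m * q + c * A 0 q
  have hDray : ∀ q, resDen w c (ray q) = D q := fun q => by
    unfold resDen; rw [thresh_ray]; rfl
  have hDne : ∀ q, 0 < q → D q ≠ 0 := fun q hq => by
    rw [← hDray]; exact hD _ (ray_mem_sector hq.le)
  have hDn : ∀ q, 0 < q → d / 2 * (1 + q) ≤ ‖D q‖ := by
    intro q hq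
    have h1 := hden _ (ray_mem_sector hq.le)
    rw [hDray] at h1
    refine le_trans ?_ h1
    have := norm_ray_ge hq.le
    nlinarith
  have hDd : ∀ q, 0 < q → HasDerivAt D (m + c * A 1 q) q := by
    intro q hq
    have h1 := (Complex.ofRealCLM.hasDerivAt (x := q)).const_mul m
    refine (h1.add ((hasDerivAt_rayThresh w 0 hq).const_mul (c : ℂ))).congr_deriv ?_
    simp [A]
  -- In the quotient rule for `-cA₀ / (mq + cA₀)` the terms in `c² A₀ A₁` cancel, so the numerator
  -- grows only linearly with respect to a quadratic denominator.
  let φ : ℝ → ℂ := fun q => -(c * m) * ((A 1 q * q - A 0 q) / D q ^ 2)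
  let φ' : ℝ → ℂ := fun q => -(c * m) * ((A 2 q * q * D q ^ 2
    - (A 1 q * q - A 0 q) * (2 * D q * (m + c * A 1 q))) / (D q ^ 2) ^ 2)
  have hnum : ∀ q, 0 < q → HasDerivAt (fun q : ℝ => A 1 q * q - A 0 q) (A 2 q * q) q := by
    intro q hq
    have h1 := (hasDerivAt_rayThresh w 1 hq).mul (Complex.ofRealCLM.hasDerivAt (x := q))
    refine (h1.sub (hasDerivAt_rayThresh w 0 hq)).congr_deriv ?_
    simp [A]
  have hφ : ∀ q, 0 < q → HasDerivAt φ (φ' q) q := by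
    intro q hq
    refine (((hnum q hq).div ((hDd q hq).pow 2) (pow_ne_zero 2 (hDne q hq))).const_mul _).congr_deriv ?_
    simp only [φ']
    norm_num
  have hnb : ∀ q, 0 < q → ‖A 1 q * q - A 0 q‖ ≤ (B0 + B1) * (1 + q) := by
    intro q hq
    refine (norm_sub_le _ _).trans ?_
    rw [norm_mul, Complex.norm_real, Real.norm_of_nonneg hq.le]
    have h1 := hb1 q hq.le
    have h2 := hb0 q hq.le
    have h3 : ‖A 1 q‖ * q ≤ B1 * q := by gcongr
    have h4 : ‖A 0 q‖ ≤ B0 := h2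
    nlinarith
  have hcm : ‖-((c : ℂ) * m)‖ ≤ |c| := by
    rw [norm_neg, norm_mul, Complex.norm_real]
    exact mul_le_of_le_one_right (abs_nonneg _) hmn
  have hdd : ∀ q, 0 < q → ‖m + c * A 1 q‖ ≤ 1 + |c| * B1 := by
    intro q hq
    refine (norm_add_le _ _).trans (add_le_add hmn ?_)
    rw [norm_mul, Complex.norm_real]
    gcongr
    exacts [le_rfl, hb1 q hq.le]
  have hbφ : ∀ q, 0 < q → ‖φ q‖ ≤ |c| * ((B0 + B1) / (d / 2) ^ 2) := by
    intro q hq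
    have h1 := hDn q hq
    simp only [φ]
    rw [norm_mul, norm_div, norm_pow]
    refine mul_le_mul hcm ?_ (by positivity) (abs_nonneg _)
    calc _ ≤ ((B0 + B1) * (1 + q)) / (d / 2 * (1 + q)) ^ 2 := by gcongr; exact hnb q hq
      _ = (B0 + B1) / (d / 2) ^ 2 * (1 / (1 + q)) := by field_simp
      _ ≤ (B0 + B1) / (d / 2) ^ 2 * 1 := by
          gcongr
          rw [div_le_one (by positivity)]
          linarith
      _ = _ := mul_one _
  have hbφ' : ∀ q, 0 < q → ‖φ' q‖ ≤ |c| * (B2 / (d / 2) ^ 2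
      + 2 * (B0 + B1) * (1 + |c| * B1) / (d / 2) ^ 3) / q := by
    intro q hq
    have h1 := hDn q hq
    have hDp : 0 < ‖D q‖ := norm_pos_iff.2 (hDne q hq)
    have hsplit : φ' q = -(c * m) * (A 2 q * q / D q ^ 2
        - (A 1 q * q - A 0 q) * (2 * (m + c * A 1 q)) / D q ^ 3) := by
      have := hDne q hq
      simp only [φ']
      field_simp
    have hq1 : q / (1 + q) ^ 2 ≤ 1 / q := by
      rw [div_le_div_iff₀ (by positivity) hq]; nlinarith
    have hq2 : 1 / (1 + q) ^ 2 ≤ 1 / q := by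
      rw [div_le_div_iff₀ (by positivity) hq]; nlinarith
    rw [hsplit, norm_mul, mul_div_assoc |c|]
    refine mul_le_mul hcm ?_ (norm_nonneg _) (abs_nonneg _)
    have t1 : ‖A 2 q * q / D q ^ 2‖ ≤ B2 / (d / 2) ^ 2 * (1 / q) := by
      rw [norm_div, norm_pow, norm_mul, Complex.norm_real, Real.norm_of_nonneg hq.le]
      calc _ ≤ B2 * q / (d / 2 * (1 + q)) ^ 2 := by gcongr; exact hb2 q hq.le
        _ = B2 / (d / 2) ^ 2 * (q / (1 + q) ^ 2) := by field_simp
        _ ≤ _ := by gcongr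
    have t2 : ‖(A 1 q * q - A 0 q) * (2 * (m + c * A 1 q)) / D q ^ 3‖
        ≤ 2 * (B0 + B1) * (1 + |c| * B1) / (d / 2) ^ 3 * (1 / q) := by
      rw [norm_div, norm_pow, norm_mul, norm_mul 2, Complex.norm_ofNat]
      calc _ ≤ (B0 + B1) * (1 + q) * (2 * (1 + |c| * B1)) / (d / 2 * (1 + q)) ^ 3 := by
            gcongr
            exacts [hnb q hq, hdd q hq]
        _ = 2 * (B0 + B1) * (1 + |c| * B1) / (d / 2) ^ 3 * (1 / (1 + q) ^ 2) := by field_simp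
        _ ≤ _ := by gcongr
    calc _ ≤ _ := (norm_sub_le _ _).trans (add_le_add t1 t2)
      _ = _ := by ring
  refine ⟨φ, φ', |c| * ((B0 + B1) / (d / 2) ^ 2) + |c| * (B2 / (d / 2) ^ 2
      + 2 * (B0 + B1) * (1 + |c| * B1) / (d / 2) ^ 3), ?_, hφ, ?_, ?_, ?_⟩
  · intro q hq
    have h1 : (fun q => resHat w c (ray q)) = fun q => -(c * A 0 q) / D q := by
      funext q
      rw [resHat, hDray, thresh_ray]
    rw [h1]
    refine ((((hasDerivAt_rayThresh w 0 hq).const_mul (c : ℂ)).neg).div (hDd q hq)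
      (hDne q hq)).congr_deriv ?_
    simp only [φ, A, D, zero_add, Pi.neg_apply]
    ring
  · have hcA : ∀ n, ContinuousOn (A n) (Ioi 0) := fun n q hq =>
      (hasDerivAt_rayThresh w n hq).continuousAt.continuousWithinAt
    have hcD : ContinuousOn D (Ioi 0) := fun q hq => (hDd q hq).continuousAt.continuousWithinAt
    have hcq : ContinuousOn (fun q : ℝ => (q : ℂ)) (Ioi 0) := Continuous.continuousOn (by fun_prop)
    have h0 := hcA 0
    have h1 := hcA 1
    have h2 := hcA 2
    refine continuousOn_const.mul (ContinuousOn.div ?_ (by fun_prop) fun q hq =>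
      pow_ne_zero 2 (pow_ne_zero 2 (hDne q hq)))
    fun_prop
  · intro q hq
    refine (hbφ q hq).trans ?_
    have : 0 ≤ |c| * (B2 / (d / 2) ^ 2 + 2 * (B0 + B1) * (1 + |c| * B1) / (d / 2) ^ 3) := by
      positivity
    linarith
  · intro q hq
    refine (hbφ' q hq).trans ?_
    gcongr
    have : 0 ≤ |c| * ((B0 + B1) / (d / 2) ^ 2) := by positivity
    linarith

end Friction

end

noncomputable section

namespace Friction

open LineDeriv

variable {W : R3 → ℝ} {w : 𝓢(R3, ℂ)} {κ M₀ c : ℝ} {K : ℝ → ℝ}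

/-! ### Fourier inversion for the derivative of the resolvent -/

theorem lap_add_eq (g : ℝ → ℂ) (s : ℝ) (ω : ℂ) :
    lap g (s + ω) = lap (fun t => Complex.exp (-(s : ℂ) * t) * g t) ω := by
  unfold lap
  refine integral_congr_ae (Eventually.of_forall fun t => ?_)
  simp only
  rw [← mul_assoc, ← Complex.exp_add]
  congr 2
  ring

theorem lap_conj (g : ℝ → ℝ) (z : ℂ) :
    lap (fun t => (g t : ℂ)) ((starRingEnd ℂ) z) = (starRingEnd ℂ) (lap (fun t => (g t : ℂ)) z) := by
  unfold lap
  rw [← integral_conj]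
  refine integral_congr_ae (Eventually.of_forall fun t => ?_)
  simp only [map_mul, Complex.conj_ofReal, ← Complex.exp_conj, map_neg]

/-- Fourier inversion for a function damped by `e^{-st}`, with the negative frequencies folded. -/
theorem exp_mul_eq_integral_lap {g : ℝ → ℝ} (hg : Continuous g) {C : ℝ}
    (hb : ∀ t, 0 ≤ t → |g t| ≤ C) {s : ℝ} (hs : 0 < s)
    (hi : Integrable fun ν : ℝ => lap (fun t => (g t : ℂ)) (s + Complex.I * ((2 * Real.pi * ν : ℝ) : ℂ)))
    {t : ℝ} (ht : 0 < t) :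
    Real.exp (-(s * t)) * g t = 2 * ∫ ν in Ioi (0 : ℝ), (Complex.exp (Complex.I *
      ((2 * Real.pi * ν * t : ℝ) : ℂ)) *
        lap (fun t => (g t : ℂ)) (s + Complex.I * ((2 * Real.pi * ν : ℝ) : ℂ))).re := by
  let G : ℝ → ℂ := (Ioi (0 : ℝ)).indicator fun t => Complex.exp (-(s : ℂ) * t) * (g t : ℂ)
  have hGi : Integrable G := by
    rw [integrable_indicator_iff measurableSet_Ioi]
    exact integrableOn_exp_mul_of_bound hg hb (by simpa using hs)
  have hFG : ∀ ν, 𝓕 G ν = lap (fun t => (g t : ℂ)) (s + Complex.I * ((2 * Real.pi * ν : ℝ) : ℂ)) := by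
    intro ν
    rw [lap_add_eq, lap, Real.fourier_eq', ← integral_indicator measurableSet_Ioi]
    refine integral_congr_ae (Eventually.of_forall fun t => ?_)
    simp only [G, smul_eq_mul, Set.indicator_apply]
    split_ifs
    · congr 2
      simp
      ring
    · simp
  have hFGi : Integrable (𝓕 G) := by
    refine hi.congr (Eventually.of_forall fun ν => (hFG ν).symm)
  -- The function extended by zero may jump at the origin; inversion is pointwise and needs
  -- continuity only at `t > 0`.
  have hct : ContinuousAt G t := by
    have h1 : Continuous fun t : ℝ => Complex.exp (-(s : ℂ) * t) * (g t : ℂ) := by fun_prop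
    refine h1.continuousAt.congr ?_
    filter_upwards [Ioi_mem_nhds ht] with r hr
    simp only [G]
    rw [Set.indicator_of_mem hr]
  have hinv := hGi.fourierInv_fourier_eq hFGi hct
  let H : ℝ → ℂ := fun ν => Complex.exp (Complex.I * ((2 * Real.pi * ν * t : ℝ) : ℂ)) *
        lap (fun t => (g t : ℂ)) (s + Complex.I * ((2 * Real.pi * ν : ℝ) : ℂ))
  have hHi : Integrable H := by
    refine hi.bdd_mul (c := 1) (Continuous.aestronglyMeasurable (by fun_prop))
      (Eventually.of_forall fun ν => (norm_exp_I_mul_ofReal _).le)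
  have h2 : G t = ∫ ν, H ν := by
    rw [← hinv, Real.fourierInv_eq']
    refine integral_congr_ae (Eventually.of_forall fun ν => ?_)
    simp only [H, hFG, smul_eq_mul]
    congr 2
    simp
    ring
  have h3 : Real.exp (-(s * t)) * g t = ∫ ν, (H ν).re := by
    have h4 := Complex.reCLM.integral_comp_comm hHi
    simp only [Complex.reCLM_apply] at h4
    rw [h4, ← h2]
    simp only [G]
    rw [Set.indicator_of_mem (show t ∈ Ioi (0 : ℝ) from ht), Complex.re_mul_ofReal]
    congr 1
    have : -(s : ℂ) * t = ((-(s * t) : ℝ) : ℂ) := by push_cast; ring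
    rw [this, ← Complex.ofReal_exp, Complex.ofReal_re]
  have heven : ∀ ν, (H |ν|).re = (H ν).re := by
    intro ν
    rcases abs_cases ν with ⟨h5, -⟩ | ⟨h5, -⟩
    · rw [h5]
    · rw [h5]
      have h6 : H (-ν) = (starRingEnd ℂ) (H ν) := by
        simp only [H, map_mul]
        rw [← lap_conj, ← Complex.exp_conj]
        simp only [map_mul, map_add, Complex.conj_I, Complex.conj_ofReal]
        congr 2
        · push_cast; ring
        · push_cast; ring
      rw [h6, Complex.conj_re]
  have h7 := integral_comp_abs (f := fun ν => (H ν).re)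
  simp only [heven] at h7
  rw [h3, h7]

theorem exists_sq_eq {l : ℂ} (hl : 0 < l.re) : ∃ z : ℂ, z ^ 2 = l ∧ |z.im| < z.re := by
  obtain ⟨y, hy⟩ := IsAlgClosed.exists_pow_nat_eq l (n := 2) two_pos
  have h1 : y.re * y.re - y.im * y.im = l.re := by rw [← hy, sq, Complex.mul_re]
  have h2 : |y.im| < |y.re| := by
    apply sq_lt_sq.1
    nlinarith
  rcases le_total 0 y.re with h | h
  · exact ⟨y, hy, by rwa [abs_of_nonneg h] at h2⟩
  · refine ⟨-y, by rw [neg_sq, hy], ?_⟩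
    rw [Complex.neg_im, Complex.neg_re, abs_neg]
    rwa [abs_of_nonpos h] at h2

theorem lt_mem_sector {z : ℂ} (hz : |z.im| < z.re) : z ∈ sector := hz.le

theorem exists_norm_lap_resDeriv_le (h : IsComplexification W w) (hZ : 0 < Z κ M₀)
    (hK : IsResolvent κ M₀ W K) (hKc : Continuous K)
    (hc : ∀ z : ℂ, |z.im| < z.re →
      lap (fun t => (f κ M₀ W t : ℂ)) (z ^ 2) = c * z * thresh w z)
    (hD : ∀ z ∈ sector, resDen w c z ≠ 0) :
    ∃ C, 0 ≤ C ∧ ∀ l : ℂ, 0 < l.re →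
      ‖lap (fun t => (resDeriv κ M₀ W K t : ℂ)) l‖ ≤ C / (1 + ‖l‖ ^ 2) := by
  obtain ⟨C, hC, hb⟩ := exists_norm_resHat_le h hc hD
  refine ⟨C, hC, fun l hl => ?_⟩
  obtain ⟨z, rfl, hz⟩ := exists_sq_eq hl
  rw [lap_resDeriv_eq h hZ hK hKc hc hz]
  refine (hb z (lt_mem_sector hz)).trans (le_of_eq ?_)
  rw [norm_pow, ← pow_mul]

/-- Returns from `z` to `λ = z²`; the common factor `z` cancels, hence `z ≠ 0`. In this form the
boundary limit can be taken in `λ` without following a square root continuously. -/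
theorem lap_f_half (h : IsComplexification W w)
    (hc : ∀ z : ℂ, |z.im| < z.re →
      lap (fun t => (f κ M₀ W t : ℂ)) (z ^ 2) = c * z * thresh w z)
    {z : ℂ} (hz : z ∈ sector) (hz0 : z ≠ 0) :
    resHat w c z = -lap (fun t => (f κ M₀ W t : ℂ)) (z ^ 2)
      / (z ^ 2 + lap (fun t => (f κ M₀ W t : ℂ)) (z ^ 2)) := by
  rw [lap_f_eq_of_mem_sector h hc hz, resHat]
  have h1 : z ^ 2 + c * z * thresh w z = z * resDen w c z := by unfold resDen; ring
  have h2 : -(c * z * thresh w z) = z * -(c * thresh w z) := by ring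
  rw [h1, h2, mul_div_mul_left _ _ hz0]

theorem ray_ne_zero {q : ℝ} (hq : 0 < q) : ray q ≠ 0 := by
  have := norm_ray_ge hq.le
  exact norm_pos_iff.1 (by linarith)

theorem tendsto_lap_resDeriv (h : IsComplexification W w) (hZ : 0 < Z κ M₀)
    (hK : IsResolvent κ M₀ W K) (hKc : Continuous K)
    (hc : ∀ z : ℂ, |z.im| < z.re →
      lap (fun t => (f κ M₀ W t : ℂ)) (z ^ 2) = c * z * thresh w z)
    (hD : ∀ z ∈ sector, resDen w c z ≠ 0) {q : ℝ} (hq : 0 < q) :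
    Tendsto (fun s : ℝ => lap (fun t => (resDeriv κ M₀ W K t : ℂ))
      (s + Complex.I * ((q ^ 2 / 2 : ℝ) : ℂ))) (𝓝[>] 0) (𝓝 (resHat w c (ray q))) := by
  set l₀ : ℂ := Complex.I * ((q ^ 2 / 2 : ℝ) : ℂ) with hl₀
  have hre : ∀ s : ℝ, ((s : ℂ) + l₀).re = s := fun s => by
    rw [hl₀, Complex.add_re, Complex.I_mul_re, Complex.ofReal_im, neg_zero, add_zero,
      Complex.ofReal_re]
  let F : ℂ → ℂ := lap (fun t => (f κ M₀ W t : ℂ))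
  have hF : Tendsto (fun s : ℝ => F (s + l₀)) (𝓝[>] 0) (𝓝 (F l₀)) := by
    have h1 : ContinuousWithinAt F {z | 0 ≤ z.re} (((0 : ℝ) : ℂ) + l₀) :=
      continuousOn_lap (integrableOn_f h κ M₀) _ (hre 0).ge
    have h2 : ContinuousWithinAt (fun s : ℝ => F (s + l₀)) (Ici 0) 0 :=
      ContinuousWithinAt.comp (g := F) (f := fun s : ℝ => (s : ℂ) + l₀) (t := {z | 0 ≤ z.re}) h1
        (Continuous.continuousWithinAt (by fun_prop)) fun s hs => le_of_le_of_eq hs (hre s).symm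
    have h3 := h2.mono_left (nhdsWithin_mono 0 Ioi_subset_Ici_self)
    simpa using h3
  have hs : Tendsto (fun s : ℝ => (s : ℂ) + l₀) (𝓝[>] 0) (𝓝 l₀) := by
    have : Continuous fun s : ℝ => (s : ℂ) + l₀ := by fun_prop
    have h4 := (this.tendsto 0).mono_left (nhdsWithin_le_nhds (s := Ioi (0 : ℝ)))
    simpa using h4
  have hlim := lap_f_half h hc (ray_mem_sector hq.le) (ray_ne_zero hq)
  rw [ray_sq, ← hl₀] at hlim
  rw [hlim]
  have hne : l₀ + F l₀ ≠ 0 := by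
    have h5 := lap_f_eq_of_mem_sector h hc (ray_mem_sector hq.le)
    rw [ray_sq, ← hl₀] at h5
    have h6 : l₀ + F l₀ = ray q * resDen w c (ray q) := by
      simp only [F]
      rw [h5, hl₀, ← ray_sq, resDen]
      ring
    rw [h6]
    exact mul_ne_zero (ray_ne_zero hq) (hD _ (ray_mem_sector hq.le))
  refine ((hF.neg).div (hs.add hF) hne).congr' ?_
  filter_upwards [self_mem_nhdsWithin] with s hs0
  have hs0' : 0 < ((s : ℂ) + l₀).re := by rw [hre]; exact hs0
  have h7 := add_lap_f_mul h hZ hK hKc hs0'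
  rw [lap_resDeriv_eq_mul h hZ hK hKc hs0', Pi.div_apply]
  rw [div_eq_iff (left_ne_zero_of_mul_eq_one h7)]
  simp only [F]
  linear_combination (lap (fun t => (f κ M₀ W t : ℂ)) (s + l₀)) * h7

/-- The representation of the derivative of the resolvent by the boundary values of its Laplace
transform. -/
theorem resDeriv_eq_integral (h : IsComplexification W w) (hZ : 0 < Z κ M₀)
    (hK : IsResolvent κ M₀ W K) (hKc : Continuous K)
    (hc : ∀ z : ℂ, |z.im| < z.re →
      lap (fun t => (f κ M₀ W t : ℂ)) (z ^ 2) = c * z * thresh w z)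
    (hD : ∀ z ∈ sector, resDen w c z ≠ 0) {t : ℝ} (ht : 0 < t) :
    resDeriv κ M₀ W K t = 2 * ∫ ν in Ioi (0 : ℝ), (Complex.exp (Complex.I *
      ((2 * Real.pi * ν * t : ℝ) : ℂ)) * resHat w c (ray (√(4 * Real.pi * ν)))).re := by
  obtain ⟨C, hC, hb⟩ := exists_norm_lap_resDeriv_le h hZ hK hKc hc hD
  obtain ⟨C', hC', hb'⟩ := exists_abs_resDeriv_le hZ h hK hKc
  have hkc := continuous_resDeriv (κ := κ) (M₀ := M₀) h hKc
  let k := fun t => (resDeriv κ M₀ W K t : ℂ)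
  -- The bound does not depend on the damping `s`, so it serves as the dominating function when `s`
  -- tends to zero.
  have hbν : ∀ s : ℝ, 0 < s → ∀ ν : ℝ, ‖lap k (s + Complex.I * ((2 * Real.pi * ν : ℝ) : ℂ))‖
      ≤ C * (1 + ν ^ 2)⁻¹ := by
    intro s hs ν
    refine (hb _ (by simpa using hs)).trans ?_
    rw [div_eq_mul_inv, ← sq_abs ν]
    have h1 := Complex.abs_im_le_norm (s + Complex.I * ((2 * Real.pi * ν : ℝ) : ℂ))
    have h2 : (s + Complex.I * ((2 * Real.pi * ν : ℝ) : ℂ)).im = 2 * Real.pi * ν := by simp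
    rw [h2, abs_mul, abs_of_pos (by positivity)] at h1
    have h3 : |ν| ≤ 2 * Real.pi * |ν| := by
      refine le_mul_of_one_le_left (abs_nonneg _) ?_
      have := Real.pi_gt_three
      linarith
    gcongr
    exact h3.trans h1
  have hcont : ∀ s : ℝ, 0 < s →
      Continuous fun ν : ℝ => lap k (s + Complex.I * ((2 * Real.pi * ν : ℝ) : ℂ)) := by
    intro s hs
    have hi : IntegrableOn (fun t : ℝ => Complex.exp (-(s : ℂ) * t) * k t) (Ioi 0) :=
      integrableOn_exp_mul_of_bound hkc hb' (by simpa using hs)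
    simp only [lap_add_eq]
    have h3 := continuousOn_lap hi
    have h4 : Continuous fun ν : ℝ => Complex.I * ((2 * Real.pi * ν : ℝ) : ℂ) := by fun_prop
    exact h3.comp_continuous h4 fun ν => by simp
  have hbi : Integrable fun ν : ℝ => C * (1 + ν ^ 2)⁻¹ := integrable_inv_one_add_sq.const_mul C
  have hi : ∀ s : ℝ, 0 < s →
      Integrable fun ν : ℝ => lap k (s + Complex.I * ((2 * Real.pi * ν : ℝ) : ℂ)) :=
    fun s hs => hbi.mono' (hcont s hs).aestronglyMeasurable (Eventually.of_forall (hbν s hs))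
  have hL : Tendsto (fun s : ℝ => Real.exp (-(s * t)) * resDeriv κ M₀ W K t) (𝓝[>] 0)
      (𝓝 (resDeriv κ M₀ W K t)) := by
    have h5 : Continuous fun s : ℝ => Real.exp (-(s * t)) * resDeriv κ M₀ W K t := by fun_prop
    have h6 := (h5.tendsto 0).mono_left (nhdsWithin_le_nhds (s := Ioi (0 : ℝ)))
    simpa using h6
  have hR : Tendsto (fun s : ℝ => 2 * ∫ ν in Ioi (0 : ℝ), (Complex.exp (Complex.I *
      ((2 * Real.pi * ν * t : ℝ) : ℂ)) * lap k (s + Complex.I * ((2 * Real.pi * ν : ℝ) : ℂ))).re)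
      (𝓝[>] 0) (𝓝 (2 * ∫ ν in Ioi (0 : ℝ), (Complex.exp (Complex.I *
      ((2 * Real.pi * ν * t : ℝ) : ℂ)) * resHat w c (ray (√(4 * Real.pi * ν)))).re)) := by
    refine Tendsto.const_mul 2 ?_
    refine tendsto_integral_filter_of_dominated_convergence (fun ν => C * (1 + ν ^ 2)⁻¹) ?_ ?_
      hbi.integrableOn ?_
    · filter_upwards [self_mem_nhdsWithin] with s hs
      have := hcont s hs
      exact Continuous.aestronglyMeasurable (by fun_prop)
    · filter_upwards [self_mem_nhdsWithin] with s hs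
      refine Eventually.of_forall fun ν => ?_
      refine (Complex.abs_re_le_norm _).trans ?_
      rw [norm_mul, norm_exp_I_mul_ofReal, one_mul]
      exact hbν s hs ν
    · filter_upwards [ae_restrict_mem measurableSet_Ioi] with ν hν
      have hν' : 0 < ν := hν
      have h8 := tendsto_lap_resDeriv h hZ hK hKc hc hD (q := √(4 * Real.pi * ν)) (by positivity)
      have h9 : √(4 * Real.pi * ν) ^ 2 / 2 = 2 * Real.pi * ν := by
        rw [Real.sq_sqrt (by positivity)]; ring
      rw [h9] at h8
      exact (Complex.continuous_re.tendsto _).comp (h8.const_mul _)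
  refine tendsto_nhds_unique hL (hR.congr' ?_)
  filter_upwards [self_mem_nhdsWithin] with s hs
  exact (exp_mul_eq_integral_lap hkc hb' hs (hi s hs) ht).symm

/-- The substitution `q² = 4πν` makes the phase quadratic and removes the square root from the
argument of `resHat`, which can then be differentiated in `q` with bounds up to the threshold. -/
theorem resDeriv_eq_integral_ray (h : IsComplexification W w) (hZ : 0 < Z κ M₀)
    (hK : IsResolvent κ M₀ W K) (hKc : Continuous K)
    (hc : ∀ z : ℂ, |z.im| < z.re →
      lap (fun t => (f κ M₀ W t : ℂ)) (z ^ 2) = c * z * thresh w z)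
    (hD : ∀ z ∈ sector, resDen w c z ≠ 0) {t : ℝ} (ht : 0 < t) :
    resDeriv κ M₀ W K t = 1 / Real.pi *
      ∫ q in Ioi (0 : ℝ), q * (quadPhase t q * resHat w c (ray q)).re := by
  rw [resDeriv_eq_integral h hZ hK hKc hc hD ht]
  let G : ℝ → ℝ := fun ν => (Complex.exp (Complex.I *
      ((2 * Real.pi * ν * t : ℝ) : ℂ)) * resHat w c (ray (√(4 * Real.pi * ν)))).re
  have hp : 0 < (4 * Real.pi)⁻¹ := by positivity
  have h1 := integral_comp_mul_left_Ioi G 0 hp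
  have h2 := integral_comp_rpow_Ioi_of_pos (g := fun y => G ((4 * Real.pi)⁻¹ * y)) (p := 2) two_pos
  rw [mul_zero] at h1
  rw [h1, inv_inv] at h2
  have h3 : ∫ x in Ioi (0 : ℝ), ((2 : ℝ) * x ^ ((2 : ℝ) - 1)) • G ((4 * Real.pi)⁻¹ * x ^ (2 : ℝ))
      = 2 * ∫ q in Ioi (0 : ℝ), q * (quadPhase t q * resHat w c (ray q)).re := by
    rw [← integral_const_mul]
    refine setIntegral_congr_fun measurableSet_Ioi fun q hq => ?_
    have hq' : 0 < q := hq
    have e1 : (2 : ℝ) - 1 = 1 := by norm_num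
    have e2 : 4 * Real.pi * ((4 * Real.pi)⁻¹ * q ^ 2) = q ^ 2 := by field_simp
    have e3 : 2 * Real.pi * ((4 * Real.pi)⁻¹ * q ^ 2) * t = t * q ^ 2 / 2 := by
      field_simp; norm_num
    simp only [G, smul_eq_mul]
    rw [e1, Real.rpow_one, Real.rpow_two, e2, Real.sqrt_sq hq'.le, e3, quadPhase]
    ring
  rw [h3, smul_eq_mul] at h2
  have h4 : ∫ ν in Ioi (0 : ℝ), G ν = 1 / (2 * Real.pi) *
      ∫ q in Ioi (0 : ℝ), q * (quadPhase t q * resHat w c (ray q)).re := by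
    field_simp
    linarith
  simp only [G] at h4
  rw [h4]
  ring

end Friction

end

noncomputable section

namespace Friction

open LineDeriv

variable {W : R3 → ℝ} {w : 𝓢(R3, ℂ)} {κ M₀ c : ℝ} {K : ℝ → ℝ}

/-! ### Decay of the resolvent -/

/-- At the threshold `z` disappears from the denominator and the quotient is universal. This value
says that `K̇` has integral `-1`, that is, `K` decays from `1` to `0`. -/
theorem resHat_zero (h : IsComplexification W w) (hc : 0 < c) : resHat w c 0 = -1 := by
  have h1 : (c : ℂ) * thresh w 0 ≠ 0 := mul_ne_zero (by exact_mod_cast hc.ne') (thresh_zero_ne h)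
  rw [resHat, resDen, zero_add, neg_div, div_self h1]

theorem continuousWithinAt_resHat_ray (hD : ∀ z ∈ sector, resDen w c z ≠ 0) :
    ContinuousWithinAt (fun q => resHat w c (ray q)) (Ici 0) 0 := by
  have h0 : ray 0 = 0 := by simp [ray]
  have hr : Continuous ray := by unfold ray; fun_prop
  exact ContinuousWithinAt.comp (t := sector) (continuousOn_resHat hD _ (ray_mem_sector le_rfl))
    hr.continuousWithinAt fun q hq => ray_mem_sector hq

theorem exists_norm_resHat_ray_le (h : IsComplexification W w)
    (hc : ∀ z : ℂ, |z.im| < z.re →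
      lap (fun t => (f κ M₀ W t : ℂ)) (z ^ 2) = c * z * thresh w z)
    (hD : ∀ z ∈ sector, resDen w c z ≠ 0) :
    ∃ C, 0 ≤ C ∧ ∀ q, 0 < q → q * ‖resHat w c (ray q)‖ ≤ C * (1 + q ^ 2)⁻¹ := by
  obtain ⟨C, hC, hb⟩ := exists_norm_resHat_le h hc hD
  refine ⟨C * 32, by positivity, fun q hq => ?_⟩
  have h1 : ‖resHat w c (ray q)‖ ≤ C / (1 + (q / 2) ^ 4) := by
    refine (hb _ (ray_mem_sector hq.le)).trans ?_
    gcongr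
    exact norm_ray_ge hq.le
  have h2 : q / (1 + (q / 2) ^ 4) ≤ 32 * (1 + q ^ 2)⁻¹ := by
    rw [← div_eq_mul_inv, div_le_div_iff₀ (by positivity) (by positivity)]
    nlinarith [sq_nonneg (q - 1), sq_nonneg (q ^ 2 - q), sq_nonneg (q ^ 2 - 1)]
  calc _ ≤ q * (C / (1 + (q / 2) ^ 4)) := by gcongr
    _ = C * (q / (1 + (q / 2) ^ 4)) := by ring
    _ ≤ C * (32 * (1 + q ^ 2)⁻¹) := by gcongr
    _ = _ := by ring

theorem continuousOn_resHat_ray (hD : ∀ z ∈ sector, resDen w c z ≠ 0) :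
    ContinuousOn (fun q => resHat w c (ray q)) (Ioi 0) := by
  have hr : Continuous ray := by unfold ray; fun_prop
  exact (continuousOn_resHat hD).comp hr.continuousOn fun q hq => ray_mem_sector (le_of_lt hq)

theorem integrableOn_resHat_ray (h : IsComplexification W w)
    (hc : ∀ z : ℂ, |z.im| < z.re →
      lap (fun t => (f κ M₀ W t : ℂ)) (z ^ 2) = c * z * thresh w z)
    (hD : ∀ z ∈ sector, resDen w c z ≠ 0) (t : ℝ) :
    IntegrableOn (fun q => q * (quadPhase t q * resHat w c (ray q)).re) (Ioi 0) := by
  obtain ⟨C, hC, hb⟩ := exists_norm_resHat_ray_le h hc hD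
  refine Integrable.mono' (integrable_inv_one_add_sq.const_mul C).integrableOn
    (ContinuousOn.aestronglyMeasurable ?_ measurableSet_Ioi) ?_
  · have h1 := continuousOn_resHat_ray hD
    have h2 := (continuous_quadPhase t).continuousOn (s := Ioi 0)
    exact continuousOn_id.mul (Complex.continuous_re.comp_continuousOn (h2.mul h1))
  · filter_upwards [ae_restrict_mem measurableSet_Ioi] with q hq
    have hq' : 0 < q := hq
    refine le_trans ?_ (hb q hq)
    rw [norm_mul, Real.norm_of_nonneg hq'.le]
    gcongr
    refine (Complex.abs_re_le_norm _).trans ?_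
    rw [norm_mul, norm_quadPhase, one_mul]

/-- Since `itq e^{itq²/2}` is the derivative of the phase, an integration by parts gains `1/t`, and
the van der Corput estimate for the remaining integral gains `t^{-1/2}`. Both boundary terms
disappear in the limit. -/
theorem exists_abs_resDeriv_le_rpow (h : IsComplexification W w) (hZ : 0 < Z κ M₀)
    (hK : IsResolvent κ M₀ W K) (hKc : Continuous K) (hc0 : 0 < c)
    (hc : ∀ z : ℂ, |z.im| < z.re →
      lap (fun t => (f κ M₀ W t : ℂ)) (z ^ 2) = c * z * thresh w z)
    (hD : ∀ z ∈ sector, resDen w c z ≠ 0) :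
    ∃ C, 0 ≤ C ∧ ∀ t, 0 < t → |resDeriv κ M₀ W K t| ≤ C * (t⁻¹ * (√t)⁻¹) := by
  obtain ⟨φ, φ', B, hφ, hφ', hφc, hB, hB'⟩ := exists_resHat_ray_deriv w hD
  obtain ⟨C, hC, hb⟩ := exists_norm_resHat_ray_le h hc hD
  have hB0 : 0 ≤ B := (norm_nonneg _).trans (hB 1 one_pos)
  refine ⟨1 / Real.pi * (5 * B), by positivity, fun t ht => ?_⟩
  rw [resDeriv_eq_integral_ray h hZ hK hKc hc hD ht, abs_mul, abs_of_pos (by positivity), mul_assoc]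
  refine mul_le_mul_of_nonneg_left ?_ (by positivity)
  set κ' : ℝ → ℂ := fun q => resHat w c (ray q) with hκ'
  have htc : (t : ℂ) ≠ 0 := by exact_mod_cast ht.ne'
  have hIt : Complex.I * (t : ℂ) ≠ 0 := mul_ne_zero Complex.I_ne_zero htc
  have hItn : ‖(Complex.I * (t : ℂ))⁻¹‖ = t⁻¹ := by
    rw [norm_inv, norm_mul, Complex.norm_I, one_mul, Complex.norm_real, Real.norm_of_nonneg ht.le]
  have hφcont : ContinuousOn φ (Ioi 0) := fun q hq => (hφ' q hq).continuousAt.continuousWithinAt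
  have hκcont : ContinuousOn κ' (Ioi 0) := fun q hq => (hφ q hq).continuousAt.continuousWithinAt
  have hfin : ∀ a R, 0 < a → a ≤ R →
      |∫ q in a..R, q * (quadPhase t q * κ' q).re| ≤ ‖κ' R‖ * t⁻¹
        + |(κ' a * (Complex.I * t)⁻¹ * quadPhase t a).re| + 5 * B * (t⁻¹ * (√t)⁻¹) := by
    intro a R ha haR
    have hsub : uIcc a R ⊆ Ioi 0 := fun q hq => by
      rw [uIcc_of_le haR] at hq
      exact ha.trans_le hq.1
    have hEc : Continuous fun q : ℝ => Complex.I * t * q * quadPhase t q := by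
      have := continuous_quadPhase t
      fun_prop
    have hibp := intervalIntegral.integral_mul_deriv_eq_deriv_mul (a := a) (b := R)
      (u := fun q => κ' q * (Complex.I * (t : ℂ))⁻¹) (u' := fun q => φ q * (Complex.I * (t : ℂ))⁻¹)
      (v := quadPhase t) (v' := fun q : ℝ => Complex.I * t * q * quadPhase t q)
      (fun q hq => (hφ q (hsub hq)).mul_const _) (fun q _ => hasDerivAt_quadPhase t q)
      (((hφcont.mono hsub).mul continuousOn_const).intervalIntegrable) (hEc.intervalIntegrable _ _)
    have hgi : IntervalIntegrable (fun q : ℝ => (q : ℂ) * (quadPhase t q * κ' q)) volume a R := by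
      refine ContinuousOn.intervalIntegrable ((Continuous.continuousOn (by fun_prop)).mul
        ((continuous_quadPhase t).continuousOn.mul (hκcont.mono hsub)))
    have h1 : ∫ q in a..R, q * (quadPhase t q * κ' q).re
        = (∫ q in a..R, (q : ℂ) * (quadPhase t q * κ' q)).re := by
      have h2 := Complex.reCLM.intervalIntegral_comp_comm hgi
      simp only [Complex.reCLM_apply, Complex.re_ofReal_mul] at h2
      exact h2
    have h3 : ∫ q in a..R, (q : ℂ) * (quadPhase t q * κ' q) = ∫ q in a..R,
        κ' q * (Complex.I * (t : ℂ))⁻¹ * (Complex.I * t * q * quadPhase t q) := by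
      refine intervalIntegral.integral_congr fun q _ => ?_
      field_simp
    have h4 : ∫ q in a..R, φ q * (Complex.I * (t : ℂ))⁻¹ * quadPhase t q
        = (Complex.I * (t : ℂ))⁻¹ * ∫ q in a..R, quadPhase t q * φ q := by
      rw [← intervalIntegral.integral_const_mul]
      refine intervalIntegral.integral_congr fun q _ => ?_
      ring
    rw [h1, h3, hibp, h4, Complex.sub_re, Complex.sub_re]
    have h5 : |(κ' R * (Complex.I * (t : ℂ))⁻¹ * quadPhase t R).re| ≤ ‖κ' R‖ * t⁻¹ := by
      refine (Complex.abs_re_le_norm _).trans (le_of_eq ?_)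
      rw [norm_mul, norm_mul, norm_quadPhase, hItn, mul_one]
    have h6 : |((Complex.I * (t : ℂ))⁻¹ * ∫ q in a..R, quadPhase t q * φ q).re|
        ≤ 5 * B * (t⁻¹ * (√t)⁻¹) := by
      refine (Complex.abs_re_le_norm _).trans ?_
      rw [norm_mul, hItn]
      have := norm_integral_quadPhase_mul_le hφ' hφc hB hB' ht ha haR
      calc _ ≤ t⁻¹ * (5 * B * (√t)⁻¹) := by gcongr
        _ = _ := by ring
    have h7 := abs_sub ((κ' R * (Complex.I * (t : ℂ))⁻¹ * quadPhase t R).re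
      - (κ' a * (Complex.I * (t : ℂ))⁻¹ * quadPhase t a).re)
      ((Complex.I * (t : ℂ))⁻¹ * ∫ q in a..R, quadPhase t q * φ q).re
    have h8 := abs_sub (κ' R * (Complex.I * (t : ℂ))⁻¹ * quadPhase t R).re
      (κ' a * (Complex.I * (t : ℂ))⁻¹ * quadPhase t a).re
    linarith
  -- The half-line is exhausted by `(1/(n+1), n+1]`, so that the finite interval bound passes to the
  -- limit.
  let a : ℕ → ℝ := fun n => 1 / ((n : ℝ) + 1)
  let R : ℕ → ℝ := fun n => (n : ℝ) + 1
  have ha : ∀ n, 0 < a n := fun n => by simp only [a]; positivity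
  have ha0 : Tendsto a atTop (𝓝 0) := tendsto_one_div_add_atTop_nhds_zero_nat
  have hR : Tendsto R atTop atTop := tendsto_natCast_atTop_atTop.atTop_add tendsto_const_nhds
  have haR : ∀ n, a n ≤ R n := fun n => by
    simp only [a, R]
    have : (1 : ℝ) ≤ (n : ℝ) + 1 := by linarith [Nat.cast_nonneg (α := ℝ) n]
    exact (div_le_one_of_le₀ this (by positivity)).trans this
  have hU : ⋃ n, Ioc (a n) (R n) = Ioi 0 := by
    ext q
    simp only [mem_iUnion, mem_Ioc, mem_Ioi]
    refine ⟨fun ⟨n, hn⟩ => (ha n).trans hn.1, fun hq => ?_⟩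
    obtain ⟨n, hn⟩ := ((ha0.eventually_lt_const hq).and (hR.eventually_ge_atTop q)).exists
    exact ⟨n, hn⟩
  have hmono : Monotone fun n => Ioc (a n) (R n) := by
    intro n m hnm
    refine Ioc_subset_Ioc ?_ ?_
    · simp only [a]; gcongr
    · simp only [R]; gcongr
  have hlim := tendsto_setIntegral_of_monotone (fun n => measurableSet_Ioc) hmono
    (f := fun q => q * (quadPhase t q * κ' q).re) (μ := volume)
    (by rw [hU]; exact integrableOn_resHat_ray h hc hD t)
  rw [hU] at hlim
  have hκR : Tendsto (fun n => ‖κ' (R n)‖ * t⁻¹) atTop (𝓝 0) := by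
    have h1 : Tendsto (fun n => C * (R n)⁻¹ * t⁻¹) atTop (𝓝 0) := by
      simpa using (hR.inv_tendsto_atTop.const_mul C).mul_const t⁻¹
    refine squeeze_zero (fun n => by positivity) (fun n => ?_) h1
    have hRn : 1 ≤ R n := by simp only [R]; linarith [Nat.cast_nonneg (α := ℝ) n]
    have h2 := hb (R n) (by linarith)
    gcongr
    calc ‖κ' (R n)‖ ≤ R n * ‖κ' (R n)‖ := le_mul_of_one_le_left (norm_nonneg _) hRn
      _ ≤ C * (1 + R n ^ 2)⁻¹ := h2
      _ ≤ C * (R n)⁻¹ := by gcongr; nlinarith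
  -- The boundary term at zero frequency tends to the real part of `-1/(it)`, which vanishes because
  -- the threshold value `-1` is real. Otherwise it would leave a contribution of order `1/t`.
  have hκa : Tendsto (fun n => |(κ' (a n) * (Complex.I * t)⁻¹ * quadPhase t (a n)).re|) atTop
      (𝓝 0) := by
    have h1 : Tendsto a atTop (𝓝[Ici 0] 0) :=
      tendsto_nhdsWithin_iff.2 ⟨ha0, Eventually.of_forall fun n => (ha n).le⟩
    have h2 := (continuousWithinAt_resHat_ray hD).tendsto.comp h1
    have h3 := ((continuous_quadPhase t).tendsto 0).comp ha0
    have h4 := (Complex.continuous_re.tendsto _).comp ((h2.mul_const (Complex.I * (t : ℂ))⁻¹).mul h3)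
    have h5 := h4.abs
    have h0 : ray 0 = 0 := by simp [ray]
    have h6 : |(resHat w c (ray 0) * (Complex.I * (t : ℂ))⁻¹ * quadPhase t 0).re| = 0 := by
      rw [h0, resHat_zero h hc0]
      simp [quadPhase]
    rw [h6] at h5
    exact h5
  have hlim2 := (hκR.add hκa).add_const (5 * B * (t⁻¹ * (√t)⁻¹))
  rw [add_zero, zero_add] at hlim2
  refine le_of_tendsto_of_tendsto' hlim.abs hlim2 fun n => ?_
  rw [← intervalIntegral.integral_of_le (haR n)]
  exact hfin _ _ (ha n) (haR n)

/-- The integral of `K̇` over the half-line is `-1`, which together with `K 0 = 1` gives `K t =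
-∫_t^∞ K̇`; the decay of `K` follows from that of `K̇`. -/
theorem exists_abs_resolvent_le_rpow (h : IsComplexification W w) (hZ : 0 < Z κ M₀)
    (hK : IsResolvent κ M₀ W K) (hKc : Continuous K) (hN : NonResonant κ M₀ W) :
    ∃ C, 0 ≤ C ∧ ∀ t, 0 ≤ t → |K t| ≤ C * (1 + t) ^ (-(1 / 2) : ℝ)
      ∧ |resDeriv κ M₀ W K t| ≤ C * (1 + t) ^ (-(3 / 2) : ℝ) := by
  obtain ⟨c, hc0, hc⟩ := exists_lap_f_eq h hZ
  have hD : ∀ z ∈ sector, resDen w c z ≠ 0 := fun z hz => resDen_ne_zero h hZ hK hKc hc0 hc hN hz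
  obtain ⟨C₁, hC₁, h₁⟩ := exists_abs_resDeriv_le_rpow h hZ hK hKc hc0 hc hD
  obtain ⟨C₂, hC₂, h₂⟩ := exists_abs_resDeriv_le hZ h hK hKc
  obtain ⟨C, hC, hk⟩ : ∃ C, 0 ≤ C ∧ ∀ t, 0 ≤ t →
      |resDeriv κ M₀ W K t| ≤ C * (1 + t) ^ (-(3 / 2) : ℝ) := by
    refine ⟨_, ?_, fun t ht => le_one_add_rpow (p := 3 / 2) (by norm_num) ht hC₂ hC₁ (h₂ t ht)
      fun ht' => ?_⟩
    · positivity
    · refine (h₁ t ht').trans (le_of_eq ?_)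
      congr 1
      rw [Real.sqrt_eq_rpow, ← Real.rpow_neg ht, ← Real.rpow_neg_one t, ← Real.rpow_add ht']
      norm_num
  have hkc := continuous_resDeriv (κ := κ) (M₀ := M₀) h hKc
  have hki := integrableOn_of_abs_le hkc hk
  have hkir : IntegrableOn (resDeriv κ M₀ W K) (Ioi 0) := by
    have := hki.re
    simp only [RCLike.re_to_complex, Complex.ofReal_re] at this
    exact this
  -- The integral is the Laplace transform at `λ = 0`; it is computed as the limit along `λ = q²`
  -- with `q` decreasing to zero.
  have hint : ∫ t in Ioi (0 : ℝ), resDeriv κ M₀ W K t = -1 := by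
    have h3 : Tendsto (fun q : ℝ => lap (fun t => (resDeriv κ M₀ W K t : ℂ)) ((q : ℂ) ^ 2)) (𝓝[>] 0)
        (𝓝 (lap (fun t => (resDeriv κ M₀ W K t : ℂ)) 0)) := by
      have h4 : ContinuousWithinAt (lap (fun t => (resDeriv κ M₀ W K t : ℂ))) {z | 0 ≤ z.re}
          (((0 : ℝ) : ℂ) ^ 2) := continuousOn_lap hki _ (by simp)
      have h5 : ContinuousWithinAt (fun q : ℝ => lap (fun t => (resDeriv κ M₀ W K t : ℂ))
          ((q : ℂ) ^ 2)) (Ioi 0) 0 :=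
        ContinuousWithinAt.comp (g := lap (fun t => (resDeriv κ M₀ W K t : ℂ)))
          (f := fun q : ℝ => (q : ℂ) ^ 2) (t := {z | 0 ≤ z.re}) h4
          (Continuous.continuousWithinAt (by fun_prop)) fun q _ => by
            show (0 : ℝ) ≤ ((q : ℂ) ^ 2).re
            rw [← Complex.ofReal_pow, Complex.ofReal_re]
            positivity
      have h6 : ((0 : ℝ) : ℂ) ^ 2 = 0 := by simp
      have h7 := h5.tendsto
      simp only [h6] at h7
      exact h7
    have h8 : Tendsto (fun q : ℝ => resHat w c q) (𝓝[>] 0) (𝓝 (resHat w c 0)) := by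
      have h9 : ContinuousWithinAt (fun q : ℝ => resHat w c q) (Ioi 0) 0 :=
        ContinuousWithinAt.comp (g := resHat w c) (f := fun q : ℝ => (q : ℂ)) (t := sector)
          (continuousOn_resHat hD _ (by simp [sector])) (Continuous.continuousWithinAt (by fun_prop))
          fun q hq => by simpa [sector] using le_of_lt hq
      simpa using h9.tendsto
    have h10 : lap (fun t => (resDeriv κ M₀ W K t : ℂ)) 0 = -1 := by
      rw [← resHat_zero h hc0]
      refine tendsto_nhds_unique h3 (h8.congr' ?_)
      filter_upwards [self_mem_nhdsWithin] with q hq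
      rw [lap_resDeriv_eq h hZ hK hKc hc]
      simpa using hq
    have h11 : lap (fun t => (resDeriv κ M₀ W K t : ℂ)) 0
        = ((∫ t in Ioi (0 : ℝ), resDeriv κ M₀ W K t : ℝ) : ℂ) := by
      rw [← integral_complex_ofReal]
      simp [lap]
    rw [h11] at h10
    exact_mod_cast h10
  -- The factor `2` comes from integrating `(1 + s)^{-3/2}` over `[t, ∞)`.
  refine ⟨2 * C, by positivity, fun t ht => ⟨?_, (hk t ht).trans ?_⟩⟩
  · have hftc : ∫ s in (0 : ℝ)..t, resDeriv κ M₀ W K s = K t - K 0 :=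
      intervalIntegral.integral_eq_sub_of_hasDeriv_right hKc.continuousOn
        (fun x hx => by
          rw [min_eq_left ht, max_eq_right ht] at hx
          exact (hK.2 x hx.1.le).mono (Ioi_subset_Ici hx.1.le)) (hkc.intervalIntegrable _ _)
    have hsplit := intervalIntegral.integral_interval_add_Ioi hkir
      (hkir.mono_set (Ioi_subset_Ioi ht))
    rw [hftc, hint, hK.1] at hsplit
    have hKt : K t = -∫ s in Ioi t, resDeriv κ M₀ W K s := by linarith
    have hmaj : IntegrableOn (fun s : ℝ => C * (1 + s) ^ (-(3 / 2) : ℝ)) (Ioi t) :=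
      (integrableOn_one_add_rpow.mono_set (Ioi_subset_Ioi ht)).const_mul C
    rw [hKt, abs_neg]
    have h12 : ‖∫ s in Ioi t, resDeriv κ M₀ W K s‖ ≤ ∫ s in Ioi t, C * (1 + s) ^ (-(3 / 2) : ℝ) := by
      refine norm_integral_le_of_norm_le hmaj ?_
      filter_upwards [ae_restrict_mem measurableSet_Ioi] with s hs
      exact hk s (ht.trans (le_of_lt hs))
    refine h12.trans (le_of_eq ?_)
    rw [integral_const_mul]
    have h13 := integral_Ioi_of_hasDerivAt_of_tendsto' (a := t) (m := 0)
      (f := fun s : ℝ => -2 * (1 + s) ^ (-(1 / 2) : ℝ)) (f' := fun s : ℝ => (1 + s) ^ (-(3 / 2) : ℝ))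
      (fun s hs => by
        have hs' : 0 ≤ s := ht.trans hs
        have h14 := (((hasDerivAt_id s).const_add 1).rpow_const (p := -(1 / 2))
          (Or.inl (by simp only [id]; linarith))).const_mul (-2)
        refine h14.congr_deriv ?_
        simp only [id]
        norm_num
        ring)
      (integrableOn_one_add_rpow.mono_set (Ioi_subset_Ioi ht)) ?_
    · rw [h13]; ring
    · have h1 : Tendsto (fun t : ℝ => 1 + t) atTop atTop :=
        tendsto_atTop_add_const_left _ _ tendsto_id
      have h2 := ((tendsto_rpow_neg_atTop (y := 1 / 2) (by norm_num)).comp h1).const_mul (-2)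
      rw [mul_zero] at h2
      exact h2
  · have : 0 ≤ (1 + t) ^ (-(3 / 2) : ℝ) := by positivity
    nlinarith

/-- If `K` returned to `1` at a positive time it would be periodic by the energy identity,
contradicting its decay. The uniform gap then follows from compactness on a bounded interval and
from `K → 0` beyond it; it needs `T > 0` since `K 0 = 1`. -/
theorem exists_one_sub_resolvent_ge (h : IsComplexification W w) (hZ : 0 < Z κ M₀)
    (hK : IsResolvent κ M₀ W K) (hKc : Continuous K) (hN : NonResonant κ M₀ W) {T : ℝ}
    (hT : 0 < T) : ∃ d, 0 < d ∧ ∀ t, T ≤ t → d ≤ 1 - K t := by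
  obtain ⟨C, hC, hb⟩ := exists_abs_resolvent_le_rpow h hZ hK hKc hN
  have hlim : Tendsto K atTop (𝓝 0) := by
    have h1 : Tendsto (fun t : ℝ => 1 + t) atTop atTop := tendsto_atTop_add_const_left _ _ tendsto_id
    have h2 := ((tendsto_rpow_neg_atTop (y := 1 / 2) (by norm_num)).comp h1).const_mul C
    rw [mul_zero] at h2
    refine squeeze_zero_norm' ?_ h2
    filter_upwards [eventually_ge_atTop 0] with t ht
    exact (hb t ht).1
  have hlt : ∀ t, 0 < t → K t < 1 := by
    intro t ht
    refine lt_of_le_of_ne ((le_abs_self _).trans (abs_resolvent_le hZ h hK hKc ht.le)) fun h1 => ?_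
    have hper : ∀ n : ℕ, K (n * t) = 1 := by
      intro n
      induction n with
      | zero => simpa using hK.1
      | succ n ih =>
        have := (hK.isHomSolution hKc).periodic hZ h ht.le (by rw [h1, hK.1]) (t := n * t)
          (by positivity)
        rw [← ih, ← this]
        congr 1
        push_cast
        ring
    have h2 : Tendsto (fun n : ℕ => K (n * t)) atTop (𝓝 0) :=
      hlim.comp (tendsto_natCast_atTop_atTop.atTop_mul_const ht)
    simp only [hper] at h2
    exact one_ne_zero (tendsto_nhds_unique tendsto_const_nhds h2)
  obtain ⟨T₁, hT₁⟩ := (hlim.eventually_lt_const (show (0 : ℝ) < 1 / 2 by norm_num)).exists_forall_of_atTop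
  obtain ⟨t₀, ht₀, hmax⟩ := isCompact_Icc.exists_isMaxOn (s := Icc T (max T T₁))
    ⟨T, le_rfl, le_max_left _ _⟩ hKc.continuousOn
  have hpos : 0 < 1 - K t₀ := sub_pos.2 (hlt t₀ (hT.trans_le ht₀.1))
  refine ⟨min (1 - K t₀) (1 / 2), by positivity, fun t ht => ?_⟩
  rcases le_total t (max T T₁) with h1 | h1
  · have : K t ≤ K t₀ := hmax ⟨ht, h1⟩
    exact (min_le_left _ _).trans (by linarith)
  · have := hT₁ t ((le_max_right _ _).trans h1)
    exact (min_le_right _ _).trans (by linarith)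

end Friction

end

/-! ### Decay of the inhomogeneous term along stopped trajectories -/

noncomputable section

namespace Friction

open LineDeriv

/-! ### Convolution with the resolvent -/

/-- Quantitative decay of a resolvent `K` with derivative `k`. -/
structure HasResolventDecay (C : ℝ) (K k : ℝ → ℝ) : Prop where
  nonneg : 0 ≤ C
  cont : Continuous K
  cont_deriv : Continuous k
  deriv : ∀ t, 0 ≤ t → HasDerivWithinAt K (k t) (Ici 0) t
  le : ∀ t, 0 ≤ t → |K t| ≤ C * (1 + t) ^ (-(1 / 2) : ℝ)
  deriv_le : ∀ t, 0 ≤ t → |k t| ≤ C * (1 + t) ^ (-(3 / 2) : ℝ)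

namespace HasResolventDecay

variable {C : ℝ} {K k : ℝ → ℝ}

lemma le_const (h : HasResolventDecay C K k) {t : ℝ} (ht : 0 ≤ t) : |K t| ≤ C := by
  refine (h.le t ht).trans ?_
  have : (1 + t) ^ (-(1 / 2) : ℝ) ≤ 1 :=
    Real.rpow_le_one_of_one_le_of_nonpos (by linarith) (by norm_num)
  nlinarith [h.nonneg]

lemma abs_sub_le_const (h : HasResolventDecay C K k) {s t : ℝ} (hs : 0 ≤ s) (hst : s ≤ t) :
    |K (t - s) - K t| ≤ 2 * C := by
  have h1 := h.le_const (sub_nonneg.2 hst)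
  have h2 := h.le_const (hs.trans hst)
  calc |K (t - s) - K t| ≤ |K (t - s)| + |K t| := abs_sub _ _
    _ ≤ 2 * C := by linarith

/-- Mean value inequality on `[t - s, t]`, where the bound for the derivative is largest at the left
end. Subtracting `K t` thus gives the rate `t^{-3/2}` for early times, although `K` itself decays
only like `t^{-1/2}`. -/
lemma abs_sub_le (h : HasResolventDecay C K k) {s t : ℝ} (hs : 0 ≤ s) (hst : s ≤ t) :
    |K (t - s) - K t| ≤ C * (1 + (t - s)) ^ (-(3 / 2) : ℝ) * s := by
  have key := norm_image_sub_le_of_norm_deriv_le_segment' (f := K) (f' := k) (a := t - s) (b := t)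
    (C := C * (1 + (t - s)) ^ (-(3 / 2) : ℝ))
    (fun x hx => (h.deriv x (by linarith [hx.1])).mono (fun y hy => by
      simp only [mem_Ici]; linarith [hy.1]))
    (fun x hx => by
      rw [Real.norm_eq_abs]
      refine (h.deriv_le x (by linarith [hx.1])).trans ?_
      refine mul_le_mul_of_nonneg_left ?_ h.nonneg
      exact Real.rpow_le_rpow_of_nonpos (by linarith) (by linarith [hx.1]) (by norm_num))
    t ⟨by linarith, le_rfl⟩
  rw [← abs_neg, neg_sub, ← Real.norm_eq_abs]
  simpa using key

lemma abs_sub_le_half (h : HasResolventDecay C K k) {s t : ℝ} (hs : 0 ≤ s) (ht : 0 < t)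
    (hst : s ≤ t / 2) : |K (t - s) - K t| ≤ C * (t / 2) ^ (-(3 / 2) : ℝ) * s := by
  refine (h.abs_sub_le hs (by linarith)).trans ?_
  refine mul_le_mul_of_nonneg_right (mul_le_mul_of_nonneg_left ?_ h.nonneg) hs
  exact Real.rpow_le_rpow_of_nonpos (by linarith) (by linarith) (by norm_num)

end HasResolventDecay

/-- `∫_{s₁}^{s₂} s^p ds ≤ s₂^{p+1} / (p+1)` for `p > -1`. -/
lemma integral_rpow_le_of_neg_one_lt {p s₁ s₂ : ℝ} (hp : -1 < p) (h₁ : 0 ≤ s₁) :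
    ∫ s in s₁..s₂, s ^ p ≤ s₂ ^ (p + 1) / (p + 1) := by
  rw [integral_rpow (Or.inl hp)]
  have : 0 ≤ s₁ ^ (p + 1) := Real.rpow_nonneg h₁ _
  have hp' : 0 < p + 1 := by linarith
  gcongr
  linarith

lemma rpow_le_mul_rpow_of_le {p q T t : ℝ} (hT : 0 < T) (ht : T ≤ t) (hpq : p ≤ q) :
    t ^ p ≤ T ^ (p - q) * t ^ q := by
  have ht0 : 0 < t := hT.trans_le ht
  calc t ^ p = t ^ (p - q) * t ^ q := by rw [← Real.rpow_add ht0]; congr 1; ring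
    _ ≤ _ := mul_le_mul_of_nonneg_right
      (Real.rpow_le_rpow_of_nonpos hT ht (by linarith)) (Real.rpow_nonneg ht0.le _)

/-- Convolution with a fast decaying remainder. -/
lemma HasResolventDecay.exists_norm_integral_le_of_decay {C : ℝ} {K k : ℝ → ℝ}
    (h : HasResolventDecay C K k) {T : ℝ} (hT : 0 < T) :
    ∃ D : ℝ, 0 ≤ D ∧ ∀ (n : ℝ → R3) (B : ℝ), 0 ≤ B →
      (∀ s, T ≤ s → ‖n s‖ ≤ B * s ^ (-(5 / 2) : ℝ)) → ∀ t, T ≤ t →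
      ‖∫ s in T..t, (K (t - s) - K t) • n s‖ ≤ D * B * t ^ (-(5 / 4) : ℝ) := by
  have hC := h.nonneg
  set a : ℝ := C * 2 ^ ((3 / 2) : ℝ) * (2 * T ^ (-(1 / 2) : ℝ)) + 2 * C * 2 ^ ((5 / 2) : ℝ) with ha
  have ha0 : 0 ≤ a := by positivity
  refine ⟨a * T ^ (-(3 / 2) - -(5 / 4) : ℝ), by positivity, fun n B hB hn t ht => ?_⟩
  have ht0 : 0 < t := hT.trans_le ht
  have e32 : (t / 2) ^ (-(3 / 2) : ℝ) = 2 ^ ((3 / 2) : ℝ) * t ^ (-(3 / 2) : ℝ) := by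
    rw [Real.div_rpow ht0.le (by norm_num), Real.rpow_neg (by norm_num : (0:ℝ) ≤ 2)]
    field_simp
  have e52 : (t / 2) ^ (-(5 / 2) : ℝ) = 2 ^ ((5 / 2) : ℝ) * t ^ (-(5 / 2) : ℝ) := by
    rw [Real.div_rpow ht0.le (by norm_num), Real.rpow_neg (by norm_num : (0:ℝ) ≤ 2)]
    field_simp
  have hint : IntervalIntegrable (fun s : ℝ => C * (t / 2) ^ (-(3 / 2) : ℝ) * B * s ^ (-(3 / 2) : ℝ)
      + 2 * C * B * (t / 2) ^ (-(5 / 2) : ℝ)) volume T t :=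
    ((intervalIntegrable_rpow_pos hT ht).const_mul _).add intervalIntegrable_const
  have hbd : ∀ s ∈ Ioc T t, ‖(K (t - s) - K t) • n s‖ ≤
      C * (t / 2) ^ (-(3 / 2) : ℝ) * B * s ^ (-(3 / 2) : ℝ)
      + 2 * C * B * (t / 2) ^ (-(5 / 2) : ℝ) := by
    intro s hs
    have hs0 : 0 < s := hT.trans hs.1
    rw [norm_smul, Real.norm_eq_abs]
    have h1 := hn s hs.1.le
    -- Early times use the cancellation in `K (t - s) - K t`, late times the decay of `n`.
    rcases le_total s (t / 2) with hst | hst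
    · have h2 := h.abs_sub_le_half hs0.le ht0 hst
      calc _ ≤ (C * (t / 2) ^ (-(3 / 2) : ℝ) * s) * (B * s ^ (-(5 / 2) : ℝ)) := by gcongr
        _ = C * (t / 2) ^ (-(3 / 2) : ℝ) * B * s ^ (-(3 / 2) : ℝ) := by
          have : s ^ (-(3 / 2) : ℝ) = s * s ^ (-(5 / 2) : ℝ) := by
            rw [← Real.rpow_one_add' hs0.le (by norm_num)]; norm_num
          rw [this]; ring
        _ ≤ _ := by
          have : 0 ≤ 2 * C * B * (t / 2) ^ (-(5 / 2) : ℝ) := by positivity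
          linarith
    · have h2 := h.abs_sub_le_const hs0.le hs.2
      have h3 : s ^ (-(5 / 2) : ℝ) ≤ (t / 2) ^ (-(5 / 2) : ℝ) :=
        Real.rpow_le_rpow_of_nonpos (by linarith) hst (by norm_num)
      calc _ ≤ (2 * C) * (B * (t / 2) ^ (-(5 / 2) : ℝ)) := by
            gcongr; exact h1.trans (mul_le_mul_of_nonneg_left h3 hB)
        _ ≤ _ := by
          have : 0 ≤ C * (t / 2) ^ (-(3 / 2) : ℝ) * B * s ^ (-(3 / 2) : ℝ) := by positivity
          linarith
  have hle := intervalIntegral.norm_integral_le_of_norm_le ht (ae_of_all _ hbd) hint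
  rw [intervalIntegral.integral_add ((intervalIntegrable_rpow_pos hT ht).const_mul _)
    intervalIntegrable_const, intervalIntegral.integral_const_mul,
    intervalIntegral.integral_const, smul_eq_mul] at hle
  have i1 : ∫ s in T..t, s ^ (-(3 / 2) : ℝ) ≤ 2 * T ^ (-(1 / 2) : ℝ) := by
    have := integral_rpow_le (p := -(3 / 2)) (by norm_num) hT ht
    norm_num at this ⊢
    linarith
  have i2 : (t - T) * (2 * C * B * (t / 2) ^ (-(5 / 2) : ℝ)) ≤
      2 * C * B * 2 ^ ((5 / 2) : ℝ) * t ^ (-(3 / 2) : ℝ) := by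
    have : t ^ (-(3 / 2) : ℝ) = t * t ^ (-(5 / 2) : ℝ) := by
      rw [← Real.rpow_one_add' ht0.le (by norm_num)]; norm_num
    rw [e52, this]
    calc _ ≤ t * (2 * C * B * (2 ^ ((5 / 2) : ℝ) * t ^ (-(5 / 2) : ℝ))) := by gcongr; linarith
      _ = _ := by ring
  have hfin : ‖∫ s in T..t, (K (t - s) - K t) • n s‖ ≤ a * B * t ^ (-(3 / 2) : ℝ) := by
    refine hle.trans ?_
    rw [e32]
    calc _ ≤ C * (2 ^ ((3 / 2) : ℝ) * t ^ (-(3 / 2) : ℝ)) * B * (2 * T ^ (-(1 / 2) : ℝ))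
          + 2 * C * B * 2 ^ ((5 / 2) : ℝ) * t ^ (-(3 / 2) : ℝ) := by gcongr
      _ = _ := by rw [ha]; ring
  -- The rate obtained is `t^{-3/2}`; it is weakened to the rate of the oscillating part, the factor
  -- `T^{-1/4}` going into the constant.
  refine hfin.trans ?_
  calc _ ≤ a * B * (T ^ (-(3 / 2) - -(5 / 4) : ℝ) * t ^ (-(5 / 4) : ℝ)) := by
        gcongr; exact rpow_le_mul_rpow_of_le hT ht (by norm_num)
    _ = _ := by ring

/-- Integration by parts in the convolution with a resolvent difference. -/
lemma HasResolventDecay.integral_smul_eq {C : ℝ} {K k : ℝ → ℝ}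
    (h : HasResolventDecay C K k) {T t : ℝ} (ht : T ≤ t) {n : ℝ → R3}
    (hn : Continuous n) :
    ∫ s in T..t, (K (t - s) - K t) • n s =
      (K (t - T) - K t) • (∫ u in T..t, n u) - ∫ s in T..t, k (t - s) • ∫ u in s..t, n u := by
  have hu : ∀ s ∈ Ioo T t, HasDerivAt (fun s => K (t - s) - K t) (-k (t - s)) s := by
    intro s hs
    have h1 : HasDerivAt K (k (t - s)) (t - s) :=
      (h.deriv (t - s) (by linarith [hs.2])).hasDerivAt (Ici_mem_nhds (by linarith [hs.2]))
    have := (h1.comp_const_sub t s).sub_const (K t)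
    simpa using this
  have hv : ∀ s, HasDerivAt (fun s => ∫ u in s..t, n u) (-n s) s := fun s =>
    intervalIntegral.integral_hasDerivAt_left (hn.intervalIntegrable _ _)
      (hn.stronglyMeasurableAtFilter _ _) hn.continuousAt
  have hvc : Continuous fun s => ∫ u in s..t, n u :=
    continuous_iff_continuousAt.2 fun s => (hv s).continuousAt
  have hK := h.cont
  have hk := h.cont_deriv
  have key := intervalIntegral.integral_smul_deriv_eq_deriv_smul_of_hasDerivAt
    (a := T) (b := t) (u := fun s => K (t - s) - K t) (v := fun s => ∫ u in s..t, n u)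
    (u' := fun s => -k (t - s)) (v' := fun s => -n s)
    (by fun_prop) hvc.continuousOn
    (fun s hs => hu s (by simpa [min_eq_left ht, max_eq_right ht] using hs)) (fun s _ => hv s)
    ((by fun_prop : Continuous fun s => -k (t - s)).intervalIntegrable _ _)
    (hn.neg.intervalIntegrable _ _)
  simp only [smul_neg, neg_smul, intervalIntegral.integral_neg, intervalIntegral.integral_same,
    smul_zero, zero_sub, sub_neg_eq_add] at key
  rw [← neg_neg (∫ s in T..t, (K (t - s) - K t) • n s), key]
  abel

/-- Convolution with a remainder that decays slowly but oscillates. -/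
lemma HasResolventDecay.exists_norm_integral_le_of_oscillation {C : ℝ} {K k : ℝ → ℝ}
    (h : HasResolventDecay C K k) {T : ℝ} (hT : 0 < T) :
    ∃ D : ℝ, 0 ≤ D ∧ ∀ (n : ℝ → R3) (B : ℝ), 0 ≤ B → Continuous n →
      (∀ s, T ≤ s → ‖n s‖ ≤ B * s ^ (-(3 / 2) : ℝ)) →
      (∀ s₁ s₂, T ≤ s₁ → s₁ ≤ s₂ → ‖∫ s in s₁..s₂, n s‖ ≤ B / s₁) → ∀ t, T ≤ t →
      ‖∫ s in T..t, (K (t - s) - K t) • n s‖ ≤ D * B * t ^ (-(5 / 4) : ℝ) := by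
  have hC := h.nonneg
  -- Times below `t₀` are absorbed into the constant. For `t ≥ 4` one has `√t ≤ t/2`, and `t ≥ 2T`
  -- then gives `T ≤ t - √t`.
  set t₀ : ℝ := max 4 (2 * T) with ht₀
  have ht₀4 : 4 ≤ t₀ := le_max_left _ _
  set D₁ : ℝ := 2 * C * T ^ (-(3 / 2) : ℝ) * t₀ * t₀ ^ ((5 / 4) : ℝ) with hD₁
  set b : ℝ := 2 ^ ((3 / 2) : ℝ) with hb
  have hb0 : 0 < b := by positivity
  set D₂ : ℝ := C * b + C * b * T ^ (-(1 / 4) : ℝ) * 4 + 4 * C + C * b * 2 with hD₂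
  have hD₁0 : 0 ≤ D₁ := by positivity
  have hD₂0 : 0 ≤ D₂ := by positivity
  refine ⟨D₁ + D₂, by positivity, fun n B hB hnc hn hnI t ht => ?_⟩
  have ht0 : 0 < t := hT.trans_le ht
  have hr : 0 ≤ t ^ (-(5 / 4) : ℝ) := by positivity
  rcases le_total t t₀ with hsmall | hlarge
  · have h1 : ‖∫ s in T..t, (K (t - s) - K t) • n s‖ ≤
        (2 * C * (B * T ^ (-(3 / 2) : ℝ))) * |t - T| := by
      refine intervalIntegral.norm_integral_le_of_norm_le_const fun s hs => ?_
      rw [uIoc_of_le ht] at hs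
      rw [norm_smul, Real.norm_eq_abs]
      have h2 := h.abs_sub_le_const (hT.le.trans hs.1.le) hs.2
      have h3 : s ^ (-(3 / 2) : ℝ) ≤ T ^ (-(3 / 2) : ℝ) :=
        Real.rpow_le_rpow_of_nonpos hT hs.1.le (by norm_num)
      exact mul_le_mul h2 ((hn s hs.1.le).trans (mul_le_mul_of_nonneg_left h3 hB))
        (norm_nonneg _) (by positivity)
    have h4 : 1 ≤ t₀ ^ ((5 / 4) : ℝ) * t ^ (-(5 / 4) : ℝ) := by
      rw [Real.rpow_neg ht0.le, ← div_eq_mul_inv, one_le_div (by positivity)]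
      exact Real.rpow_le_rpow ht0.le hsmall (by norm_num)
    have h5 : |t - T| ≤ t₀ := by rw [abs_of_nonneg (by linarith)]; linarith
    calc _ ≤ (2 * C * (B * T ^ (-(3 / 2) : ℝ))) * t₀ := h1.trans (by gcongr)
      _ ≤ (2 * C * (B * T ^ (-(3 / 2) : ℝ))) * t₀ * (t₀ ^ ((5 / 4) : ℝ) * t ^ (-(5 / 4) : ℝ)) :=
        le_mul_of_one_le_right (by positivity) h4
      _ = D₁ * B * t ^ (-(5 / 4) : ℝ) := by rw [hD₁]; ring
      _ ≤ _ := by gcongr; linarith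
  have ht4 : 4 ≤ t := ht₀4.trans hlarge
  have ht2T : 2 * T ≤ t := (le_max_right _ _).trans hlarge
  set r : ℝ := √t with hrdef
  have hr2 : r * r = t := Real.mul_self_sqrt ht0.le
  have hr_ge : 2 ≤ r := Real.le_sqrt_of_sq_le (by linarith)
  have hrhalf : r ≤ t / 2 := by nlinarith
  have hr0 : 0 < r := by linarith
  -- The cut balances two bounds for the tail integral `Ψ s = ∫_s^t n`. On `[t/2, m]`, `Ψ ≲ 1/t` and
  -- the integral of `k (t - s)` is `O(t^{-1/4})`. On `[m, t]`, `Ψ ≲ t^{-3/2} (t - s)`, and the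
  -- product with `k` integrates to `t^{-3/2} t^{1/4}`. Both equal `t^{-5/4}`.
  set m : ℝ := t - r with hm
  have hTm : T ≤ m := by linarith
  have hmt : m ≤ t := by linarith
  have rp : ∀ p : ℝ, r ^ p = t ^ (p / 2) := fun p => by
    rw [hrdef, Real.sqrt_eq_rpow, ← Real.rpow_mul ht0.le]; congr 1; ring
  have e32 : (t / 2) ^ (-(3 / 2) : ℝ) = b * t ^ (-(3 / 2) : ℝ) := by
    rw [Real.div_rpow ht0.le (by norm_num), Real.rpow_neg (by norm_num : (0:ℝ) ≤ 2)]
    field_simp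
    exact hb.symm
  have hle54 : t ^ (-(3 / 2) : ℝ) ≤ t ^ (-(5 / 4) : ℝ) :=
    Real.rpow_le_rpow_of_exponent_le (by linarith) (by norm_num)
  set Ψ : ℝ → R3 := fun s => ∫ u in s..t, n u with hΨ
  have hΨ1 : ∀ s, T ≤ s → s ≤ t → ‖Ψ s‖ ≤ B / s := fun s h1 h2 => hnI s t h1 h2
  have hΨ2 : ∀ s, t / 2 ≤ s → s ≤ t → ‖Ψ s‖ ≤ B * (b * t ^ (-(3 / 2) : ℝ)) * (t - s) := by
    intro s h1 h2
    have : ‖Ψ s‖ ≤ B * (b * t ^ (-(3 / 2) : ℝ)) * |t - s| := by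
      refine intervalIntegral.norm_integral_le_of_norm_le_const fun u hu => ?_
      rw [uIoc_of_le h2] at hu
      refine (hn u (by linarith [hu.1])).trans ?_
      rw [← e32]
      exact mul_le_mul_of_nonneg_left
        (Real.rpow_le_rpow_of_nonpos (by linarith) (by linarith [hu.1]) (by norm_num)) hB
    rwa [abs_of_nonneg (by linarith)] at this
  have hΨc : Continuous Ψ := by
    refine continuous_iff_continuousAt.2 fun s => ?_
    exact (intervalIntegral.integral_hasDerivAt_left (hnc.intervalIntegrable _ _)
      (hnc.stronglyMeasurableAtFilter _ _) hnc.continuousAt).continuousAt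
  have hkc := h.cont_deriv
  have hgc : Continuous fun s => k (t - s) • Ψ s := by fun_prop
  rw [h.integral_smul_eq ht hnc,
    ← intervalIntegral.integral_add_adjacent_intervals (hgc.intervalIntegrable T m)
      (hgc.intervalIntegrable m t)]
  have b1 : ‖(K (t - T) - K t) • Ψ T‖ ≤ C * b * B * t ^ (-(5 / 4) : ℝ) := by
    rw [norm_smul, Real.norm_eq_abs]
    have h1 := h.abs_sub_le_half hT.le ht0 (by linarith)
    calc _ ≤ (C * (t / 2) ^ (-(3 / 2) : ℝ) * T) * (B / T) := by
          gcongr; exact hΨ1 T le_rfl ht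
      _ = C * b * B * t ^ (-(3 / 2) : ℝ) := by rw [e32]; field_simp
      _ ≤ _ := by gcongr
  have b2 : ‖∫ s in T..m, k (t - s) • Ψ s‖ ≤
      (C * b * T ^ (-(1 / 4) : ℝ) * 4 + 4 * C) * B * t ^ (-(5 / 4) : ℝ) := by
    have hI1 : IntervalIntegrable (fun s : ℝ => s ^ (-(3 / 4) : ℝ)) volume T m :=
      intervalIntegrable_rpow_pos hT hTm
    have hI2 : IntervalIntegrable (fun s : ℝ => (t - s) ^ (-(3 / 2) : ℝ)) volume T m := by
      have := (intervalIntegrable_rpow_pos (p := -(3 / 2)) hr0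
        (by linarith : r ≤ t - T)).comp_sub_left t
      simpa [hm] using this.symm
    have hbd : ∀ s ∈ Ioc T m, ‖k (t - s) • Ψ s‖ ≤
        C * (b * t ^ (-(3 / 2) : ℝ)) * B * T ^ (-(1 / 4) : ℝ) * s ^ (-(3 / 4) : ℝ)
        + 2 * B / t * C * (t - s) ^ (-(3 / 2) : ℝ) := by
      intro s hs
      have hs0 : 0 < s := hT.trans hs.1
      have hts : 0 < t - s := by linarith [hs.2]
      rw [norm_smul, Real.norm_eq_abs]
      have h1 := h.deriv_le (t - s) hts.le
      have h2 := hΨ1 s hs.1.le (hs.2.trans hmt)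
      rcases le_total s (t / 2) with hst | hst
      · have h3 : (1 + (t - s)) ^ (-(3 / 2) : ℝ) ≤ (t / 2) ^ (-(3 / 2) : ℝ) :=
          Real.rpow_le_rpow_of_nonpos (by linarith) (by linarith) (by norm_num)
        have h4 : s⁻¹ ≤ T ^ (-(1 / 4) : ℝ) * s ^ (-(3 / 4) : ℝ) := by
          have := rpow_le_mul_rpow_of_le (p := -1) (q := -(3 / 4)) hT hs.1.le (by norm_num)
          rw [Real.rpow_neg_one] at this
          norm_num at this ⊢
          exact this
        calc _ ≤ (C * (b * t ^ (-(3 / 2) : ℝ))) * (B * (T ^ (-(1 / 4) : ℝ) * s ^ (-(3 / 4) : ℝ))) := by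
              refine mul_le_mul (h1.trans ?_) (h2.trans ?_) (norm_nonneg _) (by positivity)
              · rw [← e32]; gcongr
              · rw [div_eq_mul_inv]; gcongr
          _ = C * (b * t ^ (-(3 / 2) : ℝ)) * B * T ^ (-(1 / 4) : ℝ) * s ^ (-(3 / 4) : ℝ) := by ring
          _ ≤ _ := by
            have : 0 ≤ 2 * B / t * C * (t - s) ^ (-(3 / 2) : ℝ) := by positivity
            linarith
      · have h3 : (1 + (t - s)) ^ (-(3 / 2) : ℝ) ≤ (t - s) ^ (-(3 / 2) : ℝ) :=
          Real.rpow_le_rpow_of_nonpos hts (by linarith) (by norm_num)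
        have h4 : B / s ≤ 2 * B / t := by
          rw [div_le_div_iff₀ hs0 ht0]; nlinarith
        calc _ ≤ (C * (t - s) ^ (-(3 / 2) : ℝ)) * (2 * B / t) :=
              mul_le_mul (h1.trans (by gcongr)) (h2.trans h4) (norm_nonneg _) (by positivity)
          _ = 2 * B / t * C * (t - s) ^ (-(3 / 2) : ℝ) := by ring
          _ ≤ _ := by
            have : 0 ≤ C * (b * t ^ (-(3 / 2) : ℝ)) * B * T ^ (-(1 / 4) : ℝ)
              * s ^ (-(3 / 4) : ℝ) := by positivity
            linarith
    have hle := intervalIntegral.norm_integral_le_of_norm_le hTm (ae_of_all _ hbd)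
      ((hI1.const_mul _).add (hI2.const_mul _))
    rw [intervalIntegral.integral_add (hI1.const_mul _) (hI2.const_mul _),
      intervalIntegral.integral_const_mul, intervalIntegral.integral_const_mul] at hle
    have i1 : ∫ s in T..m, s ^ (-(3 / 4) : ℝ) ≤ 4 * t ^ ((1 / 4) : ℝ) := by
      have h1 := integral_rpow_le_of_neg_one_lt (p := -(3 / 4)) (s₂ := m) (by norm_num) hT.le
      have h2 : m ^ ((1 / 4) : ℝ) ≤ t ^ ((1 / 4) : ℝ) :=
        Real.rpow_le_rpow (by linarith) hmt (by norm_num)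
      norm_num at h1 h2 ⊢
      linarith
    have i2 : ∫ s in T..m, (t - s) ^ (-(3 / 2) : ℝ) ≤ 2 * t ^ (-(1 / 4) : ℝ) := by
      rw [intervalIntegral.integral_comp_sub_left (fun s => s ^ (-(3 / 2) : ℝ)) t]
      have h1 := integral_rpow_le (p := -(3 / 2)) (by norm_num) hr0
        (by linarith : r ≤ t - T)
      have h2 := rp (-(1 / 2))
      rw [hm, sub_sub_cancel]
      norm_num at h1 h2 ⊢
      rw [h2] at h1
      linarith
    have p1 : t ^ (-(3 / 2) : ℝ) * t ^ ((1 / 4) : ℝ) = t ^ (-(5 / 4) : ℝ) := by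
      rw [← Real.rpow_add ht0]; norm_num
    have p2 : t⁻¹ * t ^ (-(1 / 4) : ℝ) = t ^ (-(5 / 4) : ℝ) := by
      rw [← Real.rpow_neg_one, ← Real.rpow_add ht0]; norm_num
    calc _ ≤ C * (b * t ^ (-(3 / 2) : ℝ)) * B * T ^ (-(1 / 4) : ℝ) * (4 * t ^ ((1 / 4) : ℝ))
          + 2 * B / t * C * (2 * t ^ (-(1 / 4) : ℝ)) := hle.trans (by gcongr)
      _ = C * b * B * T ^ (-(1 / 4) : ℝ) * 4 * (t ^ (-(3 / 2) : ℝ) * t ^ ((1 / 4) : ℝ))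
          + 4 * C * B * (t⁻¹ * t ^ (-(1 / 4) : ℝ)) := by rw [div_eq_mul_inv]; ring
      _ = _ := by rw [p1, p2]; ring
  have b3 : ‖∫ s in m..t, k (t - s) • Ψ s‖ ≤ C * b * 2 * B * t ^ (-(5 / 4) : ℝ) := by
    have hI : IntervalIntegrable (fun s : ℝ => (t - s) ^ (-(1 / 2) : ℝ)) volume m t := by
      have := (intervalIntegral.intervalIntegrable_rpow' (a := 0) (b := r) (r := -(1 / 2))
        (by norm_num)).comp_sub_left t
      simpa [hm] using this.symm
    have hbd : ∀ s ∈ Ioc m t, ‖k (t - s) • Ψ s‖ ≤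
        C * (B * (b * t ^ (-(3 / 2) : ℝ))) * (t - s) ^ (-(1 / 2) : ℝ) := by
      intro s hs
      rcases hs.2.eq_or_lt with rfl | hst
      · simp only [hΨ, intervalIntegral.integral_same, smul_zero, norm_zero]
        exact mul_nonneg (by positivity) (Real.rpow_nonneg (by simp) _)
      have hts : 0 < t - s := by linarith
      rw [norm_smul, Real.norm_eq_abs]
      have h1 := h.deriv_le (t - s) hts.le
      have h2 := hΨ2 s (by linarith [hs.1]) hs.2
      have h3 : (1 + (t - s)) ^ (-(3 / 2) : ℝ) ≤ (t - s) ^ (-(3 / 2) : ℝ) :=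
        Real.rpow_le_rpow_of_nonpos hts (by linarith) (by norm_num)
      have h4 : (t - s) ^ (-(1 / 2) : ℝ) = (t - s) * (t - s) ^ (-(3 / 2) : ℝ) := by
        rw [← Real.rpow_one_add' hts.le (by norm_num)]; norm_num
      calc _ ≤ (C * (t - s) ^ (-(3 / 2) : ℝ)) * (B * (b * t ^ (-(3 / 2) : ℝ)) * (t - s)) :=
            mul_le_mul (h1.trans (by gcongr)) h2 (norm_nonneg _) (by positivity)
        _ = _ := by rw [h4]; ring
    have hle := intervalIntegral.norm_integral_le_of_norm_le hmt (ae_of_all _ hbd)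
      (hI.const_mul _)
    rw [intervalIntegral.integral_const_mul] at hle
    have i1 : ∫ s in m..t, (t - s) ^ (-(1 / 2) : ℝ) ≤ 2 * t ^ ((1 / 4) : ℝ) := by
      rw [intervalIntegral.integral_comp_sub_left (fun s => s ^ (-(1 / 2) : ℝ)) t]
      have h1 := integral_rpow_le_of_neg_one_lt (p := -(1 / 2)) (s₂ := r) (by norm_num)
        (le_refl (0:ℝ))
      have h2 := rp (1 / 2)
      rw [hm, sub_sub_cancel, sub_self]
      norm_num at h1 h2 ⊢
      rw [h2] at h1
      linarith
    have p1 : t ^ (-(3 / 2) : ℝ) * t ^ ((1 / 4) : ℝ) = t ^ (-(5 / 4) : ℝ) := by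
      rw [← Real.rpow_add ht0]; norm_num
    calc _ ≤ C * (B * (b * t ^ (-(3 / 2) : ℝ))) * (2 * t ^ ((1 / 4) : ℝ)) :=
          hle.trans (by gcongr)
      _ = C * b * 2 * B * (t ^ (-(3 / 2) : ℝ) * t ^ ((1 / 4) : ℝ)) := by ring
      _ = _ := by rw [p1]
  calc _ ≤ ‖(K (t - T) - K t) • Ψ T‖ + (‖∫ s in T..m, k (t - s) • Ψ s‖
        + ‖∫ s in m..t, k (t - s) • Ψ s‖) :=
        (norm_sub_le _ _).trans (add_le_add_right (norm_add_le _ _) _)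
    _ ≤ D₂ * B * t ^ (-(5 / 4) : ℝ) := by
        have : D₂ * B * t ^ (-(5 / 4) : ℝ) = C * b * B * t ^ (-(5 / 4) : ℝ)
          + ((C * b * T ^ (-(1 / 4) : ℝ) * 4 + 4 * C) * B * t ^ (-(5 / 4) : ℝ)
          + C * b * 2 * B * t ^ (-(5 / 4) : ℝ)) := by rw [hD₂]; ring
        rw [this]
        exact add_le_add b1 (add_le_add b2 b3)
    _ ≤ _ := by gcongr; linarith

end Friction

end

noncomputable section

namespace Friction

open LineDeriv

/-! ### Stopped trajectories -/

/-- A momentum trajectory that is bounded by `η`, vanishes from time `T` on, and moves the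
particle by at most one unit of length. -/
structure IsStopped (M₀ T η : ℝ) (Q : ℝ → R3) : Prop where
  integrable : ∀ a b, IntervalIntegrable Q volume a b
  norm_le : ∀ t, ‖Q t‖ ≤ η
  eq_zero : ∀ t, T ≤ t → Q t = 0
  displacement : M₀⁻¹ * (η * T) ≤ 1

/-- An integral whose integrand is bounded by `c` and vanishes from time `T` on. -/
lemma norm_intervalIntegral_le_of_eq_zero {E : Type*} [NormedAddCommGroup E] [NormedSpace ℝ E]
    {u : ℝ → E} {c T a s : ℝ} (hT : 0 ≤ T) (hc : 0 ≤ c) (ha : 0 ≤ a) (has : a ≤ s)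
    (h0 : ∀ r, T ≤ r → u r = 0) (hu : ∀ r, a ≤ r → r ≤ s → r < T → ‖u r‖ ≤ c) :
    ‖∫ r in a..s, u r‖ ≤ c * T := by
  have hm : ‖∫ r in a..s, u r‖ ≤ ∫ r in a..s, (Iic T).indicator (fun _ => c) r := by
    refine intervalIntegral.norm_integral_le_of_norm_le has (ae_of_all _ fun r hr => ?_) ?_
    · rcases lt_or_ge r T with h | h
      · rw [indicator_of_mem (show r ∈ Iic T from h.le)]
        exact hu r hr.1.le hr.2 h
      · rw [h0 r h, norm_zero]
        exact indicator_nonneg (fun _ _ => hc) _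
    · rw [intervalIntegrable_iff]
      exact (integrableOn_const (by simp)).indicator measurableSet_Iic
  refine hm.trans ?_
  rw [intervalIntegral.integral_of_le has, setIntegral_indicator measurableSet_Iic,
    setIntegral_const, smul_eq_mul, mul_comm]
  refine mul_le_mul_of_nonneg_left ?_ hc
  have hsub : Ioc a s ∩ Iic T ⊆ Icc 0 T := fun r hr => ⟨ha.trans hr.1.1.le, hr.2⟩
  calc volume.real (Ioc a s ∩ Iic T) ≤ volume.real (Icc 0 T) :=
        measureReal_mono hsub (by simp)
    _ = T := by simp [hT]

lemma norm_le_of_abs_le {v : R3} {c : ℝ} (hc : 0 ≤ c) (h : ∀ j, |v j| ≤ c) : ‖v‖ ≤ 2 * c := by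
  rw [EuclideanSpace.norm_eq]
  refine Real.sqrt_le_iff.2 ⟨by positivity, ?_⟩
  have h2 : ∀ j, ‖v j‖ ^ 2 ≤ c ^ 2 := fun j => by
    rw [Real.norm_eq_abs]; exact pow_le_pow_left₀ (abs_nonneg _) (h j) 2
  calc ∑ j, ‖v j‖ ^ 2 ≤ ∑ _j : Fin 3, c ^ 2 := Finset.sum_le_sum fun j _ => h2 j
    _ = 3 * c ^ 2 := by simp
    _ ≤ _ := by nlinarith [sq_nonneg c]

/-- Sources act only before `T`, and a delay `s ≤ T` costs only a constant: `1 + t ≤ (1 + T)(1 + (t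
- s))`. -/
lemma one_add_sub_rpow_le {T s t p : ℝ} (hs : 0 ≤ s) (hsT : s ≤ T) (hst : s ≤ t) (hp : 0 ≤ p) :
    (1 + (t - s)) ^ (-p) ≤ (1 + T) ^ p * (1 + t) ^ (-p) := by
  have h1 : (1 + t) ≤ (1 + T) * (1 + (t - s)) := by nlinarith
  have h2 : (1 + t) ^ p ≤ ((1 + T) * (1 + (t - s))) ^ p :=
    Real.rpow_le_rpow (by linarith) h1 hp
  have h3 : 0 < 1 + (t - s) := by linarith
  have h4 : 0 < 1 + t := by linarith
  rw [Real.mul_rpow (by linarith) h3.le] at h2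
  rw [Real.rpow_neg h3.le, Real.rpow_neg h4.le, ← div_eq_mul_inv, inv_eq_one_div,
    div_le_div_iff₀ (Real.rpow_pos_of_pos h3 _) (Real.rpow_pos_of_pos h4 _), one_mul]
  exact h2

lemma one_add_rpow_le {t : ℝ} (ht : 0 < t) :
    (1 + t) ^ (-(3 / 2) : ℝ) ≤ t ^ (-(5 / 4) : ℝ) :=
  (Real.rpow_le_rpow_of_exponent_le (by linarith) (by norm_num)).trans
    (Real.rpow_le_rpow_of_nonpos ht (by linarith) (by norm_num))

namespace IsStopped

variable {M₀ T η : ℝ} {Q : ℝ → R3}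

lemma nonneg (hQ : IsStopped M₀ T η Q) : 0 ≤ η := (norm_nonneg _).trans (hQ.norm_le 0)

lemma norm_integral_le (hQ : IsStopped M₀ T η Q) (hT : 0 ≤ T) {a s : ℝ} (ha : 0 ≤ a)
    (has : a ≤ s) : ‖∫ r in a..s, Q r‖ ≤ η * T :=
  norm_intervalIntegral_le_of_eq_zero hT hQ.nonneg ha has hQ.eq_zero fun r _ _ _ => hQ.norm_le r

lemma integral_eq_zero (hQ : IsStopped M₀ T η Q) {s t : ℝ} (hs : T ≤ s) (hst : s ≤ t) :
    ∫ r in s..t, Q r = 0 := by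
  rw [intervalIntegral.integral_congr (g := fun _ => (0 : R3)), intervalIntegral.integral_zero]
  intro r hr
  rw [uIcc_of_le hst] at hr
  exact hQ.eq_zero r (hs.trans hr.1)

lemma norm_position_sub_le (hQ : IsStopped M₀ T η Q) (hM₀ : 0 < M₀) (hT : 0 ≤ T) (X₀ : R3) {s : ℝ}
    (hs : 0 ≤ s) : ‖position M₀ X₀ Q s - X₀‖ ≤ 1 := by
  rw [position, add_sub_cancel_left, norm_smul, Real.norm_of_nonneg (by positivity)]
  exact (mul_le_mul_of_nonneg_left (hQ.norm_integral_le hT le_rfl hs) (by positivity)).trans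
    hQ.displacement

lemma position_eq (hQ : IsStopped M₀ T η Q) (X₀ : R3) {s : ℝ} (hs : T ≤ s) :
    position M₀ X₀ Q s = position M₀ X₀ Q T := by
  rw [position, position, ← intervalIntegral.integral_add_adjacent_intervals
    (hQ.integrable 0 T) (hQ.integrable T s), hQ.integral_eq_zero le_rfl hs, add_zero]

end IsStopped

section

variable {W : R3 → ℝ} {w : 𝓢(R3, ℂ)}

lemma specPair_sum (m : ℝ → ℂ) (u : R3 → ℂ) (v : Fin 3 → 𝓢(R3, ℂ)) (c : Fin 3 → ℂ)
    (hi : ∀ k, Integrable fun ξ : R3 =>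
      (starRingEnd ℂ) (u ξ) * m ((2 * Real.pi * ‖ξ‖) ^ 2) * (𝓕 (v k) : 𝓢(R3, ℂ)) ξ) :
    specPair m u (𝓕 (∑ k, c k • v k) : 𝓢(R3, ℂ))
      = ∑ k, c k * specPair m u (𝓕 (v k) : 𝓢(R3, ℂ)) := by
  have hF : (𝓕 (∑ k, c k • v k) : 𝓢(R3, ℂ)) = ∑ k, c k • (𝓕 (v k) : 𝓢(R3, ℂ)) := by
    change SchwartzMap.fourierTransformCLM ℂ (∑ k, c k • v k) = _
    rw [map_sum]
    exact Finset.sum_congr rfl fun k _ => map_smul _ _ _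
  rw [hF]
  unfold specPair
  simp_rw [← integral_const_mul]
  rw [← integral_finsetSum _ fun k _ => (hi k).const_mul (c k)]
  refine integral_congr_ae (Eventually.of_forall fun ξ => ?_)
  simp only [_root_.sum_apply, _root_.smul_apply, smul_eq_mul, Finset.mul_sum]
  exact Finset.sum_congr rfl fun k _ => by ring

/-- Bound on the interaction of the particle with the field that it created earlier. -/
lemma exists_abs_specPair_drift_le (h : IsComplexification W w) (R : ℝ) :
    ∃ C, 0 ≤ C ∧ ∀ (j : Fin 3) (t : ℝ), 0 ≤ t → ∀ p a : R3, ‖a‖ ≤ R →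
      |(specPair (fun lam => schr t lam / lam) (hat (dW W j 0)) (hat (drift W p a))).re|
        ≤ C * ‖p‖ * (1 + t) ^ (-(5 / 2) : ℝ) := by
  choose C hC hb using fun j k => exists_norm_interKernel_le h j k R
  have hCjk : ∀ j k, C j k ≤ ∑ j, ∑ k, C j k := fun j k =>
    (Finset.single_le_sum (f := fun k => C j k) (fun k _ => hC j k) (Finset.mem_univ k)).trans
      (Finset.single_le_sum (f := fun j => ∑ k, C j k)
        (fun j _ => Finset.sum_nonneg fun k _ => hC j k) (Finset.mem_univ j))
  have hS : 0 ≤ ∑ j, ∑ k, C j k := Finset.sum_nonneg fun j _ => Finset.sum_nonneg fun k _ => hC j k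
  refine ⟨3 * ∑ j, ∑ k, C j k, by positivity, fun j t ht p a ha => ?_⟩
  have h0 : shift 0 (∂_{e j} w) = ∂_{e j} w := by ext x; simp [shift_apply]
  rw [h.hat_dW, h.hat_drift, h0, specPair_sum]
  · refine (Complex.abs_re_le_norm _).trans ((norm_sum_le _ _).trans ?_)
    have hk : ∀ k, ‖((p k : ℝ) : ℂ) * specPair (fun lam => schr t lam / lam)
        (𝓕 (∂_{e j} w) : 𝓢(R3, ℂ)) (𝓕 (shift a (∂_{e k} w) - ∂_{e k} w) : 𝓢(R3, ℂ))‖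
        ≤ ‖p‖ * ((∑ j, ∑ k, C j k) * (1 + t) ^ (-(5 / 2) : ℝ)) := by
      intro k
      rw [norm_mul]
      refine mul_le_mul (norm_coord_le p k) ((hb j k t ht a ha).trans ?_) (norm_nonneg _)
        (norm_nonneg _)
      exact mul_le_mul_of_nonneg_right (hCjk j k) (by positivity)
    refine (Finset.sum_le_sum fun k _ => hk k).trans (le_of_eq ?_)
    simp
    ring
  · intro k
    refine Integrable.congr ((integrable_interDens w j k a).bdd_mul (c := 1)
      (continuous_sym t).aestronglyMeasurable (Eventually.of_forall fun ξ => (norm_sym t ξ).le))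
      (Eventually.of_forall fun ξ => (interKernel_integrand_eq h j k t a ξ).symm)

end

end Friction

end

noncomputable section

namespace Friction

open LineDeriv

variable {κ M₀ : ℝ} {W : R3 → ℝ} {w : 𝓢(R3, ℂ)}

/-! ### The nonlinear term along stopped trajectories -/

/-- The contribution of the initial field to the force. -/
def fieldForce (κ : ℝ) (w : 𝓢(R3, ℂ)) (β₀ : L2) (t : ℝ) (a : R3) : R3 :=
  WithLp.toLp 2 fun j => 2 * κ * (pair (U t (shift a (∂_{e j} w))) β₀).re

lemma fieldForce_apply (κ : ℝ) (w : 𝓢(R3, ℂ)) (β₀ : L2) (t : ℝ) (a : R3) (j : Fin 3) :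
    fieldForce κ w β₀ t a j = 2 * κ * (pair (U t (shift a (∂_{e j} w))) β₀).re := rfl

lemma continuous_fieldForce (κ : ℝ) (w : 𝓢(R3, ℂ)) (β₀ : L2) (a : R3) :
    Continuous fun t => fieldForce κ w β₀ t a := by
  refine (PiLp.continuous_toLp 2 _).comp (continuous_pi fun j => ?_)
  exact (Complex.continuous_re.comp (continuous_pair_U _ _)).const_mul _

lemma exists_norm_fieldForce_le (hκ : 0 < κ) (w : 𝓢(R3, ℂ)) :
    ∃ C, 0 ≤ C ∧ ∀ β₀ : L2, Integrable β₀ → ∀ a t, 0 ≤ t →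
      ‖fieldForce κ w β₀ t a‖ ≤ C * (∫ y, ‖β₀ y‖) * (1 + t) ^ (-(3 / 2) : ℝ) := by
  choose C hC hb using fun j => exists_norm_U_le (∂_{e j} w)
  have hS : 0 ≤ ∑ j, C j := Finset.sum_nonneg fun j _ => hC j
  refine ⟨4 * κ * ∑ j, C j, by positivity, fun β₀ hβ a t ht => ?_⟩
  have hI : 0 ≤ ∫ y, ‖β₀ y‖ := integral_nonneg fun y => norm_nonneg _
  refine (norm_le_of_abs_le (c := 2 * κ * ((∑ j, C j) * (1 + t) ^ (-(3 / 2) : ℝ) * ∫ y, ‖β₀ y‖))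
    (by positivity) fun j => ?_).trans (le_of_eq (by ring))
  rw [fieldForce_apply, abs_mul, abs_of_nonneg (by positivity : 0 ≤ 2 * κ)]
  refine mul_le_mul_of_nonneg_left ((Complex.abs_re_le_norm _).trans ?_) (by positivity)
  refine norm_pair_U_le (fun y => ?_) hβ
  rw [U_shift, shift_apply]
  refine (hb j t ht _).trans (mul_le_mul_of_nonneg_right ?_ (by positivity))
  exact Finset.single_le_sum (f := C) (fun k _ => hC k) (Finset.mem_univ j)

/-- The position `a` is fixed here, as it is once the trajectory has stopped; only then does the
oscillation of the field survive in the time average. -/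
lemma exists_norm_integral_fieldForce_le (hκ : 0 < κ) (w : 𝓢(R3, ℂ)) :
    ∃ C, 0 ≤ C ∧ ∀ β₀ : L2, Integrable β₀ → ∀ a s₁ s₂, 0 < s₁ → s₁ ≤ s₂ →
      ‖∫ s in s₁..s₂, fieldForce κ w β₀ s a‖ ≤ C * (∫ y, ‖β₀ y‖) / s₁ := by
  choose C hC hb using fun j => exists_norm_integral_pair_le j w
  have hS : 0 ≤ ∑ j, C j := Finset.sum_nonneg fun j _ => hC j
  refine ⟨4 * κ * ∑ j, C j, by positivity, fun β₀ hβ a s₁ s₂ h1 h12 => ?_⟩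
  have hI : 0 ≤ ∫ y, ‖β₀ y‖ := integral_nonneg fun y => norm_nonneg _
  refine (norm_le_of_abs_le (c := 2 * κ * ((∑ j, C j) / s₁ * ∫ y, ‖β₀ y‖))
    (by positivity) fun j => ?_).trans (le_of_eq (by ring))
  have hp : (∫ s in s₁..s₂, fieldForce κ w β₀ s a) j =
      ∫ s in s₁..s₂, fieldForce κ w β₀ s a j :=
    ((EuclideanSpace.proj (𝕜 := ℝ) j).intervalIntegral_comp_comm
      ((continuous_fieldForce κ w β₀ a).intervalIntegrable s₁ s₂)).symm
  have hr : ∫ s in s₁..s₂, fieldForce κ w β₀ s a j =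
      2 * κ * (∫ s in s₁..s₂, pair (U s (shift a (∂_{e j} w))) β₀).re := by
    simp only [fieldForce_apply]
    rw [intervalIntegral.integral_const_mul]
    congr 1
    exact Complex.reCLM.intervalIntegral_comp_comm
      ((continuous_pair_U (shift a (∂_{e j} w)) β₀).intervalIntegrable s₁ s₂)
  rw [hp, hr, abs_mul, abs_of_nonneg (by positivity : 0 ≤ 2 * κ)]
  refine mul_le_mul_of_nonneg_left ((Complex.abs_re_le_norm _).trans
    ((hb j s₁ s₂ h1 h12 a β₀ hβ).trans ?_)) (by positivity)
  gcongr
  exact Finset.single_le_sum (f := C) (fun k _ => hC k) (Finset.mem_univ j)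

/-- The nonlinear term without the contribution of the initial field is small. -/
lemma exists_norm_N_sub_le (h : IsComplexification W w) (hM₀ : 0 < M₀) (κ : ℝ) {T : ℝ}
    (hT : 0 < T) :
    ∃ C, 0 ≤ C ∧ ∀ (η : ℝ) (Q : ℝ → R3), IsStopped M₀ T η Q → ∀ (X₀ : R3) (β₀ : L2) t, 0 ≤ t →
      ‖N κ M₀ W X₀ β₀ Q t - fieldForce κ w β₀ t (position M₀ X₀ Q t)‖
        ≤ C * η * (1 + t) ^ (-(5 / 2) : ℝ) := by
  obtain ⟨C, hC, hb⟩ := exists_abs_specPair_drift_le h 2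
  set A := 4 * κ ^ 2 / M₀ with hA
  have hA0 : 0 ≤ A := by positivity
  refine ⟨2 * (A * (C * T) + A * (C * (1 + T) ^ ((5 / 2) : ℝ) * T)), by positivity,
    fun η Q hQ X₀ β₀ t ht => ?_⟩
  have hη := hQ.nonneg
  -- The drift is linear in the momentum, so both time integrals have integrands supported in `[0,
  -- T]` and are bounded by `T` times a supremum.
  have hdr : ∀ a : R3, hat (drift W 0 a) = 0 := fun a => by
    have : drift W 0 a = fun _ => 0 := by funext x; simp [drift]
    unfold hat
    rw [this]
    funext ξ
    simp [Real.fourier_eq']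
  have hsp : ∀ m u, specPair m u 0 = 0 := fun m u => by simp [specPair]
  refine (norm_le_of_abs_le (c := A * (C * η * (1 + t) ^ (-(5 / 2) : ℝ) * T)
    + A * (C * η * ((1 + T) ^ ((5 / 2) : ℝ) * (1 + t) ^ (-(5 / 2) : ℝ)) * T))
    (by positivity) fun j => ?_).trans (le_of_eq (by ring))
  have hN : (N κ M₀ W X₀ β₀ Q t - fieldForce κ w β₀ t (position M₀ X₀ Q t)) j =
      A * (∫ s in (0 : ℝ)..t,
        (specPair (fun lam => schr t lam / lam) (hat (dW W j 0))
          (hat (drift W (Q s) (X₀ - position M₀ X₀ Q s)))).re)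
      - A * (∫ s in (0 : ℝ)..t,
        (specPair (fun lam => schr (t - s) lam / lam) (hat (dW W j 0))
          (hat (drift W (Q s) (position M₀ X₀ Q s - position M₀ X₀ Q t)))).re) := by
    have h1 : specPair (schr t) (hat (dW W j (position M₀ X₀ Q t))) (𝓕 β₀ : L2)
        = pair (U t (shift (position M₀ X₀ Q t) (∂_{e j} w))) β₀ := by
      rw [h.hat_dW, specPair_schr, conjS_shift, h.conjS_lineDeriv]
    rw [PiLp.sub_apply, fieldForce_apply, ← h1]
    simp only [N]
    ring
  rw [hN]
  have hX := fun {s : ℝ} (hs : 0 ≤ s) => hQ.norm_position_sub_le hM₀ hT.le X₀ hs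
  have b1 := norm_intervalIntegral_le_of_eq_zero (u := fun s =>
      (specPair (fun lam => schr t lam / lam) (hat (dW W j 0))
        (hat (drift W (Q s) (X₀ - position M₀ X₀ Q s)))).re)
    (c := C * η * (1 + t) ^ (-(5 / 2) : ℝ)) hT.le (by positivity) le_rfl ht
    (fun r hr => by simp only [hQ.eq_zero r hr, hdr, hsp, Complex.zero_re])
    (fun r hr hrt _ => by
      rw [Real.norm_eq_abs]
      refine (hb j t ht (Q r) _ ?_).trans ?_
      · rw [norm_sub_rev]; exact (hX hr).trans (by norm_num)
      · gcongr; exact hQ.norm_le r)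
  have b2 := norm_intervalIntegral_le_of_eq_zero (u := fun s =>
      (specPair (fun lam => schr (t - s) lam / lam) (hat (dW W j 0))
        (hat (drift W (Q s) (position M₀ X₀ Q s - position M₀ X₀ Q t)))).re)
    (c := C * η * ((1 + T) ^ ((5 / 2) : ℝ) * (1 + t) ^ (-(5 / 2) : ℝ))) hT.le (by positivity)
    le_rfl ht
    (fun r hr => by simp only [hQ.eq_zero r hr, hdr, hsp, Complex.zero_re])
    (fun r hr hrt hrT => by
      rw [Real.norm_eq_abs]
      refine (hb j (t - r) (by linarith) (Q r) _ ?_).trans ?_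
      · calc _ = ‖(position M₀ X₀ Q r - X₀) - (position M₀ X₀ Q t - X₀)‖ := by congr 1; abel
          _ ≤ 1 + 1 := (norm_sub_le _ _).trans (add_le_add (hX hr) (hX ht))
          _ = 2 := by norm_num
      · refine mul_le_mul (mul_le_mul_of_nonneg_left (hQ.norm_le r) hC)
          (one_add_sub_rpow_le hr hrT.le hrt (by norm_num))
          (Real.rpow_nonneg (by linarith) _) (by positivity))
  rw [Real.norm_eq_abs] at b1 b2
  refine (abs_sub _ _).trans (add_le_add ?_ ?_)
  · rw [abs_mul, abs_of_nonneg hA0]; gcongr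
  · rw [abs_mul, abs_of_nonneg hA0]; gcongr

/-- The symbol in the first term of `L` is a time average of the propagator. -/
lemma schr_sub_div (s t lam : ℝ) (hlam : lam ≠ 0) :
    (schr (t - s) lam - schr t lam) / (-Complex.I * lam)
      = -(1 / 2) * ∫ τ in (t - s)..t, schr τ lam := by
  have hl : (lam : ℂ) ≠ 0 := by exact_mod_cast hlam
  have hd : ∀ τ : ℝ, HasDerivAt (fun τ : ℝ => schr τ lam) (-Complex.I * lam / 2 * schr τ lam) τ := by
    intro τ
    have h1 : HasDerivAt (fun τ : ℝ => -Complex.I * ((lam * τ / 2 : ℝ) : ℂ))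
        (-Complex.I * lam / 2) τ := by
      have h2 : HasDerivAt (fun τ : ℝ => ((lam * τ / 2 : ℝ) : ℂ)) ((lam * 1 / 2 : ℝ) : ℂ) τ :=
        (((hasDerivAt_id τ).const_mul lam).div_const 2).ofReal_comp
      refine (h2.const_mul (-Complex.I)).congr_deriv ?_
      push_cast
      ring
    exact h1.cexp.congr_deriv (mul_comm _ _)
  have hc : Continuous fun τ : ℝ => -Complex.I * lam / 2 * schr τ lam :=
    continuous_const.mul (continuous_iff_continuousAt.2 fun τ => (hd τ).continuousAt)
  have h3 := intervalIntegral.integral_eq_sub_of_hasDerivAt (fun τ _ => hd τ)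
    (hc.intervalIntegrable (t - s) t)
  rw [intervalIntegral.integral_const_mul] at h3
  rw [← neg_sub (schr t lam), ← h3]
  field_simp

/-- The singular symbol is a time average of the propagator except at `ξ = 0`, a null set. By Fubini
the pairing becomes an integral of `f`, whose decay is known. -/
lemma specPair_schr_sub (h : IsComplexification W w) (hZ : 0 < Z κ M₀) {s t : ℝ} (hs : 0 ≤ s) :
    (specPair (fun lam => (schr (t - s) lam - schr t lam) / (-Complex.I * lam))
        (hat W) (hat W)).re = -(1 / 2) * ((Z κ M₀)⁻¹ * ∫ τ in (t - s)..t, f κ M₀ W τ) := by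
  have hst : t - s ≤ t := by linarith
  set u : 𝓢(R3, ℂ) := 𝓕 w with hu
  let F : ℝ → R3 → ℂ := fun τ ξ => (starRingEnd ℂ) (u ξ) * sym τ ξ * u ξ
  have hFi : Integrable (Function.uncurry F)
      ((volume.restrict (uIoc (t - s) t)).prod volume) := by
    rw [uIoc_of_le hst]
    have hsq : Integrable fun ξ => ‖u ξ‖ * ‖u ξ‖ := by
      refine (dens w).integrable.norm.congr (Eventually.of_forall fun ξ => ?_)
      simp only [dens_apply, norm_mul, hu]
    have hb2 : Integrable (fun p : ℝ × R3 => ‖u p.2‖ * ‖u p.2‖)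
        ((volume.restrict (Ioc (t - s) t)).prod volume) :=
      hsq.comp_snd (volume.restrict (Ioc (t - s) t))
    refine hb2.mono' (Continuous.aestronglyMeasurable ?_) (Eventually.of_forall fun p => ?_)
    · have hsym : Continuous fun p : ℝ × R3 => sym p.1 p.2 := by
        simp only [sym_eq]
        fun_prop
      have hu2 : Continuous fun p : ℝ × R3 => u p.2 := u.continuous.comp continuous_snd
      exact ((Complex.continuous_conj.comp hu2).mul hsym).mul hu2
    · simp only [Function.uncurry, F]
      rw [norm_mul, norm_mul, norm_sym, mul_one, RCLike.norm_conj]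
  have h1 : specPair (fun lam => (schr (t - s) lam - schr t lam) / (-Complex.I * lam))
      (hat W) (hat W) = -(1 / 2) * ∫ τ in (t - s)..t, ∫ ξ, F τ ξ := by
    rw [intervalIntegral_integral_swap hFi, ← integral_const_mul, h.hat_eq, specPair]
    have hne : ∀ᵐ ξ : R3, ξ ≠ 0 := by
      simp [ae_iff]
    refine integral_congr_ae (hne.mono fun ξ hξ => ?_)
    have hl : (2 * Real.pi * ‖ξ‖) ^ 2 ≠ 0 := by
      have := norm_ne_zero_iff.2 hξ
      have := Real.pi_ne_zero
      positivity
    have hF : ∫ τ in (t - s)..t, F τ ξ = (starRingEnd ℂ) (u ξ) * (∫ τ in (t - s)..t, sym τ ξ) * u ξ := by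
      rw [← intervalIntegral.integral_const_mul, ← intervalIntegral.integral_mul_const]
    beta_reduce
    rw [hF, schr_sub_div s t _ hl]
    simp only [sym_eq_schr]
    ring
  have h2 : ∀ τ, (∫ ξ, F τ ξ).re = (Z κ M₀)⁻¹ * f κ M₀ W τ := by
    intro τ
    rw [f, ← mul_assoc, inv_mul_cancel₀ hZ.ne', one_mul, h.hat_eq]
    rfl
  have hi : IntervalIntegrable (fun τ => ∫ ξ, F τ ξ) volume (t - s) t := by
    rw [intervalIntegrable_iff]
    exact hFi.integral_prod_left
  have h3 : (∫ τ in (t - s)..t, ∫ ξ, F τ ξ).re = ∫ τ in (t - s)..t, (∫ ξ, F τ ξ).re :=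
    (Complex.reCLM.intervalIntegral_comp_comm hi).symm
  rw [h1]
  have h4 : (-(1 / 2) * ∫ τ in (t - s)..t, ∫ ξ, F τ ξ).re
      = -(1 / 2) * (∫ τ in (t - s)..t, ∫ ξ, F τ ξ).re := by
    have : (-(1 / 2) : ℂ) = ((-(1 / 2) : ℝ) : ℂ) := by push_cast; ring
    rw [this, Complex.re_ofReal_mul]
  rw [h4, h3]
  simp only [h2]
  rw [intervalIntegral.integral_const_mul]

end Friction

end

noncomputable section

namespace Friction

open LineDeriv

variable {κ M₀ : ℝ} {W : R3 → ℝ} {w : 𝓢(R3, ℂ)} {K : ℝ → ℝ}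

/-! ### The inhomogeneous term along stopped trajectories -/

lemma HasResolventDecay.abs_sub_le_stopped {C : ℝ} {k : ℝ → ℝ} (h : HasResolventDecay C K k)
    {T s t : ℝ} (hs : 0 ≤ s) (hsT : s ≤ T) (hst : s ≤ t) :
    |K (t - s) - K t| ≤ C * ((1 + T) ^ ((3 / 2) : ℝ) * (1 + t) ^ (-(3 / 2) : ℝ)) * T := by
  have hC := h.nonneg
  have hT : 0 ≤ T := hs.trans hsT
  have ht : 0 ≤ t := hs.trans hst
  refine (h.abs_sub_le hs hst).trans ?_
  refine mul_le_mul (mul_le_mul_of_nonneg_left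
    (one_add_sub_rpow_le hs hsT hst (by norm_num)) hC) hsT hs (by positivity)

/-- The linear term decays for stopped trajectories. -/
lemma exists_norm_L_le (h : IsComplexification W w) (hZ : 0 < Z κ M₀) {C : ℝ}
    (hd : HasResolventDecay C K (resDeriv κ M₀ W K)) {T : ℝ} (hT : 0 < T) :
    ∃ D, 0 ≤ D ∧ ∀ (η : ℝ) (Q : ℝ → R3), IsStopped M₀ T η Q → ∀ t, T ≤ t →
      ‖L κ M₀ W K Q t‖ ≤ D * η * (1 + t) ^ (-(3 / 2) : ℝ) := by
  obtain ⟨Cf, hCf, hf⟩ := exists_abs_f_le h κ M₀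
  have hC := hd.nonneg
  set b := (1 + T) ^ ((3 / 2) : ℝ) with hb
  have hb0 : 0 ≤ b := by positivity
  refine ⟨2 * Z κ M₀ * C * (((Z κ M₀)⁻¹ * (Cf * b * T)) * T)
    + C * b * T * Cf * T * T + C * T, by positivity, fun η Q hQ t ht => ?_⟩
  have hη := hQ.nonneg
  have ht0 : 0 < t := hT.trans_le ht
  set p := (1 + t) ^ (-(3 / 2) : ℝ) with hp
  have hp0 : 0 ≤ p := by positivity
  have hf1 : ∀ s, 0 ≤ s → |f κ M₀ W s| ≤ Cf := fun s hs => by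
    refine (hf s hs).1.trans (mul_le_of_le_one_right hCf ?_)
    exact Real.rpow_le_one_of_one_le_of_nonpos (by linarith) (by norm_num)
  have b1 : ‖∫ s in (0 : ℝ)..t,
      (specPair (fun lam => (schr (t - s) lam - schr t lam) / (-Complex.I * lam))
        (hat W) (hat W)).re • Q s‖ ≤ ((Z κ M₀)⁻¹ * (Cf * (b * p) * T)) * η * T := by
    refine norm_intervalIntegral_le_of_eq_zero hT.le (by positivity) le_rfl ht0.le
      (fun r hr => by rw [hQ.eq_zero r hr, smul_zero]) fun r hr hrt hrT => ?_
    rw [norm_smul, specPair_schr_sub h hZ hr]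
    refine mul_le_mul ?_ (hQ.norm_le r) (norm_nonneg _) (by positivity)
    have hi : ‖∫ τ in (t - r)..t, f κ M₀ W τ‖ ≤ Cf * (b * p) * |t - (t - r)| := by
      refine intervalIntegral.norm_integral_le_of_norm_le_const fun τ hτ => ?_
      rw [uIoc_of_le (by linarith)] at hτ
      refine (hf τ (by linarith [hτ.1])).1.trans (mul_le_mul_of_nonneg_left ?_ hCf)
      refine le_trans ?_ (one_add_sub_rpow_le hr hrT.le hrt (by norm_num))
      exact Real.rpow_le_rpow_of_nonpos (by linarith) (by linarith [hτ.1]) (by norm_num)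
    have hr' : |t - (t - r)| ≤ T := by rw [sub_sub_cancel, abs_of_nonneg hr]; exact hrT.le
    rw [norm_mul, norm_mul, Real.norm_of_nonneg (inv_nonneg.2 hZ.le)]
    calc _ ≤ 1 * ((Z κ M₀)⁻¹ * (Cf * (b * p) * |t - (t - r)|)) := by
          gcongr
          norm_num
      _ ≤ _ := by rw [one_mul]; gcongr
  have b2 : ‖∫ s in (0 : ℝ)..t, ((K (t - s) - K t) * f κ M₀ W s) • ∫ u in s..t, Q u‖
      ≤ (C * (b * p) * T * Cf * (η * T)) * T := by
    -- For `s ≥ T` the inner integral of the momentum vanishes, so only the times before `T`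
    -- contribute.
    have hcut : ∫ s in (0 : ℝ)..t, ((K (t - s) - K t) * f κ M₀ W s) • ∫ u in s..t, Q u
        = ∫ s in (0 : ℝ)..t, (Iio T).indicator
          (fun s => ((K (t - s) - K t) * f κ M₀ W s) • ∫ u in s..t, Q u) s := by
      refine intervalIntegral.integral_congr fun s hs => ?_
      rw [uIcc_of_le ht0.le] at hs
      rcases lt_or_ge s T with hsT | hsT
      · rw [indicator_of_mem (by exact hsT)]
      · beta_reduce
        rw [indicator_of_notMem (by simpa using hsT), hQ.integral_eq_zero hsT hs.2, smul_zero]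
    rw [hcut]
    refine norm_intervalIntegral_le_of_eq_zero hT.le (by positivity) le_rfl ht0.le
      (fun r hr => indicator_of_notMem (by simpa using hr) _) fun r hr hrt hrT => ?_
    rw [indicator_of_mem (by exact hrT), norm_smul, norm_mul, Real.norm_eq_abs, Real.norm_eq_abs]
    have h1 := hd.abs_sub_le_stopped hr hrT.le hrt
    have h2 := hf1 r hr
    have h3 := hQ.norm_integral_le hT.le hr hrt
    gcongr
  -- By the equation for `K` this convolution is `-K̇`, so it decays like `t^{-3/2}`, which neither
  -- factor would show by itself.
  have b3 : |∫ s in (0 : ℝ)..t, K (t - s) * f κ M₀ W s| ≤ C * p := by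
    have h1 : ∫ s in (0 : ℝ)..t, K (t - s) * f κ M₀ W s = -resDeriv κ M₀ W K t := by
      have h2 := intervalIntegral.integral_comp_sub_left
        (fun s => f κ M₀ W (t - s) * K s) (a := 0) (b := t) t
      simp only [sub_sub_cancel, sub_self, sub_zero] at h2
      rw [resDeriv, neg_neg, ← h2]
      exact intervalIntegral.integral_congr fun s _ => mul_comm _ _
    rw [h1, abs_neg]
    exact hd.deriv_le t ht0.le
  have b4 := hQ.norm_integral_le hT.le le_rfl ht0.le
  unfold L
  refine (norm_add_le _ _).trans ?_
  refine (add_le_add (norm_sub_le _ _) le_rfl).trans ?_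
  rw [norm_smul, norm_smul, norm_mul, norm_mul, Real.norm_eq_abs (K t), Real.norm_eq_abs (∫ _ in _.._, _),
    Real.norm_of_nonneg (by norm_num : (0:ℝ) ≤ 2), Real.norm_of_nonneg hZ.le]
  have hKt := hd.le_const ht0.le
  have hZ0 := hZ.le
  calc _ ≤ 2 * Z κ M₀ * C * (((Z κ M₀)⁻¹ * (Cf * (b * p) * T)) * η * T)
        + (C * (b * p) * T * Cf * (η * T)) * T + C * p * (η * T) := by gcongr
    _ = _ := by ring

/-- Decay of the inhomogeneous term for stopped trajectories. -/
lemma exists_norm_Ftilde_le (h : IsComplexification W w) (hκ : 0 < κ) (hM₀ : 0 < M₀)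
    (hK : IsResolvent κ M₀ W K) (hKc : Continuous K) (hN : NonResonant κ M₀ W) {T : ℝ}
    (hT : 0 < T) :
    ∃ D, 0 ≤ D ∧ ∀ (η : ℝ) (Q : ℝ → R3), IsStopped M₀ T η Q → ∀ (X₀ : R3) (β₀ : L2),
      Integrable β₀ → ∀ t, T ≤ t →
      ‖Ftilde κ M₀ W K X₀ β₀ Q t‖ ≤ D * (η + ∫ y, ‖β₀ y‖) * t ^ (-(5 / 4) : ℝ) := by
  have hZ := Z_pos hκ hM₀
  obtain ⟨C, hC, hKb⟩ := exists_abs_resolvent_le_rpow h hZ hK hKc hN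
  have hd : HasResolventDecay C K (resDeriv κ M₀ W K) :=
    ⟨hC, hKc, continuous_resDeriv h hKc, fun t ht => hK.2 t ht, fun t ht => (hKb t ht).1,
      fun t ht => (hKb t ht).2⟩
  obtain ⟨d, hd0, hdb⟩ := exists_one_sub_resolvent_ge h hZ hK hKc hN hT
  obtain ⟨DL, hDL, hL⟩ := exists_norm_L_le h hZ hd hT
  obtain ⟨C₁, hC₁, h₁⟩ := exists_norm_fieldForce_le hκ w
  obtain ⟨C₂, hC₂, h₂⟩ := exists_norm_integral_fieldForce_le hκ w
  obtain ⟨C₃, hC₃, h₃⟩ := exists_norm_N_sub_le h hM₀ κ hT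
  obtain ⟨D₁, hD₁, g₁⟩ := hd.exists_norm_integral_le_of_decay hT
  obtain ⟨D₂, hD₂, g₂⟩ := hd.exists_norm_integral_le_of_oscillation hT
  set b := (1 + T) ^ ((3 / 2) : ℝ) with hb
  have hb0 : 0 ≤ b := by positivity
  refine ⟨d⁻¹ * (DL + (C * b * T * (C₁ + C₃) * T + (D₂ * (C₁ + C₂) + D₁ * C₃))), by positivity,
    fun η Q hQ X₀ β₀ hβ t ht => ?_⟩
  have hη := hQ.nonneg
  have ht0 : 0 < t := hT.trans_le ht
  set m := ∫ y, ‖β₀ y‖ with hm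
  have hm0 : 0 ≤ m := integral_nonneg fun y => norm_nonneg _
  set q := t ^ (-(5 / 4) : ℝ) with hq
  have hq0 : 0 ≤ q := by positivity
  have hpq : (1 + t) ^ (-(3 / 2) : ℝ) ≤ q := one_add_rpow_le ht0
  set NQ := N κ M₀ W X₀ β₀ Q with hNQ
  have hNb : ∀ s, 0 ≤ s → ‖NQ s‖ ≤ (C₁ + C₃) * (η + m) := by
    intro s hs
    have e1 := h₃ η Q hQ X₀ β₀ s hs
    have e2 := h₁ β₀ hβ (position M₀ X₀ Q s) s hs
    have r1 : (1 + s) ^ (-(5 / 2) : ℝ) ≤ 1 :=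
      Real.rpow_le_one_of_one_le_of_nonpos (by linarith) (by norm_num)
    have r2 : (1 + s) ^ (-(3 / 2) : ℝ) ≤ 1 :=
      Real.rpow_le_one_of_one_le_of_nonpos (by linarith) (by norm_num)
    calc ‖NQ s‖ = ‖(NQ s - fieldForce κ w β₀ s (position M₀ X₀ Q s))
          + fieldForce κ w β₀ s (position M₀ X₀ Q s)‖ := by rw [sub_add_cancel]
      _ ≤ C₃ * η * (1 + s) ^ (-(5 / 2) : ℝ) + C₁ * m * (1 + s) ^ (-(3 / 2) : ℝ) :=
        (norm_add_le _ _).trans (add_le_add e1 e2)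
      _ ≤ C₃ * η * 1 + C₁ * m * 1 := by gcongr
      _ ≤ _ := by nlinarith [mul_nonneg hC₁ hη, mul_nonneg hC₃ hm0]
  have key : ‖∫ s in (0 : ℝ)..t, (K (t - s) - K t) • NQ s‖ ≤
      (C * b * T * (C₁ + C₃) * T + (D₂ * (C₁ + C₂) + D₁ * C₃)) * (η + m) * q := by
    -- If the integrand fails to be integrable, its integral is zero by convention and the bound is
    -- trivial; so the regularity of `N` in time never has to be proved.
    by_cases hi : IntervalIntegrable (fun s => (K (t - s) - K t) • NQ s) volume 0 t
    swap
    · rw [intervalIntegral.integral_undef hi, norm_zero]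
      positivity
    have hi1 : IntervalIntegrable (fun s => (K (t - s) - K t) • NQ s) volume 0 T :=
      hi.mono_set (by rw [uIcc_of_le hT.le, uIcc_of_le ht0.le]; exact Icc_subset_Icc_right ht)
    have hi2 : IntervalIntegrable (fun s => (K (t - s) - K t) • NQ s) volume T t :=
      hi.mono_set (by rw [uIcc_of_le ht, uIcc_of_le ht0.le]; exact Icc_subset_Icc_left hT.le)
    -- After `T` the position stays at `a`. The force of the initial field is then evaluated at a
    -- fixed point, and the oscillation estimate applies to it; the rest of `N` decays fast.
    set a := position M₀ X₀ Q T with ha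
    set nF : ℝ → R3 := fun s => fieldForce κ w β₀ s a with hnF
    have hnFc : Continuous nF := continuous_fieldForce κ w β₀ a
    have hi3 : IntervalIntegrable (fun s => (K (t - s) - K t) • nF s) volume T t :=
      (by fun_prop : Continuous fun s => (K (t - s) - K t) • nF s).intervalIntegrable _ _
    -- Before `T` the nonlinear term is merely bounded, and the decay in `t` comes from the
    -- resolvent difference.
    have i1 : ‖∫ s in (0 : ℝ)..T, (K (t - s) - K t) • NQ s‖ ≤
        (C * (b * q) * T * ((C₁ + C₃) * (η + m))) * |T - 0| := by
      refine intervalIntegral.norm_integral_le_of_norm_le_const fun s hs => ?_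
      rw [uIoc_of_le hT.le] at hs
      rw [norm_smul, Real.norm_eq_abs]
      refine mul_le_mul ((hd.abs_sub_le_stopped hs.1.le hs.2 (hs.2.trans ht)).trans ?_)
        (hNb s hs.1.le) (norm_nonneg _) (by positivity)
      gcongr
    have i2 : ‖∫ s in T..t, (K (t - s) - K t) • nF s‖ ≤ D₂ * ((C₁ + C₂) * m) * q := by
      refine g₂ nF ((C₁ + C₂) * m) (by positivity) hnFc (fun s hs => ?_) (fun s₁ s₂ hs hs12 => ?_)
        t ht
      · have hs0 : 0 < s := hT.trans_le hs
        refine (h₁ β₀ hβ a s hs0.le).trans ?_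
        have : (1 + s) ^ (-(3 / 2) : ℝ) ≤ s ^ (-(3 / 2) : ℝ) :=
          Real.rpow_le_rpow_of_nonpos hs0 (by linarith) (by norm_num)
        gcongr
        linarith
      · have hs0 : 0 < s₁ := hT.trans_le hs
        refine (h₂ β₀ hβ a s₁ s₂ hs0 hs12).trans ?_
        gcongr
        linarith
    have i3 : ‖∫ s in T..t, (K (t - s) - K t) • (NQ s - nF s)‖ ≤ D₁ * (C₃ * η) * q := by
      refine g₁ _ (C₃ * η) (by positivity) (fun s hs => ?_) t ht
      have hs0 : 0 < s := hT.trans_le hs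
      have := h₃ η Q hQ X₀ β₀ s hs0.le
      rw [hQ.position_eq X₀ hs] at this
      refine this.trans (mul_le_mul_of_nonneg_left ?_ (by positivity))
      exact Real.rpow_le_rpow_of_nonpos hs0 (by linarith) (by norm_num)
    have hsplit : ∫ s in T..t, (K (t - s) - K t) • NQ s =
        (∫ s in T..t, (K (t - s) - K t) • nF s)
        + ∫ s in T..t, (K (t - s) - K t) • (NQ s - nF s) := by
      simp only [smul_sub]
      rw [intervalIntegral.integral_sub hi2 hi3]
      abel
    rw [← intervalIntegral.integral_add_adjacent_intervals hi1 hi2, hsplit]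
    refine (norm_add_le _ _).trans ((add_le_add i1 ((norm_add_le _ _).trans
      (add_le_add i2 i3))).trans ?_)
    rw [sub_zero, abs_of_pos hT]
    have e1 : 0 ≤ D₂ * (C₁ + C₂) * η * q := by positivity
    have e2 : 0 ≤ D₁ * C₃ * m * q := by positivity
    calc _ = C * b * T * (C₁ + C₃) * T * (η + m) * q + (D₂ * (C₁ + C₂)) * m * q
          + D₁ * C₃ * η * q := by ring
      _ ≤ _ := by linarith
  have hLt : ‖L κ M₀ W K Q t‖ ≤ DL * (η + m) * q := by
    refine (hL η Q hQ t ht).trans ?_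
    gcongr
    linarith
  have h1K := hdb t ht
  rw [Ftilde, norm_smul, norm_inv, Real.norm_of_nonneg (by linarith)]
  calc _ ≤ d⁻¹ * (DL * (η + m) * q
        + (C * b * T * (C₁ + C₃) * T + (D₂ * (C₁ + C₂) + D₁ * C₃)) * (η + m) * q) := by
        gcongr
        exact (norm_add_le _ _).trans (add_le_add hLt key)
    _ = _ := by ring

end Friction

end

/-! ### Solutions of the coupled system: momentum bound, existence, choice of `ε` -/

noncomputable section

namespace Friction

open LineDeriv

/-! ### Weighted norms -/

lemma one_le_bracket (x : R3) : 1 ≤ bracket x := by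
  rw [bracket, Real.one_le_sqrt]
  nlinarith [sq_nonneg ‖x‖]

lemma bracket_pos (x : R3) : 0 < bracket x := one_pos.trans_le (one_le_bracket x)

lemma bracket_sq (x : R3) : bracket x ^ 2 = 1 + ‖x‖ ^ 2 := Real.sq_sqrt (by positivity)

lemma continuous_bracket_zpow (n : ℤ) (a : R3) : Continuous fun x : R3 => bracket (x - a) ^ n := by
  have h : Continuous fun x : R3 => bracket (x - a) := by unfold bracket; fun_prop
  exact h.zpow₀ n fun x => Or.inl (bracket_pos _).ne'

lemma memLp_bracket : MemLp (fun x : R3 => ((bracket x ^ (-3 : ℤ) : ℝ) : ℂ)) 2 volume := by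
  have hc : Continuous fun x : R3 => ((bracket x ^ (-3 : ℤ) : ℝ) : ℂ) := by
    have := Complex.continuous_ofReal.comp (continuous_bracket_zpow (-3) 0)
    simp only [sub_zero] at this
    exact this
  rw [memLp_two_iff_integrable_sq_norm hc.aestronglyMeasurable]
  have h : Integrable fun x : R3 => (1 + ‖x‖ ^ 2) ^ (-6 / 2 : ℝ) :=
    integrable_rpow_neg_one_add_norm_sq (by simp; norm_num)
  refine h.congr (Eventually.of_forall fun x => ?_)
  have h6 : (-6 / 2 : ℝ) = ((-3 : ℤ) : ℝ) := by norm_num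
  beta_reduce
  rw [h6, Real.rpow_intCast, Complex.norm_real, Real.norm_eq_abs, sq_abs, ← bracket_sq,
    ← zpow_natCast, ← zpow_natCast, ← zpow_mul, ← zpow_mul, mul_comm]

/-- The `L²` norm of `⟨x⟩⁻³`. -/
def bracketNorm : ℝ := (eLpNorm (fun x : R3 => ((bracket x ^ (-3 : ℤ) : ℝ) : ℂ)) 2 volume).toReal

lemma bracketNorm_nonneg : 0 ≤ bracketNorm := ENNReal.toReal_nonneg

/-- Cauchy-Schwarz, with one factor `⟨x - a⟩⁻³`, which is square integrable in dimension three. The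
case `n = 3` gives `β₀ ∈ L¹`; the case `n = -3` serves the local force estimate, where the test
function has to absorb six powers of the bracket. -/
lemma integrable_bracket_mul {a : R3} {n : ℤ} {b : L2} {ε : ℝ} (hε : 0 ≤ ε)
    (hb : weightedNorm a n b ≤ ENNReal.ofReal ε) :
    Integrable (fun x => ((bracket (x - a) ^ (-3 + n) : ℝ) : ℂ) * b x) ∧
      ∫ x, ‖((bracket (x - a) ^ (-3 + n) : ℝ) : ℂ) * b x‖ ≤ bracketNorm * ε := by
  have hm : ∀ k : ℤ, AEStronglyMeasurable (fun x => ((bracket (x - a) ^ k : ℝ) : ℂ)) volume :=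
    fun k => (Complex.continuous_ofReal.comp (continuous_bracket_zpow k a)).aestronglyMeasurable
  have hbm := (Lp.memLp b).aestronglyMeasurable
  have h1 : eLpNorm (fun x => ((bracket (x - a) ^ (-3 + n) : ℝ) : ℂ) * b x) 1 volume
      ≤ ENNReal.ofReal (bracketNorm * ε) := by
    have h2 := eLpNorm_smul_le_mul_eLpNorm (p := 2) (q := 2) (r := 1) ((hm n).mul hbm) (hm (-3))
    have h3 : eLpNorm (fun x => ((bracket (x - a) ^ (-3 : ℤ) : ℝ) : ℂ)) 2 volume
        = ENNReal.ofReal bracketNorm := by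
      have h4 : eLpNorm (fun x => ((bracket (x - a) ^ (-3 : ℤ) : ℝ) : ℂ)) 2 volume
          = eLpNorm (fun x : R3 => ((bracket x ^ (-3 : ℤ) : ℝ) : ℂ)) 2 volume :=
        eLpNorm_comp_measurePreserving (g := fun x : R3 => ((bracket x ^ (-3 : ℤ) : ℝ) : ℂ))
          memLp_bracket.aestronglyMeasurable (measurePreserving_sub_right volume a)
      rw [h4, bracketNorm, ENNReal.ofReal_toReal memLp_bracket.eLpNorm_ne_top]
    rw [h3] at h2
    rw [ENNReal.ofReal_mul bracketNorm_nonneg]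
    refine le_trans (le_of_eq ?_) (h2.trans (mul_le_mul_right hb _))
    refine eLpNorm_congr_ae (Eventually.of_forall fun x => ?_)
    simp only [Pi.smul_apply', Pi.mul_apply, smul_eq_mul]
    rw [zpow_add₀ (bracket_pos _).ne', Complex.ofReal_mul, mul_assoc]
  have hi : Integrable (fun x => ((bracket (x - a) ^ (-3 + n) : ℝ) : ℂ) * b x) :=
    memLp_one_iff_integrable.1 ⟨(hm _).mul hbm, h1.trans_lt ENNReal.ofReal_lt_top⟩
  refine ⟨hi, ?_⟩
  rw [integral_norm_eq_lintegral_enorm hi.aestronglyMeasurable,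
    ← eLpNorm_one_eq_lintegral_enorm]
  exact ENNReal.toReal_le_of_le_ofReal (mul_nonneg bracketNorm_nonneg hε) h1

lemma integrable_of_weightedNorm_le {b : L2} {ε : ℝ} (hε : 0 ≤ ε)
    (hb : weightedNorm 0 3 b ≤ ENNReal.ofReal ε) :
    Integrable b ∧ ∫ x, ‖b x‖ ≤ bracketNorm * ε := by
  simpa using integrable_bracket_mul hε hb

lemma weightedNorm_neg_le (a : R3) (b : L2) : weightedNorm a (-3) b ≤ weightedNorm 0 3 b := by
  refine eLpNorm_mono fun x => ?_
  rw [norm_mul, norm_mul, Complex.norm_real, Complex.norm_real, Real.norm_eq_abs, Real.norm_eq_abs,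
    abs_of_pos (zpow_pos (bracket_pos _) _), abs_of_pos (zpow_pos (bracket_pos _) _)]
  refine mul_le_mul_of_nonneg_right ?_ (norm_nonneg _)
  have h1 : bracket (x - a) ^ (-3 : ℤ) ≤ 1 := zpow_le_one_of_nonpos₀ (one_le_bracket _) (by norm_num)
  have h2 : 1 ≤ bracket (x - 0) ^ (3 : ℤ) := one_le_zpow₀ (one_le_bracket _) (by norm_num)
  exact h1.trans h2

lemma norm_pair_le_of_bracket {φ : 𝓢(R3, ℂ)} {a : R3} {D ε : ℝ} {b : L2}
    (hε : 0 ≤ ε) (hb : weightedNorm a (-3) b ≤ ENNReal.ofReal ε) (hD : 0 ≤ D)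
    (hφ : ∀ x, bracket (x - a) ^ 6 * ‖φ x‖ ≤ D) : ‖pair φ b‖ ≤ D * (bracketNorm * ε) := by
  obtain ⟨hi, hle⟩ := integrable_bracket_mul hε hb
  refine (norm_integral_le_of_norm_le (hi.norm.const_mul D)
    (Eventually.of_forall fun x => ?_)).trans ?_
  · rw [norm_mul, norm_mul, Complex.norm_real, Real.norm_eq_abs,
      abs_of_pos (zpow_pos (bracket_pos _) _), ← mul_assoc]
    refine mul_le_mul_of_nonneg_right ?_ (norm_nonneg _)
    have h6 : bracket (x - a) ^ (-3 + -3 : ℤ) = (bracket (x - a) ^ 6)⁻¹ := by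
      rw [show (-3 + -3 : ℤ) = -((6 : ℕ) : ℤ) by norm_num, zpow_neg, zpow_natCast]
    rw [h6, ← div_eq_mul_inv, le_div_iff₀ (pow_pos (bracket_pos _) _), mul_comm]
    exact hφ x
  · rw [integral_const_mul]
    exact mul_le_mul_of_nonneg_left hle hD

/-! ### Localisation of the free evolution on bounded time intervals -/

lemma norm_le_sum_abs (x : R3) : ‖x‖ ≤ ∑ j, |x j| := by
  rw [EuclideanSpace.norm_eq]
  refine Real.sqrt_le_iff.2 ⟨Finset.sum_nonneg fun j _ => abs_nonneg _, ?_⟩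
  simpa using Finset.sum_sq_le_sq_sum_of_nonneg (s := Finset.univ) (f := fun j => |x j|)
    fun j _ => abs_nonneg _

/-- Induction on the power: a coordinate passes through the propagator at the cost of `t ∂_j`, and
`t` is bounded on `[0, T]`. So Schwartz data stay localised uniformly on bounded time intervals. -/
lemma exists_pow_mul_norm_U_le (T : ℝ) (n : ℕ) : ∀ ψ : 𝓢(R3, ℂ),
    ∃ C, 0 ≤ C ∧ ∀ t ∈ Icc 0 T, ∀ x, ‖x‖ ^ n * ‖U t ψ x‖ ≤ C := by
  induction n with
  | zero =>
    intro ψ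
    refine ⟨∫ ξ, ‖𝓕 ψ ξ‖, integral_nonneg fun _ => norm_nonneg _, fun t _ x => ?_⟩
    simpa using norm_U_le_const t ψ x
  | succ n ih =>
    intro ψ
    choose A hA ha using fun j => ih (coordMul j ψ)
    choose B hB hb using fun j => ih (∂_{e j} ψ)
    refine ⟨∑ j, (A j + |T| * B j),
      Finset.sum_nonneg fun j _ => add_nonneg (hA j) (mul_nonneg (abs_nonneg _) (hB j)),
      fun t ht x => ?_⟩
    have hj : ∀ j, ‖x‖ ^ n * (|x j| * ‖U t ψ x‖) ≤ A j + |T| * B j := by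
      intro j
      have h1 : ((x j : ℝ) : ℂ) * U t ψ x
          = U t (coordMul j ψ) x - Complex.I * t * U t (∂_{e j} ψ) x := by
        rw [← coordMul_apply, coordMul_U]
        simp
      have h2 : |x j| * ‖U t ψ x‖
          ≤ ‖U t (coordMul j ψ) x‖ + |T| * ‖U t (∂_{e j} ψ) x‖ := by
        rw [← Real.norm_eq_abs, ← Complex.norm_real, ← norm_mul, h1]
        refine (norm_sub_le _ _).trans (add_le_add le_rfl ?_)
        rw [norm_mul, norm_mul, Complex.norm_I, one_mul, Complex.norm_real, Real.norm_eq_abs,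
          abs_of_nonneg ht.1]
        exact mul_le_mul_of_nonneg_right (ht.2.trans (le_abs_self T)) (norm_nonneg _)
      calc _ ≤ ‖x‖ ^ n * (‖U t (coordMul j ψ) x‖ + |T| * ‖U t (∂_{e j} ψ) x‖) := by gcongr
        _ = ‖x‖ ^ n * ‖U t (coordMul j ψ) x‖ + |T| * (‖x‖ ^ n * ‖U t (∂_{e j} ψ) x‖) := by ring
        _ ≤ _ := by
          gcongr
          · exact ha j t ht x
          · exact hb j t ht x
    calc ‖x‖ ^ (n + 1) * ‖U t ψ x‖ = ‖x‖ ^ n * (‖x‖ * ‖U t ψ x‖) := by ring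
      _ ≤ ‖x‖ ^ n * ((∑ j, |x j|) * ‖U t ψ x‖) := by gcongr; exact norm_le_sum_abs x
      _ = ∑ j, ‖x‖ ^ n * (|x j| * ‖U t ψ x‖) := by rw [Finset.sum_mul, Finset.mul_sum]
      _ ≤ _ := Finset.sum_le_sum fun j _ => hj j

lemma bracket_pow_six_le (x : R3) : bracket x ^ 6 ≤ 4 * (1 + ‖x‖ ^ 6) := by
  have h : bracket x ^ 6 = (1 + ‖x‖ ^ 2) ^ 3 := by rw [← bracket_sq]; ring
  rw [h]
  nlinarith [sq_nonneg (‖x‖ ^ 2 - 1), sq_nonneg ‖x‖,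
    mul_nonneg (sq_nonneg ‖x‖) (sq_nonneg (‖x‖ ^ 2 - 1))]

lemma bracket_sub_pow_six_le {a c : R3} (h : ‖a - c‖ ≤ 1) (x : R3) :
    bracket (x - c) ^ 6 ≤ 27 * bracket (x - a) ^ 6 := by
  have h1 : bracket (x - c) ^ 2 ≤ 3 * bracket (x - a) ^ 2 := by
    rw [bracket_sq, bracket_sq]
    have h2 : ‖x - c‖ ≤ ‖x - a‖ + 1 := by
      calc ‖x - c‖ = ‖(x - a) + (a - c)‖ := by congr 1; abel
        _ ≤ _ := (norm_add_le _ _).trans (add_le_add le_rfl h)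
    nlinarith [norm_nonneg (x - c), norm_nonneg (x - a), sq_nonneg (‖x - a‖ - 1)]
  calc bracket (x - c) ^ 6 = (bracket (x - c) ^ 2) ^ 3 := by ring
    _ ≤ (3 * bracket (x - a) ^ 2) ^ 3 := by gcongr
    _ = _ := by ring

/-- The force of the initial field is controlled by the weighted norm while the particle stays
close to its initial position. -/
lemma exists_norm_pair_U_shift_le (T : ℝ) (ψ : 𝓢(R3, ℂ)) :
    ∃ C, 0 ≤ C ∧ ∀ t ∈ Icc 0 T, ∀ a c : R3, ‖a - c‖ ≤ 1 → ∀ (b : L2) (ε : ℝ), 0 ≤ ε →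
      weightedNorm c (-3) b ≤ ENNReal.ofReal ε → ‖pair (U t (shift a ψ)) b‖ ≤ C * ε := by
  obtain ⟨A, hA, ha⟩ := exists_pow_mul_norm_U_le T 0 ψ
  obtain ⟨B, hB, hb⟩ := exists_pow_mul_norm_U_le T 6 ψ
  refine ⟨27 * (4 * (A + B)) * bracketNorm,
    mul_nonneg (by positivity) bracketNorm_nonneg, fun t ht a c hac b ε hε hw => ?_⟩
  rw [mul_assoc]
  refine norm_pair_le_of_bracket hε hw (by positivity) fun x => ?_
  rw [U_shift, shift_apply]
  have h1 := ha t ht (x - a)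
  have h2 := hb t ht (x - a)
  rw [pow_zero, one_mul] at h1
  calc _ ≤ 27 * (4 * (1 + ‖x - a‖ ^ 6)) * ‖U t ψ (x - a)‖ := by
        gcongr
        exact (bracket_sub_pow_six_le hac x).trans (by gcongr; exact bracket_pow_six_le _)
    _ = 27 * (4 * (‖U t ψ (x - a)‖ + ‖x - a‖ ^ 6 * ‖U t ψ (x - a)‖)) := by ring
    _ ≤ _ := by gcongr

/-! ### Translations -/

/-- In frequency the two translations differ by at most `2π |(a - b) · ξ|`, the modulus of the
symbol of the derivative along `a - b`; Plancherel concludes. -/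
lemma norm_toL2_shift_sub_le (φ : 𝓢(R3, ℂ)) : ∃ C, 0 ≤ C ∧ ∀ a b : R3,
    ‖toL2 (shift a φ) - toL2 (shift b φ)‖ ≤ C * ‖a - b‖ := by
  refine ⟨∑ j, ‖toL2 (∂_{e j} φ)‖, Finset.sum_nonneg fun j _ => norm_nonneg _, fun a b => ?_⟩
  have hsum : ∀ v : R3, ∂_{v} φ = ∑ j, (v j : ℝ) • ∂_{e j} φ := by
    intro v
    have hv : v = ∑ j, (v j : ℝ) • e j := by
      ext i
      simp [e, Finset.sum_apply, Pi.single_apply]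
    ext x
    simp only [SchwartzMap.lineDerivOp_apply_eq_fderiv, _root_.sum_apply, _root_.smul_apply]
    conv_lhs => rw [hv]
    simp only [map_sum, map_smul]
  have h1 : ‖toL2 (shift a φ) - toL2 (shift b φ)‖ ≤ 1 * ‖toL2 (∂_{a - b} φ)‖ := by
    rw [← map_sub, ← norm_fourier_toL2, ← norm_fourier_toL2 (∂_{a - b} φ)]
    refine norm_toLp_le_mul fun ξ => ?_
    rw [fourier_sub, _root_.sub_apply, fourier_shift, fourier_shift, fourier_lineDeriv, ← sub_mul,
      norm_mul, norm_mul, one_mul]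
    refine mul_le_mul_of_nonneg_right ?_ (norm_nonneg _)
    refine (norm_exp_I_sub_exp_I_le _ _).trans (le_of_eq ?_)
    have h2 : -(2 * Real.pi * inner ℝ a ξ) - -(2 * Real.pi * inner ℝ b ξ)
        = -(2 * Real.pi * inner ℝ ξ (a - b)) := by
      rw [inner_sub_right, real_inner_comm a ξ, real_inner_comm b ξ]; ring
    rw [h2, abs_neg]
    simp [abs_mul, abs_of_pos Real.pi_pos]
  rw [one_mul, hsum, map_sum] at h1
  refine h1.trans ((norm_sum_le _ _).trans ?_)
  rw [Finset.sum_mul]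
  refine Finset.sum_le_sum fun j _ => ?_
  have h2 : toL2 (((a - b) j : ℝ) • ∂_{e j} φ) = (((a - b) j : ℝ) : ℂ) • toL2 (∂_{e j} φ) := by
    rw [← map_smul]; rfl
  rw [h2, norm_smul, mul_comm]
  exact mul_le_mul_of_nonneg_left (norm_coord_le _ j) (norm_nonneg _)

end Friction

end

noncomputable section

namespace Friction

open LineDeriv

/-! ### Duhamel's formula for solutions -/

lemma laplacian_U (t : ℝ) (φ : 𝓢(R3, ℂ)) : Δ (U t φ) = U t (Δ φ) :=
  schwartz_ext_fourier fun ξ => by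
    rw [fourier_laplacian, fourier_U, fourier_U, fourier_laplacian]; ring

/-- A product rule in which `β` is only continuous: since `A` vanishes at `t`, the slope of the
product is the slope of `A` paired with `β`. Solutions are differentiable only in the weak sense, so
the usual rule is not available. -/
lemma hasDerivWithinAt_inner_of_eq_zero {A β : ℝ → L2} {A' : L2} {S : Set ℝ} {t : ℝ}
    (hA : HasDerivWithinAt A A' S t) (h0 : A t = 0) (hβ : ContinuousWithinAt β S t) :
    HasDerivWithinAt (fun s => inner ℂ (A s) (β s)) (inner ℂ A' (β t)) S t := by
  rw [hasDerivWithinAt_iff_tendsto_slope] at hA ⊢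
  have hβ' : Tendsto β (𝓝[S \ {t}] t) (𝓝 (β t)) := hβ.mono_left (nhdsWithin_mono _ sdiff_subset)
  refine (hA.inner (𝕜 := ℂ) hβ').congr fun s => ?_
  simp only [slope_def_module, h0, inner_zero_left, sub_zero]
  rw [RCLike.real_smul_eq_coe_smul (K := ℂ), inner_smul_left, RCLike.conj_ofReal,
    Complex.real_smul]
  rfl

/-- The test function transported by the free evolution, as a curve in `L²`. -/
lemma hasDerivAt_conjS_U_neg (φ : 𝓢(R3, ℂ)) (t : ℝ) :
    HasDerivAt (fun s => toL2 (conjS (U (-s) φ)))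
      ((Complex.I / 2) • toL2 (conjS (U (-t) (Δ φ)))) t := by
  have h : ∀ (s : ℝ) (ψ : 𝓢(R3, ℂ)), conjS (U (-s) ψ) = U s (conjS ψ) := fun s ψ => by
    rw [conjS_U, neg_neg]
  simp only [h, ← laplacian_conjS]
  exact hasDerivAt_U t (conjS φ)

variable {κ M₀ T : ℝ} {W : R3 → ℝ} {w : 𝓢(R3, ℂ)} {X₀ P₀ : R3} {β₀ : L2} {X P : ℝ → R3}
  {β : ℝ → L2}

lemma continuous_toL2_shift (φ : 𝓢(R3, ℂ)) : Continuous fun a => toL2 (shift a φ) := by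
  obtain ⟨C, hC, h⟩ := norm_toL2_shift_sub_le φ
  refine (LipschitzWith.of_dist_le_mul (K := C.toNNReal) fun a b => ?_).continuous
  rw [dist_eq_norm, dist_eq_norm, Real.coe_toNNReal C hC]
  exact h a b

lemma continuous_toL2_U_shift (φ : 𝓢(R3, ℂ)) :
    Continuous fun p : ℝ × R3 => toL2 (U p.1 (shift p.2 φ)) := by
  refine continuous_iff_continuousAt.2 fun p => ?_
  have h1 : Tendsto (fun q : ℝ × R3 => toL2 (U q.1 (shift p.2 φ))) (𝓝 p)
      (𝓝 (toL2 (U p.1 (shift p.2 φ)))) :=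
    ((continuous_toL2_U (shift p.2 φ)).comp continuous_fst).continuousAt
  have h2 : Tendsto (fun q : ℝ × R3 => toL2 (U q.1 (shift q.2 φ)) - toL2 (U q.1 (shift p.2 φ)))
      (𝓝 p) (𝓝 0) := by
    refine squeeze_zero_norm (a := fun q => ‖toL2 (shift q.2 φ) - toL2 (shift p.2 φ)‖)
      (fun q => ?_) ?_
    · rw [← map_sub, ← map_sub, ← map_sub, norm_toLp_U]
    · have := (((continuous_toL2_shift φ).comp continuous_snd).sub continuous_const).norm.tendsto
        (f := fun q : ℝ × R3 => ‖toL2 (shift q.2 φ) - toL2 (shift p.2 φ)‖) p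
      simpa using this
  simpa [ContinuousAt] using h2.add h1

lemma pair_U_right (t : ℝ) (φ ψ : 𝓢(R3, ℂ)) :
    pair φ (toL2 (U t ψ)) = pair (U t φ) (toL2 ψ) := by
  have h1 : conjS (conjS φ) = φ := by ext x; simp [conjS_apply]
  have e1 := specPair_schr_schwartz 0 (conjS φ) (U t ψ)
  have e2 := specPair_schr_schwartz t (conjS φ) ψ
  rw [h1, U_zero] at e1
  rw [h1] at e2
  rw [pair_toLp, pair_toLp, ← e1, ← e2]
  refine integral_congr_ae (Eventually.of_forall fun ξ => ?_)
  simp only [sym_eq_schr, fourier_U, sym_zero]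
  ring

namespace IsSolution

lemma continuousOn_X (hs : IsSolution κ M₀ W T X₀ P₀ β₀ X P β) : ContinuousOn X (Icc 0 T) :=
  fun t ht => (hs.X_deriv t ht).continuousWithinAt

lemma continuousOn_P (hs : IsSolution κ M₀ W T X₀ P₀ β₀ X P β) : ContinuousOn P (Icc 0 T) :=
  fun t ht => (hs.P_deriv t ht).continuousWithinAt

/-- The moving test function is split into its value at `t`, to which the weak equation applies, and
an increment vanishing at `t`, to which the product rule above applies. The two Laplacian terms
cancel and leave only the source. -/
lemma hasDerivWithinAt_pair (h : IsComplexification W w)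
    (hs : IsSolution κ M₀ W T X₀ P₀ β₀ X P β) (φ : 𝓢(R3, ℂ)) {t : ℝ} (ht : t ∈ Icc 0 T) :
    HasDerivWithinAt (fun s => pair (U (-s) φ) (β s))
      (-(Complex.I * κ) * pair (U (-t) φ) (toL2 (shift (X t) w))) (Icc 0 T) t := by
  set A : ℝ → L2 := fun s => toL2 (conjS (U (-s) φ)) with hA
  have h1 : HasDerivWithinAt (fun s => A s - A t) ((Complex.I / 2) • toL2 (conjS (U (-t) (Δ φ))))
      (Icc 0 T) t := ((hasDerivAt_conjS_U_neg φ t).sub_const (A t)).hasDerivWithinAt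
  have h2 := hasDerivWithinAt_inner_of_eq_zero h1 (sub_self _) (hs.β_cont t ht)
  have h3 := hs.β_deriv (U (-t) φ) t ht
  have hf : (fun s => pair (U (-s) φ) (β s))
      = fun s => inner ℂ (A s - A t) (β s) + ∫ x, U (-t) φ x * β s x := by
    funext s
    have : ∫ x, U (-t) φ x * β s x = inner ℂ (A t) (β s) := by
      rw [hA]; exact pair_eq_inner (U (-t) φ) (β s)
    rw [this, inner_sub_left, sub_add_cancel, pair_eq_inner]
  rw [hf]
  refine (h2.add h3).congr_deriv ?_
  have e1 : ∫ x, (Δ (U (-t) φ)) x * β t x = pair (U (-t) (Δ φ)) (β t) := by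
    rw [laplacian_U]; rfl
  have e2 : ∫ x, U (-t) φ x * (W (x - X t) : ℂ) = pair (U (-t) φ) (toL2 (shift (X t) w)) := by
    rw [pair_toLp]
    simp only [shift_apply, h.eq]
  rw [e1, e2, inner_smul_left, ← pair_eq_inner]
  simp only [map_div₀, Complex.conj_I, map_ofNat]
  ring

lemma continuousOn_pair (φ : 𝓢(R3, ℂ)) (hX : ContinuousOn X (Icc 0 T)) :
    ContinuousOn (fun s => pair (U (-s) φ) (toL2 (shift (X s) w))) (Icc 0 T) := by
  simp only [pair_eq_inner]
  refine ContinuousOn.inner (𝕜 := ℂ) (Continuous.continuousOn ?_) ?_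
  · exact continuous_iff_continuousAt.2 fun s => (hasDerivAt_conjS_U_neg φ s).continuousAt
  · exact (continuous_toL2_shift w).comp_continuousOn hX

/-- Duhamel's formula, tested against a Schwartz function. -/
lemma pair_eq (h : IsComplexification W w) (hs : IsSolution κ M₀ W T X₀ P₀ β₀ X P β)
    (φ : 𝓢(R3, ℂ)) {t : ℝ} (ht : t ∈ Icc 0 T) :
    pair φ (β t) = pair (U t φ) β₀
      - Complex.I * κ * ∫ s in (0 : ℝ)..t, pair (U (t - s) φ) (toL2 (shift (X s) w)) := by
  have hsub : Icc 0 t ⊆ Icc 0 T := Icc_subset_Icc_right ht.2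
  have hint := intervalIntegral.integral_eq_sub_of_hasDerivAt_of_le ht.1
    (f := fun s => pair (U (-s) (U t φ)) (β s))
    (f' := fun s => -(Complex.I * κ) * pair (U (-s) (U t φ)) (toL2 (shift (X s) w)))
    (fun s hx => ((hs.hasDerivWithinAt_pair h (U t φ) (hsub hx)).continuousWithinAt).mono hsub)
    (fun s hx => (hs.hasDerivWithinAt_pair h (U t φ) (hsub (Ioo_subset_Icc_self hx))).hasDerivAt
      (Icc_mem_nhds hx.1 (hx.2.trans_le ht.2)))
    ((((continuousOn_pair (U t φ) hs.continuousOn_X).mono hsub).const_smul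
      (-(Complex.I * κ))).intervalIntegrable_of_Icc ht.1)
  rw [intervalIntegral.integral_const_mul] at hint
  have hU : ∀ s, U (-s) (U t φ) = U (t - s) φ := fun s => by
    rw [← U_add]; congr 1; ring_nf
  simp only [hU, sub_self, U_zero, sub_zero, hs.β_zero] at hint
  rw [← sub_add_cancel (pair φ (β t)) (pair (U t φ) β₀), ← hint]
  ring

end IsSolution

/-! ### The force -/

/-- The self force vanishes for a particle at rest. -/
lemma pair_U_shift_self (h : IsComplexification W w) (j : Fin 3) (t : ℝ) (a : R3) :
    pair (U t (shift a (∂_{e j} w))) (toL2 (shift a w)) = 0 := by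
  have h1 := specPair_schr_schwartz t (∂_{e j} w) w
  rw [h.conjS_lineDeriv] at h1
  have h2 : pair (U t (shift a (∂_{e j} w))) (toL2 (shift a w))
      = ∫ x, U t (∂_{e j} w) x * w x := by
    rw [pair_toLp]
    simp only [U_shift, shift_apply]
    exact integral_sub_right_eq_self (fun x => U t (∂_{e j} w) x * w x) a
  rw [h2, ← h1, specPair]
  set F : R3 → ℂ := fun ξ => (starRingEnd ℂ) ((𝓕 (∂_{e j} w) : 𝓢(R3, ℂ)) ξ)
    * schr t ((2 * Real.pi * ‖ξ‖) ^ 2) * (𝓕 w : 𝓢(R3, ℂ)) ξ with hF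
  -- The transform of `w` and the propagator are even in `ξ`, while the derivative contributes an
  -- odd factor.
  have hodd : ∀ ξ, F (-ξ) = -F ξ := by
    intro ξ
    have hr : (𝓕 w : 𝓢(R3, ℂ)) (-ξ) = (𝓕 w : 𝓢(R3, ℂ)) ξ := h.fourier_radial (norm_neg ξ)
    simp only [hF, fourier_lineDeriv, hr, norm_neg, inner_neg_left, map_mul, Complex.ofReal_neg,
      map_neg]
    ring
  have h3 : ∫ ξ, F ξ = -∫ ξ, F ξ := by
    rw [← integral_neg, ← integral_neg_eq_self]
    simp only [hodd]
  exact self_eq_neg.1 h3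

lemma force_apply (h : IsComplexification W w) (κ : ℝ) (b : L2) (a : R3) (j : Fin 3) :
    ((2 * κ) • ∫ x, (b x).re • gradient W (x - a)) j
      = 2 * κ * (pair (shift a (∂_{e j} w)) b).re := by
  have hpt : ∀ (i : Fin 3) x, shift a (∂_{e i} w) x * b x
      = ((gradient W (x - a) i : ℝ) : ℂ) * b x := fun i x => by
    rw [shift_apply, h.lineDeriv_eq]
  have hi : ∀ i, Integrable fun x => shift a (∂_{e i} w) x * b x := fun i =>
    MemLp.integrable_mul (p := 2) (q := 2) ((shift a (∂_{e i} w)).memLp 2 volume) (Lp.memLp b)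
  have hre : ∀ i, (fun x => ((b x).re • gradient W (x - a)) i)
      = fun x => (shift a (∂_{e i} w) x * b x).re := fun i => by
    funext x
    rw [hpt, Complex.re_ofReal_mul, PiLp.smul_apply, smul_eq_mul, mul_comm]
  rw [PiLp.smul_apply, smul_eq_mul, eval_integral_piLp (fun i => by rw [hre]; exact (hi i).re)]
  rw [hre]
  congr 1
  exact Complex.reCLM.integral_comp_comm (hi j)

/-- The force on the particle, as long as it stays near its initial position. -/
lemma IsSolution.exists_norm_force_le (h : IsComplexification W w) (hκ : 0 < κ) (M₀ T : ℝ) :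
    ∃ A, 0 ≤ A ∧ ∀ (X₀ P₀ : R3) (β₀ : L2) (X P : ℝ → R3) (β : ℝ → L2),
      IsSolution κ M₀ W T X₀ P₀ β₀ X P β → ∀ ε, 0 ≤ ε →
      weightedNorm X₀ (-3) β₀ ≤ ENNReal.ofReal ε → ∀ t ∈ Icc 0 T, ‖X t - X₀‖ ≤ 1 →
      ∀ δ, (∀ r ∈ Icc 0 t, ‖X r - X t‖ ≤ δ) →
      ‖(2 * κ) • ∫ x, (β t x).re • gradient W (x - X t)‖ ≤ A * (ε + δ) := by
  choose C hC hb using fun j => exists_norm_pair_U_shift_le T (∂_{e j} w)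
  obtain ⟨L, hL, hl⟩ := norm_toL2_shift_sub_le w
  set S := ∑ j, C j with hS
  set R := ∑ j, ‖toL2 (∂_{e j} w)‖ with hR
  have hS0 : 0 ≤ S := Finset.sum_nonneg fun j _ => hC j
  have hR0 : 0 ≤ R := Finset.sum_nonneg fun j _ => norm_nonneg _
  refine ⟨4 * κ * (S + κ * (R * L * |T|)), by positivity,
    fun X₀ P₀ β₀ X P β hs ε hε hw t ht hXt δ hδ => ?_⟩
  have hδ0 : 0 ≤ δ := (norm_nonneg _).trans (hδ 0 ⟨le_rfl, ht.1⟩)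
  refine (norm_le_of_abs_le (c := 2 * κ * (S * ε + κ * (R * (L * δ) * |T|)))
    (by positivity) fun j => ?_).trans ?_
  · rw [force_apply h, abs_mul, abs_of_nonneg (by positivity : 0 ≤ 2 * κ)]
    refine mul_le_mul_of_nonneg_left ((Complex.abs_re_le_norm _).trans ?_) (by positivity)
    rw [hs.pair_eq h _ ht]
    have b1 : ‖pair (U t (shift (X t) (∂_{e j} w))) β₀‖ ≤ S * ε :=
      (hb j t ht (X t) X₀ hXt β₀ ε hε hw).trans (mul_le_mul_of_nonneg_right
        (Finset.single_le_sum (f := C) (fun k _ => hC k) (Finset.mem_univ j)) hε)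
    have b2 : ‖∫ s in (0 : ℝ)..t, pair (U (t - s) (shift (X t) (∂_{e j} w)))
        (toL2 (shift (X s) w))‖ ≤ R * (L * δ) * |t - 0| := by
      refine intervalIntegral.norm_integral_le_of_norm_le_const fun s hs' => ?_
      rw [uIoc_of_le ht.1] at hs'
      -- Subtracting the vanishing self force at the present position leaves the difference of two
      -- translates of `w`, which is Lipschitz in `X s - X t`.
      rw [← sub_zero (pair _ _), ← pair_U_shift_self h j (t - s) (X t), ← pair_sub_right]
      refine (norm_pair_le _ _).trans ?_
      rw [norm_toLp_U, norm_toLp_shift]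
      refine mul_le_mul (Finset.single_le_sum (f := fun j => ‖toL2 (∂_{e j} w)‖)
        (fun k _ => norm_nonneg _) (Finset.mem_univ j)) ((hl _ _).trans ?_) (norm_nonneg _) hR0
      exact mul_le_mul_of_nonneg_left (hδ s ⟨hs'.1.le, hs'.2⟩) hL
    refine (norm_sub_le _ _).trans (add_le_add b1 ?_)
    rw [norm_mul, norm_mul, Complex.norm_I, one_mul, Complex.norm_real, Real.norm_of_nonneg hκ.le]
    refine mul_le_mul_of_nonneg_left (b2.trans ?_) hκ.le
    have : |t - 0| ≤ |T| := by
      rw [sub_zero, abs_of_nonneg ht.1]; exact ht.2.trans (le_abs_self T)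
    gcongr
  · have e1 : 0 ≤ S * δ := by positivity
    have e2 : 0 ≤ κ * (R * L * |T|) * ε := by positivity
    nlinarith [mul_nonneg hκ.le e1, mul_nonneg hκ.le e2]

/-- A particle that starts slowly in a weak field stays slow. -/
lemma IsSolution.exists_norm_momentum_le (h : IsComplexification W w) (hκ : 0 < κ) (hM₀ : 0 < M₀)
    {T η : ℝ} (hT : 0 < T) (hη : 0 < η) (hηT : M₀⁻¹ * (η * T) ≤ 1) :
    ∃ ε, 0 < ε ∧ ∀ (X₀ P₀ : R3) (β₀ : L2) (X P : ℝ → R3) (β : ℝ → L2),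
      IsSolution κ M₀ W T X₀ P₀ β₀ X P β →
      weightedNorm X₀ (-3) β₀ ≤ ENNReal.ofReal ε → ‖P₀‖ ≤ ε →
      ∀ t ∈ Icc 0 T, ‖P t‖ ≤ η := by
  obtain ⟨A, hA, hF⟩ := IsSolution.exists_norm_force_le h hκ M₀ T
  -- The barrier `B` grows at rate `lam` and reaches `η` at time `T`. As long as the momentum stays
  -- below it, the force is at most `A (M₀⁻¹ T + 1) B`, hence at most `lam/2 · B`.
  set lam : ℝ := 4 * A * (M₀⁻¹ * T + 1) + 1 with hlam
  have hlam0 : 0 < lam := by positivity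
  set B : ℝ → ℝ := fun t => η * Real.exp (lam * (t - T)) with hB
  have hBpos : ∀ t, 0 < B t := fun t => by positivity
  have hBmono : ∀ s t, s ≤ t → B s ≤ B t := fun s t hst => by
    simp only [hB]; gcongr
  have hBη : ∀ t, t ≤ T → B t ≤ η := fun t ht => by
    have := hBmono t T ht
    simpa [hB] using this
  have hBd : ∀ t, HasDerivAt B (lam * B t) t := fun t => by
    have h1 : HasDerivAt (fun t : ℝ => lam * (t - T)) (lam * 1) t :=
      ((hasDerivAt_id t).sub_const T).const_mul lam
    refine (h1.exp.const_mul η).congr_deriv ?_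
    simp only [hB]
    ring
  have hBc : Continuous B := continuous_iff_continuousAt.2 fun t => (hBd t).continuousAt
  refine ⟨B 0 / 4, by linarith [hBpos 0], fun X₀ P₀ β₀ X P β hs hw hP => ?_⟩
  suffices hlt : ∀ t ∈ Icc 0 T, ‖P t‖ < B t from
    fun t ht => (hlt t ht).le.trans (hBη t ht.2)
  by_contra! hcon
  -- The infimum of this compact set is the first time the momentum reaches the barrier. Before it
  -- the particle has moved by at most one unit, so the force estimate is available.
  set V : Set ℝ := Icc 0 T ∩ (fun t => ‖P t‖ - B t) ⁻¹' Ici 0 with hV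
  have hVc : IsCompact V := by
    refine isCompact_Icc.of_isClosed_subset ?_ inter_subset_left
    exact ContinuousOn.preimage_isClosed_of_isClosed
      (hs.continuousOn_P.norm.sub hBc.continuousOn) isClosed_Icc isClosed_Ici
  have hVne : V.Nonempty := by
    obtain ⟨t, ht, hle⟩ := hcon
    exact ⟨t, ht, by simpa using hle⟩
  obtain ⟨⟨ht₀, hPt₀⟩, hmin⟩ : sInf V ∈ V ∧ ∀ t ∈ V, sInf V ≤ t :=
    ⟨hVc.sInf_mem hVne, fun t ht => csInf_le hVc.bddBelow ht⟩
  set t₀ := sInf V with ht₀def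
  have hPt₀' : B t₀ ≤ ‖P t₀‖ := by simpa using hPt₀
  have hbelow : ∀ t, 0 ≤ t → t < t₀ → ‖P t‖ ≤ B t := fun t ht0 ht => by
    by_contra! hgt
    exact absurd (hmin t ⟨⟨ht0, (ht.trans_le ht₀.2).le⟩, by simpa using hgt.le⟩) (not_le.2 ht)
  have hXdiff : ∀ c r t, 0 ≤ r → r ≤ t → t < t₀ → (∀ u ∈ Ico r t, ‖P u‖ ≤ c) →
      ‖X t - X r‖ ≤ M₀⁻¹ * c * (t - r) := by
    intro c r t hr hrt ht hc
    refine norm_image_sub_le_of_norm_deriv_le_segment' (f' := fun u => M₀⁻¹ • P u)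
      (fun u hu => (hs.X_deriv u ⟨hr.trans hu.1, hu.2.trans (ht.le.trans ht₀.2)⟩).mono
        (Icc_subset_Icc hr (ht.le.trans ht₀.2))) (fun u hu => ?_) t ⟨hrt, le_rfl⟩
    rw [norm_smul, norm_inv, Real.norm_of_nonneg hM₀.le]
    exact mul_le_mul_of_nonneg_left (hc u hu) (by positivity)
  have hPd : ∀ t ∈ Ico 0 t₀,
      ‖(2 * κ) • ∫ x, (β t x).re • gradient W (x - X t)‖ ≤ lam / 2 * B t := by
    intro t ht
    have htT : t ≤ T := ht.2.le.trans ht₀.2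
    have h1 : ‖X t - X₀‖ ≤ 1 := by
      rw [← hs.X_zero]
      refine (hXdiff η 0 t le_rfl ht.1 ht.2 fun u hu =>
        (hbelow u hu.1 (hu.2.trans ht.2)).trans (hBη u (hu.2.le.trans htT))).trans
        (le_trans ?_ hηT)
      rw [sub_zero, mul_assoc]
      gcongr
    have h2 : ∀ r ∈ Icc 0 t, ‖X r - X t‖ ≤ M₀⁻¹ * T * B t := by
      intro r hr
      rw [norm_sub_rev]
      refine (hXdiff (B t) r t hr.1 hr.2 ht.2 fun u hu =>
        (hbelow u (hr.1.trans hu.1) (hu.2.trans ht.2)).trans (hBmono u t hu.2.le)).trans ?_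
      have : t - r ≤ T := by linarith [hr.1]
      have hBt := (hBpos t).le
      calc _ ≤ M₀⁻¹ * B t * T := by gcongr
        _ = _ := by ring
    have h3 := hF X₀ P₀ β₀ X P β hs (B 0 / 4) (by linarith [hBpos 0]) hw t ⟨ht.1, htT⟩ h1 _ h2
    refine h3.trans ?_
    have h4 : B 0 ≤ B t := hBmono 0 t ht.1
    have h5 := hBpos t
    have h6 : 0 ≤ A * B t := by positivity
    calc A * (B 0 / 4 + M₀⁻¹ * T * B t) ≤ A * (B t + M₀⁻¹ * T * B t) := by
          gcongr; linarith [hBpos 0]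
      _ = A * (M₀⁻¹ * T + 1) * B t := by ring
      _ ≤ lam / 2 * B t := by
          gcongr
          rw [hlam]
          have : 0 ≤ A * (M₀⁻¹ * T + 1) := by positivity
          linarith
  -- Integrating the force bound gives `‖P‖ ≤ B/2 - B(0)/4` at the first contact time, which is
  -- strictly below the barrier: a contradiction.
  have hfin := image_norm_le_of_norm_deriv_right_le_deriv_boundary' (f := P) (a := 0) (b := t₀)
    (f' := fun t => (2 * κ) • ∫ x, (β t x).re • gradient W (x - X t))
    (hs.continuousOn_P.mono (Icc_subset_Icc_right ht₀.2))
    (fun t ht => ((hs.P_deriv t ⟨ht.1, ht.2.le.trans ht₀.2⟩).mono_of_mem_nhdsWithin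
      (Icc_mem_nhdsGE_of_mem ⟨ht.1, ht.2.trans_le ht₀.2⟩)))
    (B := fun t => B 0 / 4 + (B t - B 0) / 2) (B' := fun t => lam / 2 * B t)
    (by rw [hs.P_zero]; simpa using hP)
    (by fun_prop)
    (fun t _ => by
      refine ((((hBd t).sub_const (B 0)).div_const 2).const_add (B 0 / 4)).hasDerivWithinAt.congr_deriv ?_
      ring)
    hPd (right_mem_Icc.2 ht₀.1)
  have := hBmono 0 t₀ ht₀.1
  have := hBpos 0
  linarith [hBpos t₀]

end Friction

end

noncomputable section

namespace Friction

open LineDeriv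

/-! ### The free evolution on `L²` -/

lemma denseRange_toL2 : DenseRange (toL2 : 𝓢(R3, ℂ) → L2) :=
  SchwartzMap.denseRange_toLpCLM (by norm_num)

/-- The operator `e^{iΔt/2}` on `L²`. -/
def UL (t : ℝ) : L2 →L[ℂ] L2 :=
  ((toL2 : 𝓢(R3, ℂ) →ₗ[ℂ] L2) ∘ₗ (U t : 𝓢(R3, ℂ) →ₗ[ℂ] 𝓢(R3, ℂ))).extendOfNorm
    (toL2 : 𝓢(R3, ℂ) →ₗ[ℂ] L2)

lemma UL_toL2 (t : ℝ) (φ : 𝓢(R3, ℂ)) : UL t (toL2 φ) = toL2 (U t φ) :=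
  LinearMap.extendOfNorm_eq (e := (toL2 : 𝓢(R3, ℂ) →ₗ[ℂ] L2)) denseRange_toL2
    ⟨1, fun ψ => by simpa using (norm_toLp_U t ψ).le⟩ φ

lemma norm_UL_le (t : ℝ) (b : L2) : ‖UL t b‖ ≤ ‖b‖ := by
  have := LinearMap.norm_extendOfNorm_apply_le
    (f := (toL2 : 𝓢(R3, ℂ) →ₗ[ℂ] L2) ∘ₗ (U t : 𝓢(R3, ℂ) →ₗ[ℂ] 𝓢(R3, ℂ)))
    (e := (toL2 : 𝓢(R3, ℂ) →ₗ[ℂ] L2)) denseRange_toL2 1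
    (fun ψ => by simpa using (norm_toLp_U t ψ).le) b
  rw [one_mul] at this
  exact this

lemma continuous_UL (b : L2) : Continuous fun t => UL t b := by
  refine continuous_iff_continuousAt.2 fun t => Metric.continuousAt_iff'.2 fun ε hε => ?_
  obtain ⟨φ, hφ⟩ := denseRange_toL2.exists_dist_lt b (ε := ε / 3) (by positivity)
  have h1 : ∀ᶠ s in 𝓝 t, dist (toL2 (U s φ)) (toL2 (U t φ)) < ε / 3 :=
    Metric.continuousAt_iff'.1 (continuous_toL2_U φ).continuousAt (ε / 3) (by positivity)
  have h2 : ∀ s, dist (UL s b) (toL2 (U s φ)) < ε / 3 := fun s => by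
    rw [← UL_toL2, dist_eq_norm, ← map_sub]
    exact (norm_UL_le s _).trans_lt (by rwa [dist_eq_norm] at hφ)
  filter_upwards [h1] with s hs
  calc dist (UL s b) (UL t b) ≤ dist (UL s b) (toL2 (U s φ)) + dist (toL2 (U s φ)) (toL2 (U t φ))
        + dist (toL2 (U t φ)) (UL t b) := dist_triangle4 _ _ _ _
    _ < ε / 3 + ε / 3 + ε / 3 := by
        gcongr
        · exact h2 s
        · rw [dist_comm]; exact h2 t
    _ = ε := by ring

lemma continuous_UL_comp {c : ℝ → L2} (hc : Continuous c) : Continuous fun t => UL t (c t) := by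
  refine continuous_iff_continuousAt.2 fun t => ?_
  have h1 : Tendsto (fun s => UL s (c t)) (𝓝 t) (𝓝 (UL t (c t))) := (continuous_UL _).continuousAt
  have h2 : Tendsto (fun s => UL s (c s - c t)) (𝓝 t) (𝓝 0) := by
    refine squeeze_zero_norm (fun s => norm_UL_le s _) ?_
    simpa using ((hc.sub continuous_const).norm.tendsto (f := fun s => ‖c s - c t‖) t)
  simpa [ContinuousAt] using h2.add h1

lemma pair_UL (t : ℝ) (φ : 𝓢(R3, ℂ)) (b : L2) : pair φ (UL t b) = pair (U t φ) b := by
  have hc : ∀ ψ : 𝓢(R3, ℂ), Continuous fun b : L2 => pair ψ b := fun ψ => by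
    simp only [pair_eq_inner]; fun_prop
  refine denseRange_toL2.induction_on (p := fun b => pair φ (UL t b) = pair (U t φ) b) b
    (isClosed_eq ((hc φ).comp (UL t).continuous) (hc _)) fun ψ => ?_
  rw [UL_toL2, pair_U_right]

/-! ### Existence of solutions -/

variable {κ M₀ T : ℝ} {W : R3 → ℝ} {w : 𝓢(R3, ℂ)}

/-- The field in the interaction picture that is created along the trajectory `X`. -/
def interField (κ : ℝ) (w : 𝓢(R3, ℂ)) (β₀ : L2) (X : ℝ → R3) (t : ℝ) : L2 :=
  β₀ - (Complex.I * κ) • ∫ r in (0 : ℝ)..t, toL2 (U (-r) (shift (X r) w))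

lemma continuous_toL2_U_shift_comp (φ : 𝓢(R3, ℂ)) {τ : ℝ → ℝ} {X : ℝ → R3} (hτ : Continuous τ)
    (hX : Continuous X) : Continuous fun r => toL2 (U (τ r) (shift (X r) φ)) := by
  have h1 : Continuous fun r => (τ r, X r) := hτ.prodMk hX
  have h2 := (continuous_toL2_U_shift φ).comp h1
  simp only [Function.comp_def] at h2
  exact h2

lemma continuous_source (w : 𝓢(R3, ℂ)) {X : ℝ → R3} (hX : Continuous X) :
    Continuous fun r => toL2 (U (-r) (shift (X r) w)) :=
  continuous_toL2_U_shift_comp w continuous_neg hX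

lemma hasDerivAt_interField (κ : ℝ) (w : 𝓢(R3, ℂ)) (β₀ : L2) {X : ℝ → R3} (hX : Continuous X)
    (t : ℝ) : HasDerivAt (interField κ w β₀ X)
      (-((Complex.I * κ) • toL2 (U (-t) (shift (X t) w)))) t :=
  ((intervalIntegral.integral_hasDerivAt_right ((continuous_source w hX).intervalIntegrable _ _)
    ((continuous_source w hX).stronglyMeasurableAtFilter _ _)
    (continuous_source w hX).continuousAt).const_smul (Complex.I * (κ : ℂ))).const_sub β₀

lemma continuous_interField (κ : ℝ) (w : 𝓢(R3, ℂ)) (β₀ : L2) {X : ℝ → R3} (hX : Continuous X) :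
    Continuous (interField κ w β₀ X) :=
  continuous_iff_continuousAt.2 fun t => (hasDerivAt_interField κ w β₀ hX t).continuousAt

/-- The force along the trajectory `X`. -/
def trajForce (κ : ℝ) (w : 𝓢(R3, ℂ)) (β₀ : L2) (X : ℝ → R3) (t : ℝ) : R3 :=
  WithLp.toLp 2 fun j =>
    2 * κ * (pair (U t (shift (X t) (∂_{e j} w))) (interField κ w β₀ X t)).re

lemma trajForce_apply (κ : ℝ) (w : 𝓢(R3, ℂ)) (β₀ : L2) (X : ℝ → R3) (t : ℝ) (j : Fin 3) :
    trajForce κ w β₀ X t j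
      = 2 * κ * (pair (U t (shift (X t) (∂_{e j} w))) (interField κ w β₀ X t)).re := rfl

lemma continuous_conjS_toL2_U_shift (φ : 𝓢(R3, ℂ)) {X : ℝ → R3} (hX : Continuous X) :
    Continuous fun t => toL2 (conjS (U t (shift (X t) φ))) := by
  simp only [conjS_U, conjS_shift]
  exact continuous_toL2_U_shift_comp (conjS φ) continuous_neg hX

lemma continuous_trajForce (κ : ℝ) (w : 𝓢(R3, ℂ)) (β₀ : L2) {X : ℝ → R3} (hX : Continuous X) :
    Continuous (trajForce κ w β₀ X) := by
  refine (PiLp.continuous_toLp 2 _).comp (continuous_pi fun j => ?_)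
  simp only [pair_eq_inner]
  exact (Complex.continuous_re.comp ((continuous_conjS_toL2_U_shift _ hX).inner
    (continuous_interField κ w β₀ hX))).const_mul _

lemma norm_interField_le (hκ : 0 < κ) (w : 𝓢(R3, ℂ)) (β₀ : L2) (X : ℝ → R3) {t : ℝ}
    (ht : t ∈ Icc 0 T) : ‖interField κ w β₀ X t‖ ≤ ‖β₀‖ + κ * (‖toL2 w‖ * T) := by
  refine (norm_sub_le _ _).trans (add_le_add le_rfl ?_)
  rw [norm_smul, norm_mul, Complex.norm_I, one_mul, Complex.norm_real, Real.norm_of_nonneg hκ.le]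
  refine mul_le_mul_of_nonneg_left ?_ hκ.le
  have : ‖∫ r in (0 : ℝ)..t, toL2 (U (-r) (shift (X r) w))‖ ≤ ‖toL2 w‖ * |t - 0| :=
    intervalIntegral.norm_integral_le_of_norm_le_const fun r _ => by
      rw [norm_toLp_U, norm_toLp_shift]
  refine this.trans (mul_le_mul_of_nonneg_left ?_ (norm_nonneg _))
  rw [sub_zero, abs_of_nonneg ht.1]
  exact ht.2

/-- The force depends in a Lipschitz continuous way on the trajectory. -/
lemma exists_norm_trajForce_sub_le (hκ : 0 < κ) (w : 𝓢(R3, ℂ)) (β₀ : L2) (hT : 0 < T) :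
    ∃ C, 0 ≤ C ∧ ∀ X Y : ℝ → R3, Continuous X → Continuous Y → ∀ t ∈ Icc 0 T, ∀ δ,
      (∀ r ∈ Icc 0 t, ‖X r - Y r‖ ≤ δ) →
      ‖trajForce κ w β₀ X t - trajForce κ w β₀ Y t‖ ≤ C * δ := by
  choose A hA ha using fun j => norm_toL2_shift_sub_le (∂_{e j} w)
  obtain ⟨L, hL, hl⟩ := norm_toL2_shift_sub_le w
  set S := ∑ j, A j with hS
  set R := ∑ j, ‖toL2 (∂_{e j} w)‖ with hR
  have hS0 : 0 ≤ S := Finset.sum_nonneg fun j _ => hA j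
  have hR0 : 0 ≤ R := Finset.sum_nonneg fun j _ => norm_nonneg _
  set m := ‖β₀‖ + κ * (‖toL2 w‖ * T) with hm
  have hm0 : 0 ≤ m := by positivity
  refine ⟨4 * κ * (S * m + R * (κ * (L * T))), by positivity, fun X Y hX hY t ht δ hδ => ?_⟩
  have hδ0 : 0 ≤ δ := (norm_nonneg _).trans (hδ 0 ⟨le_rfl, ht.1⟩)
  refine (norm_le_of_abs_le (c := 2 * κ * (S * δ * m + R * (κ * (L * δ * T)))) (by positivity)
    fun j => ?_).trans (le_of_eq (by ring))
  have hsplit : (trajForce κ w β₀ X t - trajForce κ w β₀ Y t) j = 2 * κ *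
      (pair (U t (shift (X t) (∂_{e j} w) - shift (Y t) (∂_{e j} w))) (interField κ w β₀ X t)
      + pair (U t (shift (Y t) (∂_{e j} w)))
        (interField κ w β₀ X t - interField κ w β₀ Y t)).re := by
    rw [PiLp.sub_apply, trajForce_apply, trajForce_apply, map_sub, pair_sub, pair_sub_right]
    simp only [Complex.add_re, Complex.sub_re]
    ring
  rw [hsplit, abs_mul, abs_of_nonneg (by positivity : 0 ≤ 2 * κ)]
  refine mul_le_mul_of_nonneg_left ((Complex.abs_re_le_norm _).trans
    ((norm_add_le _ _).trans (add_le_add ?_ ?_))) (by positivity)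
  · refine (norm_pair_le _ _).trans ?_
    rw [norm_toLp_U, map_sub]
    refine mul_le_mul ((ha j _ _).trans ?_) (norm_interField_le hκ w β₀ X ht) (norm_nonneg _)
      (by positivity)
    exact mul_le_mul (Finset.single_le_sum (f := A) (fun k _ => hA k) (Finset.mem_univ j))
      (hδ t ⟨ht.1, le_rfl⟩) (norm_nonneg _) hS0
  · refine (norm_pair_le _ _).trans ?_
    rw [norm_toLp_U, norm_toLp_shift]
    refine mul_le_mul (Finset.single_le_sum (f := fun j => ‖toL2 (∂_{e j} w)‖)
        (fun k _ => norm_nonneg _) (Finset.mem_univ j)) ?_ (norm_nonneg _) hR0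
    have e1 : interField κ w β₀ X t - interField κ w β₀ Y t = (Complex.I * (κ : ℂ)) •
        ∫ r in (0 : ℝ)..t, (toL2 (U (-r) (shift (Y r) w)) - toL2 (U (-r) (shift (X r) w))) := by
      rw [intervalIntegral.integral_sub ((continuous_source w hY).intervalIntegrable _ _)
        ((continuous_source w hX).intervalIntegrable _ _), smul_sub, interField, interField]
      abel
    rw [e1, norm_smul, norm_mul, Complex.norm_I, one_mul, Complex.norm_real,
      Real.norm_of_nonneg hκ.le]
    refine mul_le_mul_of_nonneg_left ?_ hκ.le
    have : ‖∫ r in (0 : ℝ)..t, (toL2 (U (-r) (shift (Y r) w)) - toL2 (U (-r) (shift (X r) w)))‖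
        ≤ L * δ * |t - 0| := by
      refine intervalIntegral.norm_integral_le_of_norm_le_const fun r hr => ?_
      rw [uIoc_of_le ht.1] at hr
      rw [← map_sub, ← map_sub, norm_toLp_U, map_sub]
      refine (hl _ _).trans (mul_le_mul_of_nonneg_left ?_ hL)
      rw [norm_sub_rev]
      exact hδ r ⟨hr.1.le, hr.2⟩
    refine this.trans (mul_le_mul_of_nonneg_left ?_ (by positivity))
    rw [sub_zero, abs_of_nonneg ht.1]
    exact ht.2

end Friction

end

noncomputable section

namespace Friction

open LineDeriv

variable {κ M₀ T : ℝ} {W : R3 → ℝ} {w : 𝓢(R3, ℂ)}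

lemma UL_zero (b : L2) : UL 0 b = b :=
  denseRange_toL2.induction_on (p := fun b => UL 0 b = b) b
    (isClosed_eq (UL 0).continuous continuous_id) fun ψ => by rw [UL_toL2, U_zero]

lemma hasDerivAt_conjS_U (φ : 𝓢(R3, ℂ)) (t : ℝ) :
    HasDerivAt (fun s => toL2 (conjS (U s φ)))
      ((-1 : ℝ) • (Complex.I / 2) • toL2 (conjS (U t (Δ φ)))) t := by
  have h1 := hasDerivAt_conjS_U_neg φ (-t)
  have h2 := HasDerivAt.scomp t (h := fun s : ℝ => -s) h1 (hasDerivAt_neg t)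
  simp only [Function.comp_def, neg_neg] at h2
  exact h2

/-- The field created along a continuous trajectory solves the Schrödinger equation. -/
lemma hasDerivAt_pair_UL_interField (h : IsComplexification W w) (β₀ : L2) {X : ℝ → R3}
    (hX : Continuous X) (φ : 𝓢(R3, ℂ)) (t : ℝ) :
    HasDerivAt (fun s => ∫ x, φ x * UL s (interField κ w β₀ X s) x)
      (Complex.I / 2 * (∫ x, (Δ φ) x * UL t (interField κ w β₀ X t) x)
        - Complex.I * κ * ∫ x, φ x * (W (x - X t) : ℂ)) t := by
  have hf : (fun s => ∫ x, φ x * UL s (interField κ w β₀ X s) x)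
      = fun s => inner ℂ (toL2 (conjS (U s φ))) (interField κ w β₀ X s) := by
    funext s
    rw [← pair_eq_inner, ← pair_UL]
    rfl
  rw [hf]
  refine ((hasDerivAt_conjS_U φ t).inner ℂ (hasDerivAt_interField κ w β₀ hX t)).congr_deriv ?_
  have e1 : ∫ x, (Δ φ) x * UL t (interField κ w β₀ X t) x
      = pair (U t (Δ φ)) (interField κ w β₀ X t) := by
    rw [← pair_UL]; rfl
  have e2 : ∫ x, φ x * (W (x - X t) : ℂ) = pair (U t φ) (toL2 (U (-t) (shift (X t) w))) := by
    rw [pair_U_right, ← U_add, neg_add_cancel, U_zero, pair_toLp]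
    simp only [shift_apply, h.eq]
  have hv : ∀ v : L2, (-1 : ℝ) • v = (-1 : ℂ) • v := fun v => by simp
  rw [e1, e2, hv, inner_neg_right, inner_smul_right, inner_smul_left, inner_smul_left,
    ← pair_eq_inner, ← pair_eq_inner]
  simp only [map_div₀, Complex.conj_I, map_ofNat, map_neg, map_one]
  ring

/-- The equations of motion have a solution for all initial data. -/
lemma exists_isSolution (h : IsComplexification W w) (hκ : 0 < κ) (hM₀ : 0 < M₀) (hT : 0 < T)
    (X₀ P₀ : R3) (β₀ : L2) : ∃ X P β, IsSolution κ M₀ W T X₀ P₀ β₀ X P β := by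
  obtain ⟨C, hC, hLip⟩ := exists_norm_trajForce_sub_le hκ w β₀ hT
  -- The Lipschitz estimate for the force holds on `[0, T]` only, so the force is frozen from `T`
  -- on. This makes the map global in time without changing the equation on `[0, T]`.
  let G : (ℝ → R3) → ℝ → R3 := fun u r => trajForce κ w β₀ u (min r T)
  have hG : ∀ u, Continuous u → Continuous (G u) := fun u hu =>
    (continuous_trajForce κ w β₀ hu).comp (continuous_id.min continuous_const)
  let P : (ℝ → R3) → ℝ → R3 := fun u t => P₀ + ∫ s in (0 : ℝ)..t, G u s
  have hPd : ∀ u, Continuous u → ∀ t, HasDerivAt (P u) (G u t) t := fun u hu t =>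
    (intervalIntegral.integral_hasDerivAt_right ((hG u hu).intervalIntegrable _ _)
      ((hG u hu).stronglyMeasurableAtFilter _ _) (hG u hu).continuousAt).const_add P₀
  have hP : ∀ u, Continuous u → Continuous (P u) := fun u hu =>
    continuous_iff_continuousAt.2 fun t => (hPd u hu t).continuousAt
  let V : (ℝ → R3) → ℝ → R3 := fun u t => X₀ + M₀⁻¹ • ∫ s in (0 : ℝ)..t, P u s
  have hVd : ∀ u, Continuous u → ∀ t, HasDerivAt (V u) (M₀⁻¹ • P u t) t := fun u hu t =>
    ((intervalIntegral.integral_hasDerivAt_right ((hP u hu).intervalIntegrable _ _)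
      ((hP u hu).stronglyMeasurableAtFilter _ _) (hP u hu).continuousAt).const_smul
        M₀⁻¹).const_add X₀
  have hV : ∀ u, Continuous u → Continuous (V u) := fun u hu =>
    continuous_iff_continuousAt.2 fun t => (hVd u hu t).continuousAt
  have hmin : ∀ s, 0 ≤ s → min s T ∈ Icc 0 T := fun s hs => ⟨le_min hs hT.le, min_le_right _ _⟩
  -- Two time integrations give the Lipschitz constant `M₀⁻¹ C / a²`, which is at most `1/2` because
  -- `a ≥ 1`.
  set a : ℝ := 2 * M₀⁻¹ * C + 1 with ha
  have ha1 : 1 ≤ a := by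
    have : 0 ≤ 2 * M₀⁻¹ * C := by positivity
    linarith
  have ha0 : 0 < a := by linarith
  have hexp1 : ∀ s : ℝ, 0 ≤ s → 1 ≤ Real.exp (a * s) := fun s hs =>
    Real.one_le_exp (by positivity)
  obtain ⟨F, hF⟩ := isCompact_Icc.exists_bound_of_continuousOn (s := Icc 0 T)
    (continuous_trajForce κ w β₀ (X := 0) continuous_const).continuousOn
  have hF0 : 0 ≤ F := (norm_nonneg _).trans (hF 0 ⟨le_rfl, hT.le⟩)
  obtain ⟨u, hu, hfix⟩ := exists_weighted_fixedPoint V a (‖X₀‖ + M₀⁻¹ * (‖P₀‖ + F)) hV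
    (fun t ht => by
      have h1 : ∀ s, 0 ≤ s → ‖P 0 s‖ ≤ (‖P₀‖ + F) * Real.exp (a * s) := by
        intro s hs
        have h2 := norm_intervalIntegral_le_exp ha0 hF0 hs (u := G 0) fun r hr _ =>
          (hF _ (hmin r hr)).trans (le_mul_of_one_le_right hF0 (hexp1 r hr))
        have h3 : F / a ≤ F := div_le_self hF0 ha1
        calc _ ≤ ‖P₀‖ + F / a * Real.exp (a * s) := (norm_add_le _ _).trans (add_le_add le_rfl h2)
          _ ≤ ‖P₀‖ * Real.exp (a * s) + F * Real.exp (a * s) := by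
            gcongr
            exact le_mul_of_one_le_right (norm_nonneg _) (hexp1 s hs)
          _ = _ := by ring
      have hm : 0 ≤ ‖P₀‖ + F := by positivity
      have h4 := norm_intervalIntegral_le_exp ha0 hm ht fun s hs _ => h1 s hs
      have h5 : (‖P₀‖ + F) / a ≤ ‖P₀‖ + F := div_le_self hm ha1
      calc ‖V 0 t‖ ≤ ‖X₀‖ + ‖M₀⁻¹ • ∫ s in (0 : ℝ)..t, P 0 s‖ := norm_add_le _ _
        _ ≤ ‖X₀‖ * Real.exp (a * t) + M₀⁻¹ * ((‖P₀‖ + F) * Real.exp (a * t)) := by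
          rw [norm_smul, Real.norm_of_nonneg (by positivity)]
          gcongr
          · exact le_mul_of_one_le_right (norm_nonneg _) (hexp1 t ht)
          · exact h4.trans (by gcongr)
        _ = _ := by ring)
    (fun u v hu hv m hm t ht => by
      have hm0 : 0 ≤ m := by
        have := (norm_nonneg _).trans (hm 0 le_rfl)
        simpa using this
      have h1 : ∀ s, 0 ≤ s → ‖G u s - G v s‖ ≤ C * m * Real.exp (a * s) := by
        intro s hs
        refine (hLip u v hu hv _ (hmin s hs) (m * Real.exp (a * s)) fun r hr => ?_).trans
          (le_of_eq (by ring))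
        refine (hm r hr.1).trans ?_
        have := hr.2.trans (min_le_left _ _)
        gcongr
      have h2 : ∀ s, 0 ≤ s → ‖P u s - P v s‖ ≤ C * m / a * Real.exp (a * s) := by
        intro s hs
        have : P u s - P v s = ∫ r in (0 : ℝ)..s, (G u r - G v r) := by
          rw [intervalIntegral.integral_sub ((hG u hu).intervalIntegrable _ _)
            ((hG v hv).intervalIntegrable _ _)]
          simp only [P]
          abel
        rw [this]
        exact norm_intervalIntegral_le_exp ha0 (by positivity) hs fun r hr _ => h1 r hr
      have h3 : V u t - V v t = M₀⁻¹ • ∫ s in (0 : ℝ)..t, (P u s - P v s) := by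
        rw [intervalIntegral.integral_sub ((hP u hu).intervalIntegrable _ _)
          ((hP v hv).intervalIntegrable _ _), smul_sub]
        simp only [V]
        abel
      rw [h3, norm_smul, Real.norm_of_nonneg (by positivity)]
      have h4 := norm_intervalIntegral_le_exp ha0 (by positivity) ht fun s hs _ => h2 s hs
      calc _ ≤ M₀⁻¹ * (C * m / a / a * Real.exp (a * t)) := by gcongr
        _ = M₀⁻¹ * (C * m / a / a) * Real.exp (a * t) := by ring
        _ ≤ _ := by
          gcongr
          rw [div_div, mul_div_assoc', div_le_div_iff₀ (by positivity) (by norm_num)]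
          have h5 : 2 * M₀⁻¹ * C ≤ a * a := by nlinarith
          nlinarith [mul_le_mul_of_nonneg_right h5 hm0])
  refine ⟨u, P u, fun t => UL t (interField κ w β₀ u t), ?_⟩
  refine ⟨?_, ?_, ?_, fun t ht => ?_, fun t ht => ?_, ?_, fun φ t ht => ?_⟩
  · rw [hfix 0 le_rfl]; simp [V]
  · simp [P]
  · rw [UL_zero]; simp [interField]
  · exact (hVd u hu t).hasDerivWithinAt.congr (fun s hs => hfix s hs.1) (hfix t ht.1)
  · refine (hPd u hu t).hasDerivWithinAt.congr_deriv ?_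
    ext j
    rw [force_apply h, pair_UL]
    simp only [G]
    rw [min_eq_left ht.2, trajForce_apply]
  · exact (continuous_UL_comp (continuous_interField κ w β₀ hu)).continuousOn
  · exact (hasDerivAt_pair_UL_interField h β₀ hu φ t).hasDerivWithinAt

/-- A momentum bounded by `η` on `[0, T]`, switched off at time `T`. -/
lemma IsSolution.isStopped {X₀ P₀ : R3} {β₀ : L2} {X P : ℝ → R3} {β : ℝ → L2}
    (hs : IsSolution κ M₀ W T X₀ P₀ β₀ X P β) {η : ℝ} (hη : 0 ≤ η) (hηT : M₀⁻¹ * (η * T) ≤ 1)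
    (hP : ∀ t ∈ Icc 0 T, ‖P t‖ ≤ η) : IsStopped M₀ T η ((Ico 0 T).indicator P) where
  integrable a b := by
    have h1 : IntegrableOn P (Ico 0 T) :=
      (hs.continuousOn_P.integrableOn_Icc).mono_set Ico_subset_Icc_self
    exact ((integrable_indicator_iff measurableSet_Ico).2 h1).intervalIntegrable
  norm_le t := by
    by_cases ht : t ∈ Ico 0 T
    · rw [indicator_of_mem ht]; exact hP t (Ico_subset_Icc_self ht)
    · rw [indicator_of_notMem ht, norm_zero]; exact hη
  eq_zero t ht := indicator_of_notMem (fun hmem => absurd hmem.2 (not_lt.2 ht)) P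
  displacement := hηT

/-- The smallness condition on the data: it controls the momentum on `[0, T]`, and the
inhomogeneous term afterwards. -/
lemma exists_smallness (h : IsComplexification W w) (hκ : 0 < κ) (hM₀ : 0 < M₀) {K : ℝ → ℝ}
    (hK : IsResolvent κ M₀ W K) (hKc : Continuous K) (hT : 0 < T) :
    ∃ ε, 0 < ε ∧ ∀ (X₀ P₀ : R3) (β₀ : L2) (X P : ℝ → R3) (β : ℝ → L2),
      IsSolution κ M₀ W T X₀ P₀ β₀ X P β → ‖P₀‖ ≤ ε →
      (weightedNorm X₀ (-3) β₀ ≤ ENNReal.ofReal ε → ∀ t ∈ Icc 0 T, ‖P t‖ ≤ (T ^ 2)⁻¹) ∧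
      (NonResonant κ M₀ W → weightedNorm 0 3 β₀ ≤ ENNReal.ofReal ε → ∀ t, T ≤ t →
        ‖Ftilde κ M₀ W K X₀ β₀ ((Ico 0 T).indicator P) t‖
          ≤ (1 + T)⁻¹ * t ^ (-(5 / 4) : ℝ)) := by
  -- The same `ε` has to serve with and without resonances. In the resonant case any value of `D`
  -- will do.
  obtain ⟨D, hD, hDb⟩ : ∃ D, 0 ≤ D ∧ (NonResonant κ M₀ W → ∀ (η : ℝ) (Q : ℝ → R3),
      IsStopped M₀ T η Q → ∀ (X₀ : R3) (β₀ : L2), Integrable β₀ → ∀ t, T ≤ t →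
      ‖Ftilde κ M₀ W K X₀ β₀ Q t‖ ≤ D * (η + ∫ y, ‖β₀ y‖) * t ^ (-(5 / 4) : ℝ)) := by
    by_cases hN : NonResonant κ M₀ W
    · obtain ⟨D, hD, hDb⟩ := exists_norm_Ftilde_le h hκ hM₀ hK hKc hN hT
      exact ⟨D, hD, fun _ => hDb⟩
    · exact ⟨0, le_rfl, fun h => absurd h hN⟩
  -- With momentum and `L¹` norm of the field both at most `θ`, the bound `D (η + ∫ ‖β₀‖)` is at
  -- most `(1 + T)⁻¹`, whatever the dependence of `D` on `T`.
  set θ : ℝ := (2 * (D + 1) * (1 + T))⁻¹ with hθ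
  have hθ0 : 0 < θ := by positivity
  -- The three requirements are the momentum bound that is claimed, a displacement of at most one
  -- unit, and the smallness of the inhomogeneous term.
  set η : ℝ := min (T ^ 2)⁻¹ (min (M₀ / T) θ) with hη
  have hη0 : 0 < η := by positivity
  have hη1 : η ≤ (T ^ 2)⁻¹ := min_le_left _ _
  have hη2 : η ≤ M₀ / T := (min_le_right _ _).trans (min_le_left _ _)
  have hη3 : η ≤ θ := (min_le_right _ _).trans (min_le_right _ _)
  have hηT : M₀⁻¹ * (η * T) ≤ 1 := by
    rw [le_div_iff₀ hT] at hη2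
    rw [inv_mul_le_iff₀ hM₀, mul_one]
    exact hη2
  obtain ⟨ε, hε, hεb⟩ := IsSolution.exists_norm_momentum_le h hκ hM₀ hT hη0 hηT
  have hbn := bracketNorm_nonneg
  have hq : 0 < θ / (bracketNorm + 1) := by positivity
  -- The second entry turns the weighted `L²` bound into an `L¹` bound by `θ`; adding one avoids a
  -- division by zero.
  refine ⟨min ε (θ / (bracketNorm + 1)), lt_min hε hq, fun X₀ P₀ β₀ X P β hs hP₀ => ?_⟩
  have hle : ENNReal.ofReal (min ε (θ / (bracketNorm + 1))) ≤ ENNReal.ofReal ε :=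
    ENNReal.ofReal_le_ofReal (min_le_left _ _)
  have hle' : ENNReal.ofReal (min ε (θ / (bracketNorm + 1)))
      ≤ ENNReal.ofReal (θ / (bracketNorm + 1)) := ENNReal.ofReal_le_ofReal (min_le_right _ _)
  refine ⟨fun hw t ht => (hεb X₀ P₀ β₀ X P β hs (hw.trans hle) (hP₀.trans (min_le_left _ _))
    t ht).trans hη1, fun hN hw t ht => ?_⟩
  have hPη := hεb X₀ P₀ β₀ X P β hs ((weightedNorm_neg_le X₀ β₀).trans (hw.trans hle))
    (hP₀.trans (min_le_left _ _))
  obtain ⟨hβi, hβ⟩ := integrable_of_weightedNorm_le hq.le (hw.trans hle')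
  refine (hDb hN η _ (hs.isStopped hη0.le hηT hPη) X₀ β₀ hβi t ht).trans ?_
  have ht0 : 0 < t := hT.trans_le ht
  have hβθ : ∫ y, ‖β₀ y‖ ≤ θ := by
    refine hβ.trans ?_
    rw [mul_div_assoc', div_le_iff₀ (by positivity)]
    nlinarith
  refine mul_le_mul_of_nonneg_right ?_ (by positivity)
  calc D * (η + ∫ y, ‖β₀ y‖) ≤ (D + 1) * (θ + θ) := by gcongr; linarith
    _ = (1 + T)⁻¹ := by rw [hθ]; field_simp; ring

/-- Bound on the norm of `B_{δ,T}` by pointwise decay. -/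
lemma bNorm_le {δ c : ℝ} (hδ : δ ≤ 3 / 4) (hT : 0 < T) (hc : 0 ≤ c) {Q : ℝ → R3}
    (hQ : ∀ t, T ≤ t → ‖Q t‖ ≤ c * t ^ (-(5 / 4) : ℝ)) :
    bNorm δ T Q ≤ ENNReal.ofReal (T ^ (δ - 3 / 4) * c) := by
  refine iSup₂_le fun t ht => ENNReal.ofReal_le_ofReal ?_
  have ht0 : 0 < t := hT.trans_le ht
  calc t ^ (1 / 2 + δ) * ‖Q t‖ ≤ t ^ (1 / 2 + δ) * (c * t ^ (-(5 / 4) : ℝ)) := by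
        gcongr; exact hQ t ht
    _ = t ^ (δ - 3 / 4) * c := by
        rw [mul_left_comm, ← Real.rpow_add ht0, mul_comm]; congr 2; ring
    _ ≤ _ := mul_le_mul_of_nonneg_right
        (Real.rpow_le_rpow_of_nonpos hT ht (by linarith)) hc

lemma tendsto_rpow_mul_inv {p : ℝ} (hp : p ≤ 0) :
    Tendsto (fun T : ℝ => T ^ p * (1 + T)⁻¹) atTop (𝓝 0) := by
  have h1 : Tendsto (fun T : ℝ => (1 + T)⁻¹) atTop (𝓝 0) :=
    tendsto_inv_atTop_zero.comp (tendsto_atTop_add_const_left _ _ tendsto_id)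
  refine squeeze_zero' ?_ ?_ h1
  · filter_upwards [eventually_ge_atTop 0] with T hT
    positivity
  · filter_upwards [eventually_ge_atTop 1] with T hT
    exact mul_le_of_le_one_left (by positivity) (Real.rpow_le_one_of_one_le_of_nonpos hT hp)

end Friction

end

theorem mainTheorem3 (κ M₀ : ℝ) (hκ : 0 < κ) (hM₀ : 0 < M₀)
    (W : Friction.R3 → ℝ) (hW : Friction.IsAdmissible W) :
    ∃ K : ℝ → ℝ, Friction.IsResolvent κ M₀ W K ∧
    ∃ ε : ℝ → ℝ, (∀ T, 0 < T → 0 < ε T) ∧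
      (∀ T, 0 < T → ∀ (X₀ P₀ : Friction.R3) (β₀ : Friction.L2),
        Friction.weightedNorm X₀ (-3) β₀ ≤ ENNReal.ofReal (ε T) → ‖P₀‖ ≤ ε T →
        (∃ (X P : ℝ → Friction.R3) (β : ℝ → Friction.L2),
          Friction.IsSolution κ M₀ W T X₀ P₀ β₀ X P β) ∧
        ∀ (X P : ℝ → Friction.R3) (β : ℝ → Friction.L2),
          Friction.IsSolution κ M₀ W T X₀ P₀ β₀ X P β →
          ∀ t ∈ Icc 0 T, ‖P t‖ ≤ (T ^ 2)⁻¹) ∧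
      (Friction.NonResonant κ M₀ W → ∀ δ : ℝ, δ ≤ 3 / 4 →
        ∃ ε' : ℝ → ℝ, (∀ T, 0 < T → 0 < ε' T) ∧ Tendsto ε' atTop (𝓝 0) ∧
          ∀ T, 0 < T → ∀ (X₀ P₀ : Friction.R3) (β₀ : Friction.L2),
            Friction.weightedNorm 0 3 β₀ ≤ ENNReal.ofReal (ε T) → ‖P₀‖ ≤ ε T →
            ∀ (X P : ℝ → Friction.R3) (β : ℝ → Friction.L2),
              Friction.IsSolution κ M₀ W T X₀ P₀ β₀ X P β →
              Friction.bNorm δ T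
                (Friction.Ftilde κ M₀ W K X₀ β₀ ((Ico 0 T).indicator P))
                ≤ ENNReal.ofReal (ε' T)) := by
  
  obtain ⟨w, hw⟩ := hW.exists_schwartz
  have h : Friction.IsComplexification W w := ⟨hW, hw⟩
  obtain ⟨K, hKc, hK⟩ := Friction.exists_isResolvent h κ M₀
  choose! ε hε using fun T (hT : 0 < T) => Friction.exists_smallness h hκ hM₀ hK hKc hT
  -- The function `T^{δ - 3/4} (1 + T)⁻¹` is the supremum over `t ≥ T` of `t^{1/2+δ} (1 + T)⁻¹
  -- t^{-5/4}`, attained at `t = T` because `δ ≤ 3/4`.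
  refine ⟨K, hK, ε, fun T hT => (hε T hT).1, fun T hT X₀ P₀ β₀ hβ hP => ⟨?_, ?_⟩,
    fun hN δ hδ => ⟨fun T => T ^ (δ - 3 / 4) * (1 + T)⁻¹, fun T hT => by positivity, ?_, ?_⟩⟩
  · exact Friction.exists_isSolution h hκ hM₀ hT X₀ P₀ β₀
  · exact fun X P β hs => ((hε T hT).2 X₀ P₀ β₀ X P β hs hP).1 hβ
  · exact Friction.tendsto_rpow_mul_inv (by linarith)
  · exact fun T hT X₀ P₀ β₀ hβ hP X P β hs => Friction.bNorm_le hδ hT (by positivity)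
      (((hε T hT).2 X₀ P₀ β₀ X P β hs hP).2 hN hβ)
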